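/- Let $k$ be an algebraically closed field of characteristic zero, let $A$ be an associative unital $k$-algebra and let $e\in A$ be an idempotent. All modules are right modules; for a differential graded algebra (dga) $\Lambda$ over $k$, $D(\Lambda)$ denotes its unbounded derived category, i.e. the category of all dg-$\Lambda$-modules localised along the quasi-isomorphisms, with its usual triangulated structure (algebras are regarded as dgas in degree zero). Put $R:=eAe$, and let $A\to B$ be a map of dgas which exhibits $B=A/^{\mathbb L}AeA$ as the derived quotient of $A$ by $e$, i.e. as the derived localisation of $A$ at $1-e$: for a cofibrant replacement $Q\to A$ in dgas, $B$ is the initial object of the full subcategory of those objects $Y$ of the homotopy category of dgas under $Q$ for which the class of $1-e$ becomes invertible in $H(Y)$. Put \begin{align*} i^*&:=-\otimes^{\mathbb L}_A B, & j_!&:=-\otimes^{\mathbb L}_R eA,\\ i_*&:=\mathbb R\mathrm{Hom}_B(B,-), & j^!&:=\mathbb R\mathrm{Hom}_A(eA,-),\\ i_!&:=-\otimes^{\mathbb L}_B B, & j^*&:=-\otimes^{\mathbb L}_A Ae,\\ i^!&:=\mathbb R\mathrm{Hom}_A(B,-), & j_*&:=\mathbb R\mathrm{Hom}_R(Ae,-),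 \end{align*} the total derived functors of the corresponding tensor and Hom functors of dg-modules. These derived functors exist, $i_*\cong i_!:D(B)\to D(A)$ and $j^!\cong j^*:D(A)\to D(R)$, and they form a recollement $$D(B)\xrightarrow{\ i_*=i_!\ }D(A)\xrightarrow{\ j^!=j^*\ }D(R).$$ That is: all six functors $i^*,\,i_*=i_!,\,i^!,\,j_!,\,j^!=j^*,\,j_*$ are triangulated; $i^*\dashv i_*=i_!\dashv i^!$ and $j_!\dashv j^!=j^*\dashv j_*$ are adjoint triples; $i_*$, $j_!$ and $j_*$ are fully faithful; $j^*i_*=0$; and for every $X\in D(A)$ there are distinguished triangles $$i_!i^!X\to X\to j_*j^*X\to (i_!i^!X)[1]\qquad\text{and}\qquad j_!j^!X\to X\to i_*i^*X\to (j_!j^!X)[1]$$ whose first two maps are the counits and units of these adjunctions. -/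

import Mathlib

open CategoryTheory
open scoped TensorProduct

universe u

namespace DG

/-! ### Complexes of vector spaces

A structure map that changes degrees takes the target degree as an argument, together with a proof
that it is the right one; this avoids transport along equalities of integers. -/

/-- A dg vector space: a `ℤ`-graded cochain complex of `k`-vector spaces. -/
structure DGVect (k : Type u) [Field k] where
  X : ℤ → Type u
  [addCommGroup : ∀ i, AddCommGroup (X i)]
  [module : ∀ i, Module k (X i)]
  d (i j : ℤ) (h : i + 1 = j) : X i →ₗ[k] X j
  d_d (i j l : ℤ) (h : i + 1 = j) (h' : j + 1 = l) (x : X i) : d j l h' (d i j h x) = 0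

attribute [instance] DGVect.addCommGroup DGVect.module

variable {k : Type u} [Field k]

/-- A chain map (of degree zero). -/
@[ext]
structure ChainMap (V W : DGVect k) where
  f (i : ℤ) : V.X i →ₗ[k] W.X i
  comm (i j : ℤ) (h : i + 1 = j) (x : V.X i) : f j (V.d i j h x) = W.d i j h (f i x)

/-- `x` is a coboundary. -/
def DGVect.IsBoundary (V : DGVect k) (i : ℤ) (x : V.X i) : Prop :=
  ∃ (j : ℤ) (h : j + 1 = i) (y : V.X j), V.d j i h y = x

/-- `x` is a cocycle. -/
def DGVect.IsCocycle (V : DGVect k) (i : ℤ) (x : V.X i) : Prop :=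
  V.d i (i + 1) rfl x = 0

/-- A chain map is a quasi-isomorphism if it is injective and surjective on each `H^i`. -/
def ChainMap.IsQuasiIso {V W : DGVect k} (φ : ChainMap V W) : Prop :=
  ∀ i : ℤ,
    (∀ x : V.X i, V.IsCocycle i x → W.IsBoundary i (φ.f i x) → V.IsBoundary i x) ∧
    (∀ y : W.X i, W.IsCocycle i y →
      ∃ x : V.X i, V.IsCocycle i x ∧ W.IsBoundary i (φ.f i x - y))

/-! ### Differential graded algebras -/

variable (k) in
/-- A differential graded algebra over `k`: a complex with an associative unital `k`-bilinear
multiplication satisfying the graded Leibniz rule. -/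
structure DGA extends DGVect k where
  mul (i j l : ℤ) (h : i + j = l) : X i →ₗ[k] X j →ₗ[k] X l
  one : X 0
  one_mul (i : ℤ) (x : X i) : mul 0 i i (zero_add i) one x = x
  mul_one (i : ℤ) (x : X i) : mul i 0 i (add_zero i) x one = x
  mul_assoc (i j l ij jl n : ℤ) (h₁ : i + j = ij) (h₂ : j + l = jl) (h₃ : ij + l = n)
    (h₄ : i + jl = n) (x : X i) (y : X j) (z : X l) :
    mul ij l n h₃ (mul i j ij h₁ x y) z = mul i jl n h₄ x (mul j l jl h₂ y z)
  d_mul (i j l i' j' l' : ℤ) (h : i + j = l) (hi : i + 1 = i') (hj : j + 1 = j') (hl : l + 1 = l')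
    (x : X i) (y : X j) :
    d l l' hl (mul i j l h x y) =
      mul i' j l' (by lia) (d i i' hi x) y
        + i.negOnePow • mul i j' l' (by lia) x (d j j' hj y)

/-- A morphism of dgas. -/
@[ext]
structure DGA.Hom (Λ Γ : DGA k) extends ChainMap Λ.toDGVect Γ.toDGVect where
  map_one : f 0 Λ.one = Γ.one
  map_mul (i j l : ℤ) (h : i + j = l) (x : Λ.X i) (y : Λ.X j) :
    f l (Λ.mul i j l h x y) = Γ.mul i j l h (f i x) (f j y)

instance : Category (DGA k) where
  Hom := DGA.Hom
  id Λ :=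
    { f := fun _ => LinearMap.id
      comm := fun _ _ _ _ => rfl
      map_one := rfl
      map_mul := fun _ _ _ _ _ _ => rfl }
  comp φ ψ :=
    { f := fun i => ψ.f i ∘ₗ φ.f i
      comm := fun i j h x => by simp [φ.comm, ψ.comm]
      map_one := by simp [φ.map_one, ψ.map_one]
      map_mul := fun i j l h x y => by simp [φ.map_mul, ψ.map_mul] }

/-! ### Differential graded modules -/

/-- A right dg-module over the dga `Λ`. -/
structure DGMod (Λ : DGA k) extends DGVect k where
  act (i j l : ℤ) (h : i + j = l) : X i →ₗ[k] Λ.X j →ₗ[k] X l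
  act_one (i : ℤ) (x : X i) : act i 0 i (add_zero i) x Λ.one = x
  act_act (i j l ij jl n : ℤ) (h₁ : i + j = ij) (h₂ : j + l = jl) (h₃ : ij + l = n)
    (h₄ : i + jl = n) (x : X i) (a : Λ.X j) (b : Λ.X l) :
    act ij l n h₃ (act i j ij h₁ x a) b = act i jl n h₄ x (Λ.mul j l jl h₂ a b)
  d_act (i j l i' j' l' : ℤ) (h : i + j = l) (hi : i + 1 = i') (hj : j + 1 = j') (hl : l + 1 = l')
    (x : X i) (a : Λ.X j) :
    d l l' hl (act i j l h x a) =
      act i' j l' (by lia) (d i i' hi x) a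
        + i.negOnePow • act i j' l' (by lia) x (Λ.d j j' hj a)

/-- A morphism of right dg-modules. -/
@[ext]
structure DGMod.Hom {Λ : DGA k} (M N : DGMod Λ) extends ChainMap M.toDGVect N.toDGVect where
  map_act (i j l : ℤ) (h : i + j = l) (x : M.X i) (a : Λ.X j) :
    f l (M.act i j l h x a) = N.act i j l h (f i x) a

instance (Λ : DGA k) : Category (DGMod Λ) where
  Hom := DGMod.Hom
  id M :=
    { f := fun _ => LinearMap.id
      comm := fun _ _ _ _ => rfl
      map_act := fun _ _ _ _ _ _ => rfl }
  comp φ ψ :=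
    { f := fun i => ψ.f i ∘ₗ φ.f i
      comm := fun i j h x => by simp [φ.comm, ψ.comm]
      map_act := fun i j l h x a => by simp [φ.map_act, ψ.map_act] }

@[ext]
theorem DGMod.hom_ext {Λ : DGA k} {M N : DGMod Λ} {φ ψ : M ⟶ N}
    (h : ∀ (i : ℤ) (x : M.X i), φ.f i x = ψ.f i x) : φ = ψ := by
  apply DGMod.Hom.ext
  funext i
  exact LinearMap.ext (h i)

/-- A dg-`Λ`-`Γ`-bimodule: a left action of `Λ` and a right action of `Γ`. -/
structure DGBimod (Λ Γ : DGA k) extends DGMod Γ where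
  lact (i j l : ℤ) (h : i + j = l) : Λ.X i →ₗ[k] X j →ₗ[k] X l
  one_lact (i : ℤ) (x : X i) : lact 0 i i (zero_add i) Λ.one x = x
  lact_lact (i j l ij jl n : ℤ) (h₁ : i + j = ij) (h₂ : j + l = jl) (h₃ : ij + l = n)
    (h₄ : i + jl = n) (a : Λ.X i) (b : Λ.X j) (x : X l) :
    lact ij l n h₃ (Λ.mul i j ij h₁ a b) x = lact i jl n h₄ a (lact j l jl h₂ b x)
  lact_act (i j l ij jl n : ℤ) (h₁ : i + j = ij) (h₂ : j + l = jl) (h₃ : ij + l = n)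
    (h₄ : i + jl = n) (a : Λ.X i) (x : X j) (c : Γ.X l) :
    act ij l n h₃ (lact i j ij h₁ a x) c = lact i jl n h₄ a (act j l jl h₂ x c)
  d_lact (i j l i' j' l' : ℤ) (h : i + j = l) (hi : i + 1 = i') (hj : j + 1 = j') (hl : l + 1 = l')
    (a : Λ.X i) (x : X j) :
    d l l' hl (lact i j l h a x) =
      lact i' j l' (by lia) (Λ.d i i' hi a) x
        + i.negOnePow • lact i j' l' (by lia) a (d j j' hj x)

/-! ### The unbounded derived category and its distinguished triangles -/

/-- The class of quasi-isomorphisms of dg-modules. -/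
def quasiIso (Λ : DGA k) : MorphismProperty (DGMod Λ) := fun _ _ φ => φ.toChainMap.IsQuasiIso

/-- The derived category `D(Λ)`: all dg-modules, localised along the quasi-isomorphisms. -/
abbrev D (Λ : DGA k) : Type (u + 1) := (quasiIso Λ).Localization

/-- The localisation functor. -/
abbrev toD (Λ : DGA k) : DGMod Λ ⥤ D Λ := (quasiIso Λ).Q

/-- The shift `M[1]`, with `M[1]^i = M^{i+1}` and differential `-d`. -/
def DGMod.shift {Λ : DGA k} (M : DGMod Λ) : DGMod Λ where
  X i := M.X (i + 1)
  d i j h := -M.d (i + 1) (j + 1) (by lia)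
  d_d i j l h h' x := by simp [M.d_d]
  act i j l h := M.act (i + 1) j (l + 1) (by lia)
  act_one i x := M.act_one _ x
  act_act i j l ij jl n h₁ h₂ h₃ h₄ x a b := M.act_act _ _ _ _ _ _ _ _ _ _ x a b
  d_act i j l i' j' l' h hi hj hl x a := by
    simp [M.d_act (i + 1) j (l + 1) (i' + 1) j' (l' + 1) (by lia) (by lia) hj (by lia),
      Int.negOnePow_succ]
    abel

/-- The shift functor on dg-modules. -/
def shiftFunctor (Λ : DGA k) : DGMod Λ ⥤ DGMod Λ where
  obj M := M.shift
  map φ :=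
    { f := fun i => φ.f (i + 1)
      comm := fun i j h x => by
        change φ.f (j + 1) (-_) = -_
        rw [map_neg]
        exact congrArg Neg.neg (φ.comm _ _ _ x)
      map_act := fun i j l h x a => φ.map_act _ _ _ _ x a }

theorem shiftFunctor_inverts (Λ : DGA k) :
    (quasiIso Λ).IsInvertedBy (shiftFunctor Λ ⋙ toD Λ) := by
  intro M N φ hφ
  refine Localization.inverts (toD Λ) (quasiIso Λ) _ ?_
  have bdry : ∀ (K : DGMod Λ) (i : ℤ) (x : K.X (i + 1)),
      K.shift.IsBoundary i x ↔ K.IsBoundary (i + 1) x := by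
    intro K i x
    constructor
    · rintro ⟨j, h, y, hy⟩
      have hy' : K.d (j + 1) (i + 1) (by lia) (-(show K.X (j + 1) from y)) = x := by
        rw [map_neg]
        exact hy
      exact ⟨j + 1, by lia, _, hy'⟩
    · rintro ⟨j, h, y, hy⟩
      obtain ⟨j, rfl⟩ : ∃ j', j = j' + 1 := ⟨j - 1, by lia⟩
      have hy' : -K.d (j + 1) (i + 1) h (-y) = x := by rw [map_neg, neg_neg, hy]
      exact ⟨j, by lia, (-y : K.X (j + 1)), hy'⟩
  have cocy : ∀ (K : DGMod Λ) (i : ℤ) (x : K.X (i + 1)),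
      K.shift.IsCocycle i x ↔ K.IsCocycle (i + 1) x := by
    intro K i x
    exact neg_eq_zero
  intro i
  obtain ⟨h₁, h₂⟩ := hφ (i + 1)
  refine ⟨fun x hx hb => (bdry M i x).2 (h₁ x ((cocy M i x).1 hx) ((bdry N i _).1 hb)), ?_⟩
  intro y hy
  obtain ⟨x, hx, hb⟩ := h₂ y ((cocy N i y).1 hy)
  exact ⟨x, (cocy M i x).2 hx, (bdry N i _).2 hb⟩

/-- The shift functor on the derived category. -/
noncomputable def shiftD (Λ : DGA k) : D Λ ⥤ D Λ :=
  Localization.Construction.lift (shiftFunctor Λ ⋙ toD Λ) (shiftFunctor_inverts Λ)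

/-- The shift on the derived category is induced by the shift of dg-modules. -/
noncomputable def shiftDIso (Λ : DGA k) : toD Λ ⋙ shiftD Λ ≅ shiftFunctor Λ ⋙ toD Λ :=
  eqToIso (Localization.Construction.fac _ _)

/-- The mapping cone `M[1] ⊕ N` of `φ : M ⟶ N`, with differential `(x, y) ↦ (-dx, φ x + dy)`. -/
def cone {Λ : DGA k} {M N : DGMod Λ} (φ : M ⟶ N) : DGMod Λ where
  X i := M.X (i + 1) × N.X i
  d i j h := LinearMap.prod
    (-(M.d (i + 1) (j + 1) (by lia) ∘ₗ LinearMap.fst k _ _))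
    ((h ▸ φ.f (i + 1) : M.X (i + 1) →ₗ[k] N.X j) ∘ₗ LinearMap.fst k _ _
      + N.d i j h ∘ₗ LinearMap.snd k _ _)
  d_d i j l h h' x := by
    subst h; subst h'
    simp [M.d_d, N.d_d, φ.comm]
  act i j l h := LinearMap.mk₂ k
    (fun x a => (M.act (i + 1) j (l + 1) (by lia) x.1 a, N.act i j l h x.2 a))
    (by intros; simp) (by intros; simp) (by intros; simp) (by intros; simp)
  act_one i x := by
    ext
    · exact M.act_one _ _
    · exact N.act_one _ _
  act_act i j l ij jl n h₁ h₂ h₃ h₄ x a b := by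
    ext
    · exact M.act_act _ _ _ _ _ _ _ _ _ _ _ _ _
    · exact N.act_act _ _ _ _ _ _ _ _ _ _ _ _ _
  d_act i j l i' j' l' h hi hj hl x a := by
    subst hi hl
    ext
    · have := M.d_act (i + 1) j (l + 1) (i + 1 + 1) j' (l + 1 + 1) (by lia) rfl hj rfl x.1 a
      simp [this, Int.negOnePow_succ]
      abel
    · have := N.d_act i j l (i + 1) j' (l + 1) h rfl hj rfl x.2 a
      simp [this, φ.map_act (i + 1) j (l + 1) (by lia)]
      abel

/-- The inclusion `N ⟶ cone φ`. -/
def coneIn {Λ : DGA k} {M N : DGMod Λ} (φ : M ⟶ N) : N ⟶ cone φ where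
  f i := LinearMap.inr k (M.X (i + 1)) (N.X i)
  comm i j h x := by
    subst h
    apply Prod.ext
    · change (0 : M.X (i + 1 + 1)) = -M.d _ _ _ (0 : M.X (i + 1))
      simp
    · change N.d _ _ _ x = φ.f (i + 1) (0 : M.X (i + 1)) + N.d _ _ _ x
      simp
  map_act i j l h x a := by
    apply Prod.ext
    · change (0 : M.X (l + 1)) = M.act _ _ _ _ (0 : M.X (i + 1)) a
      simp
    · rfl

/-- The projection `cone φ ⟶ M[1]`. -/
def coneOut {Λ : DGA k} {M N : DGMod Λ} (φ : M ⟶ N) : cone φ ⟶ (shiftFunctor Λ).obj M where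
  f i := LinearMap.fst k (M.X (i + 1)) (N.X i)
  comm i j h x := rfl
  map_act i j l h x a := rfl

/-- A triangle `X ⟶ Y ⟶ Z ⟶ X[1]` in `D(Λ)` is distinguished if it is isomorphic to the triangle
`M ⟶ N ⟶ cone φ ⟶ M[1]` of some morphism `φ : M ⟶ N` of dg-modules. -/
def Distinguished {Λ : DGA k} {X Y Z : D Λ} (f : X ⟶ Y) (g : Y ⟶ Z)
    (h : Z ⟶ (shiftD Λ).obj X) : Prop :=
  ∃ (M N : DGMod Λ) (φ : M ⟶ N) (a : X ≅ (toD Λ).obj M) (b : Y ≅ (toD Λ).obj N)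
    (c : Z ≅ (toD Λ).obj (cone φ)),
    f ≫ b.hom = a.hom ≫ (toD Λ).map φ ∧
    g ≫ c.hom = b.hom ≫ (toD Λ).map (coneIn φ) ∧
    h ≫ (shiftD Λ).map a.hom =
      c.hom ≫ (toD Λ).map (coneOut φ) ≫ (shiftDIso Λ).inv.app M

/-- `F` is a triangulated (exact) functor: it commutes with the shifts, and it maps distinguished
triangles to distinguished triangles. -/
def IsTriangulated {Λ Γ : DGA k} (F : D Λ ⥤ D Γ) : Prop :=
  ∃ η : shiftD Λ ⋙ F ≅ F ⋙ shiftD Γ,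
    ∀ ⦃X Y Z : D Λ⦄ (f : X ⟶ Y) (g : Y ⟶ Z) (h : Z ⟶ (shiftD Λ).obj X),
      Distinguished f g h → Distinguished (F.map f) (F.map g) (F.map h ≫ η.hom.app X)

/-! ### Total derived functors -/

/-- `F : D(Λ) ⥤ D(Γ)` is the total left derived functor of `G`. -/
def IsLeftDerived {Λ Γ : DGA k} (F : D Λ ⥤ D Γ) (G : DGMod Λ ⥤ DGMod Γ) : Prop :=
  ∃ α : toD Λ ⋙ F ⟶ G ⋙ toD Γ, F.IsLeftDerivedFunctor α (quasiIso Λ)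

/-- `F : D(Λ) ⥤ D(Γ)` is the total right derived functor of `G`. -/
def IsRightDerived {Λ Γ : DGA k} (F : D Λ ⥤ D Γ) (G : DGMod Λ ⥤ DGMod Γ) : Prop :=
  ∃ α : G ⋙ toD Γ ⟶ toD Λ ⋙ F, F.IsRightDerivedFunctor α (quasiIso Λ)

/-! ### Recollements -/

/-- The six functors `i^*`, `i_* = i_!`, `i^!`, `j_!`, `j^! = j^*`, `j_*` form a recollement
`D(B) ⟶ D(A) ⟶ D(R)`. -/
structure Recollement {B A R : DGA k} (iPull : D A ⥤ D B) (iPush : D B ⥤ D A) (iShriek : D A ⥤ D B)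
    (jShriek : D R ⥤ D A) (jPull : D A ⥤ D R) (jPush : D R ⥤ D A) where
  iPull_triangulated : IsTriangulated iPull
  iPush_triangulated : IsTriangulated iPush
  iShriek_triangulated : IsTriangulated iShriek
  jShriek_triangulated : IsTriangulated jShriek
  jPull_triangulated : IsTriangulated jPull
  jPush_triangulated : IsTriangulated jPush
  iAdj : iPull ⊣ iPush
  iAdj' : iPush ⊣ iShriek
  jAdj : jShriek ⊣ jPull
  jAdj' : jPull ⊣ jPush
  iPush_full : iPush.Full
  iPush_faithful : iPush.Faithful
  jShriek_full : jShriek.Full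
  jShriek_faithful : jShriek.Faithful
  jPush_full : jPush.Full
  jPush_faithful : jPush.Faithful
  isZero (Y : D B) : Limits.IsZero (jPull.obj (iPush.obj Y))
  /-- `i_! i^! X ⟶ X ⟶ j_* j^* X ⟶`, given by the counit and the unit. -/
  triangle (X : D A) : ∃ h : jPush.obj (jPull.obj X) ⟶ (shiftD A).obj (iPush.obj (iShriek.obj X)),
    Distinguished (iAdj'.counit.app X) (jAdj'.unit.app X) h
  /-- `j_! j^! X ⟶ X ⟶ i_* i^* X ⟶`, given by the counit and the unit. -/
  triangle' (X : D A) : ∃ h : iPush.obj (iPull.obj X) ⟶ (shiftD A).obj (jShriek.obj (jPull.obj X)),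
    Distinguished (jAdj.counit.app X) (iAdj.unit.app X) h

/-! ### Derived localisation and the derived quotient -/

/-- The class of quasi-isomorphisms of dgas under `Q`. -/
def underQuasiIso (Q : DGA k) : MorphismProperty (Under Q) :=
  fun _ _ φ => φ.right.toChainMap.IsQuasiIso

/-- A dga is cofibrant if it has the left lifting property against surjective
quasi-isomorphisms. -/
def DGA.IsCofibrant (Q : DGA k) : Prop :=
  ∀ ⦃Y Z : DGA k⦄ (p : Y ⟶ Z), p.toChainMap.IsQuasiIso →
    (∀ i, Function.Surjective (p.f i)) → ∀ g : Q ⟶ Z, ∃ g' : Q ⟶ Y, g' ≫ p = g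

/-- The class of the degree zero cocycle `y` is invertible in the cohomology algebra `H(Y)`. -/
def DGA.IsInvertibleClass (Y : DGA k) (y : Y.X 0) : Prop :=
  ∃ z : Y.X 0, Y.IsCocycle 0 z ∧
    Y.IsBoundary 0 (Y.mul 0 0 0 (zero_add 0) y z - Y.one) ∧
    Y.IsBoundary 0 (Y.mul 0 0 0 (zero_add 0) z y - Y.one)

/-- Let `q : Q ⟶ Λ` be a quasi-isomorphism and `s` a degree zero cocycle of `Λ`. A dga `Y` under `Q`
inverts `s` if it maps the class in `H(Q)` that corresponds to the class of `s` to an invertible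
class. -/
def Inverts {Q Λ : DGA k} (q : Q ⟶ Λ) (s : Λ.X 0) (Y : Under Q) : Prop :=
  ∀ z : Q.X 0, Q.IsCocycle 0 z → Λ.IsBoundary 0 (q.f 0 z - s) →
    Y.right.IsInvertibleClass (Y.hom.f 0 z)

/-- `φ : Λ ⟶ Ω` exhibits `Ω` as the derived localisation of `Λ` at the class of the degree zero
cocycle `s`. The derived under category of `Λ` is the homotopy category of `Under Q`, where
`q : Q ⟶ Λ` is a cofibrant replacement; the derived localisation is the initial object of its full
subcategory on the dgas that invert `s`. -/
def IsDerivedLocalization {Λ Ω : DGA k} (s : Λ.X 0) (φ : Λ ⟶ Ω) : Prop :=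
  ∃ (Q : DGA k) (q : Q ⟶ Λ), Q.IsCofibrant ∧ q.toChainMap.IsQuasiIso ∧
    Inverts q s (Under.mk (q ≫ φ)) ∧
    ∀ Y : Under Q, Inverts q s Y →
      Nonempty (Unique ((underQuasiIso Q).Q.obj (Under.mk (q ≫ φ)) ⟶ (underQuasiIso Q).Q.obj Y))

/-! ### Ungraded algebras, corner rings and their bimodules -/

section Peirce

variable (k) {A : Type u} [Ring A] [Algebra k A]

/-- For idempotents `e` and `f`, the subspace `eAf` of `A`, placed in degree zero. -/
def peirce (e f : A) (i : ℤ) : Submodule k A where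
  carrier := {x | e * x = x ∧ x * f = x ∧ (i ≠ 0 → x = 0)}
  add_mem' {x y} hx hy := by
    refine ⟨by rw [mul_add, hx.1, hy.1], by rw [add_mul, hx.2.1, hy.2.1], fun h => ?_⟩
    rw [hx.2.2 h, hy.2.2 h, add_zero]
  zero_mem' := by simp
  smul_mem' c x hx := by
    refine ⟨by rw [mul_smul_comm, hx.1], by rw [smul_mul_assoc, hx.2.1], fun h => ?_⟩
    rw [hx.2.2 h, smul_zero]

/-- The multiplication `eAf × fAg → eAg` of `A`. -/
def peirceMul (e f g : A) (i j l : ℤ) (h : i + j = l) :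
    peirce k e f i →ₗ[k] peirce k f g j →ₗ[k] peirce k e g l :=
  LinearMap.mk₂ k
    (fun x y => ⟨x.1 * y.1, by
      refine ⟨by rw [← mul_assoc, x.2.1], by rw [mul_assoc, y.2.2.1], fun hl => ?_⟩
      by_cases hi : i = 0
      · rw [y.2.2.2 (by lia), mul_zero]
      · rw [x.2.2.2 hi, zero_mul]⟩)
    (fun x x' y => Subtype.ext (add_mul _ _ _))
    (fun c x y => Subtype.ext (smul_mul_assoc _ _ _))
    (fun x y y' => Subtype.ext (mul_add _ _ _))
    (fun c x y => Subtype.ext (mul_smul_comm _ _ _))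

/-- The corner ring `eAe` (with unit `e`), as a dga in degree zero. -/
def corner (e : A) (he : IsIdempotentElem e) : DGA k where
  X i := peirce k e e i
  d _ _ _ := 0
  d_d _ _ _ _ _ _ := rfl
  mul i j l h := peirceMul k e e e i j l h
  one := ⟨e, he, he, fun h => absurd rfl h⟩
  one_mul i x := Subtype.ext x.2.1
  mul_one i x := Subtype.ext x.2.2.1
  mul_assoc i j l ij jl n h₁ h₂ h₃ h₄ x y z := Subtype.ext (mul_assoc _ _ _)
  d_mul i j l i' j' l' h hi hj hl x y := by simp

/-- `eAf` as an `eAe`-`fAf`-bimodule, in degree zero. -/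
def cornerBimod (e f : A) (he : IsIdempotentElem e) (hf : IsIdempotentElem f) :
    DGBimod (corner k e he) (corner k f hf) where
  X i := peirce k e f i
  d _ _ _ := 0
  d_d _ _ _ _ _ _ := rfl
  act i j l h := peirceMul k e f f i j l h
  act_one i x := Subtype.ext x.2.2.1
  act_act i j l ij jl n h₁ h₂ h₃ h₄ x y z := Subtype.ext (mul_assoc _ _ _)
  d_act i j l i' j' l' h hi hj hl x y := by
    have (y : peirce k f f j) : (0 : peirce k e f l') = peirceMul k e f f i' j l' (by lia) 0 y
        + i.negOnePow • peirceMul k e f f i j' l' (by lia) x 0 := by simp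
    exact this y
  lact i j l h := peirceMul k e e f i j l h
  one_lact i x := Subtype.ext x.2.1
  lact_lact i j l ij jl n h₁ h₂ h₃ h₄ x y z := Subtype.ext (mul_assoc _ _ _)
  lact_act i j l ij jl n h₁ h₂ h₃ h₄ x y z := Subtype.ext (mul_assoc _ _ _)
  d_lact i j l i' j' l' h hi hj hl x y := by
    have (x : peirce k e e i) : (0 : peirce k e f l') = peirceMul k e e f i' j l' (by lia) 0 y
        + i.negOnePow • peirceMul k e e f i j' l' (by lia) x 0 := by simp
    exact this x

variable (A) in
/-- The algebra `A = 1A1`, as a dga in degree zero. -/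
abbrev ofAlgebra : DGA k := corner k (1 : A) IsIdempotentElem.one

/-- The dga map `φ : A ⟶ B` exhibits `B` as the derived quotient of `A` by the idempotent `e`, that
is, as the derived localisation of `A` at `1 - e`. -/
def IsDerivedQuotient (e : A) {B : DGA k} (φ : ofAlgebra k A ⟶ B) : Prop :=
  IsDerivedLocalization (Λ := ofAlgebra k A)
    ⟨1 - e, one_mul _, mul_one _, fun h => absurd rfl h⟩ φ

end Peirce

/-- Dga maps `α : Λ ⟶ Ω` and `β : Γ ⟶ Ω` make `Ω` a `Λ`-`Γ`-bimodule. -/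
def bimodOfHoms {Λ Γ Ω : DGA k} (α : Λ ⟶ Ω) (β : Γ ⟶ Ω) : DGBimod Λ Γ where
  toDGVect := Ω.toDGVect
  act i j l h := (Ω.mul i j l h).compl₂ (β.f j)
  act_one i x := by simp [β.map_one, Ω.mul_one]
  act_act i j l ij jl n h₁ h₂ h₃ h₄ x a b := by
    simpa [β.map_mul] using Ω.mul_assoc i j l ij jl n h₁ h₂ h₃ h₄ x (β.f j a) (β.f l b)
  d_act i j l i' j' l' h hi hj hl x a := by
    simpa [β.comm] using Ω.d_mul i j l i' j' l' h hi hj hl x (β.f j a)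
  lact i j l h := (Ω.mul i j l h) ∘ₗ (α.f i)
  one_lact i x := by simp [α.map_one, Ω.one_mul]
  lact_lact i j l ij jl n h₁ h₂ h₃ h₄ a b x := by
    simpa [α.map_mul] using Ω.mul_assoc i j l ij jl n h₁ h₂ h₃ h₄ (α.f i a) (α.f j b) x
  lact_act i j l ij jl n h₁ h₂ h₃ h₄ a x c := by
    simpa using Ω.mul_assoc i j l ij jl n h₁ h₂ h₃ h₄ (α.f i a) x (β.f l c)
  d_lact i j l i' j' l' h hi hj hl a x := by
    simpa [α.comm] using Ω.d_mul i j l i' j' l' h hi hj hl (α.f i a) x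

/-! ### The tensor product over a dga -/

section Tensor

variable {Λ Γ : DGA k} (M : DGMod Λ) (N : DGBimod Λ Γ)

/-- The degree `n` part of `M ⊗ₖ N`. -/
abbrev PreTensor (n : ℤ) : Type u :=
  DirectSum {p : ℤ × ℤ // p.1 + p.2 = n} (fun p => M.X p.1.1 ⊗[k] N.X p.1.2)

/-- The pure tensor `x ⊗ y` in `M ⊗ₖ N`. -/
noncomputable def preTmul (i j n : ℤ) (h : i + j = n) : M.X i →ₗ[k] N.X j →ₗ[k] PreTensor M N n :=
  (TensorProduct.mk k (M.X i) (N.X j)).compr₂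
    (DirectSum.lof k {p : ℤ × ℤ // p.1 + p.2 = n} (fun p => M.X p.1.1 ⊗[k] N.X p.1.2) ⟨(i, j), h⟩)

/-- The relations `x a ⊗ y = x ⊗ a y`. -/
def tensorRel (n : ℤ) : Submodule k (PreTensor M N n) :=
  Submodule.span k {t | ∃ (i j l ij jl : ℤ) (h₁ : i + j = ij) (h₂ : j + l = jl) (h₃ : ij + l = n)
    (h₄ : i + jl = n) (x : M.X i) (a : Λ.X j) (y : N.X l),
    t = preTmul M N ij l n h₃ (M.act i j ij h₁ x a) y
      - preTmul M N i jl n h₄ x (N.lact j l jl h₂ a y)}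

/-- The degree `n` part of `M ⊗_Λ N`. -/
abbrev TensorX (n : ℤ) : Type u := PreTensor M N n ⧸ tensorRel M N n

/-- The pure tensor `x ⊗ y` in `M ⊗_Λ N`. -/
noncomputable def tmul (i j n : ℤ) (h : i + j = n) : M.X i →ₗ[k] N.X j →ₗ[k] TensorX M N n :=
  (preTmul M N i j n h).compr₂ (tensorRel M N n).mkQ

theorem tmul_act (i j l ij jl n : ℤ) (h₁ : i + j = ij) (h₂ : j + l = jl) (h₃ : ij + l = n)
    (h₄ : i + jl = n) (x : M.X i) (a : Λ.X j) (y : N.X l) :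
    tmul M N ij l n h₃ (M.act i j ij h₁ x a) y = tmul M N i jl n h₄ x (N.lact j l jl h₂ a y) := by
  refine (Submodule.Quotient.eq _).2 (Submodule.subset_span ?_)
  exact ⟨i, j, l, ij, jl, h₁, h₂, h₃, h₄, x, a, y, rfl⟩

variable {M N} in
theorem tensor_ext {P : Type u} [AddCommGroup P] [Module k P] {n : ℤ} {f g : TensorX M N n →ₗ[k] P}
    (H : ∀ (i j : ℤ) (h : i + j = n) (x : M.X i) (y : N.X j),
      f (tmul M N i j n h x y) = g (tmul M N i j n h x y)) : f = g := by
  apply Submodule.linearMap_qext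
  apply DirectSum.linearMap_ext
  rintro ⟨⟨i, j⟩, h⟩
  apply TensorProduct.ext'
  intro x y
  exact H i j h x y

variable {M N} in
/-- A balanced family of bilinear maps induces a linear map on `M ⊗_Λ N`. -/
noncomputable def tensorLift {P : Type u} [AddCommGroup P] [Module k P] {n : ℤ}
    (φ : ∀ i j : ℤ, i + j = n → M.X i →ₗ[k] N.X j →ₗ[k] P)
    (hφ : ∀ (i j l ij jl : ℤ) (h₁ : i + j = ij) (h₂ : j + l = jl) (h₃ : ij + l = n)
      (h₄ : i + jl = n) (x : M.X i) (a : Λ.X j) (y : N.X l),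
      φ ij l h₃ (M.act i j ij h₁ x a) y = φ i jl h₄ x (N.lact j l jl h₂ a y)) :
    TensorX M N n →ₗ[k] P :=
  (tensorRel M N n).liftQ
    (DirectSum.toModule k _ P (fun p => TensorProduct.lift (φ p.1.1 p.1.2 p.2))) (by
      rw [tensorRel, Submodule.span_le]
      rintro _ ⟨i, j, l, ij, jl, h₁, h₂, h₃, h₄, x, a, y, rfl⟩
      simp [preTmul, hφ i j l ij jl h₁ h₂ h₃ h₄])

@[simp]
theorem tensorLift_tmul {P : Type u} [AddCommGroup P] [Module k P] {n : ℤ}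
    (φ : ∀ i j : ℤ, i + j = n → M.X i →ₗ[k] N.X j →ₗ[k] P)
    (hφ : ∀ (i j l ij jl : ℤ) (h₁ : i + j = ij) (h₂ : j + l = jl) (h₃ : ij + l = n)
      (h₄ : i + jl = n) (x : M.X i) (a : Λ.X j) (y : N.X l),
      φ ij l h₃ (M.act i j ij h₁ x a) y = φ i jl h₄ x (N.lact j l jl h₂ a y))
    (i j : ℤ) (h : i + j = n) (x : M.X i) (y : N.X j) :
    tensorLift φ hφ (tmul M N i j n h x y) = φ i j h x y := by
  simp [tensorLift, tmul, preTmul]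

/-- The differential `d(x ⊗ y) = dx ⊗ y + (-1)^|x| x ⊗ dy`. -/
noncomputable def tensorD (n n' : ℤ) (hn : n + 1 = n') : TensorX M N n →ₗ[k] TensorX M N n' :=
  tensorLift
    (fun i j h => tmul M N (i + 1) j n' (by lia) ∘ₗ M.d i (i + 1) rfl
      + i.negOnePow • (tmul M N i (j + 1) n' (by lia)).compl₂ (N.d j (j + 1) rfl))
    (by
      intro i j l ij jl h₁ h₂ h₃ h₄ x a y
      simp only [LinearMap.add_apply, LinearMap.comp_apply, LinearMap.smul_apply,
        LinearMap.compl₂_apply]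
      rw [M.d_act i j ij (i + 1) (j + 1) (ij + 1) h₁ rfl rfl rfl,
        N.d_lact j l jl (j + 1) (l + 1) (jl + 1) h₂ rfl rfl rfl]
      simp only [map_add, map_zsmul_unit, LinearMap.add_apply, LinearMap.smul_apply]
      rw [tmul_act M N (i + 1) j l (ij + 1) jl n' (by lia) h₂ (by lia) (by lia),
        tmul_act M N i (j + 1) l (ij + 1) (jl + 1) n' (by lia) (by lia) (by lia) (by lia),
        tmul_act M N i j (l + 1) ij (jl + 1) n' h₁ (by lia) (by lia) (by lia),
        show ij.negOnePow = i.negOnePow * j.negOnePow by rw [← h₁, Int.negOnePow_add]]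
      simp only [smul_add, smul_smul]
      abel)

@[simp]
theorem tensorD_tmul (i j n n' i' j' : ℤ) (h : i + j = n) (hn : n + 1 = n') (hi : i + 1 = i')
    (hj : j + 1 = j') (x : M.X i) (y : N.X j) :
    tensorD M N n n' hn (tmul M N i j n h x y) =
      tmul M N i' j n' (by lia) (M.d i i' hi x) y
        + i.negOnePow • tmul M N i j' n' (by lia) x (N.d j j' hj y) := by
  subst hi hj
  simp [tensorD]

/-- The right action `(x ⊗ y) c = x ⊗ y c`. -/
noncomputable def tensorAct (n l n' : ℤ) (hn : n + l = n') :
    TensorX M N n →ₗ[k] Γ.X l →ₗ[k] TensorX M N n' :=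
  tensorLift
    (fun i j h => LinearMap.mk₂ k
      (fun x y => tmul M N i (j + l) n' (by lia) x ∘ₗ N.act j l (j + l) rfl y)
      (by intros; ext; simp) (by intros; ext; simp) (by intros; ext; simp) (by intros; ext; simp))
    (by
      intro i j m ij jm h₁ h₂ h₃ h₄ x a y
      ext c
      simp only [LinearMap.mk₂_apply, LinearMap.comp_apply]
      rw [tmul_act M N i j (m + l) ij (jm + l) n' h₁ (by lia) (by lia) (by lia),
        N.lact_act j m l jm (m + l) (jm + l) h₂ rfl rfl (by lia)])

@[simp]
theorem tensorAct_tmul (i j n l n' jl : ℤ) (h : i + j = n) (hn : n + l = n') (hj : j + l = jl)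
    (x : M.X i) (y : N.X j) (c : Γ.X l) :
    tensorAct M N n l n' hn (tmul M N i j n h x y) c =
      tmul M N i jl n' (by lia) x (N.act j l jl hj y c) := by
  subst hj
  simp [tensorAct]

/-- The right dg-`Γ`-module `M ⊗_Λ N`. -/
noncomputable def tensorObj : DGMod Γ where
  X n := TensorX M N n
  d n n' hn := tensorD M N n n' hn
  d_d n n' n'' hn hn' t := by
    have : tensorD M N n' n'' hn' ∘ₗ tensorD M N n n' hn = 0 := by
      apply tensor_ext
      intro i j h x y
      simp only [LinearMap.comp_apply, LinearMap.zero_apply]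
      rw [tensorD_tmul M N i j n n' (i + 1) (j + 1) h hn rfl rfl]
      simp only [map_add, map_zsmul_unit]
      rw [tensorD_tmul M N (i + 1) j n' n'' (i + 1 + 1) (j + 1) (by lia) hn' rfl rfl,
        tensorD_tmul M N i (j + 1) n' n'' (i + 1) (j + 1 + 1) (by lia) hn' rfl rfl,
        M.d_d, N.d_d, Int.negOnePow_succ]
      simp
    exact LinearMap.congr_fun this t
  act n l n' hn := tensorAct M N n l n' hn
  act_one n t := by
    have : (tensorAct M N n 0 n (add_zero n)).flip Γ.one = LinearMap.id := by
      apply tensor_ext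
      intro i j h x y
      simp only [LinearMap.flip_apply, LinearMap.id_apply]
      rw [tensorAct_tmul M N i j n 0 n j h _ (add_zero j), N.act_one]
    exact LinearMap.congr_fun this t
  act_act n j l ij jl m h₁ h₂ h₃ h₄ t a b := by
    have : (tensorAct M N ij l m h₃).flip b ∘ₗ (tensorAct M N n j ij h₁).flip a =
        (tensorAct M N n jl m h₄).flip (Γ.mul j l jl h₂ a b) := by
      apply tensor_ext
      intro p q h x y
      simp only [LinearMap.flip_apply, LinearMap.comp_apply]
      rw [tensorAct_tmul M N p q n j ij (q + j) h h₁ rfl,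
        tensorAct_tmul M N p (q + j) ij l m (q + jl) (by lia) h₃ (by lia),
        tensorAct_tmul M N p q n jl m (q + jl) h h₄ rfl,
        N.act_act q j l (q + j) jl (q + jl) rfl h₂ (by lia) rfl]
    exact LinearMap.congr_fun this t
  d_act n j l n' j' l' h hn hj hl t a := by
    have : tensorD M N l l' hl ∘ₗ (tensorAct M N n j l h).flip a =
        (tensorAct M N n' j l' (by lia)).flip a ∘ₗ tensorD M N n n' hn
          + n.negOnePow • (tensorAct M N n j' l' (by lia)).flip (Γ.d j j' hj a) := by
      apply tensor_ext
      intro p q hpq x y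
      simp only [LinearMap.flip_apply, LinearMap.comp_apply, LinearMap.add_apply,
        LinearMap.smul_apply]
      rw [tensorAct_tmul M N p q n j l (q + j) hpq h rfl,
        tensorD_tmul M N p (q + j) l l' (p + 1) (q + j + 1) (by lia) hl rfl rfl,
        tensorD_tmul M N p q n n' (p + 1) (q + 1) hpq hn rfl rfl,
        tensorAct_tmul M N p q n j' l' (q + j + 1) hpq (by lia) (by lia),
        N.d_act q j (q + j) (q + 1) j' (q + j + 1) rfl rfl hj rfl]
      simp only [map_add, map_zsmul_unit, LinearMap.add_apply, LinearMap.smul_apply]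
      rw [tensorAct_tmul M N (p + 1) q n' j l' (q + j) (by lia) (by lia) rfl,
        tensorAct_tmul M N p (q + 1) n' j l' (q + j + 1) (by lia) (by lia) (by lia),
        show n.negOnePow = p.negOnePow * q.negOnePow by rw [← hpq, Int.negOnePow_add]]
      simp only [smul_add, smul_smul]
      abel
    exact LinearMap.congr_fun this t

variable {M} in
/-- The map `φ ⊗ N` in degree `n`. -/
noncomputable def tensorMap {M' : DGMod Λ} (φ : M ⟶ M') (n : ℤ) :
    TensorX M N n →ₗ[k] TensorX M' N n :=
  tensorLift (fun i j h => tmul M' N i j n h ∘ₗ φ.f i) (by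
    intro i j l ij jl h₁ h₂ h₃ h₄ x a y
    simp only [LinearMap.comp_apply]
    rw [φ.map_act, tmul_act])

variable {M} in
@[simp]
theorem tensorMap_tmul {M' : DGMod Λ} (φ : M ⟶ M') (i j n : ℤ) (h : i + j = n) (x : M.X i)
    (y : N.X j) : tensorMap N φ n (tmul M N i j n h x y) = tmul M' N i j n h (φ.f i x) y := by
  simp [tensorMap]

/-- The functor `- ⊗_Λ N` from right dg-`Λ`-modules to right dg-`Γ`-modules. -/
noncomputable def tensorFunctor : DGMod Λ ⥤ DGMod Γ where
  obj M := tensorObj M N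
  map {M M'} φ :=
    { f := tensorMap N φ
      comm := fun n n' hn t => by
        have : tensorMap N φ n' ∘ₗ tensorD M N n n' hn =
            tensorD M' N n n' hn ∘ₗ tensorMap N φ n := by
          apply tensor_ext
          intro i j h x y
          simp [tensorD_tmul _ _ i j n n' (i + 1) (j + 1) h hn rfl rfl, φ.comm]
        exact LinearMap.congr_fun this t
      map_act := fun n l n' hn t c => by
        have : tensorMap N φ n' ∘ₗ (tensorAct M N n l n' hn).flip c =
            (tensorAct M' N n l n' hn).flip c ∘ₗ tensorMap N φ n := by
          apply tensor_ext
          intro i j h x y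
          simp [tensorAct_tmul _ _ i j n l n' (j + l) h hn rfl]
        exact LinearMap.congr_fun this t }
  map_id M := by
    ext n t
    have : tensorMap N (𝟙 M) n = LinearMap.id := by
      apply tensor_ext
      intro i j h x y
      rw [tensorMap_tmul]
      rfl
    exact LinearMap.congr_fun this t
  map_comp {M M' M''} φ ψ := by
    ext n t
    have : tensorMap N (φ ≫ ψ) n = tensorMap N ψ n ∘ₗ tensorMap N φ n := by
      apply tensor_ext
      intro i j h x y
      rw [LinearMap.comp_apply, tensorMap_tmul, tensorMap_tmul, tensorMap_tmul]
      rfl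
    exact LinearMap.congr_fun this t

end Tensor

/-! ### The Hom complex over a dga -/

section Hom

variable {Λ Γ : DGA k} (N : DGBimod Λ Γ) (P : DGMod Γ)

/-- The degree `n` part of `Hom_Γ(N, P)`: families of maps `N^i ⟶ P^{i+n}` that commute with the
right action of `Γ`. -/
def homSubmodule (n : ℤ) :
    Submodule k (∀ p : {p : ℤ × ℤ // p.1 + n = p.2}, N.X p.1.1 →ₗ[k] P.X p.1.2) where
  carrier := {f | ∀ (i j l il jl : ℤ) (h₁ : i + n = j) (h₂ : i + l = il) (h₃ : j + l = jl)
    (x : N.X i) (c : Γ.X l),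
    f ⟨(il, jl), by lia⟩ (N.act i l il h₂ x c) = P.act j l jl h₃ (f ⟨(i, j), h₁⟩ x) c}
  add_mem' {f g} hf hg := by
    intro i j l il jl h₁ h₂ h₃ x c
    simp [hf i j l il jl h₁ h₂ h₃, hg i j l il jl h₁ h₂ h₃]
  zero_mem' := by
    intro i j l il jl h₁ h₂ h₃ x c
    simp
  smul_mem' r f hf := by
    intro i j l il jl h₁ h₂ h₃ x c
    simp [hf i j l il jl h₁ h₂ h₃]

/-- The degree `n` part of `Hom_Γ(N, P)`. -/
abbrev HomX (n : ℤ) : Type u := homSubmodule N P n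

variable {N P} in
/-- The component `N^i ⟶ P^j` of an element of degree `n` of `Hom_Γ(N, P)`. -/
def HomX.app {n : ℤ} (f : HomX N P n) (i j : ℤ) (h : i + n = j) : N.X i →ₗ[k] P.X j :=
  f.1 ⟨(i, j), h⟩

variable {N P} in
theorem HomX.app_act {n : ℤ} (f : HomX N P n) (i j l il jl : ℤ) (h₁ : i + n = j) (h₂ : i + l = il)
    (h₃ : j + l = jl) (h₄ : il + n = jl) (x : N.X i) (c : Γ.X l) :
    f.app il jl h₄ (N.act i l il h₂ x c) = P.act j l jl h₃ (f.app i j h₁ x) c :=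
  f.2 i j l il jl h₁ h₂ h₃ x c

variable {N P} in
theorem HomX.ext {n : ℤ} {f g : HomX N P n}
    (H : ∀ (i j : ℤ) (h : i + n = j) (x : N.X i), f.app i j h x = g.app i j h x) : f = g := by
  apply Subtype.ext
  funext p
  exact LinearMap.ext (H p.1.1 p.1.2 p.2)

@[simp]
theorem HomX.app_add {n : ℤ} (f g : HomX N P n) (i j : ℤ) (h : i + n = j) :
    (f + g).app i j h = f.app i j h + g.app i j h := rfl

@[simp]
theorem HomX.app_zero {n : ℤ} (i j : ℤ) (h : i + n = j) :
    (0 : HomX N P n).app i j h = 0 := rfl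

@[simp]
theorem HomX.app_smul {n : ℤ} (r : k) (f : HomX N P n) (i j : ℤ) (h : i + n = j) :
    (r • f).app i j h = r • f.app i j h := rfl

@[simp]
theorem HomX.app_units_smul {n : ℤ} (r : ℤˣ) (f : HomX N P n) (i j : ℤ) (h : i + n = j) :
    (r • f).app i j h = r • f.app i j h := rfl

/-- The differential `df = d ∘ f - (-1)^|f| f ∘ d`. -/
def homD (n n' : ℤ) (hn : n + 1 = n') : HomX N P n →ₗ[k] HomX N P n' where
  toFun f := ⟨fun p => P.d (p.1.1 + n) p.1.2 (by have := p.2; lia) ∘ₗ f.app p.1.1 (p.1.1 + n) rfl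
      - n.negOnePow • f.app (p.1.1 + 1) p.1.2 (by have := p.2; lia) ∘ₗ N.d p.1.1 (p.1.1 + 1) rfl, by
    intro i j l il jl h₁ h₂ h₃ x c
    simp only [LinearMap.sub_apply, LinearMap.comp_apply, LinearMap.smul_apply]
    rw [f.app_act i (i + n) l il (il + n) rfl h₂ (by lia) rfl,
      N.d_act i l il (i + 1) (l + 1) (il + 1) h₂ rfl rfl rfl,
      P.d_act (i + n) l (il + n) j (l + 1) jl (by lia) (by lia) rfl (by lia)]
    simp only [map_add, map_sub, map_zsmul_unit, LinearMap.sub_apply, LinearMap.smul_apply]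
    rw [f.app_act (i + 1) j l (il + 1) jl (by lia) (by lia) h₃ (by lia),
      f.app_act i (i + n) (l + 1) (il + 1) jl rfl (by lia) (by lia) (by lia),
      Int.negOnePow_add]
    simp only [smul_add, smul_smul, mul_comm i.negOnePow]
    abel⟩
  map_add' f g := by
    apply Subtype.ext
    funext p
    ext x
    simp
    abel
  map_smul' r f := by
    apply Subtype.ext
    funext p
    ext x
    simp [smul_sub, smul_comm n.negOnePow r]

theorem homD_app (n n' : ℤ) (hn : n + 1 = n') (f : HomX N P n) (i j i' j' : ℤ) (h : i + n' = j)
    (hi : i + 1 = i') (hj : i + n = j') (x : N.X i) :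
    (homD N P n n' hn f).app i j h x =
      P.d j' j (by lia) (f.app i j' hj x)
        - n.negOnePow • f.app i' j (by lia) (N.d i i' hi x) := by
  subst hi hj
  rfl

/-- The right action `(f b)(x) = f (b x)`. -/
def homAct (n l n' : ℤ) (hn : n + l = n') : HomX N P n →ₗ[k] Λ.X l →ₗ[k] HomX N P n' :=
  LinearMap.mk₂ k
    (fun f b => ⟨fun p => f.app (l + p.1.1) p.1.2 (by have := p.2; lia) ∘ₗ
        N.lact l p.1.1 (l + p.1.1) rfl b, by
      intro i j m im jm h₁ h₂ h₃ x c
      simp only [LinearMap.comp_apply]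
      rw [← N.lact_act l i m (l + i) im (l + im) rfl h₂ (by lia) rfl]
      exact f.app_act (l + i) j m (l + im) jm (by lia) (by lia) h₃ (by lia) _ c⟩)
    (by intros; rfl) (by intros; rfl)
    (by intros; apply Subtype.ext; funext p; ext x; simp)
    (by intros; apply Subtype.ext; funext p; ext x; simp)

theorem homAct_app (n l n' : ℤ) (hn : n + l = n') (f : HomX N P n) (b : Λ.X l) (i j li : ℤ)
    (h : i + n' = j) (hl : l + i = li) (x : N.X i) :
    (homAct N P n l n' hn f b).app i j h x = f.app li j (by lia) (N.lact l i li hl b x) := by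
  subst hl
  rfl

/-- The right dg-`Λ`-module `Hom_Γ(N, P)`. -/
def homObj : DGMod Λ where
  X n := HomX N P n
  d n n' hn := homD N P n n' hn
  d_d n n' n'' hn hn' f := by
    apply HomX.ext
    intro i j h x
    rw [homD_app N P n' n'' hn' _ i j (i + 1) (i + n') h rfl rfl,
      homD_app N P n n' hn f i (i + n') (i + 1) (i + n) rfl rfl rfl,
      homD_app N P n n' hn f (i + 1) j (i + 1 + 1) (i + n') (by lia) rfl (by lia),
      show n'.negOnePow = -n.negOnePow by rw [← hn, Int.negOnePow_succ]]
    simp [P.d_d, N.d_d]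
  act n l n' hn := homAct N P n l n' hn
  act_one n f := by
    apply HomX.ext
    intro i j h x
    rw [homAct_app N P n 0 n _ f _ i j i h (zero_add i), N.one_lact]
  act_act n j l nj jl m h₁ h₂ h₃ h₄ f a b := by
    apply HomX.ext
    intro p q h x
    rw [homAct_app N P nj l m h₃ _ b p q (l + p) h rfl,
      homAct_app N P n j nj h₁ f a (l + p) q (jl + p) (by lia) (by lia),
      homAct_app N P n jl m h₄ f _ p q (jl + p) h rfl,
      N.lact_lact j l p jl (l + p) (jl + p) h₂ rfl rfl (by lia)]
  d_act n j l n' j' l' h hn hj hl f a := by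
    apply HomX.ext
    intro p q hq x
    rw [HomX.app_add, HomX.app_units_smul, LinearMap.add_apply, LinearMap.smul_apply,
      homD_app N P l l' hl _ p q (p + 1) (p + l) hq rfl rfl,
      homAct_app N P n j l h f a p (p + l) (j + p) rfl rfl,
      homAct_app N P n j l h f a (p + 1) q (j' + p) (by lia) (by lia),
      homAct_app N P n' j l' _ _ a p q (j + p) hq rfl,
      homD_app N P n n' hn f (j + p) q (j' + p) (p + l) (by lia) (by lia) (by lia),
      homAct_app N P n j' l' _ f _ p q (j' + p) hq rfl,
      N.d_lact j p (j + p) j' (p + 1) (j' + p) rfl hj rfl (by lia),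
      show l.negOnePow = n.negOnePow * j.negOnePow by rw [← h, Int.negOnePow_add]]
    simp only [map_add, map_zsmul_unit, smul_add, smul_smul]
    abel

end Hom

/-- The functor `Hom_Γ(N, -)` from right dg-`Γ`-modules to right dg-`Λ`-modules. -/
def homFunctor {Λ Γ : DGA k} (N : DGBimod Λ Γ) : DGMod Γ ⥤ DGMod Λ where
  obj P := homObj N P
  map {P P'} φ :=
    { f := fun n =>
        { toFun := fun f => (⟨fun p => φ.f p.1.2 ∘ₗ f.app p.1.1 p.1.2 p.2, by
            intro i j l il jl h₁ h₂ h₃ x c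
            simp only [LinearMap.comp_apply]
            rw [f.app_act i j l il jl h₁ h₂ h₃, φ.map_act]⟩ : HomX N P' n)
          map_add' := fun f g => by
            apply HomX.ext
            intro i j h x
            exact map_add (φ.f j) _ _
          map_smul' := fun r f => by
            apply HomX.ext
            intro i j h x
            exact map_smul (φ.f j) _ _ }
      comm := fun n n' hn f => by
        apply HomX.ext
        intro i j h x
        refine (congrArg (φ.f j)
          (homD_app N P n n' hn f i j (i + 1) (i + n) h rfl rfl x)).trans ?_
        rw [map_sub, map_zsmul_unit, φ.comm]
        rfl
      map_act := fun n l n' hn f b => rfl }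
  map_id P := rfl
  map_comp φ ψ := rfl

end DG

namespace DG
variable {k : Type u} [Field k]

/-! ### Acyclicity, contractions and cohomology -/

theorem DGVect.isCocycle_iff (V : DGVect k) (i j : ℤ) (h : i + 1 = j) (x : V.X i) :
    V.IsCocycle i x ↔ V.d i j h x = 0 := by
  subst h; rfl

theorem DGVect.isBoundary_iff (V : DGVect k) (i j : ℤ) (h : j + 1 = i) (x : V.X i) :
    V.IsBoundary i x ↔ ∃ y, V.d j i h y = x := by
  constructor
  · rintro ⟨j', h', y, hy⟩
    obtain rfl : j = j' := by omega
    exact ⟨y, hy⟩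
  · rintro ⟨y, hy⟩
    exact ⟨j, h, y, hy⟩

/-- A complex without cohomology. -/
def DGVect.Acyclic (V : DGVect k) : Prop := ∀ (i : ℤ) (x : V.X i), V.IsCocycle i x → V.IsBoundary i x

theorem DGVect.Acyclic.exists_d_eq {V : DGVect k} (hV : V.Acyclic) (i j l : ℤ) (h : i + 1 = j)
    (h' : j + 1 = l) (x : V.X j) (hx : V.d j l h' x = 0) : ∃ y, V.d i j h y = x :=
  (V.isBoundary_iff j i h x).1 (hV j x ((V.isCocycle_iff j l h' x).2 hx))

theorem exists_generalized_inverse {V W : Type u} [AddCommGroup V] [Module k V] [AddCommGroup W]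
    [Module k W] (f : V →ₗ[k] W) : ∃ g : W →ₗ[k] V, ∀ x, f (g (f x)) = f x := by
  obtain ⟨r, hr⟩ := f.rangeRestrict.exists_rightInverse_of_surjective f.range_rangeRestrict
  obtain ⟨g, hg⟩ := r.exists_extend
  refine ⟨g, fun x => ?_⟩
  have h₁ : g (f x) = r (f.rangeRestrict x) := LinearMap.congr_fun hg (f.rangeRestrict x)
  have h₂ := LinearMap.congr_fun hr (f.rangeRestrict x)
  rw [h₁]
  exact congrArg Subtype.val h₂

/-- An acyclic complex of vector spaces is contractible. -/
theorem DGVect.Acyclic.exists_contraction {V : DGVect k} (hV : V.Acyclic) :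
    ∃ s : ∀ i j : ℤ, j + 1 = i → V.X i →ₗ[k] V.X j,
      ∀ (i j l : ℤ) (h : j + 1 = i) (h' : i + 1 = l) (x : V.X i),
        V.d j i h (s i j h x) + s l i h' (V.d i l h' x) = x := by
  choose g hg using fun (i j : ℤ) (h : j + 1 = i) => exists_generalized_inverse (V.d j i h)
  refine ⟨fun i j h => g i j h ∘ₗ (LinearMap.id - g (i + 1) i rfl ∘ₗ V.d i (i + 1) rfl), ?_⟩
  intro i j l h h' x
  subst h'
  simp only [LinearMap.comp_apply, LinearMap.sub_apply, LinearMap.id_apply]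
  have h₁ : V.d i (i + 1) rfl (x - g (i + 1) i rfl (V.d i (i + 1) rfl x)) = 0 := by
    rw [map_sub, hg, sub_self]
  obtain ⟨y, hy⟩ := hV.exists_d_eq j i (i + 1) h rfl _ h₁
  rw [← hy, hg, hy, V.d_d, map_zero, sub_zero, sub_add_cancel]

/-- The submodule of cocycles. -/
abbrev DGVect.cocycles (V : DGVect k) (i : ℤ) : Submodule k (V.X i) := LinearMap.ker (V.d i (i + 1) rfl)

/-- Cohomology. -/
abbrev DGVect.H (V : DGVect k) (i : ℤ) : Type u :=
  V.cocycles i ⧸ (LinearMap.range (V.d (i - 1) i (by omega))).comap (V.cocycles i).subtype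

/-- The map on cocycles induced by a chain map. -/
def ChainMap.mapCocycles {V W : DGVect k} (φ : ChainMap V W) (i : ℤ) :
    V.cocycles i →ₗ[k] W.cocycles i :=
  (φ.f i).restrict (fun x hx => by
    have hx : V.d i (i + 1) rfl x = 0 := hx
    change W.d i (i + 1) rfl (φ.f i x) = 0
    rw [← φ.comm, hx, map_zero])

/-- The map on cohomology induced by a chain map. -/
def ChainMap.mapH {V W : DGVect k} (φ : ChainMap V W) (i : ℤ) : V.H i →ₗ[k] W.H i :=
  Submodule.mapQ _ _ (φ.mapCocycles i) (by
    rintro ⟨x, hx⟩ ⟨y, hy⟩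
    exact ⟨φ.f _ y, by rw [← φ.comm, hy]; rfl⟩)

theorem ChainMap.isQuasiIso_iff_bijective_mapH {V W : DGVect k} (φ : ChainMap V W) :
    φ.IsQuasiIso ↔ ∀ i, Function.Bijective (φ.mapH i) := by
  refine forall_congr' fun i => and_congr ?_ ?_
  · rw [← LinearMap.ker_eq_bot, LinearMap.ker_eq_bot']
    constructor
    · intro H z
      induction z using Submodule.Quotient.induction_on with
      | H z =>
      intro hz
      refine (Submodule.Quotient.mk_eq_zero _).2 ?_
      have hz' := (Submodule.Quotient.mk_eq_zero _).1 hz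
      obtain ⟨y, hy⟩ := (V.isBoundary_iff i (i - 1) (by omega) _).1
        (H z.1 z.2 ((W.isBoundary_iff i (i - 1) (by omega) _).2 hz'))
      exact ⟨y, hy⟩
    · intro H x hx hb
      have := H (Submodule.Quotient.mk ⟨x, hx⟩)
        ((Submodule.Quotient.mk_eq_zero _).2 ((W.isBoundary_iff i (i - 1) (by omega) _).1 hb))
      exact (V.isBoundary_iff i (i - 1) (by omega) _).2 ((Submodule.Quotient.mk_eq_zero _).1 this)
  · constructor
    · intro H z
      induction z using Submodule.Quotient.induction_on with
      | H z =>
      obtain ⟨x, hx, hb⟩ := H z.1 z.2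
      exact ⟨Submodule.Quotient.mk ⟨x, hx⟩,
        (Submodule.Quotient.eq _).2 ((W.isBoundary_iff i (i - 1) (by omega) _).1 hb)⟩
    · intro H y hy
      obtain ⟨z, hz⟩ := H (Submodule.Quotient.mk ⟨y, hy⟩)
      induction z using Submodule.Quotient.induction_on with
      | H z =>
      exact ⟨z.1, z.2,
        (W.isBoundary_iff i (i - 1) (by omega) _).2 ((Submodule.Quotient.eq _).1 hz)⟩

/-- Cohomology as a functor. -/
def cohomology (Λ : DGA k) (i : ℤ) : DGMod Λ ⥤ ModuleCat.{u} k where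
  obj M := ModuleCat.of k (M.H i)
  map φ := ModuleCat.ofHom (φ.toChainMap.mapH i)
  map_id M := by
    ext z
    rfl
  map_comp φ ψ := by
    ext z
    rfl

theorem quasiIso_iff_isIso_cohomology {Λ : DGA k} {M N : DGMod Λ} (φ : M ⟶ N) :
    quasiIso Λ φ ↔ ∀ i, IsIso ((cohomology Λ i).map φ) := by
  refine (φ.toChainMap.isQuasiIso_iff_bijective_mapH).trans (forall_congr' fun i => ?_)
  exact (ConcreteCategory.isIso_iff_bijective ((cohomology Λ i).map φ)).symm

theorem quasiIso_iff_isIso_toD {Λ : DGA k} {M N : DGMod Λ} (φ : M ⟶ N) :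
    quasiIso Λ φ ↔ IsIso ((toD Λ).map φ) := by
  constructor
  · exact fun h => Localization.inverts (toD Λ) (quasiIso Λ) φ h
  · intro h
    rw [quasiIso_iff_isIso_cohomology]
    intro i
    have hi : (quasiIso Λ).IsInvertedBy (cohomology Λ i) :=
      fun _ _ ψ hψ => (quasiIso_iff_isIso_cohomology ψ).1 hψ i
    have := (NatIso.isIso_map_iff (Localization.fac (cohomology Λ i) hi (toD Λ)) φ).1
      (by dsimp; infer_instance)
    exact this

instance (Λ : DGA k) : (quasiIso Λ).HasTwoOutOfThreeProperty := by
  have : quasiIso Λ = (MorphismProperty.isomorphisms (D Λ)).inverseImage (toD Λ) := by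
    ext M N φ
    exact quasiIso_iff_isIso_toD φ
  rw [this]
  infer_instance

theorem ChainMap.isQuasiIso_of_bijective {V W : DGVect k} (φ : ChainMap V W)
    (h : ∀ i, Function.Bijective (φ.f i)) : φ.IsQuasiIso := by
  intro i
  constructor
  · rintro x hx ⟨j, hj, y, hy⟩
    obtain ⟨z, rfl⟩ := (h j).2 y
    exact ⟨j, hj, z, (h i).1 (by rw [φ.comm, hy])⟩
  · intro y hy
    obtain ⟨x, rfl⟩ := (h i).2 y
    refine ⟨x, (h (i + 1)).1 ?_, i - 1, by omega, 0, by simp⟩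
    rw [φ.comm, map_zero]
    exact hy

theorem quasiIso_of_iso {Λ : DGA k} {M N : DGMod Λ} (e : M ≅ N) : quasiIso Λ e.hom := by
  rw [quasiIso_iff_isIso_toD]
  infer_instance

theorem quasiIso_of_isIso {Λ : DGA k} {M N : DGMod Λ} (φ : M ⟶ N) [IsIso φ] : quasiIso Λ φ :=
  quasiIso_of_iso (asIso φ)

theorem isIso_toD_map {Λ : DGA k} {M N : DGMod Λ} {φ : M ⟶ N} (h : quasiIso Λ φ) :
    IsIso ((toD Λ).map φ) := (quasiIso_iff_isIso_toD φ).1 h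

/-- A morphism of dg-modules that is bijective in each degree is an isomorphism. -/
noncomputable def DGMod.isoOfBijective {Λ : DGA k} {M N : DGMod Λ} (φ : M ⟶ N)
    (h : ∀ i, Function.Bijective (φ.f i)) : M ≅ N where
  hom := φ
  inv :=
    { f := fun i => (LinearEquiv.ofBijective (φ.f i) (h i)).symm
      comm := fun i j hij x => by
        apply (h j).1
        rw [φ.comm]
        erw [(LinearEquiv.ofBijective (φ.f j) (h j)).apply_symm_apply,
          (LinearEquiv.ofBijective (φ.f i) (h i)).apply_symm_apply]
      map_act := fun i j l hl x a => by
        apply (h l).1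
        rw [φ.map_act]
        erw [(LinearEquiv.ofBijective (φ.f l) (h l)).apply_symm_apply,
          (LinearEquiv.ofBijective (φ.f i) (h i)).apply_symm_apply] }
  hom_inv_id := by
    ext i x
    exact (LinearEquiv.ofBijective (φ.f i) (h i)).symm_apply_apply x
  inv_hom_id := by
    ext i x
    exact (LinearEquiv.ofBijective (φ.f i) (h i)).apply_symm_apply x

section Cone

variable {Λ : DGA k} {M N : DGMod Λ} (φ : M ⟶ N)

theorem quasiIso_iff_acyclic_cone : quasiIso Λ φ ↔ (cone φ).Acyclic := by
  constructor
  · intro h i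
    obtain ⟨i, rfl⟩ : ∃ i', i = i' + 1 := ⟨i - 1, by omega⟩
    rintro ⟨x, y⟩ hxy
    have h₁ : M.d (i + 1 + 1) (i + 1 + 1 + 1) rfl x = 0 := neg_eq_zero.1 (congrArg Prod.fst hxy)
    have h₂ : φ.f (i + 1 + 1) x + N.d (i + 1) (i + 1 + 1) rfl y = 0 := congrArg Prod.snd hxy
    obtain ⟨x', hx'⟩ := (M.isBoundary_iff _ (i + 1) rfl x).1 ((h _).1 x h₁
      ⟨i + 1, rfl, -y, by rw [map_neg, ← eq_neg_of_add_eq_zero_left h₂]⟩)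
    have h₃ : N.d (i + 1) (i + 1 + 1) rfl (y + φ.f (i + 1) x') = 0 := by
      rw [map_add, ← φ.comm, hx']
      exact (add_comm _ _).trans h₂
    obtain ⟨z, hz, hb⟩ := (h (i + 1)).2 _ h₃
    obtain ⟨w, hw⟩ := (N.isBoundary_iff _ i rfl _).1 hb
    refine ⟨i, rfl, (z - x', -w), Prod.ext ?_ ?_⟩
    · change -M.d (i + 1) (i + 1 + 1) rfl (z - x') = x
      have hz' : M.d (i + 1) (i + 1 + 1) rfl z = 0 := hz
      rw [map_sub, hz', hx']
      simp
    · change φ.f (i + 1) (z - x') + N.d i (i + 1) rfl (-w) = y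
      rw [map_neg, hw, map_sub]
      abel
  · intro h i
    obtain ⟨i, rfl⟩ : ∃ i', i = i' + 1 := ⟨i - 1, by omega⟩
    constructor
    · intro x hx hb
      obtain ⟨y, hy⟩ := (N.isBoundary_iff _ i rfl _).1 hb
      have hc : (cone φ).IsCocycle i (x, -y) := by
        refine Prod.ext (neg_eq_zero.2 hx) ?_
        change φ.f (i + 1) x + N.d i (i + 1) rfl (-y) = 0
        rw [map_neg, hy, add_neg_cancel]
      obtain ⟨i, rfl⟩ : ∃ i', i = i' + 1 := ⟨i - 1, by omega⟩
      obtain ⟨⟨a, b⟩, hab⟩ := ((cone φ).isBoundary_iff _ i rfl _).1 (h _ _ hc)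
      refine ⟨i + 1, rfl, -a, ?_⟩
      rw [map_neg]
      exact congrArg Prod.fst hab
    · intro y hy
      have hc : (cone φ).IsCocycle (i + 1) ((0 : M.X (i + 1 + 1)), y) := by
        refine Prod.ext ?_ ?_
        · change -M.d (i + 1 + 1) _ _ 0 = 0
          simp
        · change φ.f (i + 1 + 1) 0 + N.d (i + 1) (i + 1 + 1) rfl y = 0
          rw [map_zero, zero_add]
          exact hy
      obtain ⟨⟨a, b⟩, hab⟩ := ((cone φ).isBoundary_iff _ i rfl _).1 (h _ _ hc)
      have h₁ : -M.d (i + 1) (i + 1 + 1) rfl a = 0 := congrArg Prod.fst hab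
      have h₂ : φ.f (i + 1) a + N.d i (i + 1) rfl b = y := congrArg Prod.snd hab
      exact ⟨a, neg_eq_zero.1 h₁, i, rfl, -b, by rw [map_neg, ← h₂]; abel⟩

theorem quasiIso_coneIn (hM : M.Acyclic) : quasiIso Λ (coneIn φ) := by
  intro i
  obtain ⟨i, rfl⟩ : ∃ i', i = i' + 1 := ⟨i - 1, by omega⟩
  constructor
  · intro y hy hb
    obtain ⟨⟨a, b⟩, hab⟩ := ((cone φ).isBoundary_iff _ i rfl _).1 hb
    have h₁ : -M.d (i + 1) (i + 1 + 1) rfl a = 0 := congrArg Prod.fst hab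
    have h₂ : φ.f (i + 1) a + N.d i (i + 1) rfl b = y := congrArg Prod.snd hab
    obtain ⟨c, hc⟩ := hM.exists_d_eq i (i + 1) _ rfl rfl a (neg_eq_zero.1 h₁)
    exact ⟨i, rfl, φ.f i c + b, by rw [map_add, ← φ.comm, hc, h₂]⟩
  · rintro ⟨a, b⟩ hab
    have h₁ : -M.d (i + 1 + 1) (i + 1 + 1 + 1) rfl a = 0 := congrArg Prod.fst hab
    have h₂ : φ.f (i + 1 + 1) a + N.d (i + 1) (i + 1 + 1) rfl b = 0 := congrArg Prod.snd hab
    obtain ⟨c, hc⟩ := hM.exists_d_eq (i + 1) _ _ rfl rfl a (neg_eq_zero.1 h₁)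
    refine ⟨b + φ.f (i + 1) c, ?_, i, rfl, (c, 0), Prod.ext ?_ ?_⟩
    · change N.d _ _ _ _ = 0
      rw [map_add, ← φ.comm, hc]
      exact (add_comm _ _).trans h₂
    · change -M.d (i + 1) (i + 1 + 1) rfl c = 0 - a
      rw [hc, zero_sub]
    · change φ.f (i + 1) c + N.d i (i + 1) rfl 0 = (b + φ.f (i + 1) c) - b
      simp

end Cone

theorem DGVect.Acyclic.of_isQuasiIso {V W : DGVect k} {φ : ChainMap V W} (h : φ.IsQuasiIso)
    (hV : V.Acyclic) : W.Acyclic := by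
  intro i y hy
  obtain ⟨x, hx, hb⟩ := (h i).2 y hy
  obtain ⟨w, hw⟩ := (W.isBoundary_iff i (i - 1) (by omega) _).1 hb
  obtain ⟨z, hz⟩ := (V.isBoundary_iff i (i - 1) (by omega) _).1 (hV i x hx)
  refine ⟨i - 1, by omega, φ.f _ z - w, ?_⟩
  rw [map_sub, ← φ.comm, hz, hw]
  abel

theorem DGVect.Acyclic.of_isQuasiIso' {V W : DGVect k} {φ : ChainMap V W} (h : φ.IsQuasiIso)
    (hW : W.Acyclic) : V.Acyclic := fun i x hx =>
  (h i).1 x hx (hW i _ (by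
    have hx : V.d i (i + 1) rfl x = 0 := hx
    change W.d i (i + 1) rfl (φ.f i x) = 0
    rw [← φ.comm, hx, map_zero]))

end DG

namespace DG

/-! ### Derived functors and adjunctions -/

section KanExtension

open Functor

variable {C D H : Type*} [Category* C] [Category* D] [Category* H]

theorem isRightKanExtension_of_bijective {L : C ⥤ D} {G : C ⥤ H} (F : D ⥤ H) (α : L ⋙ F ⟶ G)
    (h : ∀ K : D ⥤ H, Function.Bijective (fun σ : K ⟶ F => whiskerLeft L σ ≫ α)) :
    F.IsRightKanExtension α := by
  refine ⟨⟨Limits.IsTerminal.ofUniqueHom (fun X => CostructuredArrow.homMk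
    ((h X.left).2 X.hom).choose ((h X.left).2 X.hom).choose_spec) ?_⟩⟩
  intro X m
  refine CostructuredArrow.hom_ext _ _ ((h X.left).1 ?_)
  exact (CostructuredArrow.w m).trans ((h X.left).2 X.hom).choose_spec.symm

theorem isLeftKanExtension_of_bijective {L : C ⥤ D} {G : C ⥤ H} (F : D ⥤ H) (α : G ⟶ L ⋙ F)
    (h : ∀ K : D ⥤ H, Function.Bijective (fun σ : F ⟶ K => α ≫ whiskerLeft L σ)) :
    F.IsLeftKanExtension α := by
  refine ⟨⟨Limits.IsInitial.ofUniqueHom (fun X => StructuredArrow.homMk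
    ((h X.right).2 X.hom).choose ((h X.right).2 X.hom).choose_spec) ?_⟩⟩
  intro X m
  refine StructuredArrow.hom_ext _ _ ((h X.right).1 ?_)
  exact (StructuredArrow.w m).trans ((h X.right).2 X.hom).choose_spec.symm

variable {W : MorphismProperty C}

theorem isRightKanExtension_of_iso_comp {G : C ⥤ H} (F : W.Localization ⥤ H) (e : W.Q ⋙ F ≅ G) :
    F.IsRightKanExtension e.hom := by
  refine isRightKanExtension_of_bijective _ _ fun K => ⟨fun σ σ' h => ?_, fun β => ?_⟩
  · refine Localization.natTrans_ext W.Q W fun X => ?_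
    exact NatTrans.congr_app ((cancel_mono e.hom).1 h) X
  · refine ⟨Localization.Construction.natTransExtension (β ≫ e.inv), ?_⟩
    dsimp only
    rw [Localization.Construction.whiskerLeft_natTransExtension]
    simp

theorem isLeftKanExtension_of_iso_comp {G : C ⥤ H} (F : W.Localization ⥤ H) (e : W.Q ⋙ F ≅ G) :
    F.IsLeftKanExtension e.inv := by
  refine isLeftKanExtension_of_bijective _ _ fun K => ⟨fun σ σ' h => ?_, fun β => ?_⟩
  · refine Localization.natTrans_ext W.Q W fun X => ?_
    exact NatTrans.congr_app ((cancel_epi e.inv).1 h) X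
  · refine ⟨Localization.Construction.natTransExtension (e.hom ≫ β), ?_⟩
    dsimp only
    rw [Localization.Construction.whiskerLeft_natTransExtension]
    simp

end KanExtension

section AdjointDerived

open Functor

variable {C₁ C₂ : Type*} [Category* C₁] [Category* C₂] {W₁ : MorphismProperty C₁}
  {W₂ : MorphismProperty C₂} {G : C₁ ⥤ C₂} {F : C₂ ⥤ C₁}
  {G' : W₁.Localization ⥤ W₂.Localization} {F' : W₂.Localization ⥤ W₁.Localization}

/-- If the right adjoint `F` of `G` induces a functor `F'` between the localisations, and `G'` is
left adjoint to `F'`, then `G'` is the total left derived functor of `G`. -/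
theorem exists_isRightKanExtension_of_adjunction (adj : G ⊣ F)
    (adj' : G' ⊣ F') (e : W₂.Q ⋙ F' ≅ F ⋙ W₁.Q) :
    ∃ α : W₁.Q ⋙ G' ⟶ G ⋙ W₂.Q, G'.IsRightKanExtension α := by
  let α : W₁.Q ⋙ G' ⟶ G ⋙ W₂.Q :=
    { app := fun M => G'.map (W₁.Q.map (adj.unit.app M) ≫ e.inv.app (G.obj M)) ≫
        adj'.counit.app (W₂.Q.obj (G.obj M))
      naturality := fun M N φ => by
        have h₁ := e.inv.naturality (G.map φ)
        have h₂ := adj'.counit.naturality (W₂.Q.map (G.map φ))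
        dsimp at h₁ h₂ ⊢
        rw [Category.assoc, ← h₂, ← G'.map_comp_assoc, ← G'.map_comp_assoc, Category.assoc, ← h₁,
          ← W₁.Q.map_comp_assoc, ← W₁.Q.map_comp_assoc]
        simp }
  have hα : ∀ M, adj'.unit.app (W₁.Q.obj M) ≫ F'.map (α.app M) =
      W₁.Q.map (adj.unit.app M) ≫ e.inv.app (G.obj M) := by
    intro M
    dsimp [α]
    simp
  have hα' : ∀ P, α.app (F.obj P) ≫ W₂.Q.map (adj.counit.app P) =
      G'.map (e.inv.app P) ≫ adj'.counit.app (W₂.Q.obj P) := by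
    intro P
    have h₁ := e.inv.naturality (adj.counit.app P)
    have h₂ := adj'.counit.naturality (W₂.Q.map (adj.counit.app P))
    dsimp [α] at h₁ h₂ ⊢
    rw [Category.assoc, ← h₂, ← G'.map_comp_assoc, Category.assoc, ← h₁, ← W₁.Q.map_comp_assoc]
    simp
  refine ⟨α, isRightKanExtension_of_bijective _ _ fun K => ⟨fun σ σ' h => ?_, fun β => ?_⟩⟩
  · have key : ∀ (σ : K ⟶ G') (P : C₂), σ.app (F'.obj (W₂.Q.obj P)) ≫ adj'.counit.app (W₂.Q.obj P) =
        K.map (e.hom.app P) ≫ (whiskerLeft W₁.Q σ ≫ α).app (F.obj P) ≫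
          W₂.Q.map (adj.counit.app P) := by
      intro σ P
      have h₁ := σ.naturality (e.hom.app P)
      dsimp at h₁ ⊢
      rw [Category.assoc, hα', reassoc_of% h₁, ← G'.map_comp_assoc]
      simp
    have key₂ : ∀ Y, σ.app (F'.obj Y) ≫ adj'.counit.app Y =
        σ'.app (F'.obj Y) ≫ adj'.counit.app Y := by
      intro Y
      obtain ⟨P, rfl⟩ := (Localization.Construction.objEquiv W₂).surjective Y
      exact (key σ P).trans ((by rw [show whiskerLeft W₁.Q σ ≫ α = whiskerLeft W₁.Q σ' ≫ α from h]
        : _ = _).trans (key σ' P).symm)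
    have key₃ : ∀ (σ : K ⟶ G') X, σ.app X =
        K.map (adj'.unit.app X) ≫ σ.app (F'.obj (G'.obj X)) ≫ adj'.counit.app (G'.obj X) := by
      intro σ X
      have h₁ := σ.naturality (adj'.unit.app X)
      dsimp at h₁
      rw [reassoc_of% h₁]
      simp
    ext X
    rw [key₃ σ, key₃ σ', key₂]
  · let τ : F' ⋙ K ⟶ 𝟭 _ := Localization.Construction.natTransExtension
      (W := W₂) (F₁ := F' ⋙ K) (F₂ := 𝟭 _)
      { app := fun P => K.map (e.hom.app P) ≫ β.app (F.obj P) ≫ W₂.Q.map (adj.counit.app P)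
        naturality := fun P P' φ => by
          have h₁ := e.hom.naturality φ
          have h₂ := β.naturality (F.map φ)
          dsimp at h₁ h₂ ⊢
          rw [← K.map_comp_assoc, h₁, K.map_comp_assoc, reassoc_of% h₂, ← W₂.Q.map_comp]
          simp }
    have hτ : ∀ P, τ.app (W₂.Q.obj P) =
        K.map (e.hom.app P) ≫ β.app (F.obj P) ≫ W₂.Q.map (adj.counit.app P) :=
      fun P => Localization.Construction.NatTransExtension.app_eq _ _
    refine ⟨{ app := fun X => K.map (adj'.unit.app X) ≫ τ.app (G'.obj X)
              naturality := fun X Y f => ?_ }, ?_⟩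
    · have h₁ := adj'.unit.naturality f
      have h₂ := τ.naturality (G'.map f)
      dsimp at h₁ h₂ ⊢
      rw [← K.map_comp_assoc, h₁, K.map_comp_assoc, h₂, Category.assoc]
    · ext M
      have h₁ := τ.naturality (α.app M)
      have h₂ := β.naturality (adj.unit.app M)
      dsimp at h₁ h₂ ⊢
      rw [Category.assoc, ← h₁, ← K.map_comp_assoc, hα, hτ, ← K.map_comp_assoc]
      simp only [Category.assoc, Iso.inv_hom_id_app, Functor.comp_obj, Category.comp_id]
      rw [reassoc_of% h₂, ← W₂.Q.map_comp]
      simp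

/-- If the left adjoint `G` of `F` induces a functor `G'` between the localisations, and `F'` is
right adjoint to `G'`, then `F'` is the total right derived functor of `F`. -/
theorem exists_isLeftKanExtension_of_adjunction (adj : G ⊣ F)
    (adj' : G' ⊣ F') (e : W₁.Q ⋙ G' ≅ G ⋙ W₂.Q) :
    ∃ α : F ⋙ W₁.Q ⟶ W₂.Q ⋙ F', F'.IsLeftKanExtension α := by
  let α : F ⋙ W₁.Q ⟶ W₂.Q ⋙ F' :=
    { app := fun P => adj'.unit.app (W₁.Q.obj (F.obj P)) ≫
        F'.map (e.hom.app (F.obj P) ≫ W₂.Q.map (adj.counit.app P))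
      naturality := fun M N φ => by
        have h₁ := e.hom.naturality (F.map φ)
        have h₂ := adj'.unit.naturality (W₁.Q.map (F.map φ))
        dsimp at h₁ h₂ ⊢
        rw [reassoc_of% h₂, ← F'.map_comp, reassoc_of% h₁, ← W₂.Q.map_comp, Category.assoc,
          ← F'.map_comp, Category.assoc, ← W₂.Q.map_comp]
        simp }
  have hα : ∀ P, G'.map (α.app P) ≫ adj'.counit.app (W₂.Q.obj P) =
      e.hom.app (F.obj P) ≫ W₂.Q.map (adj.counit.app P) := by
    intro P
    dsimp [α]
    simp
  have hα' : ∀ M, W₁.Q.map (adj.unit.app M) ≫ α.app (G.obj M) =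
      adj'.unit.app (W₁.Q.obj M) ≫ F'.map (e.hom.app M) := by
    intro M
    have h₁ := e.hom.naturality (adj.unit.app M)
    have h₂ := adj'.unit.naturality (W₁.Q.map (adj.unit.app M))
    dsimp [α] at h₁ h₂ ⊢
    rw [reassoc_of% h₂, ← F'.map_comp, reassoc_of% h₁, ← W₂.Q.map_comp]
    simp
  refine ⟨α, isLeftKanExtension_of_bijective _ _ fun K => ⟨fun σ σ' h => ?_, fun β => ?_⟩⟩
  · have key : ∀ (σ : F' ⟶ K) (M : C₁),
        adj'.unit.app (W₁.Q.obj M) ≫ σ.app (G'.obj (W₁.Q.obj M)) =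
        W₁.Q.map (adj.unit.app M) ≫ (α ≫ whiskerLeft W₂.Q σ).app (G.obj M) ≫
          K.map (e.inv.app M) := by
      intro σ M
      have h₁ := σ.naturality (e.inv.app M)
      dsimp at h₁ ⊢
      rw [Category.assoc, ← h₁, reassoc_of% (hα' M), ← F'.map_comp_assoc]
      simp
    have key₂ : ∀ Y, adj'.unit.app Y ≫ σ.app (G'.obj Y) = adj'.unit.app Y ≫ σ'.app (G'.obj Y) := by
      intro Y
      obtain ⟨P, rfl⟩ := (Localization.Construction.objEquiv W₁).surjective Y
      exact (key σ P).trans ((by rw [show α ≫ whiskerLeft W₂.Q σ = α ≫ whiskerLeft W₂.Q σ' from h]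
        : _ = _).trans (key σ' P).symm)
    have key₃ : ∀ (σ : F' ⟶ K) X, σ.app X =
        (adj'.unit.app (F'.obj X) ≫ σ.app (G'.obj (F'.obj X))) ≫ K.map (adj'.counit.app X) := by
      intro σ X
      have h₁ := σ.naturality (adj'.counit.app X)
      dsimp at h₁
      rw [Category.assoc, ← h₁]
      exact (adj'.right_triangle_components_assoc X _).symm
    ext X
    rw [key₃ σ, key₃ σ', key₂]
  · let τ : 𝟭 _ ⟶ G' ⋙ K := Localization.Construction.natTransExtension
      (W := W₁) (F₁ := 𝟭 _) (F₂ := G' ⋙ K)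
      { app := fun M => W₁.Q.map (adj.unit.app M) ≫ β.app (G.obj M) ≫ K.map (e.inv.app M)
        naturality := fun P P' φ => by
          have h₁ := e.inv.naturality φ
          have h₂ := β.naturality (G.map φ)
          dsimp at h₁ h₂ ⊢
          rw [Category.assoc, Category.assoc, ← K.map_comp, ← h₁, K.map_comp, ← reassoc_of% h₂,
            ← W₁.Q.map_comp_assoc, ← W₁.Q.map_comp_assoc]
          simp }
    have hτ : ∀ M, τ.app (W₁.Q.obj M) =
        W₁.Q.map (adj.unit.app M) ≫ β.app (G.obj M) ≫ K.map (e.inv.app M) :=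
      fun P => Localization.Construction.NatTransExtension.app_eq _ _
    refine ⟨{ app := fun X => τ.app (F'.obj X) ≫ K.map (adj'.counit.app X)
              naturality := fun X Y f => ?_ }, ?_⟩
    · have h₁ := adj'.counit.naturality f
      have h₂ := τ.naturality (F'.map f)
      dsimp at h₁ h₂ ⊢
      rw [reassoc_of% h₂, ← K.map_comp, h₁, K.map_comp, Category.assoc]
    · ext P
      have h₁ := τ.naturality (α.app P)
      have h₂ := β.naturality (adj.counit.app P)
      dsimp at h₁ h₂ ⊢
      rw [reassoc_of% h₁, ← K.map_comp, hα, hτ]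
      simp only [Category.assoc]
      rw [← K.map_comp, Iso.inv_hom_id_app_assoc, ← h₂, ← W₁.Q.map_comp_assoc]
      simp

end AdjointDerived

/-- The localisation functor preserves initial objects. -/
theorem exists_unique_hom_of_isInitial {C : Type*} [Category* C] (W : MorphismProperty C) {X : C}
    (hX : Limits.IsInitial X) (Y : W.Localization) (f g : W.Q.obj X ⟶ Y) : f = g := by
  let τ : (Functor.const _).obj (W.Q.obj X) ⟶ 𝟭 W.Localization :=
    Localization.Construction.natTransExtension (W := W)
      (F₁ := (Functor.const _).obj (W.Q.obj X)) (F₂ := 𝟭 _)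
      { app := fun Z => W.Q.map (hX.to Z)
        naturality := fun Z Z' φ => by
          dsimp
          rw [Category.id_comp, ← W.Q.map_comp]
          exact congrArg _ (hX.hom_ext _ _) }
  have hτ : τ.app (W.Q.obj X) = 𝟙 _ := by
    refine (Localization.Construction.NatTransExtension.app_eq _ _).trans ?_
    exact (congrArg W.Q.map (hX.hom_ext (hX.to X) (𝟙 X))).trans (W.Q.map_id X)
  have key : ∀ f : W.Q.obj X ⟶ Y, f = τ.app Y := by
    intro f
    have h₁ := τ.naturality f
    rw [hτ] at h₁
    exact ((Category.id_comp f).symm.trans h₁.symm).trans (Category.id_comp _)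
  rw [key f, key g]

end DG

namespace DG
variable {k : Type u} [Field k]

/-! ### Functors between derived categories -/

section Desc

variable {Λ Γ Ω : DGA k}

/-- A functor that preserves quasi-isomorphisms. -/
def Exact (G : DGMod Λ ⥤ DGMod Γ) : Prop :=
  ∀ ⦃M N : DGMod Λ⦄ (φ : M ⟶ N), quasiIso Λ φ → quasiIso Γ (G.map φ)

theorem Exact.comp {G : DGMod Λ ⥤ DGMod Γ} {G' : DGMod Γ ⥤ DGMod Ω} (h : Exact G) (h' : Exact G') :
    Exact (G ⋙ G') := fun _ _ φ hφ => h' _ (h φ hφ)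

theorem Exact.of_natTrans {G G' : DGMod Λ ⥤ DGMod Γ} (τ : G ⟶ G')
    (hτ : ∀ M, quasiIso Γ (τ.app M)) (h : Exact G) : Exact G' := by
  intro M N φ hφ
  refine MorphismProperty.of_precomp _ (τ.app M) _ (hτ M) ?_
  rw [← τ.naturality]
  exact (quasiIso Γ).comp_mem _ _ (h φ hφ) (hτ N)

theorem Exact.of_natTrans' {G G' : DGMod Λ ⥤ DGMod Γ} (τ : G ⟶ G')
    (hτ : ∀ M, quasiIso Γ (τ.app M)) (h : Exact G') : Exact G := by
  intro M N φ hφ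
  refine MorphismProperty.of_postcomp _ _ (τ.app N) (hτ N) ?_
  rw [τ.naturality]
  exact (quasiIso Γ).comp_mem _ _ (hτ M) (h φ hφ)

theorem exists_toD_obj (X : D Λ) : ∃ M, (toD Λ).obj M = X :=
  (Localization.Construction.objEquiv (quasiIso Λ)).surjective X

/-- The functor on derived categories induced by an exact functor. -/
noncomputable def desc (G : DGMod Λ ⥤ DGMod Γ) (hG : Exact G) : D Λ ⥤ D Γ :=
  Localization.Construction.lift (G ⋙ toD Γ)
    (fun _ _ φ h => Localization.inverts (toD Γ) (quasiIso Γ) _ (hG φ h))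

theorem lift_map {C E : Type*} [Category* C] [Category* E] {W : MorphismProperty C} (G : C ⥤ E)
    (hG : W.IsInvertedBy G) {X Y : C} (f : X ⟶ Y) :
    (Localization.Construction.lift G hG).map (W.Q.map f) = G.map f := by
  exact (Functor.congr_hom (Localization.Construction.fac G hG) f).trans
    ((Category.id_comp _).trans (Category.comp_id _))

theorem desc_map (G : DGMod Λ ⥤ DGMod Γ) (hG : Exact G) {M N : DGMod Λ} (φ : M ⟶ N) :
    (desc G hG).map ((toD Λ).map φ) = (toD Γ).map (G.map φ) := lift_map _ _ φ

theorem shiftD_map {M N : DGMod Λ} (φ : M ⟶ N) :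
    (shiftD Λ).map ((toD Λ).map φ) = (toD Λ).map ((shiftFunctor Λ).map φ) := lift_map _ _ φ

/-- `desc G` is compatible with the localisation functors. -/
noncomputable def descIso (G : DGMod Λ ⥤ DGMod Γ) (hG : Exact G) :
    toD Λ ⋙ desc G hG ≅ G ⋙ toD Γ :=
  NatIso.ofComponents (fun _ => Iso.refl _) (fun φ => by
    refine (Category.comp_id _).trans (Eq.trans ?_ (Category.id_comp _).symm)
    exact desc_map G hG φ)

theorem shiftDIso_inv_app (M : DGMod Λ) :
    (shiftDIso Λ).inv.app M = 𝟙 ((toD Λ).obj M.shift) := by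
  simp [shiftDIso]
  rfl

theorem natTransExtension_app {C E : Type*} [Category* C] [Category* E] {W : MorphismProperty C}
    {F₁ F₂ : W.Localization ⥤ E} (τ : W.Q ⋙ F₁ ⟶ W.Q ⋙ F₂) (X : C) :
    (Localization.Construction.natTransExtension τ).app (W.Q.obj X) = τ.app X :=
  Localization.Construction.NatTransExtension.app_eq _ _

/-- An isomorphism of functors on a localisation is determined by its values on the objects of the
original category. -/
noncomputable def natIsoExtension {C E : Type*} [Category* C] [Category* E]
    {W : MorphismProperty C} {F₁ F₂ : W.Localization ⥤ E} (τ : W.Q ⋙ F₁ ≅ W.Q ⋙ F₂) : F₁ ≅ F₂ where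
  hom := Localization.Construction.natTransExtension τ.hom
  inv := Localization.Construction.natTransExtension τ.inv
  hom_inv_id := Localization.natTrans_ext W.Q W fun X => by
    rw [NatTrans.comp_app, natTransExtension_app, natTransExtension_app]
    exact τ.hom_inv_id_app X
  inv_hom_id := Localization.natTrans_ext W.Q W fun X => by
    rw [NatTrans.comp_app, natTransExtension_app, natTransExtension_app]
    exact τ.inv_hom_id_app X

/-- The transformation of functors on derived categories that is induced by a natural
transformation. -/
noncomputable def descMap {G G' : DGMod Λ ⥤ DGMod Γ} (hG : Exact G) (hG' : Exact G') (τ : G ⟶ G') :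
    desc G hG ⟶ desc G' hG' :=
  Localization.Construction.natTransExtension
    ((descIso G hG).hom ≫ Functor.whiskerRight τ (toD Γ) ≫ (descIso G' hG').inv)

theorem descMap_app {G G' : DGMod Λ ⥤ DGMod Γ} (hG : Exact G) (hG' : Exact G') (τ : G ⟶ G')
    (M : DGMod Λ) : (descMap hG hG' τ).app ((toD Λ).obj M) = (toD Γ).map (τ.app M) := by
  refine (natTransExtension_app _ M).trans ?_
  exact (Category.id_comp _).trans (Category.comp_id _)

theorem isIso_descMap {G G' : DGMod Λ ⥤ DGMod Γ} (hG : Exact G) (hG' : Exact G') (τ : G ⟶ G')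
    (hτ : ∀ M, quasiIso Γ (τ.app M)) : IsIso (descMap hG hG' τ) := by
  have : ∀ X, IsIso ((descMap hG hG' τ).app X) := by
    intro X
    obtain ⟨M, rfl⟩ := exists_toD_obj X
    rw [descMap_app]
    exact isIso_toD_map (hτ M)
  exact NatIso.isIso_of_isIso_app _

/-- The isomorphism of functors on derived categories that is induced by a natural
quasi-isomorphism. -/
noncomputable def descMapIso {G G' : DGMod Λ ⥤ DGMod Γ} (hG : Exact G) (hG' : Exact G')
    (τ : G ⟶ G') (hτ : ∀ M, quasiIso Γ (τ.app M)) : desc G hG ≅ desc G' hG' :=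
  @asIso _ _ _ _ (descMap hG hG' τ) (isIso_descMap hG hG' τ hτ)

theorem descMapIso_hom_app {G G' : DGMod Λ ⥤ DGMod Γ} (hG : Exact G) (hG' : Exact G')
    (τ : G ⟶ G') (hτ : ∀ M, quasiIso Γ (τ.app M)) (M : DGMod Λ) :
    (descMapIso hG hG' τ hτ).hom.app ((toD Λ).obj M) = (toD Γ).map (τ.app M) :=
  descMap_app hG hG' τ M

/-- The adjunction between derived categories that is induced by an adjunction of exact
functors. -/
noncomputable def descAdj {G : DGMod Λ ⥤ DGMod Γ} {F : DGMod Γ ⥤ DGMod Λ} (adj : G ⊣ F)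
    (hG : Exact G) (hF : Exact F) : desc G hG ⊣ desc F hF :=
  let _ : CatCommSq G (toD Λ) (toD Γ) (desc G hG) := ⟨(descIso G hG).symm⟩
  let _ : CatCommSq F (toD Γ) (toD Λ) (desc F hF) := ⟨(descIso F hF).symm⟩
  adj.localization (toD Λ) (quasiIso Λ) (toD Γ) (quasiIso Γ) (desc G hG) (desc F hF)

theorem descAdj_unit_app {G : DGMod Λ ⥤ DGMod Γ} {F : DGMod Γ ⥤ DGMod Λ} (adj : G ⊣ F)
    (hG : Exact G) (hF : Exact F) (M : DGMod Λ) :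
    (descAdj adj hG hF).unit.app ((toD Λ).obj M) = (toD Λ).map (adj.unit.app M) := by
  let _ : CatCommSq G (toD Λ) (toD Γ) (desc G hG) := ⟨(descIso G hG).symm⟩
  let _ : CatCommSq F (toD Γ) (toD Λ) (desc F hF) := ⟨(descIso F hF).symm⟩
  refine (adj.localization_unit_app (toD Λ) (quasiIso Λ) (toD Γ) (quasiIso Γ) (desc G hG)
    (desc F hF) M).trans ?_
  have h : (desc F hF).map (𝟙 ((toD Γ).obj (G.obj M))) = 𝟙 _ := (desc F hF).map_id _
  refine (congrArg (fun z => (toD Λ).map (adj.unit.app M) ≫ 𝟙 _ ≫ z) h).trans ?_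
  exact (congrArg (fun z => (toD Λ).map (adj.unit.app M) ≫ z) (Category.comp_id _)).trans
    (Category.comp_id _)

theorem descAdj_counit_app {G : DGMod Λ ⥤ DGMod Γ} {F : DGMod Γ ⥤ DGMod Λ} (adj : G ⊣ F)
    (hG : Exact G) (hF : Exact F) (P : DGMod Γ) :
    (descAdj adj hG hF).counit.app ((toD Γ).obj P) = (toD Γ).map (adj.counit.app P) := by
  let _ : CatCommSq G (toD Λ) (toD Γ) (desc G hG) := ⟨(descIso G hG).symm⟩
  let _ : CatCommSq F (toD Γ) (toD Λ) (desc F hF) := ⟨(descIso F hF).symm⟩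
  refine (adj.localization_counit_app (toD Λ) (quasiIso Λ) (toD Γ) (quasiIso Γ) (desc G hG)
    (desc F hF) P).trans ?_
  have h : (desc G hG).map (𝟙 ((toD Λ).obj (F.obj P))) = 𝟙 _ := (desc G hG).map_id _
  refine (congrArg (fun z => z ≫ 𝟙 _ ≫ (toD Γ).map (adj.counit.app P)) h).trans ?_
  exact (Category.id_comp _).trans (Category.id_comp _)

theorem isLeftDerived_of_iso {F : D Λ ⥤ D Γ} {G : DGMod Λ ⥤ DGMod Γ} (e : toD Λ ⋙ F ≅ G ⋙ toD Γ) :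
    IsLeftDerived F G := ⟨e.hom, ⟨isRightKanExtension_of_iso_comp F e⟩⟩

theorem isRightDerived_of_iso {F : D Λ ⥤ D Γ} {G : DGMod Λ ⥤ DGMod Γ} (e : toD Λ ⋙ F ≅ G ⋙ toD Γ) :
    IsRightDerived F G := ⟨e.inv, ⟨isLeftKanExtension_of_iso_comp F e⟩⟩

theorem isLeftDerived_of_adjunction {G : DGMod Λ ⥤ DGMod Γ} {F : DGMod Γ ⥤ DGMod Λ} (adj : G ⊣ F)
    {G' : D Λ ⥤ D Γ} {F' : D Γ ⥤ D Λ} (adj' : G' ⊣ F') (e : toD Γ ⋙ F' ≅ F ⋙ toD Λ) :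
    IsLeftDerived G' G := by
  obtain ⟨α, hα⟩ := exists_isRightKanExtension_of_adjunction adj adj' e
  exact ⟨α, ⟨hα⟩⟩

theorem isRightDerived_of_adjunction {G : DGMod Λ ⥤ DGMod Γ} {F : DGMod Γ ⥤ DGMod Λ} (adj : G ⊣ F)
    {G' : D Λ ⥤ D Γ} {F' : D Γ ⥤ D Λ} (adj' : G' ⊣ F') (e : toD Λ ⋙ G' ≅ G ⋙ toD Γ) :
    IsRightDerived F' F := by
  obtain ⟨α, hα⟩ := exists_isLeftKanExtension_of_adjunction adj adj' e
  exact ⟨α, ⟨hα⟩⟩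

theorem isZero_toD_of_acyclic (M : DGMod Λ) (hM : M.Acyclic) :
    Limits.IsZero ((toD Λ).obj M) := by
  let Z : DGMod Λ :=
    { X := fun _ => PUnit
      d := fun _ _ _ => 0
      d_d := fun _ _ _ _ _ _ => rfl
      act := fun _ _ _ _ => 0
      act_one := fun _ _ => rfl
      act_act := fun _ _ _ _ _ _ _ _ _ _ _ _ _ => rfl
      d_act := fun _ _ _ _ _ _ _ _ _ _ _ _ => rfl }
  let toZ : ∀ N : DGMod Λ, N ⟶ Z := fun N =>
    { f := fun _ => 0, comm := fun _ _ _ _ => rfl, map_act := fun _ _ _ _ _ _ => rfl }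
  let ofZ : ∀ N : DGMod Λ, Z ⟶ N := fun N =>
    { f := fun _ => 0, comm := fun _ _ _ _ => by simp, map_act := fun _ _ _ _ _ _ => by simp }
  have hZ : Limits.IsZero ((toD Λ).obj Z) := by
    let h₁ : (Functor.const _).obj ((toD Λ).obj Z) ⟶ 𝟭 (D Λ) :=
      Localization.Construction.natTransExtension (W := quasiIso Λ)
        (F₁ := (Functor.const _).obj ((toD Λ).obj Z)) (F₂ := 𝟭 _)
        { app := fun N => (toD Λ).map (ofZ N)
          naturality := fun N N' φ => by
            refine (Category.id_comp _).trans (Eq.trans (congrArg _ ?_) ((toD Λ).map_comp _ _))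
            ext i x
            exact (map_zero (φ.f i)).symm }
    let h₂ : 𝟭 (D Λ) ⟶ (Functor.const _).obj ((toD Λ).obj Z) :=
      Localization.Construction.natTransExtension (W := quasiIso Λ)
        (F₁ := 𝟭 _) (F₂ := (Functor.const _).obj ((toD Λ).obj Z))
        { app := fun N => (toD Λ).map (toZ N)
          naturality := fun N N' φ =>
            ((toD Λ).map_comp _ _).symm.trans (Category.comp_id _).symm }
    have e₁ : h₁.app ((toD Λ).obj Z) = 𝟙 _ :=
      (natTransExtension_app _ Z).trans ((congrArg (toD Λ).map rfl).trans ((toD Λ).map_id Z))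
    have e₂ : h₂.app ((toD Λ).obj Z) = 𝟙 _ :=
      (natTransExtension_app _ Z).trans ((congrArg (toD Λ).map rfl).trans ((toD Λ).map_id Z))
    refine ⟨fun Y => ⟨⟨⟨h₁.app Y⟩, fun f => ?_⟩⟩, fun Y => ⟨⟨⟨h₂.app Y⟩, fun f => ?_⟩⟩⟩
    · have := h₁.naturality f
      rw [e₁] at this
      exact ((Category.id_comp f).symm.trans this.symm).trans (Category.id_comp _)
    · have := h₂.naturality f
      rw [e₂] at this
      exact ((Category.comp_id f).symm.trans this).trans (Category.comp_id _)
  have hq : quasiIso Λ (toZ M) := fun i =>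
    ⟨fun x hx _ => hM i x hx, fun y hy => ⟨0, map_zero _, i - 1, by omega, 0, rfl⟩⟩
  have := isIso_toD_map hq
  exact hZ.of_iso (asIso ((toD Λ).map (toZ M)))

end Desc

/-! ### Triangulated functors -/

section Triangulated

variable {Λ Γ Ω : DGA k}

theorem Distinguished.of_iso {X Y Z X' Y' Z' : D Λ} {f : X ⟶ Y} {g : Y ⟶ Z}
    {h : Z ⟶ (shiftD Λ).obj X} {f' : X' ⟶ Y'} {g' : Y' ⟶ Z'} {h' : Z' ⟶ (shiftD Λ).obj X'}
    (H : Distinguished f g h) (x : X' ≅ X) (y : Y' ≅ Y) (z : Z' ≅ Z) (h₁ : f' ≫ y.hom = x.hom ≫ f)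
    (h₂ : g' ≫ z.hom = y.hom ≫ g) (h₃ : h' ≫ (shiftD Λ).map x.hom = z.hom ≫ h) :
    Distinguished f' g' h' := by
  obtain ⟨M, N, φ, a, b, c, e₁, e₂, e₃⟩ := H
  refine ⟨M, N, φ, x ≪≫ a, y ≪≫ b, z ≪≫ c, ?_, ?_, ?_⟩
  · simp [reassoc_of% h₁, e₁]
  · simp [reassoc_of% h₂, e₂]
  · simp only [Iso.trans_hom, Functor.map_comp, reassoc_of% h₃, e₃, Category.assoc]

theorem distinguished_cone {M N : DGMod Λ} (φ : M ⟶ N) :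
    Distinguished ((toD Λ).map φ) ((toD Λ).map (coneIn φ))
      ((toD Λ).map (coneOut φ) ≫ (shiftDIso Λ).inv.app M) := by
  refine ⟨M, N, φ, Iso.refl _, Iso.refl _, Iso.refl _, ?_, ?_, ?_⟩
  · simp
  · simp
  · simp only [Iso.refl_hom, CategoryTheory.Functor.map_id, Category.id_comp]
    exact Category.comp_id _

theorem IsTriangulated.comp {F : D Λ ⥤ D Γ} {G : D Γ ⥤ D Ω} (hF : IsTriangulated F)
    (hG : IsTriangulated G) : IsTriangulated (F ⋙ G) := by
  obtain ⟨η, hη⟩ := hF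
  obtain ⟨θ, hθ⟩ := hG
  refine ⟨(Functor.associator _ _ _).symm ≪≫ Functor.isoWhiskerRight η G ≪≫
    Functor.associator _ _ _ ≪≫ Functor.isoWhiskerLeft F θ ≪≫ (Functor.associator _ _ _).symm, ?_⟩
  intro X Y Z f g h H
  have := hθ _ _ _ (hη f g h H)
  simpa using! this

/-- A functor between categories of dg-modules that commutes with shifts and mapping cones. -/
structure ConeData (G : DGMod Λ ⥤ DGMod Γ) where
  /-- Commutation with shifts. -/
  shiftIso : shiftFunctor Λ ⋙ G ≅ G ⋙ shiftFunctor Γ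
  /-- Commutation with mapping cones. -/
  coneIso {M N : DGMod Λ} (φ : M ⟶ N) : G.obj (cone φ) ≅ cone (G.map φ)
  coneIn_comp {M N : DGMod Λ} (φ : M ⟶ N) : G.map (coneIn φ) ≫ (coneIso φ).hom = coneIn (G.map φ)
  coneOut_comp {M N : DGMod Λ} (φ : M ⟶ N) :
    G.map (coneOut φ) ≫ shiftIso.hom.app M = (coneIso φ).hom ≫ coneOut (G.map φ)

/-- The composition of two functors that commute with mapping cones. -/
def ConeData.comp {G : DGMod Λ ⥤ DGMod Γ} {G' : DGMod Γ ⥤ DGMod Ω} (c : ConeData G)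
    (c' : ConeData G') : ConeData (G ⋙ G') where
  shiftIso := (Functor.associator _ _ _).symm ≪≫ Functor.isoWhiskerRight c.shiftIso G' ≪≫
    Functor.associator _ _ _ ≪≫ Functor.isoWhiskerLeft G c'.shiftIso ≪≫
      (Functor.associator _ _ _).symm
  coneIso φ := G'.mapIso (c.coneIso φ) ≪≫ c'.coneIso (G.map φ)
  coneIn_comp φ := by
    dsimp
    rw [← G'.map_comp_assoc, c.coneIn_comp, c'.coneIn_comp]
  coneOut_comp φ := by
    have h₁ := c.coneOut_comp φ
    have h₂ := c'.coneOut_comp (G.map φ)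
    simp only [Functor.comp_obj, Functor.comp_map, Iso.trans_hom, Iso.symm_hom,
      Functor.isoWhiskerRight_hom, Functor.isoWhiskerLeft_hom, NatTrans.comp_app,
      Functor.associator_inv_app, Functor.whiskerRight_app, Functor.associator_hom_app,
      Functor.whiskerLeft_app, Category.comp_id, Category.id_comp, Functor.mapIso_hom,
      Category.assoc] at h₁ h₂ ⊢
    rw [← G'.map_comp_assoc, h₁, G'.map_comp_assoc, h₂]

theorem ConeData.exact {G : DGMod Λ ⥤ DGMod Γ} (c : ConeData G)
    (h : ∀ M : DGMod Λ, M.Acyclic → (G.obj M).Acyclic) : Exact G := by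
  intro M N φ hφ
  rw [quasiIso_iff_acyclic_cone] at hφ ⊢
  exact (h _ hφ).of_isQuasiIso (quasiIso_of_iso (c.coneIso φ))

theorem ConeData.acyclic_cone {G : DGMod Λ ⥤ DGMod Γ} (c : ConeData G) {M N : DGMod Λ} (φ : M ⟶ N) :
    (G.obj (cone φ)).Acyclic ↔ quasiIso Γ (G.map φ) := by
  rw [quasiIso_iff_acyclic_cone]
  exact ⟨fun h => h.of_isQuasiIso (quasiIso_of_iso (c.coneIso φ)),
    fun h => h.of_isQuasiIso' (quasiIso_of_iso (c.coneIso φ))⟩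

/-- The functor on derived categories commutes with shifts. -/
noncomputable def ConeData.shiftDescIso {G : DGMod Λ ⥤ DGMod Γ} (c : ConeData G) (hG : Exact G) :
    shiftD Λ ⋙ desc G hG ≅ desc G hG ⋙ shiftD Γ :=
  natIsoExtension (NatIso.ofComponents (F := toD Λ ⋙ shiftD Λ ⋙ desc G hG)
    (G := toD Λ ⋙ desc G hG ⋙ shiftD Γ)
    (fun M => (toD Γ).mapIso (c.shiftIso.app M)) (fun {M N} φ => by
      have h₁ : (toD Λ ⋙ shiftD Λ ⋙ desc G hG).map φ =
          (toD Γ).map (G.map ((shiftFunctor Λ).map φ)) :=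
        (congrArg (desc G hG).map (shiftD_map φ)).trans (desc_map G hG _)
      have h₂ : (toD Λ ⋙ desc G hG ⋙ shiftD Γ).map φ =
          (toD Γ).map ((shiftFunctor Γ).map (G.map φ)) :=
        (congrArg (shiftD Γ).map (desc_map G hG φ)).trans (shiftD_map _)
      refine (congrArg (· ≫ (toD Γ).map (c.shiftIso.hom.app N)) h₁).trans ?_
      refine Eq.trans ?_ (congrArg ((toD Γ).map (c.shiftIso.hom.app M) ≫ ·) h₂).symm
      refine ((toD Γ).map_comp _ _).symm.trans (Eq.trans ?_ ((toD Γ).map_comp _ _))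
      exact congrArg (toD Γ).map (c.shiftIso.hom.naturality φ)))

theorem ConeData.shiftDescIso_hom_app {G : DGMod Λ ⥤ DGMod Γ} (c : ConeData G) (hG : Exact G)
    (M : DGMod Λ) : (c.shiftDescIso hG).hom.app ((toD Λ).obj M) =
      (toD Γ).map (c.shiftIso.hom.app M) :=
  natTransExtension_app _ M

theorem ConeData.distinguished_of_iso {G : DGMod Λ ⥤ DGMod Γ} (c : ConeData G) (F : D Λ ⥤ D Γ)
    (e : toD Λ ⋙ F ≅ G ⋙ toD Γ) (η : shiftD Λ ⋙ F ≅ F ⋙ shiftD Γ)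
    (hη : ∀ M, η.hom.app ((toD Λ).obj M) ≫ (shiftD Γ).map (e.hom.app M) =
      F.map ((shiftDIso Λ).hom.app M) ≫ e.hom.app ((shiftFunctor Λ).obj M) ≫
        (toD Γ).map (c.shiftIso.hom.app M) ≫ (shiftDIso Γ).inv.app (G.obj M))
    {X Y Z : D Λ} (f : X ⟶ Y) (g : Y ⟶ Z) (h : Z ⟶ (shiftD Λ).obj X) (H : Distinguished f g h) :
    Distinguished (F.map f) (F.map g) (F.map h ≫ η.hom.app X) := by
  obtain ⟨M, N, φ, x, y, z, h₁, h₂, h₃⟩ := H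
  refine (distinguished_cone (G.map φ)).of_iso (F.mapIso x ≪≫ e.app M) (F.mapIso y ≪≫ e.app N)
    (F.mapIso z ≪≫ e.app (cone φ) ≪≫ (toD Γ).mapIso (c.coneIso φ)) ?_ ?_ ?_
  · have h₄ := e.hom.naturality φ
    simp only [Functor.comp_obj, Functor.comp_map] at h₄
    simp only [Iso.trans_hom, Functor.mapIso_hom, Iso.app_hom, Category.assoc]
    rw [← F.map_comp_assoc, h₁, F.map_comp, Category.assoc, h₄]
  · have h₄ := e.hom.naturality (coneIn φ)
    simp only [Functor.comp_obj, Functor.comp_map] at h₄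
    simp only [Iso.trans_hom, Functor.mapIso_hom, Iso.app_hom, Category.assoc]
    rw [← F.map_comp_assoc, h₂, F.map_comp, Category.assoc, reassoc_of% h₄, ← c.coneIn_comp φ,
      (toD Γ).map_comp]
  · have h₄ := η.hom.naturality x.hom
    have h₅ := e.hom.naturality (coneOut φ)
    simp only [Functor.comp_obj, Functor.comp_map] at h₄ h₅
    simp only [Iso.trans_hom, Functor.mapIso_hom, Iso.app_hom, Category.assoc, Functor.map_comp]
    rw [← reassoc_of% h₄, ← F.map_comp_assoc, h₃, hη]
    simp only [Functor.map_comp, Category.assoc]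
    rw [← F.map_comp_assoc ((shiftDIso Λ).inv.app M), Iso.inv_hom_id_app,
      CategoryTheory.Functor.map_id, Category.id_comp, reassoc_of% h₅, ← (toD Γ).map_comp_assoc,
      c.coneOut_comp, (toD Γ).map_comp, Category.assoc]

theorem ConeData.distinguished {G : DGMod Λ ⥤ DGMod Γ} (c : ConeData G) (hG : Exact G)
    {X Y Z : D Λ} (f : X ⟶ Y) (g : Y ⟶ Z) (h : Z ⟶ (shiftD Λ).obj X) (H : Distinguished f g h) :
    Distinguished ((desc G hG).map f) ((desc G hG).map g)
      ((desc G hG).map h ≫ (c.shiftDescIso hG).hom.app X) := by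
  refine c.distinguished_of_iso (desc G hG) (descIso G hG) (c.shiftDescIso hG) (fun M => ?_) f g h H
  have h₁ : (shiftD Γ).map ((descIso G hG).hom.app M) = 𝟙 _ := (shiftD Γ).map_id _
  have h₂ : (shiftDIso Λ).hom.app M = 𝟙 _ := by
    simp [shiftDIso]
    rfl
  have h₃ : (desc G hG).map ((shiftDIso Λ).hom.app M) = 𝟙 _ :=
    (congrArg (desc G hG).map h₂).trans ((desc G hG).map_id _)
  rw [h₁, h₃, shiftDIso_inv_app, c.shiftDescIso_hom_app]
  refine (Category.comp_id _).trans ?_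
  refine ((Category.id_comp _).trans ?_).symm
  exact (Category.id_comp _).trans (Category.comp_id _)

theorem ConeData.isTriangulated {G : DGMod Λ ⥤ DGMod Γ} (c : ConeData G) (hG : Exact G) :
    IsTriangulated (desc G hG) :=
  ⟨c.shiftDescIso hG, fun _ _ _ f g h H => c.distinguished hG f g h H⟩

/-- The inverse of an equivalence that is triangulated is triangulated if standard triangles lift
along the equivalence. -/
theorem isTriangulated_inverse (e : D Γ ≌ D Λ) (η : shiftD Γ ⋙ e.functor ≅ e.functor ⋙ shiftD Λ)
    (H : ∀ ⦃M N : DGMod Λ⦄ (φ : M ⟶ N), ∃ (X Y Z : D Γ) (f : X ⟶ Y) (g : Y ⟶ Z)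
      (h : Z ⟶ (shiftD Γ).obj X) (a : e.functor.obj X ≅ (toD Λ).obj M)
      (b : e.functor.obj Y ≅ (toD Λ).obj N) (c : e.functor.obj Z ≅ (toD Λ).obj (cone φ)),
      Distinguished f g h ∧ e.functor.map f ≫ b.hom = a.hom ≫ (toD Λ).map φ ∧
      e.functor.map g ≫ c.hom = b.hom ≫ (toD Λ).map (coneIn φ) ∧
      e.functor.map h ≫ η.hom.app X ≫ (shiftD Λ).map a.hom =
        c.hom ≫ (toD Λ).map (coneOut φ) ≫ (shiftDIso Λ).inv.app M) :
    IsTriangulated e.inverse := by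
  let θ : shiftD Λ ⋙ e.inverse ≅ e.inverse ⋙ shiftD Γ :=
    NatIso.ofComponents (fun X => e.inverse.mapIso ((shiftD Λ).mapIso (e.counitIso.symm.app X)) ≪≫
      e.inverse.mapIso (η.symm.app (e.inverse.obj X)) ≪≫
      e.unitIso.symm.app ((shiftD Γ).obj (e.inverse.obj X))) (fun {X Y} f => by
        have h₁ := e.counitIso.inv.naturality f
        have h₂ := η.inv.naturality (e.inverse.map f)
        have h₃ := e.unitIso.inv.naturality ((shiftD Γ).map (e.inverse.map f))
        dsimp at h₁ h₂ h₃ ⊢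
        rw [← e.inverse.map_comp_assoc, ← (shiftD Λ).map_comp, h₁, (shiftD Λ).map_comp,
          e.inverse.map_comp_assoc, ← e.inverse.map_comp_assoc ((shiftD Λ).map (e.functor.map _)),
          h₂, e.inverse.map_comp_assoc]
        simp only [Category.assoc]
        erw [h₃])
  refine ⟨θ, ?_⟩
  rintro X Y Z f g h ⟨M, N, φ, x, y, z, h₁, h₂, h₃⟩
  obtain ⟨X', Y', Z', f', g', h', a, b, c, H', e₁, e₂, e₃⟩ := H φ
  let w : ∀ {V : D Λ} {V' : D Γ} (_ : e.functor.obj V' ≅ V), V' ≅ e.inverse.obj V :=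
    fun {V V'} i => e.unitIso.app V' ≪≫ e.inverse.mapIso i
  have hw : ∀ {V : D Λ} {V' : D Γ} (i : e.functor.obj V' ≅ V),
      e.functor.map (w i).hom = i.hom ≫ e.counitIso.inv.app V := by
    intro V V' i
    have := e.counitIso.inv.naturality i.hom
    dsimp at this
    dsimp [w]
    rw [this, Functor.map_comp]
    congr 1
    exact (e.counitInv_app_functor V').symm
  have hf : f' ≫ (w (b ≪≫ y.symm)).hom = (w (a ≪≫ x.symm)).hom ≫ e.inverse.map f := by
    apply e.functor.map_injective
    have h₁' : (toD Λ).map φ ≫ y.inv = x.inv ≫ f := by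
      rw [Iso.eq_inv_comp, ← Category.assoc, ← h₁, Category.assoc, y.hom_inv_id, Category.comp_id]
    have := e.counitIso.inv.naturality f
    dsimp at this
    rw [Functor.map_comp, Functor.map_comp, hw, hw]
    dsimp
    rw [Category.assoc, Category.assoc, reassoc_of% e₁, reassoc_of% h₁', Category.assoc, this]
  have hg : g' ≫ (w (c ≪≫ z.symm)).hom = (w (b ≪≫ y.symm)).hom ≫ e.inverse.map g := by
    apply e.functor.map_injective
    have h₁' : (toD Λ).map (coneIn φ) ≫ z.inv = y.inv ≫ g := by
      rw [Iso.eq_inv_comp, ← Category.assoc, ← h₂, Category.assoc, z.hom_inv_id, Category.comp_id]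
    have := e.counitIso.inv.naturality g
    dsimp at this
    rw [Functor.map_comp, Functor.map_comp, hw, hw]
    dsimp
    rw [Category.assoc, Category.assoc, reassoc_of% e₂, reassoc_of% h₁', Category.assoc, this]
  have hh : h' ≫ (shiftD Γ).map (w (a ≪≫ x.symm)).hom =
      (w (c ≪≫ z.symm)).hom ≫ e.inverse.map h ≫ θ.hom.app X := by
    apply e.functor.map_injective
    have h₁' : ((toD Λ).map (coneOut φ) ≫ (shiftDIso Λ).inv.app M) ≫ (shiftD Λ).map x.inv =
        z.inv ≫ h := by
      rw [Iso.eq_inv_comp, ← Category.assoc, ← h₃, Category.assoc, ← Functor.map_comp,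
        x.hom_inv_id, CategoryTheory.Functor.map_id, Category.comp_id]
    have h₂' := η.hom.naturality (w (a ≪≫ x.symm)).hom
    have h₃' := e.counitIso.inv.naturality h
    have h₅' := e.counitIso.inv.naturality ((shiftD Λ).map (e.counitIso.inv.app X) ≫
      η.inv.app (e.inverse.obj X))
    dsimp at h₂' h₃' h₅'
    rw [hw, Functor.map_comp] at h₂'
    have h₄' : e.functor.map ((shiftD Γ).map (w (a ≪≫ x.symm)).hom) =
        η.hom.app X' ≫ ((shiftD Λ).map (a ≪≫ x.symm).hom ≫
          (shiftD Λ).map (e.counitIso.inv.app X)) ≫ η.inv.app (e.inverse.obj X) := by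
      rw [← Category.assoc, ← h₂', Category.assoc, Iso.hom_inv_id_app]
      exact (Category.comp_id _).symm
    have h₆' : e.functor.map (θ.hom.app X) = e.functor.map (e.inverse.map
        ((shiftD Λ).map (e.counitIso.inv.app X) ≫ η.inv.app (e.inverse.obj X))) ≫
        e.counitIso.hom.app (e.functor.obj ((shiftD Γ).obj (e.inverse.obj X))) := by
      dsimp [θ]
      simp
    rw [Functor.map_comp, Functor.map_comp, Functor.map_comp, hw, h₄', h₆']
    dsimp
    simp only [Category.assoc] at h₅' ⊢
    rw [← reassoc_of% h₃', ← reassoc_of% h₅', Functor.map_comp]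
    simp only [Category.assoc] at e₃ h₁' ⊢
    rw [reassoc_of% e₃, reassoc_of% h₁']
    have := e.counitIso.inv_hom_id_app (e.functor.obj ((shiftD Γ).obj (e.inverse.obj X)))
    dsimp at this
    rw [this, Category.comp_id]
  refine H'.of_iso (w (a ≪≫ x.symm)).symm (w (b ≪≫ y.symm)).symm (w (c ≪≫ z.symm)).symm ?_ ?_ ?_
  · rw [Iso.symm_hom, Iso.symm_hom, Iso.comp_inv_eq, Category.assoc, hf, Iso.inv_hom_id_assoc]
  · rw [Iso.symm_hom, Iso.symm_hom, Iso.comp_inv_eq, Category.assoc, hg, Iso.inv_hom_id_assoc]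
  · rw [Iso.symm_hom, Iso.symm_hom, Iso.eq_inv_comp, ← Category.assoc, ← hh, Category.assoc,
      ← Functor.map_comp, Iso.hom_inv_id, CategoryTheory.Functor.map_id, Category.comp_id]

end Triangulated


/-! ### Restriction of scalars and the tensor-Hom adjunction -/

/-- Restriction of scalars along a dga map. -/
def resObj {Λ Γ : DGA k} (f : Λ ⟶ Γ) (M : DGMod Γ) : DGMod Λ where
  toDGVect := M.toDGVect
  act i j l h := (M.act i j l h).compl₂ (f.f j)
  act_one i x := by simp [f.map_one, M.act_one]
  act_act i j l ij jl n h₁ h₂ h₃ h₄ x a b := by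
    simpa [f.map_mul] using M.act_act i j l ij jl n h₁ h₂ h₃ h₄ x (f.f j a) (f.f l b)
  d_act i j l i' j' l' h hi hj hl x a := by
    simpa [f.comm] using M.d_act i j l i' j' l' h hi hj hl x (f.f j a)

/-- Restriction of scalars along a dga map. -/
def res {Λ Γ : DGA k} (f : Λ ⟶ Γ) : DGMod Γ ⥤ DGMod Λ where
  obj M := resObj f M
  map φ :=
    { f := φ.f
      comm := φ.comm
      map_act := fun i j l h x a => φ.map_act i j l h x (f.f j a) }

theorem res_exact {Λ Γ : DGA k} (f : Λ ⟶ Γ) : Exact (res f) := fun _ _ _ h => h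

/-- Restriction of scalars commutes with mapping cones. -/
def resConeData {Λ Γ : DGA k} (f : Λ ⟶ Γ) : ConeData (res f) where
  shiftIso := NatIso.ofComponents (fun M =>
    { hom := { f := fun i => LinearMap.id, comm := fun _ _ _ _ => rfl,
               map_act := fun _ _ _ _ _ _ => rfl }
      inv := { f := fun i => LinearMap.id, comm := fun _ _ _ _ => rfl,
               map_act := fun _ _ _ _ _ _ => rfl } }) (fun φ => rfl)
  coneIso φ :=
    { hom := { f := fun i => LinearMap.id, comm := fun _ _ _ _ => rfl,
               map_act := fun _ _ _ _ _ _ => rfl }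
      inv := { f := fun i => LinearMap.id, comm := fun _ _ _ _ => rfl,
               map_act := fun _ _ _ _ _ _ => rfl } }
  coneIn_comp φ := rfl
  coneOut_comp φ := rfl

/-- The identification of `M^i` with `M[1]^j`, where `j + 1 = i`. -/
def DGMod.toShift {Λ : DGA k} (M : DGMod Λ) (i j : ℤ) (h : j + 1 = i) : M.X i →ₗ[k] M.shift.X j :=
  h ▸ LinearMap.id

theorem DGMod.toShift_act {Λ : DGA k} (M : DGMod Λ) (i j l i' l' : ℤ) (h : i + j = l)
    (hi : i' + 1 = i) (hl : l' + 1 = l) (x : M.X i) (a : Λ.X j) :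
    M.toShift l l' hl (M.act i j l h x a) =
      M.shift.act i' j l' (by omega) (M.toShift i i' hi x) a := by
  subst hi hl
  rfl

/-- The identification of `M[1]^j` with `M^i`, where `j + 1 = i`. -/
def DGMod.ofShift {Λ : DGA k} (M : DGMod Λ) (i j : ℤ) (h : j + 1 = i) : M.shift.X j →ₗ[k] M.X i :=
  h ▸ LinearMap.id

theorem DGMod.ofShift_act {Λ : DGA k} (M : DGMod Λ) (i j l i' l' : ℤ) (h : i' + j = l')
    (hi : i' + 1 = i) (hl : l' + 1 = l) (x : M.shift.X i') (a : Λ.X j) :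
    M.ofShift l l' hl (M.shift.act i' j l' h x a) =
      M.act i j l (by omega) (M.ofShift i i' hi x) a := by
  subst hi hl
  rfl

theorem bijective_of_inverse {X Y : Type*} {f : X → Y} (g : Y → X) (h : ∀ x, g (f x) = x)
    (h' : ∀ y, f (g y) = y) : Function.Bijective f :=
  Function.bijective_iff_has_inverse.2 ⟨g, h, h'⟩

section TensorHom

variable {Λ Γ : DGA k}

/-- A balanced pairing `M × N → P` of degree zero that commutes with the differentials and with the
right actions. -/
structure Pairing (M : DGMod Λ) (N : DGBimod Λ Γ) (P : DGMod Γ) where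
  φ (i j n : ℤ) (h : i + j = n) : M.X i →ₗ[k] N.X j →ₗ[k] P.X n
  balanced (i j l ij jl n : ℤ) (h₁ : i + j = ij) (h₂ : j + l = jl) (h₃ : ij + l = n)
    (h₄ : i + jl = n) (x : M.X i) (a : Λ.X j) (y : N.X l) :
    φ ij l n h₃ (M.act i j ij h₁ x a) y = φ i jl n h₄ x (N.lact j l jl h₂ a y)
  comm (i j n i' j' n' : ℤ) (h : i + j = n) (hi : i + 1 = i') (hj : j + 1 = j') (hn : n + 1 = n')
    (x : M.X i) (y : N.X j) : P.d n n' hn (φ i j n h x y) =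
      φ i' j n' (by omega) (M.d i i' hi x) y + i.negOnePow • φ i j' n' (by omega) x (N.d j j' hj y)
  map_act (i j n l n' jl : ℤ) (h : i + j = n) (hn : n + l = n') (hj : j + l = jl)
    (x : M.X i) (y : N.X j) (c : Γ.X l) :
    φ i jl n' (by omega) x (N.act j l jl hj y c) = P.act n l n' hn (φ i j n h x y) c

variable {M : DGMod Λ} {N : DGBimod Λ Γ} {P : DGMod Γ}

theorem tensorObj_hom_ext {f g : tensorObj M N ⟶ P}
    (H : ∀ (i j n : ℤ) (h : i + j = n) (x : M.X i) (y : N.X j),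
      f.f n (tmul M N i j n h x y) = g.f n (tmul M N i j n h x y)) : f = g := by
  ext n t
  exact LinearMap.congr_fun (tensor_ext (f := f.f n) (g := g.f n) fun i j h => H i j n h) t

/-- The morphism `M ⊗ N ⟶ P` given by a pairing. -/
noncomputable def Pairing.lift (B : Pairing M N P) : tensorObj M N ⟶ P where
  f n := tensorLift (fun i j h => B.φ i j n h)
    (fun i j l ij jl h₁ h₂ h₃ h₄ => B.balanced i j l ij jl n h₁ h₂ h₃ h₄)
  comm n n' hn t := by
    have : tensorLift (fun i j h => B.φ i j n' h)
        (fun i j l ij jl h₁ h₂ h₃ h₄ => B.balanced i j l ij jl n' h₁ h₂ h₃ h₄) ∘ₗ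
          tensorD M N n n' hn = P.d n n' hn ∘ₗ tensorLift (fun i j h => B.φ i j n h)
        (fun i j l ij jl h₁ h₂ h₃ h₄ => B.balanced i j l ij jl n h₁ h₂ h₃ h₄) := by
      apply tensor_ext
      intro i j h x y
      simp only [LinearMap.comp_apply]
      rw [tensorD_tmul M N i j n n' (i + 1) (j + 1) h hn rfl rfl]
      simp only [map_add, map_zsmul_unit, tensorLift_tmul]
      exact (B.comm i j n (i + 1) (j + 1) n' h rfl rfl hn x y).symm
    exact LinearMap.congr_fun this t
  map_act n l n' hn t c := by
    have : tensorLift (fun i j h => B.φ i j n' h)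
        (fun i j l ij jl h₁ h₂ h₃ h₄ => B.balanced i j l ij jl n' h₁ h₂ h₃ h₄) ∘ₗ
          (tensorAct M N n l n' hn).flip c =
        (P.act n l n' hn).flip c ∘ₗ tensorLift (fun i j h => B.φ i j n h)
        (fun i j l ij jl h₁ h₂ h₃ h₄ => B.balanced i j l ij jl n h₁ h₂ h₃ h₄) := by
      apply tensor_ext
      intro i j h x y
      simp only [LinearMap.comp_apply, LinearMap.flip_apply]
      rw [tensorAct_tmul M N i j n l n' (j + l) h hn rfl]
      simp only [tensorLift_tmul]
      exact B.map_act i j n l n' (j + l) h hn rfl x y c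
    exact LinearMap.congr_fun this t

@[simp]
theorem Pairing.lift_tmul (B : Pairing M N P) (i j n : ℤ) (h : i + j = n) (x : M.X i) (y : N.X j) :
    B.lift.f n (tmul M N i j n h x y) = B.φ i j n h x y := by
  exact tensorLift_tmul M N (fun i j h => B.φ i j n h)
    (fun i j l ij jl h₁ h₂ h₃ h₄ => B.balanced i j l ij jl n h₁ h₂ h₃ h₄) i j h x y

/-- The morphism `M ⟶ Hom(N, P)` given by a pairing. -/
def Pairing.curry (B : Pairing M N P) : M ⟶ homObj N P where
  f n :=
    { toFun := fun x => (⟨fun p => B.φ n p.1.1 p.1.2 (by have := p.2; omega) x, by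
        intro i j l il jl h₁ h₂ h₃ y c
        exact B.map_act n i j l jl il (by omega) h₃ h₂ x y c⟩ : HomX N P n)
      map_add' := fun x y => by
        apply HomX.ext
        intro i j h z
        exact LinearMap.congr_fun (map_add (B.φ n i j (by omega)) x y) z
      map_smul' := fun r x => by
        apply HomX.ext
        intro i j h z
        exact LinearMap.congr_fun (map_smul (B.φ n i j (by omega)) r x) z }
  comm n n' hn x := by
    apply HomX.ext
    intro i j h y
    refine Eq.trans ?_ (homD_app N P n n' hn _ i j (i + 1) (i + n) h rfl rfl y).symm
    have := B.comm n i (i + n) n' (i + 1) j (by omega) hn rfl (by omega) x y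
    exact eq_sub_of_add_eq this.symm
  map_act n l n' hn x a := by
    apply HomX.ext
    intro i j h y
    refine Eq.trans ?_ (homAct_app N P n l n' hn _ a i j (l + i) h rfl y).symm
    exact B.balanced n l i n' (l + i) j hn rfl (by omega) (by omega) x a y

variable (M N) in
/-- The universal pairing `M × N → M ⊗ N`. -/
noncomputable def tensorPairing : Pairing M N (tensorObj M N) where
  φ i j n h := tmul M N i j n h
  balanced i j l ij jl n h₁ h₂ h₃ h₄ x a y := tmul_act M N i j l ij jl n h₁ h₂ h₃ h₄ x a y
  comm i j n i' j' n' h hi hj hn x y := tensorD_tmul M N i j n n' i' j' h hn hi hj x y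
  map_act i j n l n' jl h hn hj x y c := (tensorAct_tmul M N i j n l n' jl h hn hj x y c).symm

variable (N P) in
/-- The evaluation pairing `Hom(N, P) × N → P`. -/
def evalPairing : Pairing (homObj N P) N P where
  φ i j n h :=
    { toFun := fun f => HomX.app f j n (by omega)
      map_add' := fun _ _ => rfl
      map_smul' := fun _ _ => rfl }
  balanced i j l ij jl n h₁ h₂ h₃ h₄ f a y :=
    homAct_app N P i j ij h₁ f a l n jl (by omega) h₂ y
  comm i j n i' j' n' h hi hj hn f y := by
    change _ = HomX.app (homD N P i i' hi f) j n' _ y + i.negOnePow • HomX.app f j' n' _ _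
    rw [homD_app N P i i' hi f j n' j' n (by omega) hj (by omega)]
    exact (sub_add_cancel _ _).symm
  map_act i j n l n' jl h hn hj f y c :=
    HomX.app_act f j n l jl n' (by omega) hj hn (by omega) y c

variable (N)

/-- The adjunction between `- ⊗_Λ N` and `Hom_Γ(N, -)`. -/
noncomputable def tensorHomAdj : tensorFunctor N ⊣ homFunctor N :=
  Adjunction.mkOfUnitCounit
    { unit :=
        { app := fun M => (tensorPairing M N).curry
          naturality := fun M M' φ => by
            ext n x
            apply HomX.ext
            intro i j h y
            exact (tensorMap_tmul N φ n i j (by omega) x y).symm }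
      counit :=
        { app := fun P => (evalPairing N P).lift
          naturality := fun P P' φ => by
            apply tensorObj_hom_ext
            intro i j n h f y
            refine (congrArg ((evalPairing N P').lift.f n)
              (tensorMap_tmul N ((homFunctor N).map φ) i j n h f y)).trans ?_
            refine ((evalPairing N P').lift_tmul i j n h _ y).trans ?_
            exact congrArg (φ.f n) ((evalPairing N P).lift_tmul i j n h f y).symm }
      left_triangle := by
        ext M : 2
        apply tensorObj_hom_ext
        intro i j n h x y
        refine (congrArg ((evalPairing N _).lift.f n)
          (tensorMap_tmul N (tensorPairing M N).curry i j n h x y)).trans ?_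
        exact (evalPairing N _).lift_tmul i j n h _ y
      right_triangle := by
        ext P n f
        apply HomX.ext
        intro i j h y
        exact (evalPairing N P).lift_tmul n i j (by omega) f y }

/-! ### Tensor products, Hom complexes and mapping cones -/

/-- The pairing `M[1] × N → (M ⊗ N)[1]`. -/
noncomputable def tensorShiftPairing (M : DGMod Λ) : Pairing M.shift N (tensorObj M N).shift where
  φ i j n h := tmul M N (i + 1) j (n + 1) (by omega)
  balanced i j l ij jl n h₁ h₂ h₃ h₄ x a y :=
    tmul_act M N (i + 1) j l (ij + 1) jl (n + 1) (by omega) h₂ (by omega) (by omega) x a y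
  comm i j n i' j' n' h hi hj hn x y := by
    have key : ∀ x : M.X (i + 1),
        -tensorD M N (n + 1) (n' + 1) (by omega) (tmul M N (i + 1) j (n + 1) (by omega) x y) =
          tmul M N (i' + 1) j (n' + 1) (by omega) (-M.d (i + 1) (i' + 1) (by omega) x) y +
            i.negOnePow • tmul M N (i + 1) j' (n' + 1) (by omega) x (N.d j j' hj y) := by
      intro x
      rw [tensorD_tmul M N (i + 1) j (n + 1) (n' + 1) (i' + 1) j' (by omega) (by omega) (by omega) hj,
        Int.negOnePow_succ, map_neg, LinearMap.neg_apply, Units.neg_smul, neg_add, neg_neg]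
    exact key x
  map_act i j n l n' jl h hn hj x y c :=
    (tensorAct_tmul M N (i + 1) j (n + 1) l (n' + 1) jl (by omega) (by omega) hj x y c).symm

/-- The inverse map `(M ⊗ N)[1] ⟶ M[1] ⊗ N` in degree `n`. -/
noncomputable def tensorUnshift (M : DGMod Λ) (n : ℤ) :
    TensorX M N (n + 1) →ₗ[k] TensorX M.shift N n :=
  tensorLift (fun i j h => tmul M.shift N (i - 1) j n (by omega) ∘ₗ M.toShift i (i - 1) (by omega))
    (by
      intro i j l ij jl h₁ h₂ h₃ h₄ x a y
      simp only [LinearMap.comp_apply]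
      rw [M.toShift_act i j ij (i - 1) (ij - 1) h₁ (by omega) (by omega) x a]
      exact tmul_act M.shift N (i - 1) j l (ij - 1) jl n (by omega) h₂ (by omega) (by omega) _ a y)

theorem tensorUnshift_tmul (M : DGMod Λ) (i i' j n : ℤ) (h : i + j = n + 1) (hi : i' + 1 = i)
    (x : M.X i) (y : N.X j) : tensorUnshift N M n (tmul M N i j (n + 1) h x y) =
      tmul M.shift N i' j n (by omega) (M.toShift i i' hi x) y := by
  obtain rfl : i' = i - 1 := by omega
  exact tensorLift_tmul _ N _ _ i j h x y

theorem tensorShift_bijective (M : DGMod Λ) (n : ℤ) :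
    Function.Bijective ((tensorShiftPairing N M).lift.f n) := by
  refine bijective_of_inverse (tensorUnshift N M n) (fun t => ?_) (fun t => ?_)
  · refine LinearMap.congr_fun (f := tensorUnshift N M n ∘ₗ (tensorShiftPairing N M).lift.f n)
      (g := LinearMap.id) (tensor_ext ?_) t
    intro i j h x y
    exact (congrArg _ ((tensorShiftPairing N M).lift_tmul i j n h x y)).trans
      (tensorUnshift_tmul N M (i + 1) i j n _ rfl x y)
  · refine LinearMap.congr_fun (f := (tensorShiftPairing N M).lift.f n ∘ₗ tensorUnshift N M n)
      (g := LinearMap.id) (tensor_ext ?_) t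
    intro i j h x y
    obtain ⟨i, rfl⟩ : ∃ i', i = i' + 1 := ⟨i - 1, by omega⟩
    exact (congrArg _ (tensorUnshift_tmul N M (i + 1) i j n h rfl x y)).trans
      ((tensorShiftPairing N M).lift_tmul i j n _ x y)

/-- The pairing `cone φ × N → cone (φ ⊗ N)`. -/
noncomputable def tensorConePairing {M M' : DGMod Λ} (φ : M ⟶ M') :
    Pairing (cone φ) N (cone ((tensorFunctor N).map φ)) where
  φ i j n h := LinearMap.mk₂ k
    (fun x y => (tmul M N (i + 1) j (n + 1) (by lia) x.1 y, tmul M' N i j n h x.2 y))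
    (fun x x' y => Prod.ext ((tmul M N (i + 1) j (n + 1) _).map_add₂ x.1 x'.1 y)
      ((tmul M' N i j n h).map_add₂ x.2 x'.2 y))
    (fun r x y => Prod.ext ((tmul M N (i + 1) j (n + 1) _).map_smul₂ r x.1 y)
      ((tmul M' N i j n h).map_smul₂ r x.2 y))
    (fun x y y' => Prod.ext (map_add _ _ _) (map_add _ _ _))
    (fun r x y => Prod.ext (map_smul _ _ _) (map_smul _ _ _))
  balanced i j l ij jl n h₁ h₂ h₃ h₄ x a y :=
    Prod.ext ((tensorShiftPairing N M).balanced i j l ij jl n h₁ h₂ h₃ h₄ x.1 a y)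
      (tmul_act M' N i j l ij jl n h₁ h₂ h₃ h₄ x.2 a y)
  comm i j n i' j' n' h hi hj hn x y := by
    subst hi hn
    refine Prod.ext ((tensorShiftPairing N M).comm i j n (i + 1) j' (n + 1) h rfl hj rfl x.1 y) ?_
    change tensorMap N φ (n + 1) (tmul M N (i + 1) j (n + 1) _ x.1 y) +
      tensorD M' N n (n + 1) rfl (tmul M' N i j n h x.2 y) =
        tmul M' N (i + 1) j (n + 1) _ (φ.f (i + 1) x.1 + M'.d i (i + 1) rfl x.2) y +
          i.negOnePow • tmul M' N i j' (n + 1) _ x.2 (N.d j j' hj y)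
    rw [tensorMap_tmul, tensorD_tmul M' N i j n (n + 1) (i + 1) j' h rfl rfl hj, map_add,
      LinearMap.add_apply, add_assoc]
  map_act i j n l n' jl h hn hj x y c :=
    Prod.ext ((tensorShiftPairing N M).map_act i j n l n' jl h hn hj x.1 y c)
      ((tensorPairing M' N).map_act i j n l n' jl h hn hj x.2 y c)

theorem tensorCone_bijective {M M' : DGMod Λ} (φ : M ⟶ M') (n : ℤ) :
    Function.Bijective ((tensorConePairing N φ).lift.f n) := by
  let incl : TensorX M.shift N n →ₗ[k] TensorX (cone φ) N n :=
    tensorLift (M := M.shift)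
      (fun i j h => tmul (cone φ) N i j n h ∘ₗ LinearMap.inl k (M.X (i + 1)) (M'.X i))
      (fun i j l ij jl h₁ h₂ h₃ h₄ x a y => by
        refine Eq.trans ?_ (tmul_act (cone φ) N i j l ij jl n h₁ h₂ h₃ h₄ (x, 0) a y)
        refine congrArg (fun z => tmul (cone φ) N ij l n h₃ z y) (Prod.ext rfl ?_)
        exact ((M'.act i j ij h₁).map_zero₂ a).symm)
  have hincl : ∀ i j h x y, incl (tmul M.shift N i j n h x y) =
    tmul (cone φ) N i j n h (x, 0) y := fun i j h x y => tensorLift_tmul _ N _ _ i j h x y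
  let inv : TensorX M N (n + 1) × TensorX M' N n →ₗ[k] TensorX (cone φ) N n :=
    LinearMap.coprod (incl ∘ₗ tensorUnshift N M n) (tensorMap N (coneIn φ) n)
  refine bijective_of_inverse inv (fun t => ?_) (fun t => ?_)
  · refine LinearMap.congr_fun (f := inv ∘ₗ (tensorConePairing N φ).lift.f n)
      (g := LinearMap.id) (tensor_ext ?_) t
    rintro i j h ⟨x, x'⟩ y
    refine (congrArg inv ((tensorConePairing N φ).lift_tmul i j n h (x, x') y)).trans ?_
    refine (congrArg₂ (· + ·) ((congrArg incl (tensorUnshift_tmul N M (i + 1) i j n (by omega) rfl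
      x y)).trans (hincl i j h x y)) (tensorMap_tmul N (coneIn φ) i j n h x' y)).trans ?_
    refine ((tmul (cone φ) N i j n h).map_add₂ (x, 0) (0, x') y).symm.trans ?_
    refine congrArg (fun z => tmul (cone φ) N i j n h z y) (Prod.ext ?_ ?_)
    · exact add_zero x
    · exact zero_add x'
  · have h₁ : (tensorConePairing N φ).lift.f n ∘ₗ incl ∘ₗ tensorUnshift N M n =
        LinearMap.inl k (TensorX M N (n + 1)) (TensorX M' N n) := by
      apply tensor_ext
      intro i j h x y
      obtain ⟨i, rfl⟩ : ∃ i', i = i' + 1 := ⟨i - 1, by omega⟩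
      refine (congrArg ((tensorConePairing N φ).lift.f n) ((congrArg incl
        (tensorUnshift_tmul N M (i + 1) i j n h rfl x y)).trans (hincl i j _ x y))).trans ?_
      refine ((tensorConePairing N φ).lift_tmul i j n (by omega) (x, 0) y).trans ?_
      exact Prod.ext rfl ((tmul M' N i j n _).map_zero₂ y)
    have h₂ : (tensorConePairing N φ).lift.f n ∘ₗ tensorMap N (coneIn φ) n =
        LinearMap.inr k (TensorX M N (n + 1)) (TensorX M' N n) := by
      apply tensor_ext
      intro i j h x y
      refine (congrArg ((tensorConePairing N φ).lift.f n)
        (tensorMap_tmul N (coneIn φ) i j n h x y)).trans ?_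
      refine ((tensorConePairing N φ).lift_tmul i j n h (0, x) y).trans ?_
      exact Prod.ext ((tmul M N (i + 1) j (n + 1) _).map_zero₂ y) rfl
    obtain ⟨t₁, t₂⟩ := t
    refine (map_add ((tensorConePairing N φ).lift.f n) _ _).trans ?_
    refine (congrArg₂ (· + ·) (LinearMap.congr_fun h₁ t₁) (LinearMap.congr_fun h₂ t₂)).trans ?_
    exact Prod.ext (add_zero _) (zero_add _)

/-- `- ⊗_Λ N` commutes with mapping cones. -/
noncomputable def tensorConeData : ConeData (tensorFunctor N) where
  shiftIso := NatIso.ofComponents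
    (fun M => DGMod.isoOfBijective (tensorShiftPairing N M).lift (tensorShift_bijective N M))
    (fun {M M'} φ => by
      apply tensorObj_hom_ext
      intro i j n h x y
      refine (congrArg ((tensorShiftPairing N M').lift.f n)
        (tensorMap_tmul N ((shiftFunctor Λ).map φ) i j n h x y)).trans ?_
      refine ((tensorShiftPairing N M').lift_tmul i j n h _ y).trans ?_
      refine ((congrArg (tensorMap N φ (n + 1))
        ((tensorShiftPairing N M).lift_tmul i j n h x y)).trans ?_).symm
      exact tensorMap_tmul N φ (i + 1) j (n + 1) _ x y)
  coneIso φ := DGMod.isoOfBijective (tensorConePairing N φ).lift (tensorCone_bijective N φ)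
  coneIn_comp {M M'} φ := by
    apply tensorObj_hom_ext
    intro i j n h x y
    refine (congrArg ((tensorConePairing N φ).lift.f n)
      (tensorMap_tmul N (coneIn φ) i j n h x y)).trans ?_
    refine ((tensorConePairing N φ).lift_tmul i j n h (0, x) y).trans ?_
    exact Prod.ext ((tmul M N (i + 1) j (n + 1) _).map_zero₂ y) rfl
  coneOut_comp {M M'} φ := by
    apply tensorObj_hom_ext
    intro i j n h x y
    refine (congrArg ((tensorShiftPairing N M).lift.f n)
      (tensorMap_tmul N (coneOut φ) i j n h x y)).trans ?_
    refine ((tensorShiftPairing N M).lift_tmul i j n h x.1 y).trans ?_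
    exact (congrArg Prod.fst ((tensorConePairing N φ).lift_tmul i j n h x y)).symm

/-- The pairing `Hom(N, P)[1] × N → P[1]`. -/
def homShiftPairing (P : DGMod Γ) : Pairing (homObj N P).shift N P.shift where
  φ i j n h := (evalPairing N P).φ (i + 1) j (n + 1) (by omega)
  balanced i j l ij jl n h₁ h₂ h₃ h₄ x a y := (evalPairing N P).balanced (i + 1) j l (ij + 1) jl
    (n + 1) (by omega) h₂ (by omega) (by omega) x a y
  comm i j n i' j' n' h hi hj hn x y := by
    have := (evalPairing N P).comm (i + 1) j (n + 1) (i' + 1) j' (n' + 1) (by omega) (by omega) hj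
      (by omega) x y
    refine (congrArg Neg.neg this).trans ?_
    rw [Int.negOnePow_succ, Units.neg_smul, neg_add, neg_neg]
    rfl
  map_act i j n l n' jl h hn hj x y c :=
    (evalPairing N P).map_act (i + 1) j (n + 1) l (n' + 1) jl (by omega) (by omega) hj x y c

theorem homShift_bijective (P : DGMod Γ) (n : ℤ) :
    Function.Bijective ((homShiftPairing N P).curry.f n) := by
  constructor
  · intro f g hfg
    refine HomX.ext (N := N) (P := P) (n := n + 1) (f := f) (g := g) ?_
    intro i j h x
    obtain ⟨j, rfl⟩ : ∃ j', j = j' + 1 := ⟨j - 1, by omega⟩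
    exact congrArg (fun z => HomX.app (N := N) (P := P.shift) z i j (by omega) x) hfg
  · intro g
    have key : ∀ (i j j₁ j₂ : ℤ) (h : i + n = j) (h₁ : i + n = j₁) (h₂ : j₁ + 1 = j₂)
        (h₃ : j + 1 = j₂) (x : N.X i),
        P.ofShift j₂ j₁ h₂ (HomX.app (N := N) (P := P.shift) g i j₁ h₁ x) =
          P.ofShift j₂ j h₃ (HomX.app (N := N) (P := P.shift) g i j h x) := by
      intro i j j₁ j₂ h h₁ h₂ h₃ x
      obtain rfl : j = j₁ := by omega
      rfl
    refine ⟨(⟨fun p => P.ofShift p.1.2 (p.1.2 - 1) (by omega) ∘ₗ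
      HomX.app (N := N) (P := P.shift) g p.1.1 (p.1.2 - 1) (by have := p.2; omega), ?_⟩ :
        HomX N P (n + 1)), ?_⟩
    · intro i j l il jl h₁ h₂ h₃ x c
      refine Eq.trans ?_ (P.ofShift_act j l jl (j - 1) (jl - 1) (by omega) (by omega) (by omega) _ c)
      exact congrArg (P.ofShift jl (jl - 1) (by omega))
        (HomX.app_act (N := N) (P := P.shift) g i (j - 1) l il (jl - 1) (by omega) h₂ (by omega)
          (by omega) x c)
    · apply HomX.ext
      intro i j h x
      exact key i j (j + 1 - 1) (j + 1) h (by omega) (by omega) rfl x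

/-- The pairing `cone (Hom(N, φ)) × N → cone φ`. -/
def homConePairing {P P' : DGMod Γ} (φ : P ⟶ P') :
    Pairing (cone ((homFunctor N).map φ)) N (cone φ) where
  φ i j n h := LinearMap.mk₂ k
    (fun x y => ((evalPairing N P).φ (i + 1) j (n + 1) (by omega) x.1 y,
      (evalPairing N P').φ i j n h x.2 y))
    (fun x x' y => rfl)
    (fun r x y => rfl)
    (fun x y y' => Prod.ext (map_add _ _ _) (map_add _ _ _))
    (fun r x y => Prod.ext (map_smul _ _ _) (map_smul _ _ _))
  balanced i j l ij jl n h₁ h₂ h₃ h₄ x a y :=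
    Prod.ext ((homShiftPairing N P).balanced i j l ij jl n h₁ h₂ h₃ h₄ x.1 a y)
      ((evalPairing N P').balanced i j l ij jl n h₁ h₂ h₃ h₄ x.2 a y)
  comm i j n i' j' n' h hi hj hn x y := by
    subst hi hn
    refine Prod.ext ((homShiftPairing N P).comm i j n (i + 1) j' (n + 1) h rfl hj rfl x.1 y) ?_
    have := (evalPairing N P').comm i j n (i + 1) j' (n + 1) h rfl hj rfl x.2 y
    refine (congrArg (φ.f (n + 1) (HomX.app (n := i + 1) x.1 j (n + 1) (by omega) y) + ·) this).trans ?_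
    exact (add_assoc _ _ _).symm
  map_act i j n l n' jl h hn hj x y c :=
    Prod.ext ((homShiftPairing N P).map_act i j n l n' jl h hn hj x.1 y c)
      ((evalPairing N P').map_act i j n l n' jl h hn hj x.2 y c)

theorem homCone_bijective {P P' : DGMod Γ} (φ : P ⟶ P') (n : ℤ) :
    Function.Bijective ((homConePairing N φ).curry.f n) := by
  constructor
  · intro f g hfg
    apply Prod.ext
    · apply (homShift_bijective N P n).1
      apply HomX.ext
      intro i j h x
      exact congrArg (fun z => (HomX.app (N := N) (P := cone φ) z i j h x).1) hfg
    · refine HomX.ext (N := N) (P := P') ?_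
      intro i j h x
      exact congrArg (fun z => (HomX.app (N := N) (P := cone φ) z i j h x).2) hfg
  · intro g
    obtain ⟨f₁, hf₁⟩ := (homShift_bijective N P n).2 (((homFunctor N).map (coneOut φ)).f n g)
    refine ⟨(f₁, (⟨fun p => LinearMap.snd k _ _ ∘ₗ
      (HomX.app (N := N) (P := cone φ) g p.1.1 p.1.2 p.2), ?_⟩ : HomX N P' n)), ?_⟩
    · intro i j l il jl h₁ h₂ h₃ x c
      exact congrArg Prod.snd (HomX.app_act (N := N) (P := cone φ) g i j l il jl h₁ h₂ h₃ (by omega)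
        x c)
    · apply HomX.ext
      intro i j h x
      apply Prod.ext
      · exact congrArg (fun z => HomX.app (N := N) (P := P.shift) z i j h x) hf₁
      · rfl

/-- The comparison of `Hom(N, P)[1]` and `Hom(N, P[1])`. -/
noncomputable def homShiftIso : homFunctor N ⋙ shiftFunctor Λ ≅ shiftFunctor Γ ⋙ homFunctor N :=
  NatIso.ofComponents
    (fun P => DGMod.isoOfBijective (homShiftPairing N P).curry (homShift_bijective N P))
    (fun _ => rfl)

/-- The comparison of `cone (Hom(N, φ))` and `Hom(N, cone φ)`. -/
noncomputable def homConeIso {P P' : DGMod Γ} (φ : P ⟶ P') :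
    cone ((homFunctor N).map φ) ≅ (homFunctor N).obj (cone φ) :=
  DGMod.isoOfBijective (homConePairing N φ).curry (homCone_bijective N φ)

/-- `Hom_Γ(N, -)` commutes with mapping cones. -/
noncomputable def homConeData : ConeData (homFunctor N) where
  shiftIso := (homShiftIso N).symm
  coneIso φ := (homConeIso N φ).symm
  coneIn_comp φ := by
    refine (Iso.comp_inv_eq (homConeIso N φ)).2 ?_
    ext n f
    rfl
  coneOut_comp {P P'} φ := by
    refine (Iso.comp_inv_eq ((homShiftIso N).app P)).2 ?_
    refine Eq.trans ?_ (Category.assoc _ _ _).symm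
    exact (Iso.eq_inv_comp (homConeIso N φ)).2 rfl

end TensorHom


/-! ### Restriction of scalars as a tensor product and as a Hom complex -/

section Restriction

variable {Λ Γ : DGA k} (f : Λ ⟶ Γ)

/-- The action of `Γ` on `M` as a pairing `res f M × Γ → M`. -/
def resHomPairing (M : DGMod Γ) : Pairing (resObj f M) (bimodOfHoms f (𝟙 Γ)) M where
  φ i j n h := M.act i j n h
  balanced i j l ij jl n h₁ h₂ h₃ h₄ x a y := M.act_act i j l ij jl n h₁ h₂ h₃ h₄ x (f.f j a) y
  comm i j n i' j' n' h hi hj hn x y := M.d_act i j n i' j' n' h hi hj hn x y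
  map_act i j n l n' jl h hn hj x y c := (M.act_act i j l n jl n' h hj hn (by omega) x y c).symm

theorem resHom_bijective (M : DGMod Γ) (n : ℤ) :
    Function.Bijective ((resHomPairing f M).curry.f n) := by
  refine bijective_of_inverse
    (fun φ => HomX.app (N := bimodOfHoms f (𝟙 Γ)) (P := M) φ 0 n (zero_add n) Γ.one)
    (fun x => M.act_one n x) (fun φ => ?_)
  apply HomX.ext
  intro i j h x
  have h₁ := HomX.app_act (N := bimodOfHoms f (𝟙 Γ)) (P := M) φ 0 n i i j (zero_add n)
    (zero_add i) (by omega) h Γ.one x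
  exact h₁.symm.trans (congrArg (HomX.app (N := bimodOfHoms f (𝟙 Γ)) (P := M) φ i j h)
    (Γ.one_mul i x))

/-- Restriction of scalars is `Hom_Γ(Γ, -)`. -/
noncomputable def resHomIso : res f ≅ homFunctor (bimodOfHoms f (𝟙 Γ)) :=
  NatIso.ofComponents (fun M => DGMod.isoOfBijective (resHomPairing f M).curry
    (resHom_bijective f M)) (fun {M M'} φ => by
    ext n x
    apply HomX.ext
    intro i j h y
    exact (φ.map_act n i j (by omega) x y).symm)

/-- The action of `Γ` on `M` as a pairing `M × Γ → res f M`. -/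
def resTensorPairing (M : DGMod Γ) : Pairing M (bimodOfHoms (𝟙 Γ) f) (resObj f M) where
  φ i j n h := M.act i j n h
  balanced i j l ij jl n h₁ h₂ h₃ h₄ x a y := M.act_act i j l ij jl n h₁ h₂ h₃ h₄ x a y
  comm i j n i' j' n' h hi hj hn x y := M.d_act i j n i' j' n' h hi hj hn x y
  map_act i j n l n' jl h hn hj x y c :=
    (M.act_act i j l n jl n' h hj hn (by omega) x y (f.f l c)).symm

theorem resTensor_bijective (M : DGMod Γ) (n : ℤ) :
    Function.Bijective ((resTensorPairing f M).lift.f n) := by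
  refine bijective_of_inverse
    (fun x => tmul M (bimodOfHoms (𝟙 Γ) f) n 0 n (add_zero n) x Γ.one) (fun t => ?_) (fun x => ?_)
  · refine LinearMap.congr_fun (f := (tmul M (bimodOfHoms (𝟙 Γ) f) n 0 n (add_zero n)).flip Γ.one ∘ₗ
      (resTensorPairing f M).lift.f n) (g := LinearMap.id) (tensor_ext ?_) t
    intro i j h x y
    refine (congrArg (fun z => tmul M (bimodOfHoms (𝟙 Γ) f) n 0 n (add_zero n) z Γ.one)
      ((resTensorPairing f M).lift_tmul i j n h x y)).trans ?_
    refine (tmul_act M (bimodOfHoms (𝟙 Γ) f) i j 0 n j n h (add_zero j) _ h x y Γ.one).trans ?_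
    exact congrArg (tmul M (bimodOfHoms (𝟙 Γ) f) i j n h x) (Γ.mul_one j y)
  · exact ((resTensorPairing f M).lift_tmul n 0 n _ x Γ.one).trans (M.act_one n x)

/-- Restriction of scalars is `- ⊗_Γ Γ`. -/
noncomputable def resTensorIso : tensorFunctor (bimodOfHoms (𝟙 Γ) f) ≅ res f :=
  NatIso.ofComponents (fun M => DGMod.isoOfBijective (resTensorPairing f M).lift
    (resTensor_bijective f M)) (fun {M M'} φ => by
    apply tensorObj_hom_ext
    intro i j n h x y
    refine (congrArg ((resTensorPairing f M').lift.f n) (tensorMap_tmul _ φ i j n h x y)).trans ?_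
    refine ((resTensorPairing f M').lift_tmul i j n h _ y).trans ?_
    refine ((congrArg (φ.f n) ((resTensorPairing f M).lift_tmul i j n h x y)).trans ?_).symm
    exact φ.map_act i j n h x y)

/-- `Λ` as a right dg-module over itself. -/
def DGA.regular (Λ : DGA k) : DGMod Λ := (bimodOfHoms (𝟙 Λ) (𝟙 Λ)).toDGMod

/-- The left action of `Λ` on `N` as a pairing. -/
def regularPairing (N : DGBimod Λ Γ) : Pairing Λ.regular N N.toDGMod where
  φ i j n h := N.lact i j n h
  balanced i j l ij jl n h₁ h₂ h₃ h₄ x a y := N.lact_lact i j l ij jl n h₁ h₂ h₃ h₄ x a y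
  comm i j n i' j' n' h hi hj hn x y := N.d_lact i j n i' j' n' h hi hj hn x y
  map_act i j n l n' jl h hn hj x y c := (N.lact_act i j l n jl n' h hj hn (by omega) x y c).symm

theorem regularPairing_bijective (N : DGBimod Λ Γ) (n : ℤ) :
    Function.Bijective ((regularPairing N).lift.f n) := by
  refine bijective_of_inverse
    (fun x => tmul Λ.regular N 0 n n (zero_add n) Λ.one x) (fun t => ?_) (fun x => ?_)
  · refine LinearMap.congr_fun (f := tmul Λ.regular N 0 n n (zero_add n) Λ.one ∘ₗ
      (regularPairing N).lift.f n) (g := LinearMap.id) (tensor_ext ?_) t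
    intro i j h x y
    refine (congrArg (tmul Λ.regular N 0 n n (zero_add n) Λ.one)
      ((regularPairing N).lift_tmul i j n h x y)).trans ?_
    refine (tmul_act Λ.regular N 0 i j i n n (zero_add i) h h _ Λ.one x y).symm.trans ?_
    exact congrArg (fun z => tmul Λ.regular N i j n h z y) (Λ.one_mul i x)
  · exact ((regularPairing N).lift_tmul 0 n n _ Λ.one x).trans (N.one_lact n x)

/-- `Λ ⊗_Λ N` is `N`. -/
noncomputable def regularTensorIso (N : DGBimod Λ Γ) : tensorObj Λ.regular N ≅ N.toDGMod :=
  DGMod.isoOfBijective (regularPairing N).lift (regularPairing_bijective N)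

end Restriction


/-! ### The additive structure on morphisms of dg-modules -/

section Preadditive

variable {Λ : DGA k}

instance (M N : DGMod Λ) : Zero (M ⟶ N) where
  zero :=
    { f := fun _ => 0
      comm := fun i j h _ => (map_zero (N.d i j h)).symm
      map_act := fun i j l h _ a => ((N.act i j l h).map_zero₂ a).symm }

instance (M N : DGMod Λ) : Add (M ⟶ N) where
  add φ ψ :=
    { f := fun i => φ.f i + ψ.f i
      comm := fun i j h x => by simp [φ.comm, ψ.comm]
      map_act := fun i j l h x a => by simp [φ.map_act, ψ.map_act] }

instance (M N : DGMod Λ) : Neg (M ⟶ N) where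
  neg φ :=
    { f := fun i => -φ.f i
      comm := fun i j h x => by simp [φ.comm]
      map_act := fun i j l h x a => by simp [φ.map_act] }

instance (M N : DGMod Λ) : AddCommGroup (M ⟶ N) where
  add_assoc φ ψ χ := by ext i x; exact add_assoc _ _ _
  zero_add φ := by ext i x; exact zero_add _
  add_zero φ := by ext i x; exact add_zero _
  nsmul := nsmulRec
  zsmul := zsmulRec
  neg_add_cancel φ := by ext i x; exact neg_add_cancel _
  add_comm φ ψ := by ext i x; exact add_comm _ _

instance : Preadditive (DGMod Λ) where
  add_comp M N P φ ψ χ := by ext i x; exact map_add (χ.f i) _ _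
  comp_add M N P φ ψ χ := by ext i x; rfl

theorem sub_f_apply {M N : DGMod Λ} (φ ψ : M ⟶ N) (i : ℤ) (x : M.X i) :
    (φ - ψ).f i x = φ.f i x - ψ.f i x := by
  rw [sub_eq_add_neg, sub_eq_add_neg]
  rfl

end Preadditive

/-! ### Coinduction from complexes of vector spaces -/

section Coinduction

variable (Γ : DGA k) (M : DGVect k)

/-- The degree `n` part of `Hom_k(Γ, M)`. -/
abbrev CoindX (n : ℤ) : Type u := ∀ p : {p : ℤ × ℤ // p.1 + n = p.2}, Γ.X p.1.1 →ₗ[k] M.X p.1.2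

variable {Γ M} in
/-- The component `Γ^i ⟶ M^j` of an element of degree `n` of `Hom_k(Γ, M)`. -/
def CoindX.app {n : ℤ} (φ : CoindX Γ M n) (i j : ℤ) (h : i + n = j) : Γ.X i →ₗ[k] M.X j :=
  φ ⟨(i, j), h⟩

variable {Γ M} in
theorem CoindX.ext {n : ℤ} {φ ψ : CoindX Γ M n}
    (H : ∀ (i j : ℤ) (h : i + n = j) (x : Γ.X i), φ.app i j h x = ψ.app i j h x) : φ = ψ := by
  funext p
  exact LinearMap.ext (H p.1.1 p.1.2 p.2)

/-- The differential of `Hom_k(Γ, M)`. -/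
def coindD (n n' : ℤ) (hn : n + 1 = n') : CoindX Γ M n →ₗ[k] CoindX Γ M n' where
  toFun φ := fun p => M.d (p.1.1 + n) p.1.2 (by have := p.2; omega) ∘ₗ φ.app p.1.1 (p.1.1 + n) rfl
      - n.negOnePow • φ.app (p.1.1 + 1) p.1.2 (by have := p.2; omega) ∘ₗ Γ.d p.1.1 (p.1.1 + 1) rfl
  map_add' φ ψ := by
    funext p
    ext x
    simp [CoindX.app]
    abel
  map_smul' r φ := by
    funext p
    ext x
    simp [CoindX.app, smul_sub, smul_comm n.negOnePow r]

theorem coindD_app (n n' : ℤ) (hn : n + 1 = n') (φ : CoindX Γ M n) (i j i' j' : ℤ) (h : i + n' = j)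
    (hi : i + 1 = i') (hj : i + n = j') (x : Γ.X i) :
    CoindX.app (coindD Γ M n n' hn φ) i j h x =
      M.d j' j (by omega) (φ.app i j' hj x)
        - n.negOnePow • φ.app i' j (by omega) (Γ.d i i' hi x) := by
  subst hi hj
  rfl

/-- The right action `(φ a)(x) = φ (a x)`. -/
def coindAct (n l n' : ℤ) (hn : n + l = n') : CoindX Γ M n →ₗ[k] Γ.X l →ₗ[k] CoindX Γ M n' :=
  LinearMap.mk₂ k
    (fun φ a p => φ.app (l + p.1.1) p.1.2 (by have := p.2; omega) ∘ₗ Γ.mul l p.1.1 (l + p.1.1) rfl a)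
    (by intros; rfl) (by intros; rfl)
    (by intros; funext p; ext x; simp)
    (by intros; funext p; ext x; simp)

theorem coindAct_app (n l n' : ℤ) (hn : n + l = n') (φ : CoindX Γ M n) (a : Γ.X l) (i j li : ℤ)
    (h : i + n' = j) (hl : l + i = li) (x : Γ.X i) :
    CoindX.app (coindAct Γ M n l n' hn φ a) i j h x =
      φ.app li j (by omega) (Γ.mul l i li hl a x) := by
  subst hl
  rfl

theorem CoindX.app_add {n : ℤ} (φ ψ : CoindX Γ M n) (i j : ℤ) (h : i + n = j) (x : Γ.X i) :
    CoindX.app (φ + ψ) i j h x = φ.app i j h x + ψ.app i j h x := rfl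

theorem CoindX.app_units_smul {n : ℤ} (r : ℤˣ) (φ : CoindX Γ M n) (i j : ℤ) (h : i + n = j)
    (x : Γ.X i) : CoindX.app (r • φ) i j h x = r • φ.app i j h x := rfl

/-- The right dg-module `Hom_k(Γ, M)`. -/
def coindObj : DGMod Γ where
  X n := CoindX Γ M n
  d n n' hn := coindD Γ M n n' hn
  d_d n n' n'' hn hn' φ := by
    apply CoindX.ext
    intro i j h x
    rw [coindD_app Γ M n' n'' hn' _ i j (i + 1) (i + n') h rfl rfl,
      coindD_app Γ M n n' hn φ i (i + n') (i + 1) (i + n) rfl rfl rfl,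
      coindD_app Γ M n n' hn φ (i + 1) j (i + 1 + 1) (i + n') (by omega) rfl (by omega),
      show n'.negOnePow = -n.negOnePow by rw [← hn, Int.negOnePow_succ]]
    simp [M.d_d, Γ.d_d]
    rfl
  act n l n' hn := coindAct Γ M n l n' hn
  act_one n φ := by
    apply CoindX.ext
    intro i j h x
    rw [coindAct_app Γ M n 0 n _ φ _ i j i h (zero_add i), Γ.one_mul]
  act_act n j l nj jl m h₁ h₂ h₃ h₄ φ a b := by
    apply CoindX.ext
    intro p q h x
    rw [coindAct_app Γ M nj l m h₃ _ b p q (l + p) h rfl,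
      coindAct_app Γ M n j nj h₁ φ a (l + p) q (jl + p) (by omega) (by omega),
      coindAct_app Γ M n jl m h₄ φ _ p q (jl + p) h rfl,
      Γ.mul_assoc j l p jl (l + p) (jl + p) h₂ rfl rfl (by omega)]
  d_act n j l n' j' l' h hn hj hl φ a := by
    apply CoindX.ext
    intro p q hq x
    rw [CoindX.app_add, CoindX.app_units_smul,
      coindD_app Γ M l l' hl _ p q (p + 1) (p + l) hq rfl rfl,
      coindAct_app Γ M n j l h φ a p (p + l) (j + p) rfl rfl,
      coindAct_app Γ M n j l h φ a (p + 1) q (j' + p) (by omega) (by omega),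
      coindAct_app Γ M n' j l' _ _ a p q (j + p) hq rfl,
      coindD_app Γ M n n' hn φ (j + p) q (j' + p) (p + l) (by omega) (by omega) (by omega),
      coindAct_app Γ M n j' l' _ φ _ p q (j' + p) hq rfl,
      Γ.d_mul j p (j + p) j' (p + 1) (j' + p) rfl hj rfl (by omega),
      show l.negOnePow = n.negOnePow * j.negOnePow by rw [← h, Int.negOnePow_add]]
    simp only [map_add, map_zsmul_unit, smul_add, smul_smul]
    abel

variable {Γ M} in
theorem CoindX.app_mul_congr {n : ℤ} (φ : CoindX Γ M n) (i l j m m' : ℤ) (h₁ : i + l = m)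
    (h₂ : i + l = m') (e : m + n = j) (e' : m' + n = j) (x : Γ.X i) (y : Γ.X l) :
    φ.app m j e (Γ.mul i l m h₁ x y) = φ.app m' j e' (Γ.mul i l m' h₂ x y) := by
  subst h₁ h₂
  rfl

variable {M} in
/-- The functoriality of `Hom_k(Γ, -)`. -/
def coindMap {M' : DGVect k} (ψ : ChainMap M M') : coindObj Γ M ⟶ coindObj Γ M' where
  f n :=
    { toFun := fun φ p => ψ.f p.1.2 ∘ₗ CoindX.app φ p.1.1 p.1.2 p.2
      map_add' := fun φ φ' => by
        apply CoindX.ext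
        intro i j h x
        exact map_add (ψ.f j) _ _
      map_smul' := fun r φ => by
        apply CoindX.ext
        intro i j h x
        exact map_smul (ψ.f j) _ _ }
  comm n n' hn φ := by
    apply CoindX.ext
    intro i j h x
    refine (congrArg (ψ.f j) (coindD_app Γ M n n' hn φ i j (i + 1) (i + n) h rfl rfl x)).trans ?_
    rw [map_sub, map_zsmul_unit, ψ.comm]
    rfl
  map_act n l n' hn φ a := rfl

end Coinduction

section CobarResolution

variable {Λ Γ : DGA k}

/-- The functor `Hom_k(Γ, -)` on dg-modules. -/
abbrev coindHom (Γ : DGA k) {M M' : DGMod Λ} (ψ : M ⟶ M') :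
    coindObj Γ M.toDGVect ⟶ coindObj Γ M'.toDGVect := coindMap Γ ψ.toChainMap

theorem coindHom_comp {M M' M'' : DGMod Λ} (ψ : M ⟶ M') (ψ' : M' ⟶ M'') :
    coindHom Γ (ψ ≫ ψ') = coindHom Γ ψ ≫ coindHom Γ ψ' := rfl

theorem coindHom_sub {M M' : DGMod Λ} (ψ ψ' : M ⟶ M') :
    coindHom Γ (ψ - ψ') = coindHom Γ ψ - coindHom Γ ψ' := by
  ext n φ
  rw [sub_f_apply]
  apply CoindX.ext
  intro i j h x
  exact sub_f_apply ψ ψ' j _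

theorem coindHom_zero {M M' : DGMod Λ} : coindHom Γ (0 : M ⟶ M') = 0 := rfl

/-- The unit `M ⟶ Hom_k(Γ, M)`. -/
def coindUnit (M : DGMod Γ) : M ⟶ coindObj Γ M.toDGVect where
  f n :=
    { toFun := fun x p => M.act n p.1.1 p.1.2 (by have := p.2; omega) x
      map_add' := fun x y => by
        apply CoindX.ext
        intro i j h z
        exact LinearMap.congr_fun (map_add (M.act n i j (by omega)) x y) z
      map_smul' := fun r x => by
        apply CoindX.ext
        intro i j h z
        exact LinearMap.congr_fun (map_smul (M.act n i j (by omega)) r x) z }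
  comm n n' hn x := by
    apply CoindX.ext
    intro i j h y
    refine Eq.trans ?_ (coindD_app Γ M.toDGVect n n' hn _ i j (i + 1) (i + n) h rfl rfl y).symm
    exact eq_sub_of_add_eq
      (M.d_act n i (i + n) n' (i + 1) j (by omega) hn rfl (by omega) x y).symm
  map_act n l n' hn x a := by
    apply CoindX.ext
    intro i j h y
    refine Eq.trans ?_ (coindAct_app Γ M.toDGVect n l n' hn _ a i j (l + i) h rfl y).symm
    exact M.act_act n l i n' (l + i) j hn rfl (by omega) (by omega) x a y

theorem coindUnit_naturality {M M' : DGMod Γ} (ψ : M ⟶ M') :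
    ψ ≫ coindUnit M' = coindUnit M ≫ coindHom Γ ψ := by
  ext n x
  apply CoindX.ext
  intro i j h y
  exact (ψ.map_act n i j (by omega) x y).symm

/-- The comultiplication `Hom_k(Γ, M) ⟶ Hom_k(Γ, Hom_k(Λ, M))` along `f : Λ ⟶ Γ`. -/
def coindComul (f : Λ ⟶ Γ) (M : DGVect k) :
    coindObj Γ M ⟶ coindObj Γ (coindObj Λ M).toDGVect where
  f n :=
    { toFun := fun φ p =>
        { toFun := fun x q => CoindX.app φ (p.1.1 + q.1.1) q.1.2
              (by have := p.2; have := q.2; omega) ∘ₗ Γ.mul p.1.1 q.1.1 _ rfl x ∘ₗ f.f q.1.1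
          map_add' := fun x y => by
            apply CoindX.ext
            intro i j h z
            simp [CoindX.app]
            rfl
          map_smul' := fun r x => by
            apply CoindX.ext
            intro i j h z
            simp [CoindX.app]
            rfl }
      map_add' := fun _ _ => rfl
      map_smul' := fun _ _ => rfl }
  comm n n' hn φ := by
    apply CoindX.ext
    intro i j h x
    refine Eq.trans ?_
      (coindD_app Γ (coindObj Λ M).toDGVect n n' hn _ i j (i + 1) (i + n) h rfl rfl x).symm
    apply CoindX.ext
    intro p q hpq y
    have e₁ := coindD_app Λ M (i + n) j (by omega) (fun q => CoindX.app φ (i + q.1.1) q.1.2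
      (by have := q.2; omega) ∘ₗ Γ.mul i q.1.1 _ rfl x ∘ₗ f.f q.1.1) p q (p + 1) (i + p + n) (by omega)
      rfl (by omega) y
    have e₂ : CoindX.app φ (i + p + 1) q (by omega) (Γ.mul (i + 1) p (i + p + 1) (by omega)
        (Γ.d i (i + 1) rfl x) (f.f p y)) = CoindX.app φ (i + 1 + p) q (by omega)
        (Γ.mul (i + 1) p (i + 1 + p) rfl (Γ.d i (i + 1) rfl x) (f.f p y)) :=
      CoindX.app_mul_congr φ _ _ _ _ _ _ _ _ _ _ _
    have e₃ : CoindX.app φ (i + p + 1) q (by omega) (Γ.mul i (p + 1) (i + p + 1) (by omega)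
        x (Γ.d p (p + 1) rfl (f.f p y))) = CoindX.app φ (i + (p + 1)) q (by omega)
        (Γ.mul i (p + 1) (i + (p + 1)) rfl x (f.f (p + 1) (Λ.d p (p + 1) rfl y))) := by
      rw [f.comm]
      exact CoindX.app_mul_congr φ _ _ _ _ _ _ _ _ _ _ _
    have e₄ : CoindX.app (coindD Γ M n n' hn φ) (i + p) q (by omega)
        (Γ.mul i p (i + p) rfl x (f.f p y)) =
        M.d (i + p + n) q (by omega) (CoindX.app φ (i + p) (i + p + n) rfl
          (Γ.mul i p (i + p) rfl x (f.f p y))) -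
        (i + n).negOnePow • CoindX.app φ (i + (p + 1)) q (by omega)
          (Γ.mul i (p + 1) (i + (p + 1)) rfl x (f.f (p + 1) (Λ.d p (p + 1) rfl y))) -
        n.negOnePow • CoindX.app φ (i + 1 + p) q (by omega)
          (Γ.mul (i + 1) p (i + 1 + p) rfl (Γ.d i (i + 1) rfl x) (f.f p y)) := by
      rw [coindD_app Γ M n n' hn φ (i + p) q (i + p + 1) (i + p + n) (by omega) rfl rfl,
        Γ.d_mul i p (i + p) (i + 1) (p + 1) (i + p + 1) rfl rfl rfl rfl,
        map_add, map_zsmul_unit, e₂, e₃, smul_add, smul_smul, Int.negOnePow_add, mul_comm]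
      exact sub_add_eq_sub_sub_swap _ _ _
    refine e₄.trans ?_
    exact (congrArg (fun z => z - n.negOnePow • CoindX.app φ (i + 1 + p) q (by omega)
      (Γ.mul (i + 1) p (i + 1 + p) rfl (Γ.d i (i + 1) rfl x) (f.f p y))) e₁).symm
  map_act n l n' hn φ a := by
    apply CoindX.ext
    intro i j h x
    apply CoindX.ext
    intro p q hpq y
    refine (coindAct_app Γ M n l n' hn φ a (i + p) q (l + i + p) (by omega) (by omega) _).trans ?_
    have key : CoindX.app (φ : CoindX Γ M n) (l + i + p) q (by omega)
        (Γ.mul l (i + p) (l + i + p) (by omega) a (Γ.mul i p (i + p) rfl x (f.f p y))) =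
        CoindX.app (φ : CoindX Γ M n) (l + i + p) q (by omega)
          (Γ.mul (l + i) p (l + i + p) rfl (Γ.mul l i (l + i) rfl a x) (f.f p y)) := by
      rw [← Γ.mul_assoc l i p (l + i) (i + p) (l + i + p) rfl rfl rfl (by omega)]
    exact key

theorem coindComul_comul (f : Λ ⟶ Γ) (M : DGVect k) :
    coindComul f M ≫ coindComul f (coindObj Λ M).toDGVect =
      coindComul f M ≫ coindHom Γ (coindUnit (coindObj Λ M)) := by
  ext n φ
  apply CoindX.ext
  intro i j h x
  apply CoindX.ext
  intro p q hpq y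
  apply CoindX.ext
  intro r s hrs z
  change CoindX.app φ (i + p + r) s _ (Γ.mul (i + p) r (i + p + r) rfl
    (Γ.mul i p (i + p) rfl x (f.f p y)) (f.f r z)) = CoindX.app φ (i + (p + r)) s _
      (Γ.mul i (p + r) (i + (p + r)) rfl x (f.f (p + r) (Λ.mul p r (p + r) rfl y z)))
  rw [f.map_mul, Γ.mul_assoc i p r (i + p) (p + r) (i + p + r) rfl rfl rfl (by omega)]
  exact CoindX.app_mul_congr φ _ _ _ _ _ _ _ _ _ _ _

/-- The iterated coinduction of `M`. -/
def cobar (M : DGMod Λ) : ℕ → DGMod Λ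
  | 0 => M
  | n + 1 => coindObj Λ (cobar M n).toDGVect

/-- The unit as a morphism of the cobar complex. -/
def cobarUnit (M : DGMod Λ) (n : ℕ) : cobar M n ⟶ cobar M (n + 1) := coindUnit (cobar M n)

/-- Coinduction applied to a morphism between terms of cobar complexes. -/
def cobarHom {M M' : DGMod Λ} {n m : ℕ} (ψ : cobar M n ⟶ cobar M' m) :
    cobar M (n + 1) ⟶ cobar M' (m + 1) := coindHom Λ ψ

theorem cobarUnit_naturality {M M' : DGMod Λ} {n m : ℕ} (ψ : cobar M n ⟶ cobar M' m) :
    ψ ≫ cobarUnit M' m = cobarUnit M n ≫ cobarHom ψ := coindUnit_naturality ψ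

/-- The differential of the cobar complex. -/
def cobarD (M : DGMod Λ) : ∀ n, cobar M n ⟶ cobar M (n + 1)
  | 0 => cobarUnit M 0
  | n + 1 => cobarUnit M (n + 1) - cobarHom (cobarD M n)

theorem cobarD_succ (M : DGMod Λ) (n : ℕ) :
    cobarD M (n + 1) = cobarUnit M (n + 1) - cobarHom (cobarD M n) := rfl

theorem cobarD_comp (M : DGMod Λ) (n : ℕ) : cobarD M n ≫ cobarD M (n + 1) = 0 := by
  induction n with
  | zero =>
    rw [cobarD_succ, Preadditive.comp_sub, cobarUnit_naturality]
    exact sub_self _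
  | succ n ih =>
    rw [cobarD_succ M (n + 1), Preadditive.comp_sub, cobarUnit_naturality, ← Preadditive.sub_comp]
    have : cobarUnit M (n + 1) - cobarD M (n + 1) = cobarHom (cobarD M n) := sub_sub_cancel _ _
    rw [this]
    exact (coindHom_comp _ _).symm.trans ((congrArg (coindHom Λ) ih).trans coindHom_zero)

/-- The functoriality of the cobar complex. -/
def cobarMap {M M' : DGMod Λ} (ψ : M ⟶ M') : ∀ n, cobar M n ⟶ cobar M' n
  | 0 => ψ
  | n + 1 => cobarHom (cobarMap ψ n)

theorem cobarMap_comm {M M' : DGMod Λ} (ψ : M ⟶ M') (n : ℕ) :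
    cobarMap ψ n ≫ cobarD M' n = cobarD M n ≫ cobarMap ψ (n + 1) := by
  induction n with
  | zero => exact coindUnit_naturality ψ
  | succ n ih =>
    rw [cobarD_succ, cobarD_succ, Preadditive.comp_sub, Preadditive.sub_comp]
    refine congrArg₂ _ (cobarUnit_naturality (cobarMap ψ (n + 1))) ?_
    exact congrArg (coindHom Λ) ih

theorem cobarMap_id (M : DGMod Λ) (n : ℕ) : cobarMap (𝟙 M) n = 𝟙 _ := by
  induction n with
  | zero => rfl
  | succ n ih => exact congrArg (coindHom Λ) ih

theorem cobarMap_comp {M M' M'' : DGMod Λ} (ψ : M ⟶ M') (ψ' : M' ⟶ M'') (n : ℕ) :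
    cobarMap (ψ ≫ ψ') n = cobarMap ψ n ≫ cobarMap ψ' n := by
  induction n with
  | zero => rfl
  | succ n ih => exact congrArg (coindHom Λ) ih

/-- The terms of the relative cobar complex. -/
def rel (Γ : DGA k) (M : DGMod Λ) (n : ℕ) : DGMod Γ := coindObj Γ (cobar M n).toDGVect

/-- Coinduction applied to a morphism between terms of cobar complexes. -/
def relHom (Γ : DGA k) {M M' : DGMod Λ} {n m : ℕ} (ψ : cobar M n ⟶ cobar M' m) :
    rel Γ M n ⟶ rel Γ M' m := coindHom Γ ψ

theorem relHom_sub {M M' : DGMod Λ} {n m : ℕ} (ψ ψ' : cobar M n ⟶ cobar M' m) :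
    relHom Γ (ψ - ψ') = relHom Γ ψ - relHom Γ ψ' := coindHom_sub ψ ψ'

theorem relHom_comp {M M' M'' : DGMod Λ} {n m l : ℕ} (ψ : cobar M n ⟶ cobar M' m)
    (ψ' : cobar M' m ⟶ cobar M'' l) : relHom Γ (ψ ≫ ψ') = relHom Γ ψ ≫ relHom Γ ψ' := rfl

/-- The comultiplication as a morphism of the relative cobar complex. -/
def relComul (f : Λ ⟶ Γ) (M : DGMod Λ) (n : ℕ) : rel Γ M n ⟶ rel Γ M (n + 1) :=
  coindComul f (cobar M n).toDGVect

theorem relComul_naturality (f : Λ ⟶ Γ) {M M' : DGMod Λ} {n m : ℕ} (ψ : cobar M n ⟶ cobar M' m) :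
    relHom Γ ψ ≫ relComul f M' m = relComul f M n ≫ relHom Γ (cobarHom ψ) := rfl

theorem relComul_comul (f : Λ ⟶ Γ) (M : DGMod Λ) (n : ℕ) :
    relComul f M n ≫ relComul f M (n + 1) =
      relComul f M n ≫ relHom Γ (cobarUnit M (n + 1)) := coindComul_comul f _

/-- The differential of the relative cobar complex. -/
def relD (f : Λ ⟶ Γ) (M : DGMod Λ) (n : ℕ) : rel Γ M n ⟶ rel Γ M (n + 1) :=
  relComul f M n - relHom Γ (cobarD M n)

theorem relD_comp (f : Λ ⟶ Γ) (M : DGMod Λ) (n : ℕ) : relD f M n ≫ relD f M (n + 1) = 0 := by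
  have h : relD f M n ≫ relComul f M (n + 1) = relComul f M n ≫ relHom Γ (cobarD M (n + 1)) := by
    rw [relD, Preadditive.sub_comp, relComul_comul, relComul_naturality, cobarD_succ, relHom_sub,
      Preadditive.comp_sub]
  rw [show relD f M (n + 1) = relComul f M (n + 1) - relHom Γ (cobarD M (n + 1)) from rfl,
    Preadditive.comp_sub, h, ← Preadditive.sub_comp, relD, sub_sub_cancel, ← relHom_comp,
    cobarD_comp]
  rfl

theorem relD_naturality (f : Λ ⟶ Γ) {M M' : DGMod Λ} (ψ : M ⟶ M') (n : ℕ) :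
    relHom Γ (cobarMap ψ n) ≫ relD f M' n = relD f M n ≫ relHom Γ (cobarMap ψ (n + 1)) := by
  rw [relD, relD, Preadditive.comp_sub, Preadditive.sub_comp, relComul_naturality, ← relHom_comp,
    cobarMap_comm]
  rfl

end CobarResolution

/-! ### Total complexes -/

section Total

variable {Γ : DGA k} (C : ℕ → DGMod Γ) (c : ∀ n, C n ⟶ C (n + 1))

/-- The degree `j` part of the total complex of `C`. -/
abbrev TotX (j : ℤ) : Type u := ∀ p : {p : ℕ × ℤ // p.2 + p.1 = j}, (C p.1.1).X p.1.2

variable {C} in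
/-- A component of an element of the total complex. -/
def TotX.app {j : ℤ} (x : TotX C j) (n : ℕ) (i : ℤ) (h : i + n = j) : (C n).X i := x ⟨(n, i), h⟩

variable {C} in
theorem TotX.ext {j : ℤ} {x y : TotX C j}
    (H : ∀ (n : ℕ) (i : ℤ) (h : i + n = j), x.app n i h = y.app n i h) : x = y :=
  funext fun p => H p.1.1 p.1.2 p.2

variable {C} in
/-- The horizontal part of the differential of the total complex. -/
def totPrev {j : ℤ} (x : TotX C j) : ∀ (n : ℕ) (i : ℤ), i + n = j + 1 → (C n).X i
  | 0, _, _ => 0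
  | n + 1, i, h => (c n).f i (x.app n i (by lia))

theorem totPrev_add {j : ℤ} (x y : TotX C j) (n : ℕ) (i : ℤ) (h : i + n = j + 1) :
    totPrev c (x + y) n i h = totPrev c x n i h + totPrev c y n i h := by
  cases n with
  | zero => exact (add_zero _).symm
  | succ n => exact map_add ((c n).f i) _ _

theorem totPrev_smul {j : ℤ} (r : k) (x : TotX C j) (n : ℕ) (i : ℤ) (h : i + n = j + 1) :
    totPrev c (r • x) n i h = r • totPrev c x n i h := by
  cases n with
  | zero => exact (smul_zero _).symm
  | succ n => exact map_smul ((c n).f i) _ _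

/-- The differential of the total complex. -/
def totD (j j' : ℤ) (hj : j + 1 = j') : TotX C j →ₗ[k] TotX C j' where
  toFun x p := (p.1.1 : ℤ).negOnePow • (C p.1.1).d (p.1.2 - 1) p.1.2 (by lia)
    (x.app p.1.1 (p.1.2 - 1) (by have := p.2; lia)) +
      totPrev c x p.1.1 p.1.2 (by have := p.2; lia)
  map_add' x y := by
    funext p
    refine (congrArg₂ (· + ·) ((congrArg (_ • ·) (map_add _ _ _)).trans (smul_add _ _ _))
      (totPrev_add C c x y p.1.1 p.1.2 (by have := p.2; lia))).trans ?_
    exact add_add_add_comm _ _ _ _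
  map_smul' r x := by
    funext p
    refine (congrArg₂ (· + ·) ((congrArg (_ • ·) (map_smul _ _ _)).trans (smul_comm _ _ _))
      (totPrev_smul C c r x p.1.1 p.1.2 (by have := p.2; lia))).trans ?_
    exact (smul_add _ _ _).symm

theorem totD_app (j j' : ℤ) (hj : j + 1 = j') (x : TotX C j) (n : ℕ) (i i' : ℤ) (h : i' + n = j')
    (hi : i + 1 = i') : TotX.app (totD C c j j' hj x) n i' h =
      (n : ℤ).negOnePow • (C n).d i i' hi (x.app n i (by lia)) + totPrev c x n i' (by lia) := by
  obtain rfl : i = i' - 1 := by lia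
  rfl

theorem TotX.app_add {j : ℤ} (x y : TotX C j) (n : ℕ) (i : ℤ) (h : i + n = j) :
    TotX.app (x + y) n i h = x.app n i h + y.app n i h := rfl

theorem TotX.app_units_smul {j : ℤ} (r : ℤˣ) (x : TotX C j) (n : ℕ) (i : ℤ) (h : i + n = j) :
    TotX.app (r • x) n i h = r • x.app n i h := rfl

/-- The right action on the total complex. -/
def totAct (j l j' : ℤ) (hj : j + l = j') : TotX C j →ₗ[k] Γ.X l →ₗ[k] TotX C j' :=
  LinearMap.mk₂ k
    (fun x a p => (C p.1.1).act (p.1.2 - l) l p.1.2 (by lia)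
      (x.app p.1.1 (p.1.2 - l) (by have := p.2; lia)) a)
    (fun x y a => funext fun p => ((C p.1.1).act _ _ _ _).map_add₂ _ _ a)
    (fun r x a => funext fun p => ((C p.1.1).act _ _ _ _).map_smul₂ r _ a)
    (fun x a b => funext fun p => map_add _ _ _)
    (fun r x a => funext fun p => map_smul _ _ _)

theorem totAct_app (j l j' : ℤ) (hj : j + l = j') (x : TotX C j) (a : Γ.X l) (n : ℕ) (i i' : ℤ)
    (h : i' + n = j') (hi : i + l = i') : TotX.app (totAct C j l j' hj x a) n i' h =
      (C n).act i l i' hi (x.app n i (by lia)) a := by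
  obtain rfl : i = i' - l := by lia
  rfl

variable {C c}

theorem totPrev_act {j : ℤ} (l j' : ℤ) (hj : j + l = j') (x : TotX C j) (a : Γ.X l) (n : ℕ)
    (i i' : ℤ) (h : i' + n = j' + 1) (hi : i + l = i') :
    totPrev c (totAct C j l j' hj x a) n i' h =
      (C n).act i l i' hi (totPrev c x n i (by lia)) a := by
  cases n with
  | zero => exact (((C 0).act i l i' hi).map_zero₂ a).symm
  | succ n =>
    change (c n).f i' (TotX.app (totAct C j l j' hj x a) n i' _) = (C (n + 1)).act i l i' hi
      ((c n).f i (x.app n i _)) a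
    rw [totAct_app C j l j' hj x a n i i' _ hi, (c n).map_act]

/-- The total complex of a complex of dg-modules. -/
def tot (hc : ∀ n, c n ≫ c (n + 1) = 0) : DGMod Γ where
  X j := TotX C j
  d j j' hj := totD C c j j' hj
  d_d j j' j'' hj hj' x := by
    have hcc : ∀ (n : ℕ) (i : ℤ) (y : (C n).X i), (c (n + 1)).f i ((c n).f i y) = 0 :=
      fun n i y => congrArg (fun φ : C n ⟶ C (n + 1 + 1) => φ.f i y) (hc n)
    apply TotX.ext
    intro n i h
    rw [totD_app C c j' j'' hj' _ n (i - 1) i h (by lia),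
      totD_app C c j j' hj x n (i - 1 - 1) (i - 1) (by lia) (by lia)]
    rw [map_add, map_zsmul_unit, (C n).d_d, smul_zero, zero_add]
    cases n with
    | zero =>
      change _ • (C 0).d _ _ _ 0 + 0 = 0
      rw [map_zero, smul_zero, add_zero]
    | succ n =>
      change _ • (C (n + 1)).d (i - 1) i _ ((c n).f (i - 1) (x.app n (i - 1) _)) +
        (c n).f i (TotX.app (totD C c j j' hj x) n i _) = 0
      rw [totD_app C c j j' hj x n (i - 1) i _ (by lia), map_add, map_zsmul_unit, ← (c n).comm,
        Nat.cast_succ, Int.negOnePow_succ, Units.neg_smul, neg_add_cancel_left]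
      cases n with
      | zero => exact map_zero _
      | succ n => exact hcc n i _
  act j l j' hj := totAct C j l j' hj
  act_one j x := by
    apply TotX.ext
    intro n i h
    rw [totAct_app C j 0 j _ x _ n i i h (add_zero i), (C n).act_one]
  act_act j l m jl lm t h₁ h₂ h₃ h₄ x a b := by
    apply TotX.ext
    intro n i h
    rw [totAct_app C jl m t h₃ _ b n (i - m) i h (by lia),
      totAct_app C j l jl h₁ x a n (i - lm) (i - m) (by lia) (by lia),
      totAct_app C j lm t h₄ x _ n (i - lm) i h (by lia),
      (C n).act_act (i - lm) l m (i - m) lm i (by lia) h₂ (by lia) (by lia)]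
  d_act j l m j' l' m' h hj hl hm x a := by
    apply TotX.ext
    intro n i hi
    rw [TotX.app_add, TotX.app_units_smul, totD_app C c m m' hm _ n (i - 1) i hi (by lia),
      totAct_app C j l m h x a n (i - 1 - l) (i - 1) (by lia) (by lia),
      totAct_app C j' l m' _ _ a n (i - l) i hi (by lia),
      totD_app C c j j' hj x n (i - 1 - l) (i - l) (by lia) (by lia),
      totAct_app C j l' m' _ x _ n (i - 1 - l) i hi (by lia),
      totPrev_act l m h x a n (i - l) i _ (by lia),
      (C n).d_act (i - 1 - l) l (i - 1) (i - l) l' i (by lia) (by lia) hl (by lia),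
      show j.negOnePow = (n : ℤ).negOnePow * (i - 1 - l).negOnePow by
        rw [← Int.negOnePow_add]; congr 1; lia]
    rw [map_add, LinearMap.add_apply, smul_add, smul_smul, map_zsmul_unit, LinearMap.smul_apply]
    abel

end Total


/-! ### Quasi-isomorphisms of total complexes -/

theorem quasiIso_iff_exists {Λ : DGA k} {M N : DGMod Λ} (φ : M ⟶ N) :
    quasiIso Λ φ ↔ ∀ (h i j l : ℤ) (e₀ : h + 1 = i) (e₁ : i + 1 = j) (e₂ : j + 1 = l)
      (u : M.X j) (v : N.X i), M.d j l e₂ u = 0 → φ.f j u + N.d i j e₁ v = 0 →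
      ∃ (a : M.X i) (b : N.X h), -M.d i j e₁ a = u ∧ φ.f i a + N.d h i e₀ b = v := by
  rw [quasiIso_iff_acyclic_cone]
  constructor
  · intro H h i j l e₀ e₁ e₂ u v hu huv
    subst e₀ e₁ e₂
    obtain ⟨⟨a, b⟩, hab⟩ := H.exists_d_eq h (h + 1) (h + 1 + 1) rfl rfl (u, v)
      (Prod.ext (neg_eq_zero.2 hu) huv)
    exact ⟨a, b, congrArg Prod.fst hab, congrArg Prod.snd hab⟩
  · intro H i x hx
    obtain ⟨h, rfl⟩ : ∃ h, i = h + 1 := ⟨i - 1, by omega⟩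
    obtain ⟨u, v⟩ := x
    obtain ⟨a, b, ha, hb⟩ := H h (h + 1) (h + 1 + 1) (h + 1 + 1 + 1) rfl rfl rfl u v
      (neg_eq_zero.1 (congrArg Prod.fst hx)) (congrArg Prod.snd hx)
    exact ⟨h, rfl, (a, b), Prod.ext ha hb⟩

theorem exists_seq {S : ℕ → Type*} (P₀ : S 0 → Prop) (P : ∀ n, S n → S (n + 1) → Prop)
    (G : ∀ n, S n → Prop) (h₀ : ∃ z, P₀ z ∧ G 0 z)
    (h : ∀ n z, G n z → ∃ z', P n z z' ∧ G (n + 1) z') :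
    ∃ z : ∀ n, S n, P₀ (z 0) ∧ ∀ n, P n (z n) (z (n + 1)) := by
  obtain ⟨z₀, hz₀, hG₀⟩ := h₀
  choose s hs hs' using h
  let w : ∀ n, {z : S n // G n z} := fun n =>
    Nat.rec ⟨z₀, hG₀⟩ (fun n z => ⟨s n z.1 z.2, hs' n z.1 z.2⟩) n
  exact ⟨fun n => (w n).1, hz₀, fun n => hs n _ _⟩

/-- The identification of components of equal degrees. -/
def DGVect.cast (V : DGVect k) {i j : ℤ} (h : i = j) : V.X i →ₗ[k] V.X j := h ▸ LinearMap.id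

theorem units_smul_smul_self {A : Type*} [AddCommGroup A] (r : ℤˣ) (x : A) : r • r • x = x := by
  rw [smul_smul, Int.units_mul_self, one_smul]

theorem totD_app_zero {Γ : DGA k} {C : ℕ → DGMod Γ} (c : ∀ n, C n ⟶ C (n + 1)) (j j' : ℤ)
    (hj : j + 1 = j') (x : TotX C j) (i i' : ℤ) (h : i' + (0 : ℕ) = j') (hi : i + 1 = i') :
    TotX.app (totD C c j j' hj x) 0 i' h = (C 0).d i i' hi (x.app 0 i (by lia)) := by
  refine (totD_app C c j j' hj x 0 i i' h hi).trans ((add_zero _).trans ?_)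
  rw [Nat.cast_zero, Int.negOnePow_zero, one_smul]

section TotalMap

variable {Γ : DGA k} {C C' : ℕ → DGMod Γ} {c : ∀ n, C n ⟶ C (n + 1)} {c' : ∀ n, C' n ⟶ C' (n + 1)}
  (hc : ∀ n, c n ≫ c (n + 1) = 0) (hc' : ∀ n, c' n ≫ c' (n + 1) = 0)

/-- The morphism of total complexes given by a morphism of complexes. -/
def totMap (φ : ∀ n, C n ⟶ C' n) (hφ : ∀ n, φ n ≫ c' n = c n ≫ φ (n + 1)) :
    tot hc ⟶ tot hc' where
  f j :=
    { toFun := fun x p => (φ p.1.1).f p.1.2 (TotX.app x p.1.1 p.1.2 p.2)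
      map_add' := fun x y => funext fun p => map_add ((φ p.1.1).f p.1.2) _ _
      map_smul' := fun r x => funext fun p => map_smul ((φ p.1.1).f p.1.2) _ _ }
  comm j j' hj x := by
    apply TotX.ext
    intro n i h
    refine (congrArg ((φ n).f i) (totD_app C c j j' hj x n (i - 1) i h (by lia))).trans ?_
    refine Eq.trans ?_ (totD_app C' c' j j' hj _ n (i - 1) i h (by lia)).symm
    rw [map_add, map_zsmul_unit, (φ n).comm]
    refine congrArg₂ _ rfl ?_
    cases n with
    | zero => exact map_zero _
    | succ n => exact (congrArg (fun ψ : C n ⟶ C' (n + 1) => ψ.f i (TotX.app x n i _)) (hφ n)).symm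
  map_act j l j' hj x a := by
    apply TotX.ext
    intro n i h
    refine (congrArg ((φ n).f i) (totAct_app C j l j' hj x a n (i - l) i h (by lia))).trans ?_
    refine Eq.trans ?_ (totAct_app C' j l j' hj _ a n (i - l) i h (by lia)).symm
    exact (φ n).map_act _ _ _ _ _ _

theorem quasiIso_totMap (φ : ∀ n, C n ⟶ C' n) (hφ : ∀ n, φ n ≫ c' n = c n ≫ φ (n + 1))
    (H : ∀ n, quasiIso Γ (φ n)) : quasiIso Γ (totMap hc hc' φ hφ) := by
  rw [quasiIso_iff_exists]
  intro j₀ j₁ j₂ j₃ e₀ e₁ e₂ x y hx hxy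
  have hcc : ∀ (n : ℕ) (i : ℤ) (z : (C n).X i), (c (n + 1)).f i ((c n).f i z) = 0 :=
    fun n i z => congrArg (fun ψ : C n ⟶ C (n + 1 + 1) => ψ.f i z) (hc n)
  have hcc' : ∀ (n : ℕ) (i : ℤ) (z : (C' n).X i), (c' (n + 1)).f i ((c' n).f i z) = 0 :=
    fun n i z => congrArg (fun ψ : C' n ⟶ C' (n + 1 + 1) => ψ.f i z) (hc' n)
  have hφc : ∀ (n : ℕ) (i : ℤ) (z : (C n).X i),
      (c' n).f i ((φ n).f i z) = (φ (n + 1)).f i ((c n).f i z) :=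
    fun n i z => congrArg (fun ψ : C n ⟶ C' (n + 1) => ψ.f i z) (hφ n)
  obtain ⟨b, hb⟩ : ∃ b : ℕ → ℤ, ∀ m : ℕ, b m + m = j₃ := ⟨fun m => j₃ - m, fun m => by simp⟩
  have hs : ∀ m, b (m + 1) + 1 = b m := by
    intro m
    have h₁ := hb m
    have h₂ := hb (m + 1)
    push_cast at h₂
    lia
  have b₂ : ∀ n : ℕ, b (n + 1) + n = j₂ := fun n => by have := hb n; have := hs n; lia
  have b₁ : ∀ n : ℕ, b (n + 2) + n = j₁ := fun n => by have := b₂ n; have := hs (n + 1); lia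
  have b₀ : ∀ n : ℕ, b (n + 3) + n = j₀ := fun n => by have := b₁ n; have := hs (n + 2); lia
  let X : ∀ n : ℕ, (C n).X (b (n + 1)) := fun n => TotX.app x n _ (b₂ n)
  let Y : ∀ n : ℕ, (C' n).X (b (n + 2)) := fun n => TotX.app y n _ (b₁ n)
  have hx₀ : (C 0).d (b 1) (b 0) (hs 0) (X 0) = 0 :=
    (totD_app_zero c j₂ j₃ e₂ x (b 1) (b 0) (hb 0) (hs 0)).symm.trans
      (congrArg (fun z : TotX C j₃ => z.app 0 (b 0) (hb 0)) hx)
  have hx₁ : ∀ n : ℕ, ((n + 1 : ℕ) : ℤ).negOnePow • (C (n + 1)).d (b (n + 2)) (b (n + 1)) (hs _)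
      (X (n + 1)) + (c n).f (b (n + 1)) (X n) = 0 := fun n =>
    (totD_app C c j₂ j₃ e₂ x (n + 1) (b (n + 2)) (b (n + 1)) (hb _) (hs _)).symm.trans
      (congrArg (fun z : TotX C j₃ => z.app (n + 1) (b (n + 1)) (hb _)) hx)
  have hy₀ : (φ 0).f (b 1) (X 0) + (C' 0).d (b 2) (b 1) (hs 1) (Y 0) = 0 :=
    (congrArg ((φ 0).f (b 1) (X 0) + ·)
      (totD_app_zero c' j₁ j₂ e₁ y (b 2) (b 1) (b₂ 0) (hs 1)).symm).trans
      (congrArg (fun z : TotX C' j₂ => z.app 0 (b 1) (b₂ 0)) hxy)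
  have hy₁ : ∀ n : ℕ, (φ (n + 1)).f (b (n + 2)) (X (n + 1)) + (((n + 1 : ℕ) : ℤ).negOnePow •
      (C' (n + 1)).d (b (n + 3)) (b (n + 2)) (hs _) (Y (n + 1)) +
        (c' n).f (b (n + 2)) (Y n)) = 0 := fun n =>
    (congrArg ((φ (n + 1)).f (b (n + 2)) (X (n + 1)) + ·)
      (totD_app C' c' j₁ j₂ e₁ y (n + 1) (b (n + 3)) (b (n + 2)) (b₂ (n + 1)) (hs _)).symm).trans
      (congrArg (fun z : TotX C' j₂ => z.app (n + 1) (b (n + 2)) (b₂ (n + 1))) hxy)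
  have step : ∀ (n : ℕ) (U : (C n).X (b (n + 1))) (V : (C' n).X (b (n + 2))),
      (C n).d (b (n + 1)) (b n) (hs n) U = 0 →
      (φ n).f (b (n + 1)) U +
        (n : ℤ).negOnePow • (C' n).d (b (n + 2)) (b (n + 1)) (hs (n + 1)) V = 0 →
      (c n).f (b (n + 1)) U = (c n).f (b (n + 1)) (X n) →
      (c' n).f (b (n + 2)) V = (c' n).f (b (n + 2)) (Y n) →
      ∃ (a : (C n).X (b (n + 2))) (a' : (C' n).X (b (n + 3))),
        (n : ℤ).negOnePow • (C n).d (b (n + 2)) (b (n + 1)) (hs (n + 1)) a = -U ∧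
        (φ n).f (b (n + 2)) a +
          (n : ℤ).negOnePow • (C' n).d (b (n + 3)) (b (n + 2)) (hs (n + 2)) a' = V ∧
        (C (n + 1)).d (b (n + 2)) (b (n + 1)) (hs _) (X (n + 1) + (c n).f (b (n + 2)) a) = 0 ∧
        (φ (n + 1)).f (b (n + 2)) (X (n + 1) + (c n).f (b (n + 2)) a) +
          ((n + 1 : ℕ) : ℤ).negOnePow • (C' (n + 1)).d (b (n + 3)) (b (n + 2)) (hs _)
            (Y (n + 1) - (c' n).f (b (n + 3)) a') = 0 := by
    intro n U V hU hUV hcU hcV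
    obtain ⟨a, a', ha, ha'⟩ := (quasiIso_iff_exists _).1 (H n) (b (n + 3)) (b (n + 2)) (b (n + 1))
      (b n) (hs _) (hs _) (hs _) ((n : ℤ).negOnePow • U) V
      (by rw [map_zsmul_unit, hU, smul_zero])
      (by rw [map_zsmul_unit, ← units_smul_smul_self (n : ℤ).negOnePow
        ((C' n).d _ _ (hs (n + 1)) V), ← smul_add, hUV, smul_zero])
    have hn : ((n + 1 : ℕ) : ℤ).negOnePow = -(n : ℤ).negOnePow := by
      rw [Nat.cast_succ, Int.negOnePow_succ]
    have h₁ := hx₁ n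
    have h₂ := hy₁ n
    rw [hn, Units.neg_smul] at h₁ h₂
    rw [hn]
    refine ⟨a, (n : ℤ).negOnePow • a', ?_, ?_, ?_, ?_⟩
    · rw [neg_eq_iff_eq_neg.1 ha, smul_neg, units_smul_smul_self]
    · rw [map_zsmul_unit, units_smul_smul_self, ha']
    · rw [map_add, ← (c n).comm _ _ (hs (n + 1)), neg_eq_iff_eq_neg.1 ha, map_neg, map_zsmul_unit,
        hcU, ← neg_add_eq_zero.1 h₁, units_smul_smul_self, add_neg_cancel]
    · rw [map_add, ← hφc, eq_sub_of_add_eq ha', map_sub, hcV, map_sub, map_zsmul_unit, Units.neg_smul, smul_sub,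
        map_zsmul_unit, units_smul_smul_self, ← (c' n).comm _ _ (hs (n + 2)), ← h₂]
      abel
  obtain ⟨z, ⟨hz₀, hz₀'⟩, hz₁⟩ := exists_seq
    (S := fun n => (C n).X (b (n + 2)) × (C' n).X (b (n + 3)))
    (fun z => -(C 0).d (b 2) (b 1) (hs 1) z.1 = X 0 ∧
      (φ 0).f (b 2) z.1 + (C' 0).d (b 3) (b 2) (hs 2) z.2 = Y 0)
    (fun n z z' => -(((n + 1 : ℕ) : ℤ).negOnePow • (C (n + 1)).d (b (n + 3)) (b (n + 2)) (hs _) z'.1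
        + (c n).f (b (n + 2)) z.1) = X (n + 1) ∧
      (φ (n + 1)).f (b (n + 3)) z'.1 + (((n + 1 : ℕ) : ℤ).negOnePow •
        (C' (n + 1)).d (b (n + 4)) (b (n + 3)) (hs _) z'.2 + (c' n).f (b (n + 3)) z.2) = Y (n + 1))
    (fun n z => (C (n + 1)).d (b (n + 2)) (b (n + 1)) (hs _)
        (X (n + 1) + (c n).f (b (n + 2)) z.1) = 0 ∧
      (φ (n + 1)).f (b (n + 2)) (X (n + 1) + (c n).f (b (n + 2)) z.1) +
        ((n + 1 : ℕ) : ℤ).negOnePow • (C' (n + 1)).d (b (n + 3)) (b (n + 2)) (hs _)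
          (Y (n + 1) - (c' n).f (b (n + 3)) z.2) = 0)
    (by
      obtain ⟨a, a', ha, ha', h₁, h₂⟩ := step 0 (X 0) (Y 0) hx₀
        (by rw [Nat.cast_zero, Int.negOnePow_zero, one_smul]; exact hy₀) rfl rfl
      rw [Nat.cast_zero, Int.negOnePow_zero, one_smul] at ha ha'
      exact ⟨(a, a'), ⟨neg_eq_iff_eq_neg.2 ha, ha'⟩, h₁, h₂⟩)
    (by
      rintro n ⟨z, z'⟩ ⟨h₁, h₂⟩
      obtain ⟨a, a', ha, ha', h₃, h₄⟩ := step (n + 1) _ _ h₁ h₂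
        (by rw [map_add, hcc, add_zero]) (by rw [map_sub, hcc', sub_zero])
      refine ⟨(a, a'), ⟨?_, ?_⟩, h₃, h₄⟩
      · exact neg_eq_iff_eq_neg.2 ((congrArg (· + _) ha).trans (by abel))
      · exact (add_assoc _ _ _).symm.trans ((congrArg (· + _) ha').trans (sub_add_cancel _ _)))
  refine ⟨fun p => (C p.1.1).cast (by have := p.2; have := b₁ p.1.1; lia) (z p.1.1).1,
    fun p => (C' p.1.1).cast (by have := p.2; have := b₀ p.1.1; lia) (z p.1.1).2, ?_, ?_⟩
  · apply TotX.ext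
    intro n i h
    obtain rfl : i = b (n + 1) := by have := b₂ n; lia
    cases n with
    | zero =>
      exact (congrArg Neg.neg (totD_app_zero c j₁ j₂ e₁ _ (b 2) (b 1) h (hs _))).trans hz₀
    | succ n =>
      exact (congrArg Neg.neg (totD_app C c j₁ j₂ e₁ _ (n + 1) (b (n + 3)) (b (n + 2)) h
        (hs _))).trans (hz₁ n).1
  · apply TotX.ext
    intro n i h
    obtain rfl : i = b (n + 2) := by have := b₁ n; lia
    cases n with
    | zero =>
      exact (congrArg ((φ 0).f (b 2) (z 0).1 + ·)
        (totD_app_zero c' j₀ j₁ e₀ _ (b 3) (b 2) h (hs _))).trans hz₀'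
    | succ n =>
      exact (congrArg ((φ (n + 1)).f (b (n + 3)) (z (n + 1)).1 + ·)
        (totD_app C' c' j₀ j₁ e₀ _ (n + 1) (b (n + 4)) (b (n + 3)) h (hs _))).trans (hz₁ n).2

end TotalMap


/-! ### Restriction of scalars along a quasi-isomorphism -/

section Contraction

variable {Λ : DGA k} {M N : DGMod Λ} (φ : M ⟶ N)

theorem exists_cone_contraction (hφ : quasiIso Λ φ) :
    ∃ (α : ∀ i j : ℤ, j + 1 = i → M.X i →ₗ[k] M.X j)
      (β : ∀ i j l : ℤ, j + 1 = i → l + 1 = j → M.X i →ₗ[k] N.X l)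
      (γ : ∀ i : ℤ, N.X i →ₗ[k] M.X i) (δ : ∀ i j : ℤ, j + 1 = i → N.X i →ₗ[k] N.X j),
      (∀ (i j : ℤ) (h : i + 1 = j) (y : N.X i), M.d i j h (γ i y) = γ j (N.d i j h y)) ∧
      (∀ (h i j : ℤ) (e : h + 1 = i) (e' : i + 1 = j) (y : N.X i),
        φ.f i (γ i y) + N.d h i e (δ i h e y) + δ j i e' (N.d i j e' y) = y) ∧
      (∀ (h i j : ℤ) (e : h + 1 = i) (e' : i + 1 = j) (x : M.X i),
        γ i (φ.f i x) = x + M.d h i e (α i h e x) + α j i e' (M.d i j e' x)) ∧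
      (∀ (g h i j : ℤ) (e : g + 1 = h) (e' : h + 1 = i) (e'' : i + 1 = j) (x : M.X i),
        φ.f h (α i h e' x) + N.d g h e (β i h g e' e x) + δ i h e' (φ.f i x) =
          β j i h e'' e' (M.d i j e'' x)) := by
  obtain ⟨s, hs⟩ := ((quasiIso_iff_acyclic_cone φ).1 hφ).exists_contraction
  let S : ∀ g h i : ℤ, g + 1 = h → h + 1 = i → M.X i × N.X h →ₗ[k] M.X h × N.X g :=
    fun g h i e e' => by
      subst e e'
      exact s (g + 1) g rfl
  have hS : ∀ (g h i j : ℤ) (e : g + 1 = h) (e' : h + 1 = i) (e'' : i + 1 = j)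
      (x : M.X i) (y : N.X h),
      -M.d h i e' (S g h i e e' (x, y)).1 +
        (S h i j e' e'' (-M.d i j e'' x, φ.f i x + N.d h i e' y)).1 = x ∧
      φ.f h (S g h i e e' (x, y)).1 + N.d g h e (S g h i e e' (x, y)).2 +
        (S h i j e' e'' (-M.d i j e'' x, φ.f i x + N.d h i e' y)).2 = y := by
    intro g h i j e e' e'' x y
    subst e e' e''
    have key := hs (g + 1) g (g + 1 + 1) rfl rfl (x, y)
    exact ⟨congrArg Prod.fst key, congrArg Prod.snd key⟩
  refine ⟨fun i h e => LinearMap.fst k _ _ ∘ₗ S (h - 1) h i (by omega) e ∘ₗ LinearMap.inl k _ _,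
    fun i h g e e' => LinearMap.snd k _ _ ∘ₗ S g h i e' e ∘ₗ LinearMap.inl k _ _,
    fun h => LinearMap.fst k _ _ ∘ₗ S (h - 1) h (h + 1) (by omega) rfl ∘ₗ LinearMap.inr k _ _,
    fun h g e => LinearMap.snd k _ _ ∘ₗ S g h (h + 1) e rfl ∘ₗ LinearMap.inr k _ _, ?_, ?_, ?_, ?_⟩
  · rintro h i rfl y
    have key := (hS (h - 1) h (h + 1) (h + 1 + 1) (by omega) rfl rfl 0 y).1
    obtain e : h + 1 - 1 = h := by omega
    simp only [map_zero, neg_zero, zero_add] at key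
    have h₁ : ∀ (g : ℤ) (hg : g = h) (e₁ : g + 1 = h + 1), (S h (h + 1) (h + 1 + 1) rfl rfl
      (0, N.d h (h + 1) rfl y)).1 = (S g (h + 1) (h + 1 + 1) e₁ rfl
      (0, N.d h (h + 1) rfl y)).1 := by
      rintro g rfl e₁
      rfl
    exact (neg_add_eq_zero.1 key).trans (h₁ _ e _)
  · rintro g h i rfl rfl y
    have key := (hS g (g + 1) (g + 1 + 1) (g + 1 + 1 + 1) rfl rfl rfl 0 y).2
    simp only [map_zero, neg_zero, zero_add] at key
    have h₁ : ∀ (f : ℤ) (hf : f = g) (e₁ : f + 1 = g + 1), (S g (g + 1) (g + 1 + 1) rfl rfl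
      (0, y)).1 = (S f (g + 1) (g + 1 + 1) e₁ rfl (0, y)).1 := by
      rintro f rfl e₁
      rfl
    rw [h₁ (g + 1 - 1) (by omega) (by omega)] at key
    exact key
  · rintro h i j rfl rfl x
    have key := (hS (h - 1) h (h + 1) (h + 1 + 1) (by omega) rfl rfl x 0).1
    simp only [map_zero, add_zero] at key
    have h₁ : ∀ (g : ℤ) (hg : g = h) (e₁ : g + 1 = h + 1) (z), (S h (h + 1) (h + 1 + 1) rfl rfl
      z).1 = (S g (h + 1) (h + 1 + 1) e₁ rfl z).1 := by
      rintro g rfl e₁ z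
      rfl
    rw [h₁ (h + 1 - 1) (by omega) (by omega), show (-M.d (h + 1) (h + 1 + 1) rfl x, φ.f (h + 1) x) =
      -(M.d (h + 1) (h + 1 + 1) rfl x, (0 : N.X (h + 1))) + (0, φ.f (h + 1) x) by simp, map_add,
      map_neg, Prod.fst_add, Prod.fst_neg] at key
    refine eq_add_of_sub_eq (eq_add_of_sub_eq ?_)
    refine Eq.trans ?_ key
    simp only [LinearMap.comp_apply, LinearMap.fst_apply, LinearMap.inl_apply, LinearMap.inr_apply]
    abel
  · rintro g h i j rfl rfl rfl x
    have key := (hS g (g + 1) (g + 1 + 1) (g + 1 + 1 + 1) rfl rfl rfl x 0).2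
    have h₁ : ∀ (f : ℤ) (hf : f = g) (e₁ : f + 1 = g + 1) (z), (S g (g + 1) (g + 1 + 1) rfl rfl
      z).1 = (S f (g + 1) (g + 1 + 1) e₁ rfl z).1 := by
      rintro f rfl e₁ z
      rfl
    simp only [map_zero, add_zero] at key
    rw [h₁ (g + 1 - 1) (by omega) (by omega), show (-M.d (g + 1 + 1) (g + 1 + 1 + 1) rfl x,
      φ.f (g + 1 + 1) x) = -(M.d (g + 1 + 1) (g + 1 + 1 + 1) rfl x, (0 : N.X (g + 1 + 1))) +
        (0, φ.f (g + 1 + 1) x) by simp, map_add, map_neg, Prod.snd_add, Prod.snd_neg] at key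
    refine eq_of_sub_eq_zero (Eq.trans ?_ key)
    simp only [LinearMap.comp_apply, LinearMap.fst_apply, LinearMap.snd_apply, LinearMap.inl_apply,
      LinearMap.inr_apply]
    abel

end Contraction
section Coinduction

variable {Λ Γ : DGA k} (f : Λ ⟶ Γ)

/-- A dga map as a morphism of regular modules. -/
def regularMap : Λ.regular ⟶ (res f).obj Γ.regular where
  f := f.f
  comm := f.comm
  map_act := f.map_mul

/-- The restriction map `Hom_k(Γ, M) ⟶ Hom_k(Λ, M)`. -/
def resCoind (M : DGVect k) : (res f).obj (coindObj Γ M) ⟶ coindObj Λ M where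
  f n :=
    { toFun := fun φ p => CoindX.app φ p.1.1 p.1.2 p.2 ∘ₗ f.f p.1.1
      map_add' := fun _ _ => rfl
      map_smul' := fun _ _ => rfl }
  comm n n' hn φ := by
    apply CoindX.ext
    intro i j h x
    refine (coindD_app Γ M n n' hn φ i j (i + 1) (i + n) h rfl rfl _).trans ?_
    refine Eq.trans ?_ (coindD_app Λ M n n' hn _ i j (i + 1) (i + n) h rfl rfl x).symm
    rw [← f.comm]
    rfl
  map_act n l n' hn φ a := by
    apply CoindX.ext
    intro i j h x
    exact congrArg (CoindX.app (φ : CoindX Γ M n) (l + i) j (by omega)) (f.map_mul l i (l + i) rfl a x).symm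

theorem exists_contraction (hf : f.toChainMap.IsQuasiIso) :
    ∃ (α : ∀ i j : ℤ, j + 1 = i → Λ.X i →ₗ[k] Λ.X j)
      (β : ∀ i j l : ℤ, j + 1 = i → l + 1 = j → Λ.X i →ₗ[k] Γ.X l)
      (γ : ∀ i : ℤ, Γ.X i →ₗ[k] Λ.X i) (δ : ∀ i j : ℤ, j + 1 = i → Γ.X i →ₗ[k] Γ.X j),
      (∀ (i j : ℤ) (h : i + 1 = j) (y : Γ.X i), Λ.d i j h (γ i y) = γ j (Γ.d i j h y)) ∧
      (∀ (h i j : ℤ) (e : h + 1 = i) (e' : i + 1 = j) (y : Γ.X i),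
        f.f i (γ i y) + Γ.d h i e (δ i h e y) + δ j i e' (Γ.d i j e' y) = y) ∧
      (∀ (h i j : ℤ) (e : h + 1 = i) (e' : i + 1 = j) (x : Λ.X i),
        γ i (f.f i x) = x + Λ.d h i e (α i h e x) + α j i e' (Λ.d i j e' x)) ∧
      (∀ (g h i j : ℤ) (e : g + 1 = h) (e' : h + 1 = i) (e'' : i + 1 = j) (x : Λ.X i),
        f.f h (α i h e' x) + Γ.d g h e (β i h g e' e x) + δ i h e' (f.f i x) =
          β j i h e'' e' (Λ.d i j e'' x)) :=
  exists_cone_contraction (regularMap f) hf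

set_option maxHeartbeats 1600000 in
theorem quasiIso_resCoind (hf : f.toChainMap.IsQuasiIso) (M : DGVect k) :
    quasiIso Λ (resCoind f M) := by
  obtain ⟨α, β, γ, δ, h₁, h₂, h₃, h₄⟩ := exists_contraction f hf
  rw [quasiIso_iff_exists]
  intro h i j l e₀ e₁ e₂ (φ : CoindX Γ M j) (ψ : CoindX Λ M i) hφ hψ
  have hφ' : ∀ (p p' q q' : ℤ) (hq : p + j = q) (hp : p + 1 = p') (hq' : q + 1 = q') (y : Γ.X p),
      M.d q q' hq' (φ.app p q hq y) =
        j.negOnePow • φ.app p' q' (by omega) (Γ.d p p' hp y) := by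
    intro p p' q q' hq hp hq' y
    exact sub_eq_zero.1 ((coindD_app Γ M j l e₂ φ p q' p' q (by omega) hp hq y).symm.trans
      (congrArg (fun φ : CoindX Γ M l => φ.app p q' (by omega) y) hφ))
  have hψ' : ∀ (p p' q q' : ℤ) (hq : p + i = q) (hp : p + 1 = p') (hq' : q + 1 = q') (x : Λ.X p),
      φ.app p q' (by omega) (f.f p x) + (M.d q q' hq' (ψ.app p q hq x) -
        i.negOnePow • ψ.app p' q' (by omega) (Λ.d p p' hp x)) = 0 := by
    intro p p' q q' hq hp hq' x
    exact (congrArg (φ.app p q' (by omega) (f.f p x) + ·)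
      (coindD_app Λ M i j e₁ ψ p q' p' q (by omega) hp hq x)).symm.trans
      (congrArg (fun φ : CoindX Λ M j => φ.app p q' (by omega) x) hψ)
  have hji : j.negOnePow = -i.negOnePow := by rw [← e₁, Int.negOnePow_succ]
  have hhi : h.negOnePow = -i.negOnePow := by rw [← e₀, Int.negOnePow_succ, neg_neg]
  obtain ⟨a, ha⟩ : ∃ a : CoindX Γ M i, ∀ (p p' q : ℤ) (hq : p + i = q) (hp : p' + 1 = p)
      (y : Γ.X p), a.app p q hq y =
        ψ.app p q hq (γ p y) + i.negOnePow • φ.app p' q (by omega) (δ p p' hp y) := by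
    refine ⟨fun p => ψ.app p.1.1 p.1.2 p.2 ∘ₗ γ p.1.1 + i.negOnePow •
      φ.app (p.1.1 - 1) p.1.2 (by have := p.2; omega) ∘ₗ δ p.1.1 (p.1.1 - 1) (by omega), ?_⟩
    intro p p' q hq hp y
    obtain rfl : p' = p - 1 := by omega
    rfl
  obtain ⟨b, hb⟩ : ∃ b : CoindX Λ M h, ∀ (p p' p'' q : ℤ) (hq : p + h = q) (hp : p' + 1 = p)
      (hp' : p'' + 1 = p') (x : Λ.X p), b.app p q hq x =
        -(i.negOnePow • ψ.app p' q (by omega) (α p p' hp x)) -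
          φ.app p'' q (by omega) (β p p' p'' hp hp' x) := by
    refine ⟨fun p => -(i.negOnePow • ψ.app (p.1.1 - 1) p.1.2 (by have := p.2; omega) ∘ₗ
      α p.1.1 (p.1.1 - 1) (by omega)) - φ.app (p.1.1 - 2) p.1.2 (by have := p.2; omega) ∘ₗ
        β p.1.1 (p.1.1 - 1) (p.1.1 - 2) (by omega) (by omega), ?_⟩
    intro p p' p'' q hq hp hp' x
    obtain rfl : p' = p - 1 := by omega
    obtain rfl : p'' = p - 2 := by omega
    rfl
  refine ⟨a, b, ?_, ?_⟩
  · apply CoindX.ext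
    intro p q hq y
    have key : -(M.d (p + i) q (by omega) (a.app p (p + i) rfl y) -
        i.negOnePow • a.app (p + 1) q (by omega) (Γ.d p (p + 1) rfl y)) = φ.app p q hq y := by
      have e := congrArg (φ.app p q hq) (h₂ (p - 1) p (p + 1) (by omega) rfl y)
      have e' := eq_neg_of_add_eq_zero_right
        (hψ' p (p + 1) (p + i) q rfl rfl (by omega) (γ p y))
      rw [ha p (p - 1) (p + i) rfl (by omega), ha (p + 1) p q (by omega) rfl, map_add, map_zsmul_unit,
        hφ' (p - 1) p (p + i) q (by omega) (by omega) (by omega), ← h₁, eq_add_of_sub_eq e', hji, ← e,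
        map_add, map_add, smul_add, units_smul_smul_self, Units.neg_smul, smul_neg,
        units_smul_smul_self]
      abel
    exact (congrArg Neg.neg (coindD_app Γ M i j e₁ a p q (p + 1) (p + i) hq rfl rfl y)).trans key
  · apply CoindX.ext
    intro p q hq x
    have key : a.app p q hq (f.f p x) + (M.d (p + h) q (by omega) (b.app p (p + h) rfl x) -
        h.negOnePow • b.app (p + 1) q (by omega) (Λ.d p (p + 1) rfl x)) = ψ.app p q hq x := by
      have e := congrArg (ψ.app p q hq) (h₃ (p - 1) p (p + 1) (by omega) rfl x)
      have e' := eq_neg_of_add_eq_zero_right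
        (hψ' (p - 1) p (p + h) q (by omega) (by omega) (by omega) (α p (p - 1) (by omega) x))
      have e'' := congrArg (φ.app (p - 1) q (by omega))
        (h₄ (p - 2) (p - 1) p (p + 1) (by omega) (by omega) rfl x)
      rw [map_add, map_add] at e e''
      rw [ha p (p - 1) q hq (by omega), hb p (p - 1) (p - 2) (p + h) rfl (by omega) (by omega),
        hb (p + 1) p (p - 1) q (by omega) rfl (by omega), map_sub, map_neg, map_zsmul_unit,
        hφ' (p - 2) (p - 1) (p + h) q (by omega) (by omega) (by omega), eq_add_of_sub_eq e', e, ← e'',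
        hji, hhi]
      simp only [smul_add, smul_sub, smul_neg, Units.neg_smul, units_smul_smul_self]
      abel
    exact (congrArg (a.app p q hq (f.f p x) + ·)
      (coindD_app Λ M h i e₀ b p q (p + 1) (p + h) hq rfl rfl x)).trans key

end Coinduction


theorem ChainMap.isQuasiIso_of_homotopy {V W : DGVect k} (φ : ChainMap V W) (ρ : ChainMap W V)
    (h₁ : ∀ i x, ρ.f i (φ.f i x) = x)
    (h₂ : ∀ i y, W.IsCocycle i y → W.IsBoundary i (y - φ.f i (ρ.f i y))) : φ.IsQuasiIso := by
  intro i
  refine ⟨?_, fun y hy => ⟨ρ.f i y, ?_, ?_⟩⟩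
  · rintro x hx ⟨j, h, w, hw⟩
    exact ⟨j, h, ρ.f j w, by rw [← ρ.comm, hw, h₁]⟩
  · exact (ρ.comm i (i + 1) rfl y).symm.trans ((congrArg (ρ.f (i + 1)) hy).trans (map_zero _))
  · obtain ⟨j, h, w, hw⟩ := h₂ i y hy
    exact ⟨j, h, -w, by rw [map_neg, hw, neg_sub]⟩

theorem DGA.d_one (Λ : DGA k) (i : ℤ) (h : 0 + 1 = i) : Λ.d 0 i h Λ.one = 0 := by
  have e := Λ.d_mul 0 0 0 i i i (zero_add 0) h h h Λ.one Λ.one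
  rw [Λ.one_mul, Λ.mul_one, Int.negOnePow_zero, one_smul] at e
  obtain rfl : i = 1 := by omega
  rw [Λ.one_mul] at e
  exact left_eq_add.1 e

section Desc

variable {Λ Γ Ω : DGA k}

theorem id_exact : Exact (𝟭 (DGMod Λ)) := fun _ _ _ h => h

/-- `desc` of the identity. -/
noncomputable def descId : desc (𝟭 (DGMod Λ)) id_exact ≅ 𝟭 (D Λ) :=
  natIsoExtension (descIso (𝟭 (DGMod Λ)) id_exact)

/-- `desc` of a composition. -/
noncomputable def descComp {G : DGMod Λ ⥤ DGMod Γ} {G' : DGMod Γ ⥤ DGMod Ω} (hG : Exact G)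
    (hG' : Exact G') : desc (G ⋙ G') (hG.comp hG') ≅ desc G hG ⋙ desc G' hG' :=
  natIsoExtension (NatIso.ofComponents (fun _ => Iso.refl _) (fun {M N} φ => by
    refine (Category.comp_id _).trans (Eq.trans ?_ (Category.id_comp _).symm)
    refine (desc_map (G ⋙ G') (hG.comp hG') φ).trans (Eq.symm ?_)
    exact (congrArg (desc G' hG').map (desc_map G hG φ)).trans (desc_map G' hG' _)))

end Desc

section ConeMap

variable {Λ : DGA k} {M N M' N' : DGMod Λ} {φ : M ⟶ N} {φ' : M' ⟶ N'}

/-- The functoriality of mapping cones. -/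
def coneMap (a : M ⟶ M') (b : N ⟶ N') (h : φ ≫ b = a ≫ φ') : cone φ ⟶ cone φ' where
  f i := LinearMap.prodMap (a.f (i + 1)) (b.f i)
  comm i j hij x := by
    subst hij
    refine Prod.ext ?_ ?_
    · exact (map_neg (a.f (i + 1 + 1)) _).trans (congrArg Neg.neg (a.comm _ _ rfl x.1))
    · refine (map_add (b.f (i + 1)) _ _).trans (congrArg₂ (· + ·) ?_ (b.comm _ _ rfl x.2))
      exact congrArg (fun ψ : M ⟶ N' => ψ.f (i + 1) x.1) h
  map_act i j l hij x c := Prod.ext (a.map_act _ _ _ _ x.1 c) (b.map_act _ _ _ _ x.2 c)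

theorem quasiIso_coneMap (a : M ⟶ M') (b : N ⟶ N') (h : φ ≫ b = a ≫ φ') (ha : quasiIso Λ a)
    (hb : quasiIso Λ b) : quasiIso Λ (coneMap a b h) := by
  have hφ : ∀ i x, b.f i (φ.f i x) = φ'.f i (a.f i x) :=
    fun i x => congrArg (fun ψ : M ⟶ N' => ψ.f i x) h
  rw [quasiIso_iff_exists] at ha hb ⊢
  rintro g i j l rfl rfl rfl ⟨m, n⟩ ⟨p, q⟩ hu hv
  have h₁ : M.d (g + 1 + 1 + 1) (g + 1 + 1 + 1 + 1) rfl m = 0 := neg_eq_zero.1 (congrArg Prod.fst hu)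
  have h₂ : φ.f (g + 1 + 1 + 1) m + N.d (g + 1 + 1) (g + 1 + 1 + 1) rfl n = 0 := congrArg Prod.snd hu
  have h₃ : a.f (g + 1 + 1 + 1) m + -M'.d (g + 1 + 1) (g + 1 + 1 + 1) rfl p = 0 :=
    congrArg Prod.fst hv
  have h₄ : b.f (g + 1 + 1) n + (φ'.f (g + 1 + 1) p + N'.d (g + 1) (g + 1 + 1) rfl q) = 0 :=
    congrArg Prod.snd hv
  obtain ⟨m₁, p₁, hm, hp⟩ := ha (g + 1) (g + 1 + 1) (g + 1 + 1 + 1) _ rfl rfl rfl m (-p) h₁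
    (by rw [map_neg]; exact h₃)
  obtain ⟨n₂, q₂, hn, hq⟩ := hb g (g + 1) (g + 1 + 1) _ rfl rfl rfl (n - φ.f _ m₁)
    (q - φ'.f _ p₁)
    (by
      rw [map_sub, ← φ.comm, neg_eq_iff_eq_neg.1 hm, map_neg, sub_neg_eq_add]
      exact (add_comm _ _).trans h₂)
    (by
      rw [map_sub, map_sub, hφ, ← φ'.comm, eq_sub_of_add_eq hp, map_sub, map_neg, ← h₄]
      abel)
  refine ⟨(-m₁, n₂), (p₁, q₂), Prod.ext ?_ ?_, Prod.ext ?_ ?_⟩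
  · have key : -(-M.d (g + 1 + 1) (g + 1 + 1 + 1) rfl (-m₁)) = m := by rw [neg_neg, map_neg, hm]
    exact key
  · have key : -(φ.f (g + 1 + 1) (-m₁) + N.d (g + 1) (g + 1 + 1) rfl n₂) = n := by
      rw [map_neg, neg_add, neg_neg, hn, add_sub_cancel]
    exact key
  · have key : a.f (g + 1 + 1) (-m₁) + -M'.d (g + 1) (g + 1 + 1) rfl p₁ = p := by
      rw [map_neg, ← neg_add, hp, neg_neg]
    exact key
  · have key : b.f (g + 1) n₂ + (φ'.f (g + 1) p₁ + N'.d g (g + 1) rfl q₂) = q := by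
      rw [← add_assoc, add_right_comm, hq, sub_add_cancel]
    exact key

theorem coneIn_coneMap (a : M ⟶ M') (b : N ⟶ N') (h : φ ≫ b = a ≫ φ') :
    coneIn φ ≫ coneMap a b h = b ≫ coneIn φ' := by
  ext i x
  exact Prod.ext (map_zero (a.f (i + 1))) rfl

theorem coneMap_coneOut (a : M ⟶ M') (b : N ⟶ N') (h : φ ≫ b = a ≫ φ') :
    coneMap a b h ≫ coneOut φ' = coneOut φ ≫ (shiftFunctor Λ).map a := rfl

end ConeMap

section TotIn

variable {Γ : DGA k} {C : ℕ → DGMod Γ} {c : ∀ n, C n ⟶ C (n + 1)}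
  (hc : ∀ n, c n ≫ c (n + 1) = 0) {M : DGMod Γ} (θ : M ⟶ C 0)

/-- The components of `totIn`. -/
def totInApp {j : ℤ} (x : M.X j) : ∀ (n : ℕ) (i : ℤ), i + n = j → (C n).X i
  | 0, i, h => (C 0).cast (by simpa using h.symm) (θ.f j x)
  | _ + 1, _, _ => 0

/-- The morphism to the total complex given by an augmentation. -/
def totIn (hθ : θ ≫ c 0 = 0) : M ⟶ tot hc where
  f j :=
    { toFun := fun x p => totInApp θ x p.1.1 p.1.2 p.2
      map_add' := fun x y => by
        apply TotX.ext
        rintro (_ | n) i h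
        · obtain rfl : i = j := by simpa using h
          exact map_add (θ.f i) x y
        · exact (add_zero _).symm
      map_smul' := fun r x => by
        apply TotX.ext
        rintro (_ | n) i h
        · obtain rfl : i = j := by simpa using h
          exact map_smul (θ.f i) r x
        · exact (smul_zero r : r • (0 : (C (n + 1)).X i) = 0).symm }
  comm j j' hj x := by
    apply TotX.ext
    rintro (_ | n) i h
    · obtain rfl : i = j' := by simpa using h
      refine Eq.trans ?_ (totD_app_zero c j i hj _ j i h hj).symm
      exact θ.comm j i hj x
    · refine Eq.trans ?_ (totD_app C c j j' hj _ (n + 1) (i - 1) i h (by lia)).symm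
      refine Eq.symm ((congrArg₂ (· + ·) ((congrArg _ (map_zero _)).trans (smul_zero _))
        (?_ : _ = (0 : (C (n + 1)).X i))).trans (add_zero _))
      cases n with
      | zero =>
        obtain rfl : i = j := by simp at h; lia
        exact congrArg (fun ψ : M ⟶ C 1 => ψ.f i x) hθ
      | succ n => exact map_zero _
  map_act j l j' hj x a := by
    apply TotX.ext
    rintro (_ | n) i h
    · obtain rfl : i = j' := by simpa using h
      refine Eq.trans ?_ (totAct_app C j l i hj _ a 0 j i h hj).symm
      exact θ.map_act j l i hj x a
    · refine Eq.trans ?_ (totAct_app C j l j' hj _ a (n + 1) (i - l) i h (by lia)).symm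
      exact (((C (n + 1)).act _ _ _ _).map_zero₂ a).symm

end TotIn

section ResTot

variable {Λ Γ : DGA k} (f : Λ ⟶ Γ) {C : ℕ → DGMod Γ} {c : ∀ n, C n ⟶ C (n + 1)}

theorem res_comp_eq_zero (hc : ∀ n, c n ≫ c (n + 1) = 0) (n : ℕ) : (res f).map (c n) ≫ (res f).map (c (n + 1)) = 0 :=
  congrArg (res f).map (hc n)

variable (hc : ∀ n, c n ≫ c (n + 1) = 0)

/-- Restriction of scalars commutes with total complexes. -/
def resTot : (res f).obj (tot hc) ⟶
    tot (C := fun n => (res f).obj (C n)) (c := fun n => (res f).map (c n))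
      (res_comp_eq_zero f hc) where
  f j := LinearMap.id
  comm j j' hj x := by
    apply TotX.ext
    intro n i h
    refine (totD_app C c j j' hj x n (i - 1) i h (by lia)).trans ?_
    refine Eq.trans ?_ (totD_app (fun n => (res f).obj (C n)) (fun n => (res f).map (c n)) j j' hj x
      n (i - 1) i h (by lia)).symm
    cases n <;> rfl
  map_act j l j' hj x a := rfl

theorem quasiIso_resTot : quasiIso Λ (resTot f hc) :=
  ChainMap.isQuasiIso_of_bijective _ fun _ => Function.bijective_id

end ResTot

section Coind

variable {Λ Γ : DGA k} (f : Λ ⟶ Γ)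

/-- The cobar model of derived coinduction along `f`. -/
def coind : DGMod Λ ⥤ DGMod Γ where
  obj M := tot (relD_comp f M)
  map ψ := totMap _ _ (fun n => relHom Γ (cobarMap ψ n)) (relD_naturality f ψ)
  map_id M := by
    ext j x
    apply TotX.ext
    intro n i h
    refine congrArg (fun ψ : cobar M n ⟶ cobar M n => (relHom Γ ψ).f i (TotX.app x n i h))
      (cobarMap_id M n)
  map_comp ψ ψ' := by
    ext j x
    apply TotX.ext
    intro n i h
    exact congrArg (fun χ => (relHom Γ χ).f i (TotX.app x n i h)) (cobarMap_comp ψ ψ' n)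

theorem resCoind_relD (M : DGMod Λ) (n : ℕ) :
    (resCoind f (cobar M n).toDGVect ≫ relD (𝟙 Λ) M n :
      (res f).obj (rel Γ M n) ⟶ rel Λ M (n + 1)) =
    (res f).map (relD f M n) ≫ resCoind f (cobar M (n + 1)).toDGVect := by
  ext i φ
  apply CoindX.ext
  intro p q h x
  refine (congrArg (fun z : CoindX Λ _ i => z.app p q h x) (sub_f_apply
    (relComul (𝟙 Λ) M n) (relHom Λ (cobarD M n)) i _)).trans ?_
  refine Eq.trans ?_ (congrArg (fun z : CoindX Γ _ i => z.app p q h (f.f p x)) (sub_f_apply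
    (relComul f M n) (relHom Γ (cobarD M n)) i φ)).symm
  refine congrArg (· - (cobarD M n).f q (CoindX.app (φ : CoindX Γ _ i) p q h (f.f p x))) ?_
  apply CoindX.ext
  intro p' q' h' x'
  exact congrArg (CoindX.app (φ : CoindX Γ _ i) (p + p') q' (by lia))
    (f.map_mul p p' (p + p') rfl x x')

/-- Comparison of `coind f` and `coind (𝟙 Λ)`. -/
def coindRes : coind f ⋙ res f ⟶ coind (𝟙 Λ) where
  app M := resTot f (relD_comp f M) ≫
    totMap (res_comp_eq_zero f (relD_comp f M)) (relD_comp (𝟙 Λ) M)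
      (fun n => resCoind f (cobar M n).toDGVect) (resCoind_relD f M)

theorem quasiIso_coindRes (hf : f.toChainMap.IsQuasiIso) (M : DGMod Λ) :
    quasiIso Λ ((coindRes f).app M) :=
  (quasiIso Λ).comp_mem _ _ (quasiIso_resTot f (relD_comp f M))
    (quasiIso_totMap (res_comp_eq_zero f (relD_comp f M)) (relD_comp (𝟙 Λ) M) _
      (resCoind_relD f M) fun _ => quasiIso_resCoind f hf _)

theorem coindUnit_relD (N : DGMod Γ) :
    (coindUnit N ≫ relD f ((res f).obj N) 0 : N ⟶ rel Γ ((res f).obj N) 1) = 0 := by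
  refine (Preadditive.comp_sub _ _ _).trans (sub_eq_zero.2 ?_)
  ext i x
  apply CoindX.ext
  intro p q h y
  apply CoindX.ext
  intro p' q' h' y'
  exact (N.act_act i p p' q (p + p') q' (by omega) rfl (by omega) (by omega) x y (f.f p' y')).symm

/-- The unit `N ⟶ coind f (res f N)`. -/
def coindAug : 𝟭 _ ⟶ res f ⋙ coind f where
  app N := totIn (relD_comp f ((res f).obj N)) (coindUnit N) (coindUnit_relD f N)
  naturality N N' ψ := by
    ext j x
    apply TotX.ext
    rintro (_ | n) i h
    · obtain rfl : i = j := by simpa using h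
      exact congrArg (fun χ : N ⟶ coindObj Γ N'.toDGVect => χ.f i x) (coindUnit_naturality ψ)
    · exact (map_zero ((relHom Γ (cobarMap ((res f).map ψ) (n + 1))).f i)).symm

end Coind

section CoindId

variable {Λ : DGA k} (M : DGMod Λ)

theorem relD_id (n : ℕ) : relD (𝟙 Λ) M n = cobarD M (n + 1) := by
  rw [cobarD_succ]
  rfl

/-- Evaluation at `1`. -/
def evalOne (V : DGVect k) : ChainMap (coindObj Λ V).toDGVect V where
  f i :=
    { toFun := fun φ => CoindX.app (φ : CoindX Λ V i) 0 i (zero_add i) Λ.one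
      map_add' := fun _ _ => rfl
      map_smul' := fun _ _ => rfl }
  comm i j h φ := by
    refine (coindD_app Λ V i j h φ 0 j 1 i (zero_add j) (zero_add 1) (zero_add i) Λ.one).trans ?_
    rw [Λ.d_one, map_zero, smul_zero, sub_zero]
    rfl

/-- Evaluation at `1` on the cobar complex. -/
def evalCobar (n : ℕ) : ChainMap (cobar M (n + 1)).toDGVect (cobar M n).toDGVect :=
  evalOne (cobar M n).toDGVect

theorem evalCobar_relD (n : ℕ) (i : ℤ) (x : (cobar M (n + 1)).X i) :
    (evalCobar M (n + 1)).f i ((relD (𝟙 Λ) M n).f i x) =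
      x - (cobarD M n).f i ((evalCobar M n).f i x) := by
  refine (congrArg ((evalCobar M (n + 1)).f i) (sub_f_apply _ _ i x)).trans ?_
  refine (map_sub ((evalCobar M (n + 1)).f i) _ _).trans ?_
  refine congrArg (· - (cobarD M n).f i ((evalCobar M n).f i x)) ?_
  apply CoindX.ext
  intro p q h y
  have key := CoindX.app_mul_congr (x : CoindX Λ _ i) 0 p q (0 + p) p rfl (zero_add p) (by omega) h
    Λ.one y
  rw [Λ.one_mul] at key
  exact key

theorem coindUnit_cobarD : (coindUnit M ≫ relD (𝟙 Λ) M 0 : M ⟶ rel Λ M 1) = 0 := by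
  rw [relD_id]
  exact cobarD_comp M 0

/-- The unit `M ⟶ coind (𝟙 Λ) M`. -/
def coindAugId : 𝟭 _ ⟶ coind (𝟙 Λ) where
  app M := totIn (relD_comp (𝟙 Λ) M) (coindUnit M) (coindUnit_cobarD M)
  naturality N N' ψ := by
    ext j x
    apply TotX.ext
    rintro (_ | n) i h
    · obtain rfl : i = j := by simpa using h
      exact congrArg (fun χ : N ⟶ coindObj Λ N'.toDGVect => χ.f i x) (coindUnit_naturality ψ)
    · exact (map_zero ((relHom Λ (cobarMap ψ (n + 1))).f i)).symm

theorem quasiIso_coindAugId : quasiIso Λ (coindAugId.app M) := by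
  refine ChainMap.isQuasiIso_of_homotopy _
    { f := fun j =>
        { toFun := fun x => (evalOne M.toDGVect).f j (TotX.app x 0 j (by simp))
          map_add' := fun x y => map_add ((evalOne M.toDGVect).f j) _ _
          map_smul' := fun r x => map_smul ((evalOne M.toDGVect).f j) _ _ }
      comm := fun i j h x => ?_ } ?_ ?_
  · refine (congrArg ((evalOne M.toDGVect).f j)
      (totD_app_zero (relD (𝟙 Λ) M) i j h x i j (by simp) h)).trans ?_
    exact (evalOne M.toDGVect).comm i j h _
  · intro i x
    exact M.act_one i x
  · intro j x hx
    let X : ∀ (n : ℕ) (i : ℤ), i + n = j → (cobar M (n + 1)).X i := fun n i h => TotX.app x n i h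
    have key : ∀ (n : ℕ) (i' i : ℤ) (h : i + n = j) (hi : i' + 1 = i),
        (n : ℤ).negOnePow • (cobar M (n + 1)).d i' i hi
          ((evalCobar M (n + 1)).f i' (X (n + 1) i' (by lia))) +
        (cobarD M n).f i ((evalCobar M n).f i (X n i h)) =
          X n i h := by
      intro n i' i h hi
      have e := (totD_app (rel Λ M) (relD (𝟙 Λ) M) j (j + 1) rfl x (n + 1) i' i (by lia)
        hi).symm.trans (congrArg (fun z : TotX (rel Λ M) (j + 1) => z.app (n + 1) i (by lia)) hx)
      have e₂ := congrArg ((evalCobar M (n + 1)).f i) e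
      have e₃ : -((n : ℤ).negOnePow • (cobar M (n + 1)).d i' i hi
          ((evalCobar M (n + 1)).f i' (X (n + 1) i' (by lia)))) +
          (X n i h -
            (cobarD M n).f i ((evalCobar M n).f i (X n i h))) = 0 := by
        rw [← evalCobar_relD, ← ChainMap.comm, ← Units.neg_smul, ← Int.negOnePow_succ,
          ← Nat.cast_succ, ← map_zsmul_unit]
        exact (map_add _ _ _).symm.trans (e₂.trans (map_zero _))
      rw [neg_add_eq_zero.1 e₃, sub_add_cancel]
    refine ⟨j - 1, by lia, (fun p => (evalCobar M (p.1.1 + 1)).f p.1.2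
      (TotX.app x (p.1.1 + 1) p.1.2 (by have := p.2; lia)) : TotX (rel Λ M) (j - 1)), ?_⟩
    apply TotX.ext
    rintro (_ | n) i h
    · obtain rfl : i = j := by simpa using h
      refine (totD_app_zero (relD (𝟙 Λ) M) (i - 1) i (by lia) _ (i - 1) i h (by lia)).trans ?_
      refine eq_sub_of_add_eq ?_
      have e := key 0 (i - 1) i h (by lia)
      rw [Nat.cast_zero, Int.negOnePow_zero, one_smul] at e
      exact e
    · refine (totD_app (rel Λ M) (relD (𝟙 Λ) M) (j - 1) j (by lia) _ (n + 1) (i - 1) i h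
        (by lia)).trans ?_
      refine Eq.trans ?_ (sub_zero (X (n + 1) i h)).symm
      refine Eq.trans ?_ (key (n + 1) (i - 1) i h (by lia))
      rw [← relD_id]
      rfl

end CoindId

section Equivalence

variable {Λ Γ : DGA k} (f : Λ ⟶ Γ)

theorem coindAug_comp_coindRes (N : DGMod Γ) :
    (res f).map ((coindAug f).app N) ≫ (coindRes f).app ((res f).obj N) =
      coindAugId.app ((res f).obj N) := by
  ext j x
  apply TotX.ext
  rintro (_ | n) i h
  · obtain rfl : i = j := by simpa using h
    rfl
  · exact map_zero ((resCoind f (cobar ((res f).obj N) (n + 1)).toDGVect).f i)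

theorem quasiIso_coindAug (hf : f.toChainMap.IsQuasiIso) (N : DGMod Γ) :
    quasiIso Γ ((coindAug f).app N) := by
  have h : quasiIso Λ ((res f).map ((coindAug f).app N)) := by
    refine MorphismProperty.of_postcomp _ _ ((coindRes f).app ((res f).obj N))
      (quasiIso_coindRes f hf _) ?_
    rw [coindAug_comp_coindRes]
    exact quasiIso_coindAugId _
  exact h

theorem coind_id_exact : Exact (coind (𝟙 Λ)) :=
  Exact.of_natTrans coindAugId quasiIso_coindAugId (fun _ _ _ h => h)

theorem coind_exact (hf : f.toChainMap.IsQuasiIso) : Exact (coind f) := by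
  have h : Exact (coind f ⋙ res f) :=
    Exact.of_natTrans' (coindRes f) (quasiIso_coindRes f hf) coind_id_exact
  exact h

/-- Restriction of scalars along a quasi-isomorphism is an equivalence of derived categories. -/
noncomputable def resEquiv (hf : f.toChainMap.IsQuasiIso) : D Γ ≌ D Λ :=
  CategoryTheory.Equivalence.mk (desc (res f) (res_exact f)) (desc (coind f) (coind_exact f hf))
    (descId.symm ≪≫ descMapIso id_exact ((res_exact f).comp (coind_exact f hf)) (coindAug f)
      (quasiIso_coindAug f hf) ≪≫ descComp _ _)
    ((descComp (coind_exact f hf) (res_exact f)).symm ≪≫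
      descMapIso ((coind_exact f hf).comp (res_exact f)) coind_id_exact (coindRes f)
        (quasiIso_coindRes f hf) ≪≫
      (descMapIso id_exact coind_id_exact coindAugId quasiIso_coindAugId).symm ≪≫ descId)

theorem map_comp_inv_comm {C E : Type*} [Category* C] [Category* E] (L : C ⥤ E)
    {X X' T T' Y Y' : C} {p : X ⟶ X'} {r : X ⟶ T} {r' : X' ⟶ T'} {q : T ⟶ T'} {i : Y ⟶ T}
    {i' : Y' ⟶ T'} {φ : Y ⟶ Y'} [IsIso (L.map i)] [IsIso (L.map i')] (h : p ≫ r' = r ≫ q)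
    (h' : φ ≫ i' = i ≫ q) :
    L.map p ≫ L.map r' ≫ inv (L.map i') = (L.map r ≫ inv (L.map i)) ≫ L.map φ := by
  rw [← L.map_comp_assoc, h, L.map_comp, Category.assoc, Category.assoc]
  congr 1
  rw [IsIso.comp_inv_eq, Category.assoc, ← L.map_comp, h', L.map_comp, IsIso.inv_hom_id_assoc]

theorem shiftD_map_comp_inv {X Y T : DGMod Λ} (r : X ⟶ T) (i : Y ⟶ T) [IsIso ((toD Λ).map i)]
    [IsIso ((toD Λ).map ((shiftFunctor Λ).map i))] :
    (shiftD Λ).map ((toD Λ).map r ≫ inv ((toD Λ).map i)) =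
      (toD Λ).map ((shiftFunctor Λ).map r) ≫ inv ((toD Λ).map ((shiftFunctor Λ).map i)) := by
  refine (IsIso.eq_comp_inv ((toD Λ).map ((shiftFunctor Λ).map i))).2 ?_
  refine (congrArg (_ ≫ ·) (shiftD_map i).symm).trans ?_
  refine ((shiftD Λ).map_comp _ _).symm.trans ?_
  exact (congrArg (shiftD Λ).map (by simp)).trans (shiftD_map r)

theorem isTriangulated_resEquiv_inverse (hf : f.toChainMap.IsQuasiIso) :
    IsTriangulated (resEquiv f hf).inverse := by
  refine isTriangulated_inverse _ ((resConeData f).shiftDescIso (res_exact f)) fun M N φ => ?_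
  have i₁ := fun M => isIso_toD_map (quasiIso_coindRes f hf M)
  have i₂ : ∀ M : DGMod Λ, IsIso ((toD Λ).map (coindAugId.app M)) :=
    fun M => isIso_toD_map (quasiIso_coindAugId M)
  let c₁ : cone ((res f).map ((coind f).map φ)) ⟶ cone ((coind (𝟙 Λ)).map φ) :=
    coneMap ((coindRes f).app M) ((coindRes f).app N) ((coindRes f).naturality φ)
  let c₂ : cone φ ⟶ cone ((coind (𝟙 Λ)).map φ) :=
    coneMap (coindAugId.app M) (coindAugId.app N) (coindAugId.naturality φ)
  have i₃ : IsIso ((toD Λ).map c₁) := isIso_toD_map (quasiIso_coneMap _ _ _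
    (quasiIso_coindRes f hf M) (quasiIso_coindRes f hf N))
  have i₄ : IsIso ((toD Λ).map c₂) := isIso_toD_map (quasiIso_coneMap _ _ _
    (quasiIso_coindAugId M) (quasiIso_coindAugId N))
  have i₅ : IsIso ((toD Λ).map ((shiftFunctor Λ).map (coindAugId.app M))) := by
    rw [← shiftD_map]
    exact @Functor.map_isIso _ _ _ _ _ _ (shiftD Λ) _ (i₂ M)
  let a : ∀ M, (toD Λ).obj ((res f).obj ((coind f).obj M)) ≅ (toD Λ).obj M :=
    fun M => asIso ((toD Λ).map ((coindRes f).app M)) ≪≫ (asIso ((toD Λ).map (coindAugId.app M))).symm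
  let c : (toD Λ).obj ((res f).obj (cone ((coind f).map φ))) ≅ (toD Λ).obj (cone φ) :=
    (toD Λ).mapIso ((resConeData f).coneIso ((coind f).map φ)) ≪≫ asIso ((toD Λ).map c₁) ≪≫
      (asIso ((toD Λ).map c₂)).symm
  have hc : c.hom = (toD Λ).map (((resConeData f).coneIso ((coind f).map φ)).hom ≫ c₁) ≫
      inv ((toD Λ).map c₂) := by
    simp [c]
  have e₁ := desc_map (res f) (res_exact f) ((coind f).map φ)
  have e₂ := desc_map (res f) (res_exact f) (coneIn ((coind f).map φ))
  have e₃ := desc_map (res f) (res_exact f) (coneOut ((coind f).map φ))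
  refine ⟨(toD Γ).obj ((coind f).obj M), (toD Γ).obj ((coind f).obj N),
    (toD Γ).obj (cone ((coind f).map φ)), _, _, _, a M, a N, c, distinguished_cone ((coind f).map φ), ?_, ?_, ?_⟩
  · refine (congrArg (· ≫ (a N).hom) e₁).trans ?_
    exact map_comp_inv_comm (toD Λ) ((coindRes f).naturality φ) (coindAugId.naturality φ)
  · refine (congrArg (· ≫ c.hom) e₂).trans ?_
    rw [hc]
    refine map_comp_inv_comm (toD Λ) (q := coneIn ((coind (𝟙 Λ)).map φ)) ?_
      (coneIn_coneMap _ _ _)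
    rw [reassoc_of% (resConeData f).coneIn_comp]
    exact coneIn_coneMap _ _ _
  · have h₁ : (desc (res f) (res_exact f)).map ((toD Γ).map (coneOut ((coind f).map φ)) ≫
        (shiftDIso Γ).inv.app ((coind f).obj M)) =
        (toD Λ).map ((res f).map (coneOut ((coind f).map φ))) := by
      rw [shiftDIso_inv_app]
      exact (congrArg _ (Category.comp_id _)).trans e₃
    have h₂ : (shiftD Λ).map (a M).hom =
        (toD Λ).map ((shiftFunctor Λ).map ((coindRes f).app M)) ≫
          inv ((toD Λ).map ((shiftFunctor Λ).map (coindAugId.app M))) :=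
      shiftD_map_comp_inv ((coindRes f).app M) (coindAugId.app M)
    have h₃ := (resConeData f).shiftDescIso_hom_app (res_exact f) ((coind f).obj M)
    have h₄ : (toD Λ).map (coneOut φ) ≫ (shiftDIso Λ).inv.app M = (toD Λ).map (coneOut φ) := by
      rw [shiftDIso_inv_app]
      exact Category.comp_id _
    refine (congrArg₂ (· ≫ ·) h₁ (congrArg₂ (· ≫ ·) h₃ h₂)).trans
      (Eq.trans ?_ (congrArg₂ (· ≫ ·) hc h₄).symm)
    refine ((toD Λ).map_comp_assoc _ _ _).symm.trans ?_
    exact map_comp_inv_comm (toD Λ) (q := coneOut ((coind (𝟙 Λ)).map φ)) rfl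
      (coneMap_coneOut _ _ _).symm

end Equivalence


/-! ### The Drinfeld quotient -/

section Tower

variable (k) (A : Type u) [Ring A] [Algebra k A]

/-- A bundled left `A`-module. -/
structure LeftMod where
  X : Type u
  [addCommGroup : AddCommGroup X]
  [module : Module k X]
  [moduleA : Module A X]
  [isScalarTower : IsScalarTower k A X]

attribute [instance] LeftMod.addCommGroup LeftMod.module LeftMod.moduleA LeftMod.isScalarTower

variable {A} (e : A)

/-- The left ideal `Ae`. -/
def idealRight : Submodule A A where
  carrier := {x | x * e = x}
  add_mem' {x y} hx hy := by
    change (x + y) * e = x + y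
    rw [add_mul, hx, hy]
  zero_mem' := zero_mul e
  smul_mem' a x hx := by
    change a * x * e = a * x
    rw [mul_assoc, hx]

section

variable (X : Type u) [AddCommGroup X] [Module k X] [Module A X] [IsScalarTower k A X]

/-- The subspace `eX`. -/
def cornerSub : Submodule k X where
  carrier := {x | e • x = x}
  add_mem' {x y} hx hy := by
    change e • (x + y) = x + y
    rw [smul_add, hx, hy]
  zero_mem' := smul_zero e
  smul_mem' r x hx := by
    change e • r • x = r • x
    rw [smul_comm, hx]

/-- The left module `Ae ⊗ₖ eX`. -/
abbrev Induced : Type u := idealRight e ⊗[k] cornerSub k e X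

variable {e} (he : IsIdempotentElem e)

/-- The map `a ↦ ae`. -/
def mulRightCorner : A →ₗ[k] idealRight e where
  toFun a := ⟨a * e, show a * e * e = a * e by rw [mul_assoc, he]⟩
  map_add' a b := Subtype.ext (add_mul a b e)
  map_smul' r a := Subtype.ext (smul_mul_assoc r a e)

/-- The map `x ↦ ex`. -/
def smulCorner : X →ₗ[k] cornerSub k e X where
  toFun x := ⟨e • x, show e • e • x = e • x by rw [smul_smul, he]⟩
  map_add' x y := Subtype.ext (smul_add e x y)
  map_smul' r x := Subtype.ext (smul_comm e r x)

/-- The element `ae ⊗ ex`. -/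
noncomputable def tau : A →ₗ[k] X →ₗ[k] Induced k e X :=
  (TensorProduct.mk k (idealRight e) (cornerSub k e X)).compl₁₂ (mulRightCorner k he)
    (smulCorner k X he)

theorem smul_tau (a b : A) (x : X) : a • tau k X he b x = tau k X he (a * b) x := by
  refine (TensorProduct.smul_tmul' a _ _).trans ?_
  exact congrArg (· ⊗ₜ[k] smulCorner k X he x) (Subtype.ext (mul_assoc a b e).symm)

theorem tau_mul_corner (a : A) (x : X) : tau k X he (a * e) x = tau k X he a x :=
  congrArg (· ⊗ₜ[k] smulCorner k X he x)
    (Subtype.ext (show a * e * e = a * e by rw [mul_assoc, he]))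

theorem tau_corner_smul (a : A) (x : X) : tau k X he a (e • x) = tau k X he a x :=
  congrArg (mulRightCorner k he a ⊗ₜ[k] ·)
    (Subtype.ext (show e • e • x = e • x by rw [smul_smul, he]))

variable {X}

theorem tau_ext {W : Type*} [AddCommGroup W] [Module k W] {f g : Induced k e X →ₗ[k] W}
    (h : ∀ a x, f (tau k X he a x) = g (tau k X he a x)) : f = g := by
  refine TensorProduct.ext' fun a x => ?_
  have key : tau k X he a.1 x.1 = a ⊗ₜ x :=
    congrArg₂ (fun a x => a ⊗ₜ[k] x) (Subtype.ext a.2) (Subtype.ext x.2)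
  rw [← key]
  exact h _ _

/-- The linear map on `Ae ⊗ₖ eX` given by a bilinear map on `A × X`. -/
noncomputable def tauLift {W : Type*} [AddCommGroup W] [Module k W] (f : A →ₗ[k] X →ₗ[k] W) :
    Induced k e X →ₗ[k] W :=
  TensorProduct.lift (f.compl₁₂ ((idealRight e).subtype.restrictScalars k) (cornerSub k e X).subtype)

theorem tauLift_tau {W : Type*} [AddCommGroup W] [Module k W] (f : A →ₗ[k] X →ₗ[k] W) (a : A)
    (x : X) : tauLift k f (tau k X he a x) = f (a * e) (e • x) :=
  TensorProduct.lift.tmul _ _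

end

/-- The tower `A`, `Ae ⊗ₖ eA`, `Ae ⊗ₖ eAe ⊗ₖ eA`, ... -/
noncomputable def tower : ℕ → LeftMod k A
  | 0 => { X := A }
  | n + 1 => { X := Induced k e (tower n).X }

variable {e} (he : IsIdempotentElem e)

/-- The total space of the Drinfeld quotient. -/
abbrev Drin : Type u := DirectSum ℕ fun n => (tower k e n).X

/-- The inclusion of a component of the tower. -/
noncomputable abbrev drinOf (n : ℕ) : (tower k e n).X →ₗ[k] Drin k (e := e) :=
  DirectSum.lof k ℕ (fun n => (tower k e n).X) n

theorem toModule_drinOf {W : Type*} [AddCommGroup W] [Module k W]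
    (f : ∀ n, (tower k e n).X →ₗ[k] W) (n : ℕ) (x : (tower k e n).X) :
    DirectSum.toModule k ℕ W f (drinOf k n x) = f n x :=
  DirectSum.toModule_lof (M := fun n => (tower k e n).X) (φ := f) k n x

/-- The inclusion `A ⟶ Drin`. -/
noncomputable def drinUnit : A →ₗ[k] Drin k (e := e) := drinOf k 0

/-- The map `(a, x) ↦ ae ⊗ ex` on the tower. -/
noncomputable def towerTau (n : ℕ) : A →ₗ[k] (tower k e n).X →ₗ[k] (tower k e (n + 1)).X :=
  tau k (tower k e n).X he

/-- Left multiplication by an element of `A`. -/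
noncomputable def drinL : A →ₗ[k] Drin k (e := e) →ₗ[k] Drin k (e := e) :=
  (DirectSum.toModule k ℕ _ fun n => (LinearMap.mk₂ k (fun (x : (tower k e n).X) (a : A) => a • x)
    (fun x y a => smul_add a x y) (fun r x a => smul_comm a r x) (fun x a b => add_smul a b x)
    (fun r x a => smul_assoc r a x)).compr₂ (drinOf k n)).flip

/-- The operator `x ↦ ae ⊗ ex`. -/
noncomputable def drinH : A →ₗ[k] Drin k (e := e) →ₗ[k] Drin k (e := e) :=
  (DirectSum.toModule k ℕ _ fun n => (towerTau k he n).flip.compr₂ (drinOf k (n + 1))).flip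

theorem drinL_of (a : A) (n : ℕ) (x : (tower k e n).X) :
    drinL k a (drinOf k n x) = drinOf k n (a • x) := by
  simp [drinL]

theorem drinH_of (a : A) (n : ℕ) (x : (tower k e n).X) :
    drinH k he a (drinOf k n x) = drinOf k (n + 1) (towerTau k he n a x) := by
  simp [drinH]

theorem drinL_unit (a b : A) : drinL k a (drinUnit k (e := e) b) = drinUnit k (a * b) :=
  drinL_of k a 0 b

variable {k}

theorem towerTau_ext {W : Type*} [AddCommGroup W] [Module k W] {n : ℕ}
    {f g : (tower k e (n + 1)).X →ₗ[k] W}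
    (h : ∀ a x, f (towerTau k he n a x) = g (towerTau k he n a x)) : f = g :=
  tau_ext k he h

theorem drin_ext {W : Type*} [AddCommGroup W] [Module k W] {f g : Drin k (e := e) →ₗ[k] W}
    (h₀ : ∀ a, f (drinUnit k a) = g (drinUnit k a))
    (h₁ : ∀ a x, f x = g x → f (drinH k he a x) = g (drinH k he a x)) : f = g := by
  refine DirectSum.linearMap_ext _ fun n => ?_
  induction n with
  | zero => exact LinearMap.ext h₀
  | succ n ih =>
    refine towerTau_ext he fun a x => ?_
    have := h₁ a (drinOf k n x) (LinearMap.congr_fun ih x)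
    rw [drinH_of] at this
    exact this

variable (k)

theorem drinL_one (x : Drin k (e := e)) : drinL k 1 x = x := by
  refine LinearMap.congr_fun (g := LinearMap.id) (DirectSum.linearMap_ext _ fun n => ?_) x
  refine LinearMap.ext fun y => ?_
  exact (drinL_of k 1 n y).trans (congrArg (drinOf k n) (one_smul A y))

theorem drinL_mul (a b : A) (x : Drin k (e := e)) : drinL k a (drinL k b x) = drinL k (a * b) x := by
  refine LinearMap.congr_fun (f := drinL k a ∘ₗ drinL k b) (DirectSum.linearMap_ext _ fun n => ?_) x
  refine LinearMap.ext fun y => ?_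
  refine (congrArg (drinL k a) (drinL_of k b n y)).trans ((drinL_of k a n _).trans ?_)
  exact (congrArg (drinOf k n) (mul_smul a b y).symm).trans (drinL_of k (a * b) n y).symm

theorem drinL_H (a b : A) (x : Drin k (e := e)) :
    drinL k a (drinH k he b x) = drinH k he (a * b) x := by
  refine LinearMap.congr_fun (f := drinL k a ∘ₗ drinH k he b)
    (DirectSum.linearMap_ext _ fun n => ?_) x
  refine LinearMap.ext fun y => ?_
  refine (congrArg (drinL k a) (drinH_of k he b n y)).trans ((drinL_of k a (n + 1) _).trans ?_)
  exact (congrArg (drinOf k (n + 1)) (smul_tau k _ he a b y)).trans (drinH_of k he (a * b) n y).symm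

theorem drinH_mul_corner (a : A) (x : Drin k (e := e)) :
    drinH k he (a * e) x = drinH k he a x := by
  refine LinearMap.congr_fun (DirectSum.linearMap_ext _ fun n => ?_) x
  refine LinearMap.ext fun y => ?_
  refine (drinH_of k he (a * e) n y).trans (Eq.trans ?_ (drinH_of k he a n y).symm)
  exact congrArg (drinOf k (n + 1)) (tau_mul_corner k _ he a y)

theorem drinH_corner (a : A) (x : Drin k (e := e)) :
    drinH k he a (drinL k e x) = drinH k he a x := by
  refine LinearMap.congr_fun (f := drinH k he a ∘ₗ drinL k e)
    (DirectSum.linearMap_ext _ fun n => ?_) x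
  refine LinearMap.ext fun y => ?_
  refine (congrArg (drinH k he a) (drinL_of k e n y)).trans ((drinH_of k he a n _).trans ?_)
  exact (congrArg (drinOf k (n + 1)) (tau_corner_smul k _ he a y)).trans (drinH_of k he a n y).symm

/-- The differential on a component of the tower. -/
noncomputable def towerD : ∀ n, (tower k e n).X →ₗ[k] Drin k (e := e)
  | 0 => 0
  | n + 1 => tauLift k ((drinL k).compl₂ (drinOf k n) - (drinH k he).compl₂ (towerD n))

/-- The differential of the Drinfeld quotient. -/
noncomputable def drinD : Drin k (e := e) →ₗ[k] Drin k (e := e) :=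
  DirectSum.toModule k ℕ _ (towerD k he)

theorem drinD_of (n : ℕ) (x : (tower k e n).X) : drinD k he (drinOf k n x) = towerD k he n x :=
  toModule_drinOf k (towerD k he) n x

theorem drinD_unit (a : A) : drinD k he (drinUnit k a) = 0 := drinD_of k he 0 a

theorem towerD_succ (n : ℕ) (a : A) (x : (tower k e n).X) :
    towerD k he (n + 1) (towerTau k he n a x) =
      drinL k (a * e) (drinOf k n x) - drinH k he a (towerD k he n (e • x)) := by
  refine (tauLift_tau k he _ a x).trans ?_
  change drinL k (a * e) (drinOf k n (e • x)) - drinH k he (a * e) (towerD k he n (e • x)) = _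
  rw [drinH_mul_corner, ← drinL_of, drinL_mul, mul_assoc, he]

theorem drinD_L (a : A) (x : Drin k (e := e)) :
    drinD k he (drinL k a x) = drinL k a (drinD k he x) := by
  refine LinearMap.congr_fun (f := drinD k he ∘ₗ drinL k a) (g := drinL k a ∘ₗ drinD k he)
    (DirectSum.linearMap_ext _ fun n => ?_) x
  cases n with
  | zero =>
    refine LinearMap.ext fun (y : A) => ?_
    change drinD k he (drinL k a (drinUnit k y)) = drinL k a (drinD k he (drinUnit k y))
    rw [drinL_unit, drinD_unit, drinD_unit, map_zero]
  | succ n =>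
    refine towerTau_ext he fun b y => ?_
    change drinD k he (drinL k a (drinOf k (n + 1) _)) = drinL k a (drinD k he (drinOf k (n + 1) _))
    rw [← drinH_of, drinL_H, drinH_of, drinH_of, drinD_of, drinD_of, towerD_succ, towerD_succ,
      map_sub, drinL_mul, drinL_H, mul_assoc]

theorem drinD_H (a : A) (x : Drin k (e := e)) :
    drinD k he (drinH k he a x) = drinL k (a * e) x - drinH k he a (drinD k he x) := by
  refine LinearMap.congr_fun (f := drinD k he ∘ₗ drinH k he a)
    (g := drinL k (a * e) - drinH k he a ∘ₗ drinD k he) (DirectSum.linearMap_ext _ fun n => ?_) x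
  refine LinearMap.ext fun y => ?_
  change drinD k he (drinH k he a (drinOf k n y)) =
    drinL k (a * e) (drinOf k n y) - drinH k he a (drinD k he (drinOf k n y))
  rw [drinH_of, drinD_of, towerD_succ, ← drinD_of, ← drinL_of, drinD_L, drinH_corner]

theorem drinD_D (x : Drin k (e := e)) : drinD k he (drinD k he x) = 0 := by
  refine LinearMap.congr_fun (f := drinD k he ∘ₗ drinD k he) (g := 0) (drin_ext he ?_ ?_) x
  · intro a
    exact (congrArg (drinD k he) (drinD_unit k he a)).trans (map_zero _)
  · intro a x hx
    change drinD k he (drinD k he x) = 0 at hx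
    change drinD k he (drinD k he (drinH k he a x)) = 0
    rw [drinD_H, map_sub, drinD_L, drinD_H, hx, map_zero, sub_zero, sub_self]

/-- The multiplication on a component of the tower. -/
noncomputable def towerMul : ∀ n, (tower k e n).X →ₗ[k] Drin k (e := e) →ₗ[k] Drin k (e := e)
  | 0 => drinL (A := A) (e := e) k
  | n + 1 => tauLift k (LinearMap.mk₂ k (fun a x => drinH k he a ∘ₗ towerMul n x)
      (fun a b x => by rw [map_add, LinearMap.add_comp])
      (fun r a x => by rw [map_smul, LinearMap.smul_comp])
      (fun a x y => by rw [map_add, LinearMap.comp_add])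
      (fun r a x => by rw [map_smul, LinearMap.comp_smul]))

/-- The multiplication of the Drinfeld quotient. -/
noncomputable def drinMul : Drin k (e := e) →ₗ[k] Drin k (e := e) →ₗ[k] Drin k (e := e) :=
  DirectSum.toModule k ℕ _ (towerMul k he)

theorem drinMul_of (n : ℕ) (x : (tower k e n).X) : drinMul k he (drinOf k n x) = towerMul k he n x :=
  toModule_drinOf k (towerMul k he) n x

theorem drinMul_unit (a : A) (y : Drin k (e := e)) : drinMul k he (drinUnit k a) y = drinL k a y :=
  LinearMap.congr_fun (drinMul_of k he 0 a) y

theorem towerMul_succ (n : ℕ) (a : A) (x : (tower k e n).X) (y : Drin k (e := e)) :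
    towerMul k he (n + 1) (towerTau k he n a x) y = drinH k he a (towerMul k he n (e • x) y) :=
  (LinearMap.congr_fun (tauLift_tau k he _ a x) y).trans (drinH_mul_corner k he a _)

theorem drinMul_L (a : A) (x y : Drin k (e := e)) :
    drinMul k he (drinL k a x) y = drinL k a (drinMul k he x y) := by
  refine LinearMap.congr_fun (f := (drinMul k he).flip y ∘ₗ drinL k a)
    (g := drinL k a ∘ₗ (drinMul k he).flip y) (DirectSum.linearMap_ext _ fun n => ?_) x
  cases n with
  | zero =>
    refine LinearMap.ext fun (b : A) => ?_
    change drinMul k he (drinL k a (drinUnit k b)) y = drinL k a (drinMul k he (drinUnit k b) y)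
    rw [drinL_unit, drinMul_unit, drinMul_unit, drinL_mul]
  | succ n =>
    refine towerTau_ext he fun b x => ?_
    change drinMul k he (drinL k a (drinOf k (n + 1) _)) y =
      drinL k a (drinMul k he (drinOf k (n + 1) _) y)
    rw [← drinH_of, drinL_H, drinH_of, drinH_of, drinMul_of, drinMul_of, towerMul_succ,
      towerMul_succ, drinL_H]

theorem drinMul_H (a : A) (x y : Drin k (e := e)) :
    drinMul k he (drinH k he a x) y = drinH k he a (drinMul k he x y) := by
  refine LinearMap.congr_fun (f := (drinMul k he).flip y ∘ₗ drinH k he a)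
    (g := drinH k he a ∘ₗ (drinMul k he).flip y) (DirectSum.linearMap_ext _ fun n => ?_) x
  refine LinearMap.ext fun x => ?_
  change drinMul k he (drinH k he a (drinOf k n x)) y = drinH k he a (drinMul k he (drinOf k n x) y)
  rw [drinH_of, drinMul_of, towerMul_succ, ← drinMul_of, ← drinL_of, drinMul_L, drinH_corner]

theorem drinMul_assoc (x y z : Drin k (e := e)) :
    drinMul k he (drinMul k he x y) z = drinMul k he x (drinMul k he y z) := by
  refine LinearMap.congr_fun (f := (drinMul k he).flip z ∘ₗ (drinMul k he).flip y)
    (g := (drinMul k he).flip (drinMul k he y z)) (drin_ext he (fun a => ?_) fun a x hx => ?_) x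
  · change drinMul k he (drinMul k he (drinUnit k a) y) z =
      drinMul k he (drinUnit k a) (drinMul k he y z)
    rw [drinMul_unit, drinMul_unit, drinMul_L]
  · change drinMul k he (drinMul k he x y) z = drinMul k he x (drinMul k he y z) at hx
    change drinMul k he (drinMul k he (drinH k he a x) y) z =
      drinMul k he (drinH k he a x) (drinMul k he y z)
    rw [drinMul_H, drinMul_H, drinMul_H, hx]

theorem drinMul_one (x : Drin k (e := e)) : drinMul k he x (drinUnit k 1) = x := by
  refine LinearMap.congr_fun (f := (drinMul k he).flip (drinUnit k 1)) (g := LinearMap.id)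
    (drin_ext he (fun a => ?_) fun a x hx => ?_) x
  · change drinMul k he (drinUnit k a) (drinUnit k 1) = drinUnit k a
    rw [drinMul_unit, drinL_unit, mul_one]
  · change drinMul k he x (drinUnit k 1) = x at hx
    change drinMul k he (drinH k he a x) (drinUnit k 1) = drinH k he a x
    rw [drinMul_H, hx]

/-- The sign `(-1)^n` on the component `n`. -/
noncomputable def drinSign : Drin k (e := e) →ₗ[k] Drin k (e := e) :=
  DirectSum.toModule k ℕ _ fun n => (n : ℤ).negOnePow • drinOf k n

theorem drinSign_of (n : ℕ) (x : (tower k e n).X) :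
    drinSign k (drinOf k n x) = (n : ℤ).negOnePow • drinOf k n x :=
  toModule_drinOf k (fun n => (n : ℤ).negOnePow • drinOf k n) n x

theorem drinSign_unit (a : A) : drinSign k (drinUnit k (e := e) a) = drinUnit k a :=
  (drinSign_of k 0 a).trans (by rw [Nat.cast_zero, Int.negOnePow_zero, one_smul]; rfl)

theorem drinSign_H (a : A) (x : Drin k (e := e)) :
    drinSign k (drinH k he a x) = -drinH k he a (drinSign k x) := by
  refine LinearMap.congr_fun (f := drinSign k ∘ₗ drinH k he a) (g := -(drinH k he a ∘ₗ drinSign k))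
    (DirectSum.linearMap_ext _ fun n => ?_) x
  refine LinearMap.ext fun y => ?_
  change drinSign k (drinH k he a (drinOf k n y)) = -drinH k he a (drinSign k (drinOf k n y))
  rw [drinH_of, drinSign_of, drinSign_of, map_zsmul_unit, drinH_of, Nat.cast_succ,
    Int.negOnePow_succ, Units.neg_smul]

theorem drinD_mul (x y : Drin k (e := e)) : drinD k he (drinMul k he x y) =
    drinMul k he (drinD k he x) y + drinMul k he (drinSign k x) (drinD k he y) := by
  refine LinearMap.congr_fun (f := drinD k he ∘ₗ (drinMul k he).flip y)
    (g := (drinMul k he).flip y ∘ₗ drinD k he +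
      (drinMul k he).flip (drinD k he y) ∘ₗ drinSign k) (drin_ext he (fun a => ?_)
        fun a x hx => ?_) x
  · change drinD k he (drinMul k he (drinUnit k a) y) =
      drinMul k he (drinD k he (drinUnit k a)) y +
        drinMul k he (drinSign k (drinUnit k a)) (drinD k he y)
    rw [drinMul_unit, drinD_unit, drinSign_unit, drinMul_unit, drinD_L, map_zero,
      LinearMap.zero_apply, zero_add]
  · change drinD k he (drinMul k he x y) =
      drinMul k he (drinD k he x) y + drinMul k he (drinSign k x) (drinD k he y) at hx
    change drinD k he (drinMul k he (drinH k he a x) y) = drinMul k he (drinD k he (drinH k he a x)) y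
      + drinMul k he (drinSign k (drinH k he a x)) (drinD k he y)
    rw [drinMul_H, drinD_H, hx, drinD_H, drinSign_H, map_sub, LinearMap.sub_apply, drinMul_L,
      drinMul_H, map_neg, LinearMap.neg_apply, drinMul_H, map_add]
    abel

end Tower


section Drinfeld

variable (k) {A : Type u} [Ring A] [Algebra k A] {e : A} (he : IsIdempotentElem e)

variable {k} in
theorem tower_induction {n : ℕ} {P : (tower k e (n + 1)).X → Prop} (h₀ : P 0)
    (h₁ : ∀ x y, P x → P y → P (x + y)) (h₂ : ∀ a x, P (towerTau k he n a x)) (x) : P x := by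
  refine TensorProduct.induction_on x h₀ (fun a x => ?_) h₁
  have key : towerTau k he n a.1 x.1 = a ⊗ₜ x :=
    congrArg₂ (fun a x => a ⊗ₜ[k] x) (Subtype.ext a.2) (Subtype.ext x.2)
  rw [← key]
  exact h₂ _ _

variable (e) in
/-- The homogeneous elements of degree `j`. -/
def drinGr (j : ℤ) : Submodule k (Drin k (e := e)) where
  carrier := {x | ∀ n : ℕ, (n : ℤ) + j ≠ 0 → x n = 0}
  add_mem' {x y} hx hy n hn := by
    rw [DirectSum.add_apply, hx n hn, hy n hn, add_zero]
  zero_mem' n hn := rfl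
  smul_mem' r x hx n hn := by
    rw [DirectSum.smul_apply, hx n hn, smul_zero]

theorem drinOf_apply_self (n : ℕ) (x : (tower k e n).X) : drinOf k n x n = x :=
  DirectSum.of_eq_same (β := fun n => (tower k e n).X) n x

theorem drinOf_apply_of_ne (n m : ℕ) (h : m ≠ n) (x : (tower k e n).X) : drinOf k n x m = 0 :=
  DirectSum.of_eq_of_ne (β := fun n => (tower k e n).X) n m x h

theorem drinOf_mem (n : ℕ) (j : ℤ) (h : (n : ℤ) + j = 0) (x : (tower k e n).X) :
    drinOf k n x ∈ drinGr k e j := by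
  intro m hm
  exact drinOf_apply_of_ne k n m (by rintro rfl; exact hm h) x

variable {k} in
theorem drinGr_induction {j : ℤ} {P : Drin k (e := e) → Prop} (h₀ : P 0)
    (h₁ : ∀ (n : ℕ) (x : (tower k e n).X), (n : ℤ) + j = 0 → P (drinOf k n x)) (x)
    (hx : x ∈ drinGr k e j) : P x := by
  by_cases h : ∃ n : ℕ, (n : ℤ) + j = 0
  · obtain ⟨n, hn⟩ := h
    have : x = drinOf k n (x n) := by
      refine DFinsupp.ext fun m => ?_
      by_cases hm : m = n
      · subst hm
        exact (drinOf_apply_self k m _).symm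
      · exact (hx m (by omega)).trans (drinOf_apply_of_ne k n m hm _).symm
    rw [this]
    exact h₁ n _ hn
  · have : x = 0 := DFinsupp.ext fun m => hx m fun hm => h ⟨m, hm⟩
    rw [this]
    exact h₀

theorem drinUnit_mem (a : A) : drinUnit k a ∈ drinGr k e 0 := drinOf_mem k 0 0 (by simp) a

theorem drinL_mem (a : A) {j : ℤ} {x : Drin k (e := e)} (hx : x ∈ drinGr k e j) :
    drinL k a x ∈ drinGr k e j := by
  refine drinGr_induction (P := fun x => drinL k a x ∈ drinGr k e j) ?_ (fun n x hn => ?_) x hx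
  · rw [map_zero]
    exact zero_mem _
  · rw [drinL_of]
    exact drinOf_mem k n j hn _

theorem drinH_mem (a : A) {i j : ℤ} (h : j + 1 = i) {x : Drin k (e := e)}
    (hx : x ∈ drinGr k e i) : drinH k he a x ∈ drinGr k e j := by
  refine drinGr_induction (P := fun x => drinH k he a x ∈ drinGr k e j) ?_ (fun n x hn => ?_) x hx
  · rw [map_zero]
    exact zero_mem _
  · rw [drinH_of]
    exact drinOf_mem k (n + 1) j (by push_cast; omega) _

theorem towerD_mem (n : ℕ) (j : ℤ) (h : (n : ℤ) + j = 1) (x : (tower k e n).X) :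
    towerD k he n x ∈ drinGr k e j := by
  induction n generalizing j with
  | zero => exact zero_mem _
  | succ n ih =>
    refine tower_induction he (P := fun x => towerD k he (n + 1) x ∈ drinGr k e j) ?_ ?_ ?_ x
    · rw [map_zero]
      exact zero_mem _
    · intro x y hx hy
      rw [map_add]
      exact add_mem hx hy
    · intro a x
      rw [towerD_succ]
      push_cast at h
      exact sub_mem (drinL_mem k _ (drinOf_mem k n j (by omega) x))
        (drinH_mem k he a rfl (ih (j + 1) (by omega) _))

theorem drinD_mem {i j : ℤ} (h : i + 1 = j) {x : Drin k (e := e)} (hx : x ∈ drinGr k e i) :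
    drinD k he x ∈ drinGr k e j := by
  refine drinGr_induction (P := fun x => drinD k he x ∈ drinGr k e j) ?_ (fun n x hn => ?_) x hx
  · rw [map_zero]
    exact zero_mem _
  · rw [drinD_of]
    exact towerD_mem k he n j (by omega) x

theorem towerMul_mem (n : ℕ) {i j : ℤ} (h : i = n + j) (x : (tower k e n).X)
    {y : Drin k (e := e)} (hy : y ∈ drinGr k e i) : towerMul k he n x y ∈ drinGr k e j := by
  induction n generalizing i j with
  | zero =>
    obtain rfl : i = j := by simpa using h
    exact drinL_mem k (A := A) (show A from x) hy
  | succ n ih =>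
    refine tower_induction he (P := fun x => towerMul k he (n + 1) x y ∈ drinGr k e j) ?_ ?_ ?_ x
    · rw [map_zero]
      exact zero_mem _
    · intro x y hx hy
      rw [map_add]
      exact add_mem hx hy
    · intro a x
      rw [towerMul_succ]
      push_cast at h
      exact drinH_mem k he a rfl (ih (j := j + 1) (by omega) _ hy)

theorem drinMul_mem {i j l : ℤ} (h : i + j = l) {x y : Drin k (e := e)}
    (hx : x ∈ drinGr k e i) (hy : y ∈ drinGr k e j) : drinMul k he x y ∈ drinGr k e l := by
  refine drinGr_induction (P := fun x => drinMul k he x y ∈ drinGr k e l) ?_ (fun n x hn => ?_) x hx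
  · rw [map_zero]
    exact zero_mem _
  · rw [drinMul_of]
    exact towerMul_mem k he n (by omega) x hy

theorem drinSign_eq {i : ℤ} {x : Drin k (e := e)} (hx : x ∈ drinGr k e i) :
    drinSign k x = i.negOnePow • x := by
  refine drinGr_induction (P := fun x => drinSign k x = i.negOnePow • x) ?_ (fun n x hn => ?_) x hx
  · rw [map_zero, smul_zero]
  · rw [drinSign_of, show i = -(n : ℤ) by omega, Int.negOnePow_neg]

/-- The Drinfeld quotient of `A` by `e`. -/
noncomputable def drinDGA : DGA k where
  X j := drinGr k e j
  d i j h := LinearMap.restrict (drinD k he) fun x hx => drinD_mem k he h hx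
  d_d i j l h h' x := Subtype.ext (drinD_D k he x.1)
  mul i j l h := LinearMap.mk₂ k (fun x y => ⟨drinMul k he x.1 y.1, drinMul_mem k he h x.2 y.2⟩)
    (fun x x' y => Subtype.ext (LinearMap.map_add₂ (drinMul k he) x.1 x'.1 y.1))
    (fun r x y => Subtype.ext (LinearMap.map_smul₂ (drinMul k he) r x.1 y.1))
    (fun x y y' => Subtype.ext (map_add (drinMul k he x.1) y.1 y'.1))
    (fun r x y => Subtype.ext (map_smul (drinMul k he x.1) r y.1))
  one := ⟨drinUnit k 1, drinUnit_mem k 1⟩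
  one_mul i x := Subtype.ext ((drinMul_unit k he 1 x.1).trans (drinL_one k x.1))
  mul_one i x := Subtype.ext (drinMul_one k he x.1)
  mul_assoc i j l ij jl n h₁ h₂ h₃ h₄ x y z := Subtype.ext (drinMul_assoc k he x.1 y.1 z.1)
  d_mul i j l i' j' l' h hi hj hl x y := Subtype.ext (by
    refine (drinD_mul k he x.1 y.1).trans ?_
    rw [drinSign_eq k x.2, LinearMap.map_smul_of_tower, LinearMap.smul_apply]
    rfl)

/-- The map from `A` to its Drinfeld quotient. -/
noncomputable def drinUnitHom : ofAlgebra k A ⟶ drinDGA k he where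
  f i :=
    { toFun := fun a => ⟨drinUnit k a.1, by
        by_cases h : i = 0
        · subst h
          exact drinUnit_mem k a.1
        · rw [a.2.2.2 h, map_zero]
          exact zero_mem _⟩
      map_add' := fun a b => Subtype.ext (map_add (drinUnit k) a.1 b.1)
      map_smul' := fun r a => Subtype.ext (map_smul (drinUnit k) r a.1) }
  comm i j h a := Subtype.ext ((map_zero _).trans (drinD_unit k he a.1).symm)
  map_one := rfl
  map_mul i j l h a b := Subtype.ext
    ((drinMul_unit k he a.1 _).trans (drinL_unit k a.1 b.1)).symm

/-- The component in `A` of an element of the Drinfeld quotient. -/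
noncomputable def drinAug : Drin k (e := e) →ₗ[k] A :=
  DirectSum.component k ℕ (fun n => (tower k e n).X) 0

theorem drinAug_unit (a : A) : drinAug k (e := e) (drinUnit k a) = a :=
  drinOf_apply_self k (e := e) 0 a

theorem drinAug_H (a : A) (x : Drin k (e := e)) : drinAug k (drinH k he a x) = 0 := by
  refine LinearMap.congr_fun (f := drinAug k ∘ₗ drinH k he a) (g := 0)
    (DirectSum.linearMap_ext _ fun n => ?_) x
  refine LinearMap.ext fun y => ?_
  exact (congrArg (drinAug k) (drinH_of k he a n y)).trans
    (drinOf_apply_of_ne k (n + 1) 0 (by simp) (towerTau k he n a y))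

theorem drinAug_L (a : A) (x : Drin k (e := e)) : drinAug k (drinL k a x) = a * drinAug k x := by
  have h : ∀ n y, drinAug k (drinL k a (drinOf k n y)) = a * drinAug k (e := e) (drinOf k n y) := by
    intro n y
    rw [drinL_of]
    cases n with
    | zero =>
      exact (drinAug_unit k (a * show A from y)).trans
        (congrArg (a * ·) (drinAug_unit k (e := e) y).symm)
    | succ n =>
      refine (drinOf_apply_of_ne k (n + 1) 0 (by simp) (a • y)).trans ?_
      exact ((congrArg (a * ·) (drinOf_apply_of_ne k (n + 1) 0 (by simp) y)).trans
        (mul_zero a)).symm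
  exact LinearMap.congr_fun (f := drinAug k ∘ₗ drinL k a)
    (g := LinearMap.mulLeft k a ∘ₗ drinAug k)
    (DirectSum.linearMap_ext _ fun n => LinearMap.ext (h n)) x

theorem drinAug_mul_unit (b : A) (x : Drin k (e := e)) :
    drinAug k (drinMul k he x (drinUnit k b)) = drinAug k x * b := by
  refine LinearMap.congr_fun (f := drinAug k ∘ₗ (drinMul k he).flip (drinUnit k b))
    (g := LinearMap.mulRight k b ∘ₗ drinAug k) (drin_ext he (fun a => ?_) fun a x hx => ?_) x
  · change drinAug k (drinMul k he (drinUnit k a) (drinUnit k b)) = drinAug k (drinUnit k a) * b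
    rw [drinMul_unit, drinAug_L, drinAug_unit, drinAug_unit]
  · change drinAug k (drinMul k he (drinH k he a x) (drinUnit k b)) =
      drinAug k (drinH k he a x) * b
    rw [drinMul_H, drinAug_H, drinAug_H, zero_mul]

theorem drinAug_eq_zero {j : ℤ} (hj : j ≠ 0) {x : Drin k (e := e)} (hx : x ∈ drinGr k e j) :
    drinAug k x = 0 := hx 0 (by simpa using hj)

/-- The projection to the components other than `A`. -/
noncomputable def drinProj : Drin k (e := e) →ₗ[k] Drin k (e := e) :=
  LinearMap.id - drinUnit k ∘ₗ drinAug k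

theorem drinProj_apply (x : Drin k (e := e)) :
    drinProj k x = x - drinUnit k (drinAug k x) := rfl

theorem drinProj_mem {j : ℤ} {x : Drin k (e := e)} (hx : x ∈ drinGr k e j) :
    drinProj k x ∈ drinGr k e j := by
  by_cases hj : j = 0
  · subst hj
    exact sub_mem hx (drinUnit_mem k _)
  · rw [drinProj_apply, drinAug_eq_zero k hj hx, map_zero, sub_zero]
    exact hx

theorem drinAug_proj (x : Drin k (e := e)) : drinAug k (drinProj k x) = 0 := by
  rw [drinProj_apply, map_sub, drinAug_unit, sub_self]

theorem drinProj_of_aug {x : Drin k (e := e)} (hx : drinAug k x = 0) : drinProj k x = x := by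
  rw [drinProj_apply, hx, map_zero, sub_zero]

theorem drinProj_unit (a : A) : drinProj k (drinUnit k (e := e) a) = 0 := by
  rw [drinProj_apply, drinAug_unit, sub_self]

theorem drinProj_L (a : A) (x : Drin k (e := e)) :
    drinProj k (drinL k a x) = drinL k a (drinProj k x) := by
  rw [drinProj_apply, drinProj_apply, drinAug_L, map_sub, drinL_unit]

theorem drinProj_mul_unit (b : A) (x : Drin k (e := e)) :
    drinProj k (drinMul k he x (drinUnit k b)) = drinMul k he (drinProj k x) (drinUnit k b) := by
  rw [drinProj_apply, drinProj_apply, drinAug_mul_unit, map_sub, LinearMap.sub_apply, drinMul_unit,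
    drinL_unit]

theorem drinD_proj (x : Drin k (e := e)) : drinD k he (drinProj k x) = drinD k he x := by
  rw [drinProj_apply, map_sub, drinD_unit, sub_zero]

theorem drinD_mul_unit (b : A) (x : Drin k (e := e)) :
    drinD k he (drinMul k he x (drinUnit k b)) = drinMul k he (drinD k he x) (drinUnit k b) := by
  rw [drinD_mul, drinD_unit, map_zero, add_zero]

variable (e) in
/-- The homogeneous elements of degree `j` of the bimodule `Ae ⊗_R^L eA`. -/
noncomputable def barGr (j : ℤ) : Submodule k (Drin k (e := e)) :=
  drinGr k e (j - 1) ⊓ LinearMap.ker (drinAug k)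

/-- The bar resolution of `Ae ⊗_R^L eA`, the fibre of the map from `A` to its Drinfeld
quotient. -/
noncomputable def barBimod : DGBimod (ofAlgebra k A) (ofAlgebra k A) where
  X j := barGr k e j
  d i j h := LinearMap.restrict (-(drinProj k ∘ₗ drinD k he)) fun x hx =>
    neg_mem ⟨drinProj_mem k (drinD_mem k he (by omega) hx.1), drinAug_proj k _⟩
  d_d i j l h h' x := Subtype.ext (by
    change -drinProj k (drinD k he (-drinProj k (drinD k he x.1))) = 0
    rw [map_neg, drinD_proj, drinD_D, neg_zero, map_zero, neg_zero])
  act i j l h := LinearMap.mk₂ k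
    (fun x a => ⟨drinMul k he x.1 ((drinUnitHom k he).f j a).1,
      drinMul_mem k he (by omega) x.2.1 ((drinUnitHom k he).f j a).2,
      show drinAug k (drinMul k he x.1 (drinUnit k a.1)) = 0 by
        rw [drinAug_mul_unit, show drinAug k x.1 = 0 from x.2.2, zero_mul]⟩)
    (fun x x' y => Subtype.ext (LinearMap.map_add₂ (drinMul k he) x.1 x'.1 _))
    (fun r x y => Subtype.ext (LinearMap.map_smul₂ (drinMul k he) r x.1 _))
    (fun x y y' => Subtype.ext ((congrArg (drinMul k he x.1)
      (map_add (drinUnit k) y.1 y'.1)).trans (map_add (drinMul k he x.1) _ _)))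
    (fun r x y => Subtype.ext ((congrArg (drinMul k he x.1)
      (map_smul (drinUnit k) r y.1)).trans (map_smul (drinMul k he x.1) r _)))
  act_one i x := Subtype.ext (drinMul_one k he x.1)
  act_act i j l ij jl n h₁ h₂ h₃ h₄ x a b := Subtype.ext (by
    refine (drinMul_assoc k he x.1 _ _).trans (congrArg (drinMul k he x.1) ?_)
    exact (drinMul_unit k he a.1 _).trans (drinL_unit k a.1 b.1))
  d_act i j l i' j' l' h hi hj hl x a := Subtype.ext (by
    refine Eq.trans ?_ (add_zero _).symm |>.trans (congrArg₂ (· + ·) rfl ?_)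
    · change -drinProj k (drinD k he (drinMul k he x.1 (drinUnit k a.1))) =
        drinMul k he (-drinProj k (drinD k he x.1)) (drinUnit k a.1)
      rw [drinD_mul_unit, drinProj_mul_unit, map_neg, LinearMap.neg_apply]
    · change (0 : Drin k (e := e)) = i.negOnePow • drinMul k he x.1 (drinUnit k 0)
      rw [map_zero, map_zero, smul_zero])
  lact i j l h := LinearMap.mk₂ k
    (fun a x => ⟨drinL k a.1 x.1, by
      rw [← drinMul_unit k he]
      exact drinMul_mem k he (by omega) ((drinUnitHom k he).f i a).2 x.2.1,
      show drinAug k (drinL k a.1 x.1) = 0 by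
        rw [drinAug_L, show drinAug k x.1 = 0 from x.2.2, mul_zero]⟩)
    (fun x x' y => Subtype.ext (LinearMap.map_add₂ (drinL k) x.1 x'.1 y.1))
    (fun r x y => Subtype.ext (LinearMap.map_smul₂ (drinL k) r x.1 y.1))
    (fun x y y' => Subtype.ext (map_add (drinL k x.1) y.1 y'.1))
    (fun r x y => Subtype.ext (map_smul (drinL k x.1) r y.1))
  one_lact i x := Subtype.ext (drinL_one k x.1)
  lact_lact i j l ij jl n h₁ h₂ h₃ h₄ a b x := Subtype.ext (drinL_mul k a.1 b.1 x.1).symm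
  lact_act i j l ij jl n h₁ h₂ h₃ h₄ a x b := Subtype.ext (drinMul_L k he a.1 x.1 _)
  d_lact i j l i' j' l' h hi hj hl a x := Subtype.ext (by
    have hi' : i.negOnePow • drinL k a.1 (-drinProj k (drinD k he x.1)) =
        drinL k a.1 (-drinProj k (drinD k he x.1)) := by
      by_cases h0 : i = 0
      · rw [show i.negOnePow = 1 by rw [h0, Int.negOnePow_zero], one_smul]
      · rw [a.2.2.2 h0, map_zero, LinearMap.zero_apply, smul_zero]
    refine Eq.trans ?_ ((congrArg₂ (· + ·) (LinearMap.map_zero₂ (drinL k) x.1) hi').trans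
      (zero_add _)).symm
    change -drinProj k (drinD k he (drinL k a.1 x.1)) = drinL k a.1 (-drinProj k (drinD k he x.1))
    rw [drinD_L, drinProj_L, map_neg])

/-- The map `Ae ⊗_R^L eA ⟶ A`. -/
noncomputable def barAug (j : ℤ) : (barBimod k he).X j →ₗ[k] (ofAlgebra k A).X j where
  toFun x := ⟨drinAug k (drinD k he x.1), one_mul _, mul_one _, fun hj =>
    drinAug_eq_zero k hj (drinD_mem k he (by omega) x.2.1)⟩
  map_add' x y := Subtype.ext (map_add (drinAug k ∘ₗ drinD k he) x.1 y.1)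
  map_smul' r x := Subtype.ext (map_smul (drinAug k ∘ₗ drinD k he) r x.1)

/-- The inclusion `Ae ⊗_R^L eA ⟶ Drin` of degree `-1`. -/
noncomputable def barIncl (i j : ℤ) (h : j + 1 = i) : (barBimod k he).X i →ₗ[k] (drinDGA k he).X j where
  toFun x := ⟨x.1, by
    obtain rfl : j = i - 1 := by omega
    exact x.2.1⟩
  map_add' x y := rfl
  map_smul' r x := rfl

/-- The projection `Drin ⟶ Ae ⊗_R^L eA` of degree `1`. -/
noncomputable def barProj (i j : ℤ) (h : j + 1 = i) : (drinDGA k he).X j →ₗ[k] (barBimod k he).X i where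
  toFun x := ⟨drinProj k x.1, by
    obtain rfl : j = i - 1 := by omega
    exact ⟨drinProj_mem k x.2, drinAug_proj k x.1⟩⟩
  map_add' x y := Subtype.ext (map_add (drinProj k) x.1 y.1)
  map_smul' r x := Subtype.ext (map_smul (drinProj k) r x.1)

/-- The projection `Drin ⟶ A`. -/
noncomputable def drinAugMap (j : ℤ) : (drinDGA k he).X j →ₗ[k] (ofAlgebra k A).X j where
  toFun x := ⟨drinAug k x.1, one_mul _, mul_one _, fun hj => drinAug_eq_zero k hj x.2⟩
  map_add' x y := Subtype.ext (map_add (drinAug k) x.1 y.1)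
  map_smul' r x := Subtype.ext (map_smul (drinAug k) r x.1)

end Drinfeld


/-! ### Dg-modules over an algebra in degree zero -/

section Algebra

variable (k) {A : Type u} [Ring A] [Algebra k A]

/-- An element of `A`, in degree zero. -/
def algElt : A →ₗ[k] (ofAlgebra k A).X 0 where
  toFun a := ⟨a, one_mul _, mul_one _, fun h => absurd rfl h⟩
  map_add' _ _ := rfl
  map_smul' _ _ := rfl

variable {k}

theorem ofAlgebra_eq_zero {j : ℤ} (hj : j ≠ 0) (a : (ofAlgebra k A).X j) : a = 0 :=
  Subtype.ext (a.2.2.2 hj)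

theorem d_act_algebra (Z : DGMod (ofAlgebra k A)) (i j : ℤ) (h : i + 1 = j) (x : Z.X i)
    (a : (ofAlgebra k A).X 0) : Z.d i j h (Z.act i 0 i (add_zero i) x a) =
      Z.act j 0 j (add_zero j) (Z.d i j h x) a := by
  refine (Z.d_act i 0 i j 1 j (add_zero i) h rfl h x a).trans ?_
  refine (congrArg (Z.act j 0 j (add_zero j) (Z.d i j h x) a + ·) ?_).trans (add_zero _)
  exact (congrArg (i.negOnePow • ·) (map_zero (Z.act i 1 j h x))).trans (smul_zero _)

/-- The complex `Ze` is contractible. -/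
def CornerAcyclic (e : A) (Z : DGMod (ofAlgebra k A)) : Prop :=
  ∃ s : ∀ i j : ℤ, j + 1 = i → Z.X i →ₗ[k] Z.X j,
    ∀ (i j l : ℤ) (h : j + 1 = i) (h' : i + 1 = l) (x : Z.X i),
      Z.d j i h (s i j h x) + s l i h' (Z.d i l h' x) =
        Z.act i 0 i (add_zero i) x (algElt k e)

theorem tensorX_induction {Λ Γ : DGA k} {M : DGMod Λ} {N : DGBimod Λ Γ} {n : ℤ}
    {P : TensorX M N n → Prop} (h₀ : P 0) (h₁ : ∀ t t', P t → P t' → P (t + t'))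
    (h₂ : ∀ (r : k) t, P t → P (r • t))
    (h₃ : ∀ (i j : ℤ) (h : i + j = n) (x : M.X i) (y : N.X j), P (tmul M N i j n h x y)) (t) :
    P t := by
  let S : Submodule k (TensorX M N n) :=
    { carrier := {t | P t}
      add_mem' := fun {t t'} ht ht' => h₁ t t' ht ht'
      zero_mem' := h₀
      smul_mem' := fun r t ht => h₂ r t ht }
  have : S.mkQ = 0 := by
    apply tensor_ext
    intro i j h x y
    exact (Submodule.Quotient.mk_eq_zero S).2 (h₃ i j h x y)
  exact (Submodule.Quotient.mk_eq_zero S).1 (LinearMap.congr_fun this t)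

theorem tensorD_tensorD {Λ Γ : DGA k} (M : DGMod Λ) (N : DGBimod Λ Γ) (n n' n'' : ℤ)
    (hn : n + 1 = n') (hn' : n' + 1 = n'') (t : TensorX M N n) :
    tensorD M N n' n'' hn' (tensorD M N n n' hn t) = 0 :=
  (tensorObj M N).d_d n n' n'' hn hn' t

theorem homD_homD {Λ Γ : DGA k} (N : DGBimod Λ Γ) (P : DGMod Γ) (n n' n'' : ℤ)
    (hn : n + 1 = n') (hn' : n' + 1 = n'') (f : HomX N P n) :
    homD N P n' n'' hn' (homD N P n n' hn f) = 0 :=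
  (homObj N P).d_d n n' n'' hn hn' f

section TensorAcyclic

variable {e : A} {Γ : DGA k} {Z : DGMod (ofAlgebra k A)} (N : DGBimod (ofAlgebra k A) Γ)

variable (Z) in
/-- The part of `Z ⊗ N` spanned by the components of `N` of degree at least `m`. -/
def tensorFil (m n : ℤ) : Submodule k (TensorX Z N n) :=
  Submodule.span k {t | ∃ (i j : ℤ) (h : i + j = n) (_ : m ≤ j) (x : Z.X i) (y : N.X j),
    tmul Z N i j n h x y = t}

theorem tmul_mem_tensorFil {m n i j : ℤ} (h : i + j = n) (hj : m ≤ j) (x : Z.X i) (y : N.X j) :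
    tmul Z N i j n h x y ∈ tensorFil Z N m n := Submodule.subset_span ⟨i, j, h, hj, x, y, rfl⟩

theorem tensorFil_mono {m m' n : ℤ} (h : m' ≤ m) : tensorFil Z N m n ≤ tensorFil Z N m' n := by
  refine Submodule.span_mono ?_
  rintro t ⟨i, j, hij, hj, x, y, rfl⟩
  exact ⟨i, j, hij, h.trans hj, x, y, rfl⟩

theorem exists_mem_tensorFil {n : ℤ} (t : TensorX Z N n) :
    ∃ p : ℕ, t ∈ tensorFil Z N (1 - p) n := by
  refine tensorX_induction (P := fun t => ∃ p : ℕ, t ∈ tensorFil Z N (1 - p) n) ?_ ?_ ?_ ?_ t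
  · exact ⟨0, zero_mem _⟩
  · rintro t t' ⟨p, hp⟩ ⟨q, hq⟩
    exact ⟨p + q, add_mem (tensorFil_mono N (by push_cast; omega) hp)
      (tensorFil_mono N (by push_cast; omega) hq)⟩
  · rintro r t ⟨p, hp⟩
    exact ⟨p, Submodule.smul_mem _ r hp⟩
  · intro i j h x y
    exact ⟨(1 - j).toNat, tmul_mem_tensorFil N h (by omega) x y⟩

variable (s : ∀ i j : ℤ, j + 1 = i → Z.X i →ₗ[k] Z.X j)

/-- The map `x ↦ (a ⊗ y ↦ s (x a) ⊗ y)`. -/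
noncomputable def tensorHtpyAux (i j i' n : ℤ) (hi : i' + 1 = i) (h : i' + j = n) :
    Z.X i →ₗ[k] ((ofAlgebra k A).X 0 ⊗[k] N.X j) →ₗ[k] TensorX Z N n :=
  TensorProduct.uncurry (.id k) _ _ _ ∘ₗ LinearMap.llcomp k _ _ _ (tmul Z N i' j n h ∘ₗ s i i' hi) ∘ₗ
    Z.act i 0 i (add_zero i)

theorem tensorHtpyAux_tmul (i j i' n : ℤ) (hi : i' + 1 = i) (h : i' + j = n) (x : Z.X i)
    (a : (ofAlgebra k A).X 0) (y : N.X j) : tensorHtpyAux N s i j i' n hi h x (a ⊗ₜ y) =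
      tmul Z N i' j n h (s i i' hi (Z.act i 0 i (add_zero i) x a)) y := rfl

theorem tensorHtpyAux_mem (i j i' n : ℤ) (hi : i' + 1 = i) (h : i' + j = n) (x : Z.X i)
    (t : (ofAlgebra k A).X 0 ⊗[k] N.X j) :
    tensorHtpyAux N s i j i' n hi h x t ∈ tensorFil Z N j n := by
  refine TensorProduct.induction_on t ?_ (fun a y => ?_) (fun t t' ht ht' => ?_)
  · rw [map_zero]
    exact zero_mem _
  · rw [tensorHtpyAux_tmul]
    exact tmul_mem_tensorFil N h le_rfl _ y
  · rw [map_add]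
    exact add_mem ht ht'

theorem tensorHtpyAux_act (i j i' n : ℤ) (hi : i' + 1 = i) (h : i' + j = n) (x : Z.X i)
    (a : (ofAlgebra k A).X 0) (t : (ofAlgebra k A).X 0 ⊗[k] N.X j) :
    tensorHtpyAux N s i j i' n hi h (Z.act i 0 i (add_zero i) x a) t =
      tensorHtpyAux N s i j i' n hi h x (((ofAlgebra k A).mul 0 0 0 rfl a).rTensor (N.X j) t) := by
  refine TensorProduct.induction_on t ?_ (fun b y => ?_) (fun t t' ht ht' => ?_)
  · rw [map_zero, map_zero, map_zero]
  · rw [LinearMap.rTensor_tmul, tensorHtpyAux_tmul, tensorHtpyAux_tmul,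
      Z.act_act i 0 0 i 0 i _ rfl _ (add_zero i)]
  · rw [map_add, map_add, map_add, ht, ht']

/-- The map `a ⊗ y ↦ a e y`. -/
noncomputable def cornerLact (e : A) (j : ℤ) : (ofAlgebra k A).X 0 ⊗[k] N.X j →ₗ[k] N.X j :=
  TensorProduct.lift (N.lact 0 j j (zero_add j) ∘ₗ ((ofAlgebra k A).mul 0 0 0 rfl).flip (algElt k e))

theorem tensorHtpyAux_d (hs : ∀ (i j l : ℤ) (h : j + 1 = i) (h' : i + 1 = l) (x : Z.X i),
      Z.d j i h (s i j h x) + s l i h' (Z.d i l h' x) =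
        Z.act i 0 i (add_zero i) x (algElt k e))
    (i j i' l n m : ℤ) (hi : i' + 1 = i) (h : i' + j = n) (hn : n + 1 = m) (hl : i + 1 = l)
    (x : Z.X i) (t : (ofAlgebra k A).X 0 ⊗[k] N.X j) :
    tensorD Z N n m hn (tensorHtpyAux N s i j i' n hi h x t) +
      tensorHtpyAux N s l j i m hl (by omega) (Z.d i l hl x) t -
        tmul Z N i j m (by omega) x (cornerLact N e j t) ∈ tensorFil Z N (j + 1) m := by
  refine TensorProduct.induction_on t ?_ (fun a y => ?_) (fun t t' ht ht' => ?_)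
  · simp only [map_zero, sub_zero, add_zero]
    exact zero_mem _
  · have h₁ : tmul Z N i j m (by omega) x (cornerLact N e j (a ⊗ₜ y)) =
        tmul Z N i j m (by omega) (Z.act i 0 i (add_zero i) (Z.act i 0 i (add_zero i) x a)
          (algElt k e)) y := by
      rw [Z.act_act i 0 0 i 0 i _ rfl _ (add_zero i)]
      exact (tmul_act Z N i 0 j i j m (add_zero i) (zero_add j) (by omega) (by omega) x _ y).symm
    rw [tensorHtpyAux_tmul, tensorHtpyAux_tmul, h₁,
      tensorD_tmul Z N i' j n m i (j + 1) h hn hi rfl, ← hs i i' l hi hl, map_add,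
      LinearMap.add_apply, d_act_algebra]
    have : ∀ (a b c : TensorX Z N m), a + b + c - (a + c) = b := fun a b c => by abel
    rw [this, ← map_zsmul_unit]
    exact tmul_mem_tensorFil N _ le_rfl _ _
  · have key := add_mem ht ht'
    simp only [map_add]
    convert key using 1
    abel

theorem exists_tensorHtpy (c : ∀ j, N.X j →ₗ[k] (ofAlgebra k A).X 0 ⊗[k] N.X j)
    (hc : ∀ j a y, c j (N.lact 0 j j (zero_add j) a y) =
      ((ofAlgebra k A).mul 0 0 0 rfl a).rTensor (N.X j) (c j y)) :
    ∃ σ : ∀ n n' : ℤ, n' + 1 = n → (TensorX Z N n →ₗ[k] TensorX Z N n'),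
      ∀ n n' hn i j i' (hi : i' + 1 = i) (h : i + j = n) x y,
      σ n n' hn (tmul Z N i j n h x y) = tensorHtpyAux N s i j i' n' hi (by omega) x (c j y) := by
  refine ⟨fun n n' hn => tensorLift (fun i j h => (tensorHtpyAux N s i j (i - 1) n' (by omega) (by omega)).compl₂ (c j))
    (by
      intro i j l ij jl h₁ h₂ h₃ h₄ x a y
      by_cases hj : j = 0
      · subst hj
        obtain rfl : i = ij := by omega
        obtain rfl : l = jl := by omega
        simp only [LinearMap.compl₂_apply]
        rw [hc, tensorHtpyAux_act]
      · rw [ofAlgebra_eq_zero hj a]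
        simp only [map_zero, LinearMap.zero_apply]), ?_⟩
  intro n n' hn i j i' hi h x y
  obtain rfl : i' = i - 1 := by omega
  exact tensorLift_tmul Z N _ _ i j h x y

theorem sub_htpy_mem_tensorFil (hs : ∀ (i j l : ℤ) (h : j + 1 = i) (h' : i + 1 = l) (x : Z.X i),
      Z.d j i h (s i j h x) + s l i h' (Z.d i l h' x) =
        Z.act i 0 i (add_zero i) x (algElt k e))
    (c : ∀ j, N.X j →ₗ[k] (ofAlgebra k A).X 0 ⊗[k] N.X j)
    (hc' : ∀ j y, cornerLact N e j (c j y) = y)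
    (σ : ∀ n n' : ℤ, n' + 1 = n → (TensorX Z N n →ₗ[k] TensorX Z N n'))
    (hσ : ∀ n n' hn i j i' (hi : i' + 1 = i) (h : i + j = n) x y,
      σ n n' hn (tmul Z N i j n h x y) = tensorHtpyAux N s i j i' n' hi (by omega) x (c j y))
    (m l n n' : ℤ) (hn : n + 1 = n') (hl : l + 1 = n) (t : TensorX Z N n)
    (ht : t ∈ tensorFil Z N m n) :
    t - tensorD Z N l n hl (σ n l hl t) - σ n' n hn (tensorD Z N n n' hn t) ∈
      tensorFil Z N (m + 1) n := by
  refine (Submodule.span_le (p := (tensorFil Z N (m + 1) n).comap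
    (LinearMap.id - tensorD Z N l n hl ∘ₗ σ n l hl - σ n' n hn ∘ₗ tensorD Z N n n' hn))).2 ?_ ht
  rintro _ ⟨i, j, hij, hj, x, y, rfl⟩
  change tmul Z N i j n hij x y - tensorD Z N l n hl (σ n l hl (tmul Z N i j n hij x y)) -
    σ n' n hn (tensorD Z N n n' hn (tmul Z N i j n hij x y)) ∈ tensorFil Z N (m + 1) n
  have h₁ := tensorHtpyAux_d N s hs i j (i - 1) (i + 1) l n (by omega) (by omega) hl rfl x (c j y)
  rw [hc'] at h₁
  have h₂ := tensorHtpyAux_mem N s i (j + 1) (i - 1) n (by omega) (by omega) x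
    (c (j + 1) (N.d j (j + 1) rfl y))
  have h₃ := sub_mem (neg_mem h₁) (Submodule.smul_of_tower_mem _ i.negOnePow h₂)
  refine tensorFil_mono N (show m + 1 ≤ j + 1 by omega) ?_
  rw [tensorD_tmul Z N i j n n' (i + 1) (j + 1) hij hn rfl rfl, map_add, map_zsmul_unit,
    hσ n l hl i j (i - 1) (by omega), hσ n' n hn (i + 1) j i rfl,
    hσ n' n hn i (j + 1) (i - 1) (by omega)]
  convert h₃ using 1
  abel

theorem acyclic_tensorObj (hN : ∀ j : ℤ, 0 < j → ∀ y : N.X j, y = 0)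
    (c : ∀ j, N.X j →ₗ[k] (ofAlgebra k A).X 0 ⊗[k] N.X j)
    (hc : ∀ j a y, c j (N.lact 0 j j (zero_add j) a y) =
      ((ofAlgebra k A).mul 0 0 0 rfl a).rTensor (N.X j) (c j y))
    (hc' : ∀ j y, cornerLact N e j (c j y) = y) (hZ : CornerAcyclic e Z) :
    (tensorObj Z N).Acyclic := by
  obtain ⟨s, hs⟩ := hZ
  obtain ⟨σ, hσ⟩ := exists_tensorHtpy N s c hc
  have step := sub_htpy_mem_tensorFil N s hs c hc' σ hσ
  have main : ∀ (p : ℕ) (n : ℤ) (t : TensorX Z N n), t ∈ tensorFil Z N (1 - p) n →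
      tensorD Z N n (n + 1) rfl t = 0 → ∃ y, tensorD Z N (n - 1) n (by omega) y = t := by
    intro p
    induction p with
    | zero =>
      intro n t ht hd
      refine ⟨0, (map_zero _).trans (Eq.symm ?_)⟩
      have : tensorFil Z N (1 - (0 : ℕ)) n ≤ ⊥ := by
        refine Submodule.span_le.2 ?_
        rintro _ ⟨i, j, hij, hj, x, y, rfl⟩
        rw [hN j (by simp at hj; omega) y, map_zero]
        exact zero_mem _
      exact (Submodule.mem_bot k).1 (this ht)
    | succ p ih =>
      intro n t ht hd
      have h₁ := step _ (n - 1) n (n + 1) rfl (by omega) t ht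
      rw [hd, map_zero, sub_zero, show 1 - ((p + 1 : ℕ) : ℤ) + 1 = 1 - p by push_cast; omega] at h₁
      obtain ⟨y, hy⟩ := ih n _ h₁ (by
        rw [map_sub, hd, tensorD_tensorD, sub_zero])
      refine ⟨y + σ n (n - 1) (by omega) t, ?_⟩
      rw [map_add, hy, sub_add_cancel]
  intro n t ht
  obtain ⟨p, hp⟩ := exists_mem_tensorFil N t
  exact ⟨n - 1, by omega, main p n t hp ht⟩

end TensorAcyclic

section HomAcyclic

variable {e : A} {Λ : DGA k} {Z : DGMod (ofAlgebra k A)} (N : DGBimod Λ (ofAlgebra k A))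

/-- The map `y ⊗ a ↦ y e a`. -/
noncomputable def cornerAct (e : A) (j : ℤ) : N.X j ⊗[k] (ofAlgebra k A).X 0 →ₗ[k] N.X j :=
  TensorProduct.lift ((N.act j 0 j (add_zero j)).compl₂
    ((ofAlgebra k A).mul 0 0 0 rfl (algElt k e)))

variable (s : ∀ i j : ℤ, j + 1 = i → Z.X i →ₗ[k] Z.X j)

variable {N} in
/-- The map `y ⊗ a ↦ s (f y) a`. -/
noncomputable def homHtpyAux {n : ℤ} (f : HomX N Z n) (i j l : ℤ) (h : i + n = j) (hl : l + 1 = j) :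
    N.X i ⊗[k] (ofAlgebra k A).X 0 →ₗ[k] Z.X l :=
  TensorProduct.lift (Z.act l 0 l (add_zero l) ∘ₗ s j l hl ∘ₗ f.app i j h)

theorem homHtpyAux_act {n : ℤ} (f : HomX N Z n) (i j l : ℤ) (h : i + n = j) (hl : l + 1 = j)
    (t : N.X i ⊗[k] (ofAlgebra k A).X 0) (a : (ofAlgebra k A).X 0) :
    homHtpyAux s f i j l h hl
      ((((ofAlgebra k A).mul 0 0 0 rfl).flip a).lTensor (N.X i) t) =
        Z.act l 0 l (add_zero l) (homHtpyAux s f i j l h hl t) a := by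
  refine TensorProduct.induction_on t ?_ (fun y b => ?_) (fun t t' ht ht' => ?_)
  · simp only [map_zero, LinearMap.zero_apply]
  · exact (Z.act_act l 0 0 l 0 l (add_zero l) rfl _ (add_zero l) _ b a).symm
  · simp only [map_add, LinearMap.add_apply, ht, ht']

theorem homHtpyAux_eq_zero {n : ℤ} (f : HomX N Z n) (i j l : ℤ) (h : i + n = j) (hl : l + 1 = j)
    (hf : f.app i j h = 0) (t) : homHtpyAux s f i j l h hl t = 0 := by
  rw [homHtpyAux, hf, LinearMap.comp_zero, LinearMap.comp_zero]
  exact LinearMap.congr_fun (map_zero (TensorProduct.uncurry (.id k) _ _ _)) t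

theorem d_homHtpyAux (hs : ∀ (i j l : ℤ) (h : j + 1 = i) (h' : i + 1 = l) (x : Z.X i),
      Z.d j i h (s i j h x) + s l i h' (Z.d i l h' x) =
        Z.act i 0 i (add_zero i) x (algElt k e)) {n : ℤ} (f : HomX N Z n) (i j l : ℤ)
    (h : i + n = j) (hl : l + 1 = j)
    (hf : ∀ y, Z.d j (j + 1) rfl (f.app i j h y) = 0) (t : N.X i ⊗[k] (ofAlgebra k A).X 0) :
    Z.d l j hl (homHtpyAux s f i j l h hl t) = f.app i j h (cornerAct N e i t) := by
  refine TensorProduct.induction_on t ?_ (fun y b => ?_) (fun t t' ht ht' => ?_)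
  · simp only [map_zero]
  · refine (d_act_algebra Z l j hl _ b).trans ?_
    have h₁ := hs j l (j + 1) hl rfl (f.app i j h y)
    rw [hf, map_zero, add_zero] at h₁
    refine (congrArg (fun z => Z.act j 0 j (add_zero j) z b) h₁).trans ?_
    refine (Z.act_act j 0 0 j 0 j (add_zero j) rfl _ (add_zero j) _ _ b).trans ?_
    exact (f.app_act i j 0 i j h (add_zero i) (add_zero j) h y _).symm
  · simp only [map_add, ht, ht']

variable {N} in
theorem map_act_of_degree_zero {n : ℤ} (F : ∀ i j, i + n = j → N.X i →ₗ[k] Z.X j)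
    (hF : ∀ i j h y a, F i j h (N.act i 0 i (add_zero i) y a) =
      Z.act j 0 j (add_zero j) (F i j h y) a) (i j l il jl : ℤ) (h₁ : i + n = j) (h₂ : i + l = il)
    (h₃ : j + l = jl) (h₄ : il + n = jl) (x : N.X i) (a : (ofAlgebra k A).X l) :
    F il jl h₄ (N.act i l il h₂ x a) = Z.act j l jl h₃ (F i j h₁ x) a := by
  by_cases hl : l = 0
  · subst hl
    obtain rfl : i = il := by omega
    obtain rfl : j = jl := by omega
    exact hF i j _ x a
  · rw [ofAlgebra_eq_zero hl a]
    simp only [map_zero]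

theorem exists_homHtpy (c : ∀ j, N.X j →ₗ[k] N.X j ⊗[k] (ofAlgebra k A).X 0)
    (hc : ∀ j a y, c j (N.act j 0 j (add_zero j) y a) =
      (((ofAlgebra k A).mul 0 0 0 rfl).flip a).lTensor (N.X j) (c j y)) :
    ∃ σ : ∀ n n' : ℤ, n' + 1 = n → (HomX N Z n → HomX N Z n'),
      ∀ n n' hn f i j l (h : i + n' = l) (hj : i + n = j) y,
      (σ n n' hn f).app i l h y = homHtpyAux s f i j l hj (by omega) (c i y) := by
  refine ⟨fun n n' hn f =>
    ⟨fun p => homHtpyAux s f p.1.1 (p.1.1 + n) p.1.2 rfl (by have := p.2; omega) ∘ₗ c p.1.1, ?_⟩, ?_⟩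
  · intro i j l il jl h₁ h₂ h₃ x a
    refine map_act_of_degree_zero (fun i j h => homHtpyAux s f i (i + n) j rfl (by omega) ∘ₗ c i) ?_
      i j l il jl h₁ h₂ h₃ (by omega) x a
    intro i j h y a
    refine (congrArg (homHtpyAux s f i (i + n) j rfl (by omega)) (hc i a y)).trans ?_
    exact homHtpyAux_act N s f i (i + n) j rfl (by omega) (c i y) a
  · intro n n' hn f i j l h hj y
    subst hj
    rfl

theorem homD_htpy_app (hs : ∀ (i j l : ℤ) (h : j + 1 = i) (h' : i + 1 = l) (x : Z.X i),
      Z.d j i h (s i j h x) + s l i h' (Z.d i l h' x) =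
        Z.act i 0 i (add_zero i) x (algElt k e))
    (c : ∀ j, N.X j →ₗ[k] N.X j ⊗[k] (ofAlgebra k A).X 0)
    (hc' : ∀ j y, cornerAct N e j (c j y) = y)
    (σ : ∀ n n' : ℤ, n' + 1 = n → (HomX N Z n → HomX N Z n'))
    (hσ : ∀ n n' hn f i j l (h : i + n' = l) (hj : i + n = j) y,
      (σ n n' hn f).app i l h y = homHtpyAux s f i j l hj (by omega) (c i y)) {n : ℤ} (f : HomX N Z n)
    (hf : homD N Z n (n + 1) rfl f = 0) (i j : ℤ) (h : i + n = j)
    (hi : ∀ j h y, f.app (i + 1) j h y = 0) (y : N.X i) :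
    (homD N Z (n - 1) n (by omega) (σ n (n - 1) (by omega) f)).app i j h y = f.app i j h y := by
  have hz : ∀ y : N.X i, Z.d j (j + 1) rfl (f.app i j h y) = 0 := by
    intro y
    have := congrArg (fun f => HomX.app f i (j + 1) (by omega) y) hf
    rw [homD_app N Z n (n + 1) rfl f i (j + 1) (i + 1) j (by omega) rfl h, hi,
      smul_zero, sub_zero] at this
    exact this
  have h₁ := d_homHtpyAux N s hs f i j (j - 1) h (by omega) hz (c i y)
  rw [hc'] at h₁
  have h₂ := homHtpyAux_eq_zero N s f (i + 1) (j + 1) j (by omega) (by omega)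
    (LinearMap.ext fun y => hi _ _ y) (c (i + 1) (N.d i (i + 1) rfl y))
  rw [homD_app N Z (n - 1) n _ _ i j (i + 1) (j - 1) h rfl (by omega),
      hσ n (n - 1) _ f i j (j - 1) _ h, hσ n (n - 1) _ f (i + 1) (j + 1) j _ (by omega),
      h₁, h₂, smul_zero, sub_zero]

theorem exists_sum_homX {m : ℤ} (b : ℕ → HomX N Z m)
    (hb : ∀ (p : ℕ) i j h y, 1 - (p : ℤ) ≤ i → (b p).app i j h y = 0) :
    ∃ Y : HomX N Z m, ∀ i j h (K : ℕ), (1 - i).toNat ≤ K → ∀ y,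
      Y.app i j h y = ∑ p ∈ Finset.range K, (b p).app i j h y := by
  let F (i j : ℤ) (h : i + m = j) : N.X i →ₗ[k] Z.X j :=
    ∑ p ∈ Finset.range (1 - i).toNat, (b p).app i j h
  have hF : ∀ i j h y, F i j h y = ∑ p ∈ Finset.range (1 - i).toNat, (b p).app i j h y :=
    fun i j h y => LinearMap.sum_apply _ _ y
  refine ⟨⟨fun p => F p.1.1 p.1.2 p.2, ?_⟩, ?_⟩
  · intro i j l il jl h₁ h₂ h₃ x a
    refine map_act_of_degree_zero F ?_ i j l il jl h₁ h₂ h₃ (by omega) x a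
    intro i j h y a
    refine (hF i j h _).trans (Eq.trans ?_ (congrArg (Z.act j 0 j (add_zero j) · a) (hF i j h y)).symm)
    refine Eq.trans ?_ (map_sum ((Z.act j 0 j (add_zero j)).flip a) _ _).symm
    refine Finset.sum_congr rfl fun p hp => ?_
    exact HomX.app_act (b p) i j 0 i j h (add_zero i) (add_zero j) h y a
  · intro i j h K hK y
    refine (hF i j h y).trans (Finset.sum_subset (by simpa using hK) fun p hp hp' => ?_)
    refine hb p i j h y ?_
    simp only [Finset.mem_range] at hp'
    omega

theorem exists_homD_eq (m n : ℤ) (hn : m + 1 = n) (g : ℕ → HomX N Z n) (b : ℕ → HomX N Z m)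
    (hg : ∀ (p : ℕ) i j h y, 1 - (p : ℤ) ≤ i → (g p).app i j h y = 0)
    (hb : ∀ (p : ℕ) i j h y, 1 - (p : ℤ) ≤ i → (b p).app i j h y = 0)
    (h : ∀ p, homD N Z m n hn (b p) = g p - g (p + 1)) :
    ∃ Y : HomX N Z m, homD N Z m n hn Y = g 0 := by
  obtain ⟨Y, hY⟩ := exists_sum_homX N b hb
  refine ⟨Y, HomX.ext fun i j hij y => ?_⟩
  have hj : j - 1 + 1 = j := by omega
  rw [homD_app N Z m n hn Y i j (i + 1) (j - 1) hij rfl (by omega) y,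
    hY i (j - 1) _ (1 - i).toNat le_rfl, hY (i + 1) j _ (1 - i).toNat (by omega), map_sum,
    Finset.smul_sum, ← Finset.sum_sub_distrib]
  have key : ∀ p, Z.d (j - 1) j hj ((b p).app i (j - 1) (by omega) y) -
      m.negOnePow • (b p).app (i + 1) j (by omega) (N.d i (i + 1) rfl y) =
        (g p).app i j hij y - (g (p + 1)).app i j hij y := by
    intro p
    rw [← homD_app N Z m n hn _ i j (i + 1) (j - 1) hij rfl (by omega) y, h]
    rfl
  rw [Finset.sum_congr rfl fun p _ => key p, Finset.sum_range_sub' (fun p => (g p).app i j hij y),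
    hg (1 - i).toNat i j hij y (by omega), sub_zero]

theorem acyclic_homObj (hN : ∀ j : ℤ, 0 < j → ∀ y : N.X j, y = 0)
    (c : ∀ j, N.X j →ₗ[k] N.X j ⊗[k] (ofAlgebra k A).X 0)
    (hc : ∀ j a y, c j (N.act j 0 j (add_zero j) y a) =
      (((ofAlgebra k A).mul 0 0 0 rfl).flip a).lTensor (N.X j) (c j y))
    (hc' : ∀ j y, cornerAct N e j (c j y) = y) (hZ : CornerAcyclic e Z) :
    (homObj N Z).Acyclic := by
  obtain ⟨s, hs⟩ := hZ
  obtain ⟨σ, hσ⟩ := exists_homHtpy N s c hc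
  intro n f hf
  have hf : homD N Z n (n + 1) rfl f = 0 := hf
  obtain ⟨g, hg0, hg⟩ : ∃ g : ℕ → HomX N Z n, g 0 = f ∧
      ∀ p, g (p + 1) = g p - homD N Z (n - 1) n (by omega) (σ n (n - 1) (by omega) (g p)) :=
    ⟨fun p => (fun f => f - homD N Z (n - 1) n (by omega) (σ n (n - 1) (by omega) f))^[p] f, rfl,
      fun p => Function.iterate_succ_apply' _ p f⟩
  have hgd : ∀ p, homD N Z n (n + 1) rfl (g p) = 0 := by
    intro p
    induction p with
    | zero => rw [hg0, hf]
    | succ p ih =>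
      rw [hg, map_sub, ih, homD_homD, sub_zero]
  have hg₀ : ∀ (p : ℕ) i j h y, 1 - (p : ℤ) ≤ i → (g p).app i j h y = 0 := by
    intro p
    induction p with
    | zero =>
      intro i j h y hi
      rw [hN i (by simp at hi; omega) y, map_zero]
    | succ p ih =>
      intro i j h y hi
      have hi' : 1 - (p : ℤ) ≤ i + 1 := by push_cast at hi; omega
      have h₃ := homD_htpy_app N s hs c hc' σ hσ (g p) (hgd p) i j h (fun j h y => ih _ _ _ y hi') y
      have h₄ := congrArg (fun f => HomX.app f i j h y) (hg p)
      exact h₄.trans ((congrArg ((g p).app i j h y - ·) h₃).trans (sub_self _))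
  obtain ⟨Y, hY⟩ := exists_homD_eq N (n - 1) n (sub_add_cancel n 1) g
    (fun p => σ n (n - 1) (sub_add_cancel n 1) (g p)) hg₀ (fun p i j h y hi => by
      rw [hσ n (n - 1) (sub_add_cancel n 1) (g p) i (j + 1) j h (by omega)]
      exact homHtpyAux_eq_zero N s (g p) i (j + 1) j _ _
        (LinearMap.ext fun y => hg₀ p i _ _ y hi) _)
    (fun p => by rw [hg p, sub_sub_cancel])
  exact ⟨n - 1, sub_add_cancel n 1, Y, hY.trans hg0⟩

end HomAcyclic

end Algebra


section Coordinates

variable (k) {A : Type u} [Ring A] [Algebra k A] {e : A} (he : IsIdempotentElem e)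

/-- The projection to the homogeneous elements of degree `i`. -/
noncomputable def drinGrProj (i : ℤ) : Drin k (e := e) →ₗ[k] Drin k (e := e) :=
  DirectSum.toModule k ℕ _ fun n => if (n : ℤ) + i = 0 then drinOf k n else 0

theorem drinGrProj_of_eq (i : ℤ) (n : ℕ) (h : (n : ℤ) + i = 0) (x : (tower k e n).X) :
    drinGrProj k i (drinOf k n x) = drinOf k n x :=
  (toModule_drinOf k _ n x).trans (by rw [if_pos h])

theorem drinGrProj_of_ne (i : ℤ) (n : ℕ) (h : (n : ℤ) + i ≠ 0) (x : (tower k e n).X) :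
    drinGrProj k i (drinOf k n x) = 0 :=
  (toModule_drinOf k _ n x).trans (by rw [if_neg h, LinearMap.zero_apply])

theorem drinGrProj_of_mem {i : ℤ} {x : Drin k (e := e)} (hx : x ∈ drinGr k e i) :
    drinGrProj k i x = x :=
  drinGr_induction (P := fun x => drinGrProj k i x = x) (map_zero _)
    (fun n x hn => drinGrProj_of_eq k i n hn x) x hx

theorem drinGrProj_eq_zero {i j : ℤ} (hij : j ≠ i) {x : Drin k (e := e)} (hx : x ∈ drinGr k e j) :
    drinGrProj k i x = 0 :=
  drinGr_induction (P := fun x => drinGrProj k i x = 0) (map_zero _)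
    (fun n x hn => drinGrProj_of_ne k i n (by omega) x) x hx

theorem drinGrProj_comm (T : Drin k (e := e) →ₗ[k] Drin k (e := e))
    (hT : ∀ (n : ℕ) x, T (drinOf k n x) ∈ drinGr k e (-(n : ℤ))) (i : ℤ) (x : Drin k (e := e)) :
    drinGrProj k i (T x) = T (drinGrProj k i x) := by
  refine LinearMap.congr_fun (f := drinGrProj k i ∘ₗ T) (g := T ∘ₗ drinGrProj k i)
    (DirectSum.linearMap_ext _ fun n => LinearMap.ext fun y => ?_) x
  change drinGrProj k i (T (drinOf k n y)) = T (drinGrProj k i (drinOf k n y))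
  by_cases hn : (n : ℤ) + i = 0
  · obtain rfl : i = -n := by omega
    rw [drinGrProj_of_eq k _ n hn, drinGrProj_of_mem k (hT n y)]
  · rw [drinGrProj_of_ne k _ n hn, map_zero, drinGrProj_eq_zero k (by omega) (hT n y)]

theorem drinGrProj_mem (i : ℤ) (x : Drin k (e := e)) : drinGrProj k i x ∈ drinGr k e i := by
  refine (Submodule.Quotient.mk_eq_zero _).1 (LinearMap.congr_fun
    (f := (drinGr k e i).mkQ ∘ₗ drinGrProj k i) (g := 0)
    (DirectSum.linearMap_ext _ fun n => LinearMap.ext fun y => ?_) x)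
  refine (Submodule.Quotient.mk_eq_zero _).2 ?_
  by_cases hn : (n : ℤ) + i = 0
  · rw [drinGrProj_of_eq k i n hn]
    exact drinOf_mem k n i hn y
  · rw [drinGrProj_of_ne k i n hn]
    exact zero_mem _

/-- The projection to the bar resolution. -/
noncomputable def barOf (j : ℤ) : Drin k (e := e) →ₗ[k] (barBimod k he).X j where
  toFun x := ⟨drinProj k (drinGrProj k (j - 1) x),
    drinProj_mem k (drinGrProj_mem k (j - 1) x), drinAug_proj k _⟩
  map_add' x y := Subtype.ext (map_add (drinProj k ∘ₗ drinGrProj k (j - 1)) x y)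
  map_smul' r x := Subtype.ext (map_smul (drinProj k ∘ₗ drinGrProj k (j - 1)) r x)

theorem barOf_coe (j : ℤ) (y : (barBimod k he).X j) : barOf k he j y.1 = y :=
  Subtype.ext ((congrArg (drinProj k) (drinGrProj_of_mem k y.2.1)).trans
    (drinProj_of_aug k y.2.2))

theorem barOf_L (j : ℤ) (a : (ofAlgebra k A).X 0) (x : Drin k (e := e)) :
    barOf k he j (drinL k a.1 x) = (barBimod k he).lact 0 j j (zero_add j) a (barOf k he j x) := by
  refine Subtype.ext ((congrArg (drinProj k) (drinGrProj_comm k (drinL k a.1) ?_ (j - 1) x)).trans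
    (drinProj_L k a.1 _))
  intro n x
  exact drinL_mem k a.1 (drinOf_mem k n _ (by omega) x)

theorem barOf_mul (j : ℤ) (a : (ofAlgebra k A).X 0) (x : Drin k (e := e)) :
    barOf k he j (drinMul k he x (drinUnit k a.1)) =
      (barBimod k he).act j 0 j (add_zero j) (barOf k he j x) a := by
  refine Subtype.ext ((congrArg (drinProj k) (drinGrProj_comm k
    ((drinMul k he).flip (drinUnit k a.1)) ?_ (j - 1) x)).trans (drinProj_mul_unit k he a.1 _))
  intro n x
  exact drinMul_mem k he (add_zero _) (drinOf_mem k n _ (by omega) x) (drinUnit_mem k a.1)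

/-- The map `ae ⊗ x ↦ ae ⊗ (e ⊗ x)`. -/
noncomputable def towerCoordL : ∀ n, (tower k e n).X →ₗ[k] A ⊗[k] Drin k (e := e)
  | 0 => 0
  | n + 1 => tauLift k ((TensorProduct.mk k A (Drin k (e := e))).compl₂
      (drinH k he 1 ∘ₗ drinOf k n))

/-- The map `H a x ↦ ae ⊗ H 1 x`. -/
noncomputable def drinCoordL : Drin k (e := e) →ₗ[k] A ⊗[k] Drin k (e := e) :=
  DirectSum.toModule k ℕ _ (towerCoordL k he)

theorem drinCoordL_unit (a : A) : drinCoordL k he (drinUnit k a) = 0 :=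
  toModule_drinOf k (towerCoordL k he) 0 a

theorem drinCoordL_H (a : A) (x : Drin k (e := e)) :
    drinCoordL k he (drinH k he a x) = (a * e) ⊗ₜ drinH k he 1 x := by
  refine LinearMap.congr_fun (f := drinCoordL k he ∘ₗ drinH k he a)
    (g := TensorProduct.mk k A _ (a * e) ∘ₗ drinH k he 1)
    (DirectSum.linearMap_ext _ fun n => LinearMap.ext fun y => ?_) x
  refine (congrArg (drinCoordL k he) (drinH_of k he a n y)).trans ?_
  refine (toModule_drinOf k (towerCoordL k he) (n + 1) _).trans ?_
  refine (tauLift_tau k he _ a y).trans (congrArg ((a * e) ⊗ₜ ·) ?_)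
  exact (congrArg (drinH k he 1) (drinL_of k e n y).symm).trans (drinH_corner k he 1 _)

theorem drinCoordL_L (b : A) (x : Drin k (e := e)) : drinCoordL k he (drinL k b x) =
    (LinearMap.mulLeft k b).rTensor _ (drinCoordL k he x) := by
  refine LinearMap.congr_fun (f := drinCoordL k he ∘ₗ drinL k b)
    (g := (LinearMap.mulLeft k b).rTensor _ ∘ₗ drinCoordL k he)
    (drin_ext he (fun a => ?_) fun a x hx => ?_) x
  · change drinCoordL k he (drinL k b (drinUnit k a)) =
      (LinearMap.mulLeft k b).rTensor _ (drinCoordL k he (drinUnit k a))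
    rw [drinL_unit, drinCoordL_unit, drinCoordL_unit, map_zero]
  · change drinCoordL k he (drinL k b (drinH k he a x)) =
      (LinearMap.mulLeft k b).rTensor _ (drinCoordL k he (drinH k he a x))
    rw [drinL_H, drinCoordL_H, drinCoordL_H, mul_assoc]
    rfl

theorem lift_drinCoordL (x : Drin k (e := e)) :
    TensorProduct.lift (drinL k ∘ₗ LinearMap.mulRight k e) (drinCoordL k he x) = drinProj k x := by
  refine LinearMap.congr_fun
    (f := TensorProduct.lift (drinL k ∘ₗ LinearMap.mulRight k e) ∘ₗ drinCoordL k he)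
    (g := drinProj k) (drin_ext he (fun a => ?_) fun a x hx => ?_) x
  · change TensorProduct.lift (drinL k ∘ₗ LinearMap.mulRight k e) (drinCoordL k he (drinUnit k a)) =
      drinProj k (drinUnit k a)
    rw [drinCoordL_unit, map_zero, drinProj_unit]
  · change TensorProduct.lift (drinL k ∘ₗ LinearMap.mulRight k e)
      (drinCoordL k he (drinH k he a x)) = drinProj k (drinH k he a x)
    rw [drinCoordL_H, drinProj_of_aug k (drinAug_H k he a x)]
    change drinL k (a * e * e) (drinH k he 1 x) = _
    rw [drinL_H, mul_one, drinH_mul_corner, drinH_mul_corner]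

theorem acyclic_tensor_bar {Z : DGMod (ofAlgebra k A)} (hZ : CornerAcyclic e Z) :
    (tensorObj Z (barBimod k he)).Acyclic := by
  refine acyclic_tensorObj (barBimod k he) (fun j hj y => ?_)
    (fun j => TensorProduct.map (algElt k) (barOf k he j) ∘ₗ drinCoordL k he ∘ₗ
      (barGr k e j).subtype) (fun j a y => ?_) (fun j y => ?_) hZ
  · refine Subtype.ext (DFinsupp.ext fun n => ?_)
    by_cases hn : n = 0
    · subst hn
      exact y.2.2
    · exact y.2.1 n (by omega)
  · refine (congrArg (TensorProduct.map (algElt k) (barOf k he j))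
      (drinCoordL_L k he a.1 y.1)).trans ?_
    change _ = LinearMap.rTensor _ _ (TensorProduct.map (algElt k) (barOf k he j)
      (drinCoordL k he y.1))
    generalize drinCoordL k he y.1 = t
    refine TensorProduct.induction_on t ?_ (fun b y => rfl) (fun t t' ht ht' => ?_)
    · simp only [map_zero]
    · simp only [map_add, ht, ht']
  · have key : ∀ t, cornerLact (barBimod k he) e j
        (TensorProduct.map (algElt k) (barOf k he j) t) =
          barOf k he j (TensorProduct.lift (drinL k ∘ₗ LinearMap.mulRight k e) t) := by
      intro t
      refine TensorProduct.induction_on t ?_ (fun b y => ?_) (fun t t' ht ht' => ?_)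
      · simp only [map_zero]
      · exact (barOf_L k he j (algElt k (b * e)) y).symm
      · simp only [map_add, ht, ht']
    refine (key _).trans ?_
    refine (congrArg (barOf k he j) (lift_drinCoordL k he y.1)).trans ?_
    exact (congrArg (barOf k he j) (drinProj_of_aug k y.2.2)).trans (barOf_coe k he j y)

/-- The map `ae ⊗ x ↦ (a ⊗ 1) x` on components. -/
noncomputable def towerCoordR : ∀ n, (tower k e n).X →ₗ[k] Drin k (e := e) ⊗[k] A
  | 0 => TensorProduct.mk k (Drin k (e := e)) A (drinUnit k 1)
  | n + 1 => tauLift k ((LinearMap.rTensorHom A ∘ₗ drinH k he).compl₂ (towerCoordR n))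

/-- The map that splits off the last factor. -/
noncomputable def drinCoordR : Drin k (e := e) →ₗ[k] Drin k (e := e) ⊗[k] A :=
  DirectSum.toModule k ℕ _ (towerCoordR k he)

theorem drinCoordR_unit (a : A) : drinCoordR k he (drinUnit k a) = drinUnit k 1 ⊗ₜ a :=
  toModule_drinOf k (towerCoordR k he) 0 a

theorem drinCoordR_H (a : A) (x : Drin k (e := e)) : drinCoordR k he (drinH k he a x) =
    (drinH k he a).rTensor A (drinCoordR k he (drinL k e x)) := by
  refine LinearMap.congr_fun (f := drinCoordR k he ∘ₗ drinH k he a)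
    (g := (drinH k he a).rTensor A ∘ₗ drinCoordR k he ∘ₗ drinL k e)
    (DirectSum.linearMap_ext _ fun n => LinearMap.ext fun y => ?_) x
  refine (congrArg (drinCoordR k he) (drinH_of k he a n y)).trans ?_
  refine (toModule_drinOf k (towerCoordR k he) (n + 1) _).trans ?_
  refine (tauLift_tau k he _ a y).trans ?_
  change (drinH k he (a * e)).rTensor A (towerCoordR k he n (e • y)) =
    (drinH k he a).rTensor A (drinCoordR k he (drinL k e (drinOf k n y)))
  rw [drinL_of, show drinH k he (a * e) = drinH k he a from
    LinearMap.ext (drinH_mul_corner k he a)]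
  exact congrArg _ (toModule_drinOf k (towerCoordR k he) n _).symm

theorem drinCoordR_mul (b : A) (x : Drin k (e := e)) :
    drinCoordR k he (drinMul k he x (drinUnit k b)) =
      (LinearMap.mulRight k b).lTensor _ (drinCoordR k he x) := by
  have h : ∀ n (y : (tower k e n).X), drinCoordR k he (drinMul k he (drinOf k n y) (drinUnit k b)) =
      (LinearMap.mulRight k b).lTensor _ (drinCoordR k he (drinOf k n y)) := by
    intro n
    induction n with
    | zero =>
      intro (y : A)
      change drinCoordR k he (drinMul k he (drinUnit k y) (drinUnit k b)) =
        (LinearMap.mulRight k b).lTensor _ (drinCoordR k he (drinUnit k y))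
      rw [drinMul_unit, drinL_unit, drinCoordR_unit, drinCoordR_unit]
      rfl
    | succ n ih =>
      refine LinearMap.congr_fun (f := drinCoordR k he ∘ₗ (drinMul k he).flip (drinUnit k b) ∘ₗ
        drinOf k (n + 1)) (g := (LinearMap.mulRight k b).lTensor _ ∘ₗ drinCoordR k he ∘ₗ
          drinOf k (n + 1)) (towerTau_ext he fun a x => ?_)
      change drinCoordR k he (drinMul k he (drinOf k (n + 1) (towerTau k he n a x))
        (drinUnit k b)) = (LinearMap.mulRight k b).lTensor _
          (drinCoordR k he (drinOf k (n + 1) (towerTau k he n a x)))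
      rw [← drinH_of, drinMul_H, drinCoordR_H, ← drinMul_L, drinCoordR_H, drinL_of, ih]
      generalize drinCoordR k he (drinOf k n (e • x)) = t
      refine TensorProduct.induction_on t ?_ (fun b y => rfl) (fun t t' ht ht' => ?_)
      · simp only [map_zero]
      · simp only [map_add, ht, ht']
  exact LinearMap.congr_fun (f := drinCoordR k he ∘ₗ (drinMul k he).flip (drinUnit k b))
    (g := (LinearMap.mulRight k b).lTensor _ ∘ₗ drinCoordR k he)
    (DirectSum.linearMap_ext _ fun n => LinearMap.ext (h n)) x

/-- The map `x ⊗ a ↦ x e a`. -/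
noncomputable def drinCornerAct : Drin k (e := e) ⊗[k] A →ₗ[k] Drin k (e := e) :=
  TensorProduct.lift ((drinMul k he).compl₂ (drinUnit k ∘ₗ LinearMap.mulLeft k e))

theorem drinCornerAct_H (a : A) (t : Drin k (e := e) ⊗[k] A) :
    drinCornerAct k he ((drinH k he a).rTensor A t) = drinH k he a (drinCornerAct k he t) := by
  refine TensorProduct.induction_on t ?_ (fun x b => ?_) (fun t t' ht ht' => ?_)
  · simp only [map_zero]
  · exact drinMul_H k he a x _
  · simp only [map_add, ht, ht']

theorem drinH_cornerAct (x : Drin k (e := e)) :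
    drinH k he 1 (drinCornerAct k he (drinCoordR k he (drinL k e x))) = drinH k he 1 x := by
  refine LinearMap.congr_fun (f := drinH k he 1 ∘ₗ drinCornerAct k he ∘ₗ drinCoordR k he ∘ₗ drinL k e)
    (g := drinH k he 1) (drin_ext he (fun a => ?_) fun a x hx => ?_) x
  · change drinH k he 1 (drinCornerAct k he (drinCoordR k he (drinL k e (drinUnit k a)))) =
      drinH k he 1 (drinUnit k a)
    rw [drinL_unit, drinCoordR_unit]
    change drinH k he 1 (drinMul k he (drinUnit k 1) (drinUnit k (e * (e * a)))) = _
    rw [drinMul_unit, drinL_one, ← drinL_unit, drinH_corner, ← drinL_unit, drinH_corner]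
  · change drinH k he 1 (drinCornerAct k he (drinCoordR k he (drinL k e x))) =
      drinH k he 1 x at hx
    change drinH k he 1 (drinCornerAct k he (drinCoordR k he (drinL k e (drinH k he a x)))) =
      drinH k he 1 (drinH k he a x)
    rw [drinL_H, drinCoordR_H, drinCornerAct_H, ← mul_one (e * a), ← drinL_H, hx, drinL_H, mul_one,
      ← drinL_H, drinH_corner]

theorem drinCornerAct_coordR (x : Drin k (e := e)) (hx : drinAug k x = 0) :
    drinCornerAct k he (drinCoordR k he x) = x := by
  have key : drinProj k x = drinCornerAct k he (drinCoordR k he (drinProj k x)) := by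
    refine LinearMap.congr_fun (f := drinProj k)
      (g := drinCornerAct k he ∘ₗ drinCoordR k he ∘ₗ drinProj k)
      (drin_ext he (fun a => ?_) fun a x _ => ?_) x
    · change drinProj k (drinUnit k a) =
        drinCornerAct k he (drinCoordR k he (drinProj k (drinUnit k a)))
      rw [drinProj_unit, map_zero, map_zero]
    · change drinProj k (drinH k he a x) =
        drinCornerAct k he (drinCoordR k he (drinProj k (drinH k he a x)))
      rw [drinProj_of_aug k (drinAug_H k he a x), drinCoordR_H, drinCornerAct_H]
      conv_rhs => rw [← mul_one a, ← drinL_H, drinH_cornerAct, drinL_H, mul_one]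
  rw [drinProj_of_aug k hx] at key
  exact key.symm

theorem acyclic_hom_bar {Z : DGMod (ofAlgebra k A)} (hZ : CornerAcyclic e Z) :
    (homObj (barBimod k he) Z).Acyclic := by
  refine acyclic_homObj (barBimod k he) (fun j hj y => ?_)
    (fun j => TensorProduct.map (barOf k he j) (algElt k) ∘ₗ drinCoordR k he ∘ₗ
      (barGr k e j).subtype) (fun j a y => ?_) (fun j y => ?_) hZ
  · refine Subtype.ext (DFinsupp.ext fun n => ?_)
    by_cases hn : n = 0
    · subst hn
      exact y.2.2
    · exact y.2.1 n (by omega)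
  · refine (congrArg (TensorProduct.map (barOf k he j) (algElt k))
      (drinCoordR_mul k he a.1 y.1)).trans ?_
    change _ = LinearMap.lTensor _ _ (TensorProduct.map (barOf k he j) (algElt k)
      (drinCoordR k he y.1))
    generalize drinCoordR k he y.1 = t
    refine TensorProduct.induction_on t ?_ (fun b y => rfl) (fun t t' ht ht' => ?_)
    · simp only [map_zero]
    · simp only [map_add, ht, ht']
  · have key : ∀ t, cornerAct (barBimod k he) e j
        (TensorProduct.map (barOf k he j) (algElt k) t) =
          barOf k he j (drinCornerAct k he t) := by
      intro t
      refine TensorProduct.induction_on t ?_ (fun y b => ?_) (fun t t' ht ht' => ?_)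
      · simp only [map_zero]
      · exact (barOf_mul k he j (algElt k (e * b)) y).symm
      · simp only [map_add, ht, ht']
    refine (key _).trans ?_
    exact (congrArg (barOf k he j) (drinCornerAct_coordR k he y.1 y.2.2)).trans (barOf_coe k he j y)

end Coordinates


/-! ### The functors between modules over `A` and over the corner ring -/

section Corner

variable (k) {A : Type u} [Ring A] [Algebra k A] {e : A} (he : IsIdempotentElem e)

/-- The bimodule `eA`. -/
abbrev rowBimod : DGBimod (corner k e he) (ofAlgebra k A) :=
  cornerBimod k e 1 he IsIdempotentElem.one

/-- The bimodule `Ae`. -/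
abbrev colBimod : DGBimod (ofAlgebra k A) (corner k e he) :=
  cornerBimod k 1 e IsIdempotentElem.one he

/-- The idempotent `e` as an element of `eA`. -/
def rowOne : (rowBimod k he).X 0 := ⟨e, he, mul_one e, fun h => absurd rfl h⟩

/-- The idempotent `e` as an element of `Ae`. -/
def colOne : (colBimod k he).X 0 := ⟨e, one_mul e, he, fun h => absurd rfl h⟩

/-- The inclusion of `eA` in `A`. -/
def rowIncl (i : ℤ) : (rowBimod k he).X i →ₗ[k] (ofAlgebra k A).X i where
  toFun y := ⟨y.1, one_mul _, mul_one _, y.2.2.2⟩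
  map_add' _ _ := rfl
  map_smul' _ _ := rfl

/-- The inclusion of `Ae` in `A`. -/
def colIncl (i : ℤ) : (colBimod k he).X i →ₗ[k] (ofAlgebra k A).X i where
  toFun y := ⟨y.1, one_mul _, mul_one _, y.2.2.2⟩
  map_add' _ _ := rfl
  map_smul' _ _ := rfl

variable {k} {Z : DGMod (ofAlgebra k A)}

theorem homX_row_app {n : ℤ} (f : HomX (rowBimod k he) Z n) (i j : ℤ) (h : i + n = j)
    (h' : n + i = j) (y : (rowBimod k he).X i) :
    Z.act n i j h' (f.app 0 n (zero_add n) (rowOne k he)) (rowIncl k he i y) = f.app i j h y := by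
  refine (f.app_act 0 n i i j (zero_add n) (zero_add i) h' h (rowOne k he)
    (rowIncl k he i y)).symm.trans (congrArg (f.app i j h) ?_)
  exact Subtype.ext y.2.1

/-- The map `y ↦ xy` on `eA`. -/
def rowMul (n : ℤ) : Z.X n →ₗ[k] HomX (rowBimod k he) Z n where
  toFun x := ⟨fun p => Z.act n p.1.1 p.1.2 (by have := p.2; omega) x ∘ₗ rowIncl k he p.1.1, by
    intro i j l il jl h₁ h₂ h₃ y c
    exact (Z.act_act n i l j il jl (by omega) h₂ h₃ (by omega) x (rowIncl k he i y) c).symm⟩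
  map_add' x x' := by
    apply HomX.ext
    intro i j h y
    exact (Z.act n i j (by omega)).map_add₂ x x' _
  map_smul' r x := by
    apply HomX.ext
    intro i j h y
    exact (Z.act n i j (by omega)).map_smul₂ r x _

theorem rowMul_app (n i j : ℤ) (h : i + n = j) (h' : n + i = j) (x : Z.X n)
    (y : (rowBimod k he).X i) :
    (rowMul he n x).app i j h y = Z.act n i j h' x (rowIncl k he i y) := rfl

theorem d_act_algebra' (n i j n' j' : ℤ) (h : n + i = j) (hn : n + 1 = n') (hj : j + 1 = j')
    (x : Z.X n) (a : (ofAlgebra k A).X i) : Z.d j j' hj (Z.act n i j h x a) =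
      Z.act n' i j' (by omega) (Z.d n n' hn x) a := by
  refine (Z.d_act n i j n' (i + 1) j' h hn rfl hj x a).trans ?_
  refine (congrArg (Z.act n' i j' _ (Z.d n n' hn x) a + ·) ?_).trans (add_zero _)
  exact (congrArg (n.negOnePow • ·) (map_zero (Z.act n (i + 1) j' (by omega) x))).trans (smul_zero _)

theorem homD_row (n n' : ℤ) (hn : n + 1 = n') (f : HomX (rowBimod k he) Z n) (i j j' : ℤ)
    (h : i + n' = j) (hj : i + n = j') (y : (rowBimod k he).X i) :
    (homD (rowBimod k he) Z n n' hn f).app i j h y = Z.d j' j (by omega) (f.app i j' hj y) := by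
  rw [homD_app (rowBimod k he) Z n n' hn f i j (i + 1) j' h rfl hj y]
  refine (congrArg (Z.d j' j (by omega) (f.app i j' hj y) - ·) ?_).trans (sub_zero _)
  exact (congrArg (n.negOnePow • ·) (map_zero (f.app (i + 1) j (by omega)))).trans (smul_zero _)

theorem homD_rowMul (n n' : ℤ) (hn : n + 1 = n') (x : Z.X n) :
    homD (rowBimod k he) Z n n' hn (rowMul he n x) = rowMul he n' (Z.d n n' hn x) := by
  apply HomX.ext
  intro i j h y
  rw [homD_row he n n' hn _ i j (i + n) h rfl, rowMul_app he n i (i + n) rfl (add_comm _ _),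
    rowMul_app he n' i j h (by omega), d_act_algebra' n i (i + n) n' j (add_comm _ _) hn]

theorem rowMul_app_rowOne {n : ℤ} (f : HomX (rowBimod k he) Z n) :
    rowMul he n (f.app 0 n (zero_add n) (rowOne k he)) = f := by
  apply HomX.ext
  intro i j h y
  exact homX_row_app he f i j h (by omega) y

theorem rowMul_act_corner (n : ℤ) (x : Z.X n) :
    rowMul he n (Z.act n 0 n (add_zero n) x (algElt k e)) = rowMul he n x :=
  rowMul_app_rowOne he (rowMul he n x)

theorem cornerAcyclic_iff :
    CornerAcyclic e Z ↔ (homObj (rowBimod k he) Z).Acyclic := by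
  constructor
  · rintro ⟨s, hs⟩ n f hf
    have hf : homD (rowBimod k he) Z n (n + 1) rfl f = 0 := hf
    refine ⟨n - 1, by omega, rowMul he (n - 1) (s n (n - 1) (by omega)
      (f.app 0 n (zero_add n) (rowOne k he))), ?_⟩
    refine (homD_rowMul he (n - 1) n (by omega) _).trans ?_
    have h₁ := hs n (n - 1) (n + 1) (by omega) rfl (f.app 0 n (zero_add n) (rowOne k he))
    rw [← homD_row he n (n + 1) rfl f 0 (n + 1) n (zero_add _) (zero_add _), hf, HomX.app_zero,
      LinearMap.zero_apply, map_zero, add_zero] at h₁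
    rw [h₁, rowMul_act_corner]
    exact rowMul_app_rowOne he f
  · intro h
    obtain ⟨t, ht⟩ := h.exists_contraction
    let t' (i j : ℤ) (h : j + 1 = i) : HomX (rowBimod k he) Z i →ₗ[k] HomX (rowBimod k he) Z j :=
      t i j h
    have ht' : ∀ (i j l : ℤ) (h : j + 1 = i) (h' : i + 1 = l) (f : HomX (rowBimod k he) Z i),
      homD (rowBimod k he) Z j i h (t' i j h f) + t' l i h' (homD (rowBimod k he) Z i l h' f) = f :=
      ht
    let ev (i : ℤ) : HomX (rowBimod k he) Z i →ₗ[k] Z.X i :=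
      { toFun := fun f => f.app 0 i (zero_add i) (rowOne k he)
        map_add' := fun f g => rfl
        map_smul' := fun r f => rfl }
    refine ⟨fun i j h => ev j ∘ₗ t' i j h ∘ₗ rowMul he i, fun i j l h h' x => ?_⟩
    have h₁ : Z.d j i h (ev j (t' i j h (rowMul he i x))) =
        ev i (homD (rowBimod k he) Z j i h (t' i j h (rowMul he i x))) :=
      (homD_row he j i h _ 0 i j (zero_add i) (zero_add j) _).symm
    refine (congrArg (· + ev i (t' l i h' (rowMul he l (Z.d i l h' x)))) h₁).trans ?_
    rw [← homD_rowMul he i l h', ← map_add, ht']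
    rfl

theorem CornerAcyclic.of_acyclic (hZ : Z.Acyclic) : CornerAcyclic e Z := by
  obtain ⟨s, hs⟩ := hZ.exists_contraction
  refine ⟨fun i j h => s i j h ∘ₗ (Z.act i 0 i (add_zero i)).flip (algElt k e),
    fun i j l h h' x => ?_⟩
  refine Eq.trans ?_ (hs i j l h h' (Z.act i 0 i (add_zero i) x (algElt k e)))
  rw [d_act_algebra]
  rfl

variable (k)

/-- The pairing `Z × Ae → Hom(eA, Z)`. -/
def colRowPairing (Z : DGMod (ofAlgebra k A)) :
    Pairing Z (colBimod k he) (homObj (rowBimod k he) Z) where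
  φ i j n h := ((Z.act i j n h).compl₂ (colIncl k he j)).compr₂ (rowMul he n)
  balanced i j l ij jl n h₁ h₂ h₃ h₄ x a y :=
    congrArg (rowMul he n) (Z.act_act i j l ij jl n h₁ h₂ h₃ h₄ x a (colIncl k he l y))
  comm i j n i' j' n' h hi hj hn x y := by
    refine (homD_rowMul he n n' hn _).trans ?_
    have h₀ : i.negOnePow • rowMul he n' (Z.act i j' n' (by omega) x 0) = 0 := by
      rw [map_zero, map_zero, smul_zero]
    refine Eq.trans ?_ (congrArg (rowMul he n' (Z.act i' j n' (by omega) (Z.d i i' hi x)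
      (colIncl k he j y)) + ·) h₀.symm)
    exact (congrArg (rowMul he n') (d_act_algebra' i j n i' n' h hi hn x _)).trans (add_zero _).symm
  map_act i j n l n' jl h hn hj x y c := by
    apply HomX.ext
    intro p q hq z
    refine Eq.trans ?_ (homAct_app (rowBimod k he) Z n l n' hn _ c p q (l + p) hq rfl z).symm
    refine Eq.trans (rowMul_app he n' p q hq (by omega) _ z) ?_
    refine Eq.trans ?_ (rowMul_app he n (l + p) q (by omega) (by omega) _ _).symm
    refine (Z.act_act i jl p n' (j + (l + p)) q (by omega) (by omega) _ (by omega) x _ _).trans ?_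
    refine Eq.trans ?_ (Z.act_act i j (l + p) n (j + (l + p)) q h rfl _ (by omega) x _ _).symm
    exact congrArg (Z.act i (j + (l + p)) q (by omega) x) (Subtype.ext (mul_assoc y.1 c.1 z.1))

theorem colRow_bijective (Z : DGMod (ofAlgebra k A)) (n : ℤ) :
    Function.Bijective ((colRowPairing k he Z).lift.f n) := by
  let inv : HomX (rowBimod k he) Z n →ₗ[k] TensorX Z (colBimod k he) n :=
    { toFun := fun f => tmul Z (colBimod k he) n 0 n (add_zero n)
        (f.app 0 n (zero_add n) (rowOne k he)) (colOne k he)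
      map_add' := fun f g => (tmul Z (colBimod k he) n 0 n (add_zero n)).map_add₂ _ _ _
      map_smul' := fun r f => (tmul Z (colBimod k he) n 0 n (add_zero n)).map_smul₂ r _ _ }
  refine bijective_of_inverse inv (fun t => ?_) (fun f => ?_)
  · refine LinearMap.congr_fun (f := inv ∘ₗ (colRowPairing k he Z).lift.f n) (g := LinearMap.id)
      (tensor_ext fun i j h x y => ?_) t
    refine (congrArg inv ((colRowPairing k he Z).lift_tmul i j n h x y)).trans ?_
    change tmul Z (colBimod k he) n 0 n (add_zero n) (Z.act n 0 n (add_zero n)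
      (Z.act i j n h x (colIncl k he j y)) (algElt k e)) (colOne k he) =
        tmul Z (colBimod k he) i j n h x y
    refine (congrArg (fun z => tmul Z (colBimod k he) n 0 n (add_zero n) z (colOne k he))
      (Z.act_act i j 0 n j n h (add_zero j) _ h x _ _)).trans ?_
    refine (tmul_act Z (colBimod k he) i j 0 n j n h (add_zero j) _ h x _ _).trans ?_
    refine congrArg (tmul Z (colBimod k he) i j n h x) (Subtype.ext ?_)
    exact (congrArg (· * e) y.2.2.1).trans y.2.2.1
  · refine ((colRowPairing k he Z).lift_tmul n 0 n (add_zero n) _ (colOne k he)).trans ?_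
    exact (rowMul_act_corner he n _).trans (rowMul_app_rowOne he f)

/-- The functors `- ⊗_A Ae` and `Hom_A(eA, -)` agree. -/
noncomputable def colRowIso : tensorFunctor (colBimod k he) ≅ homFunctor (rowBimod k he) :=
  NatIso.ofComponents (fun Z => DGMod.isoOfBijective (colRowPairing k he Z).lift
    (colRow_bijective k he Z)) (fun {Z Z'} φ => by
    apply tensorObj_hom_ext
    intro i j n h x y
    refine (congrArg ((colRowPairing k he Z').lift.f n) (tensorMap_tmul _ φ i j n h x y)).trans ?_
    refine ((colRowPairing k he Z').lift_tmul i j n h _ y).trans ?_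
    refine Eq.trans ?_ (congrArg (((homFunctor (rowBimod k he)).map φ).f n)
      ((colRowPairing k he Z).lift_tmul i j n h x y)).symm
    apply HomX.ext
    intro p q hq z
    refine (rowMul_app he n p q hq (by omega) _ z).trans ?_
    refine Eq.trans ?_ (φ.map_act n p q (by omega) (Z.act i j n h x (colIncl k he j y))
      (rowIncl k he p z)).symm
    exact congrArg (fun w => Z'.act n p q (by omega) w (rowIncl k he p z))
      (φ.map_act i j n h x _).symm)

/-- The map `a ↦ ea` from `Ae` to the corner ring, or `a ↦ ae` from `eA` to the corner ring. -/
def rowToCorner (i : ℤ) : (rowBimod k he).X i →ₗ[k] (corner k e he).X i where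
  toFun y := ⟨y.1 * e, by rw [← mul_assoc, y.2.1], by rw [mul_assoc, he],
    fun h => by rw [y.2.2.2 h, zero_mul]⟩
  map_add' x y := Subtype.ext (add_mul x.1 y.1 e)
  map_smul' r x := Subtype.ext (smul_mul_assoc r x.1 e)

/-- The map `a ↦ ea` from `Ae` to the corner ring. -/
def colToCorner (i : ℤ) : (colBimod k he).X i →ₗ[k] (corner k e he).X i where
  toFun y := ⟨e * y.1, by rw [← mul_assoc, he], by rw [mul_assoc, y.2.2.1],
    fun h => by rw [y.2.2.2 h, mul_zero]⟩
  map_add' x y := Subtype.ext (mul_add e x.1 y.1)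
  map_smul' r x := Subtype.ext (mul_smul_comm r e x.1)

/-- The unit `N ⟶ Hom_A(eA, N ⊗ eA)` is an isomorphism. -/
theorem cornerUnit_bijective (N : DGMod (corner k e he)) (n : ℤ) :
    Function.Bijective ((tensorPairing N (rowBimod k he)).curry.f n) := by
  let γ : TensorX N (rowBimod k he) n →ₗ[k] N.X n :=
    tensorLift (fun i j h => (N.act i j n h).compl₂ (rowToCorner k he j))
      (fun i j l ij jl h₁ h₂ h₃ h₄ x a y => by
        refine (N.act_act i j l ij jl n h₁ h₂ h₃ h₄ x a _).trans ?_
        exact congrArg (N.act i jl n h₄ x) (Subtype.ext (mul_assoc a.1 y.1 e).symm))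
  have hγ : ∀ i j h x y, γ (tmul N (rowBimod k he) i j n h x y) =
      N.act i j n h x (rowToCorner k he j y) := fun i j h x y =>
    tensorLift_tmul N (rowBimod k he) _ _ i j h x y
  refine bijective_of_inverse (fun f => γ (HomX.app (N := rowBimod k he)
    (P := tensorObj N (rowBimod k he)) f 0 n (zero_add n) (rowOne k he))) (fun x => ?_) (fun f => ?_)
  · refine (hγ n 0 (add_zero n) x (rowOne k he)).trans ?_
    refine Eq.trans ?_ (N.act_one n x)
    exact congrArg (N.act n 0 n (add_zero n) x) (Subtype.ext he)
  · apply HomX.ext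
    intro i j h y
    have key : ∀ t : TensorX N (rowBimod k he) n,
        tmul N (rowBimod k he) n i j (by omega) (γ t) y =
          tensorAct N (rowBimod k he) n i j (by omega) t (rowIncl k he i y) := by
      intro t
      refine LinearMap.congr_fun (f := (tmul N (rowBimod k he) n i j (by omega)).flip y ∘ₗ γ)
        (g := (tensorAct N (rowBimod k he) n i j (by omega)).flip (rowIncl k he i y))
        (tensor_ext fun p q hpq x z => ?_) t
      refine (congrArg (fun w => tmul N (rowBimod k he) n i j (by omega) w y) (hγ p q hpq x z)).trans ?_
      refine (tmul_act N (rowBimod k he) p q i n (q + i) j hpq rfl _ (by omega) x _ y).trans ?_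
      refine Eq.trans ?_ (tensorAct_tmul N (rowBimod k he) p q n i j (q + i) hpq (by omega) rfl x z _).symm
      refine congrArg (tmul N (rowBimod k he) p (q + i) j _ x) (Subtype.ext ?_)
      exact (mul_assoc z.1 e y.1).trans (congrArg (z.1 * ·) y.2.1)
    refine (key _).trans ?_
    exact homX_row_app he (Z := tensorObj N (rowBimod k he)) f i j h (by omega) y

/-- The counit `Hom_R(Ae, N) ⊗ Ae ⟶ N` is an isomorphism. -/
theorem cornerCounit_bijective (N : DGMod (corner k e he)) (n : ℤ) :
    Function.Bijective ((evalPairing (colBimod k he) N).lift.f n) := by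
  let ν : N.X n →ₗ[k] HomX (colBimod k he) N n :=
    { toFun := fun x => ⟨fun p => N.act n p.1.1 p.1.2 (by have := p.2; omega) x ∘ₗ
        colToCorner k he p.1.1, by
        intro i j l il jl h₁ h₂ h₃ y c
        refine Eq.trans ?_ (N.act_act n i l j il jl (by omega) h₂ h₃ (by omega) x
          (colToCorner k he i y) c).symm
        exact congrArg (N.act n il jl (by omega) x) (Subtype.ext (mul_assoc e y.1 c.1).symm)⟩
      map_add' := fun x x' => by
        apply HomX.ext
        intro i j h y
        exact (N.act n i j (by omega)).map_add₂ x x' _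
      map_smul' := fun r x => by
        apply HomX.ext
        intro i j h y
        exact (N.act n i j (by omega)).map_smul₂ r x _ }
  have hν : ∀ i j h (h' : n + i = j) x y, (ν x).app i j h y =
    N.act n i j h' x (colToCorner k he i y) := fun _ _ _ _ _ _ => rfl
  let H := homObj (colBimod k he) N
  let inv : N.X n →ₗ[k] TensorX H (colBimod k he) n :=
    (tmul H (colBimod k he) n 0 n (add_zero n)).flip (colOne k he) ∘ₗ ν
  refine bijective_of_inverse inv (fun t => ?_) (fun x => ?_)
  · refine LinearMap.congr_fun (f := inv ∘ₗ (evalPairing (colBimod k he) N).lift.f n)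
      (g := LinearMap.id) (tensor_ext fun i j h f y => ?_) t
    refine (congrArg inv ((evalPairing (colBimod k he) N).lift_tmul i j n h f y)).trans ?_
    have h₁ : ν (HomX.app (N := colBimod k he) (P := N) f j n (by omega) y) =
        H.act i j n h f (colIncl k he j y) := by
      apply HomX.ext
      intro p q hq z
      refine (hν p q hq (by omega) _ z).trans ?_
      refine Eq.trans ?_ (homAct_app (colBimod k he) N i j n h f _ p q (j + p) hq rfl z).symm
      refine (HomX.app_act (N := colBimod k he) (P := N) f j n p (j + p) q _ rfl (by omega) (by omega)
        y (colToCorner k he p z)).symm.trans ?_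
      refine congrArg (HomX.app (N := colBimod k he) (P := N) f (j + p) q (by omega))
        (Subtype.ext ?_)
      exact (mul_assoc y.1 e z.1).symm.trans (congrArg (· * z.1) y.2.2.1)
    refine (congrArg (fun w => tmul H (colBimod k he) n 0 n (add_zero n) w (colOne k he)) h₁).trans ?_
    refine (tmul_act H (colBimod k he) i j 0 n j n h (add_zero j) _ h f _ _).trans ?_
    exact congrArg (tmul H (colBimod k he) i j n h f) (Subtype.ext y.2.2.1)
  · refine ((evalPairing (colBimod k he) N).lift_tmul n 0 n (add_zero n) (ν x) (colOne k he)).trans ?_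
    refine (hν 0 n (zero_add n) (add_zero n) x (colOne k he)).trans ?_
    refine Eq.trans ?_ (N.act_one n x)
    exact congrArg (N.act n 0 n (add_zero n) x) (Subtype.ext he)

/-- A module on which the class of `e` acts by zero for a given reason: right multiplication by an
element of degree `-1` with boundary `e` is a contraction. -/
theorem cornerAcyclic_res {Γ : DGA k} (l : ofAlgebra k A ⟶ Γ) (h : Γ.X (-1))
    (hh : Γ.d (-1) 0 rfl h = l.f 0 (algElt k e)) (Y : DGMod Γ) : CornerAcyclic e (resObj l Y) := by
  refine ⟨fun i j hj => i.negOnePow • (Y.act i (-1) j (by omega)).flip h, fun i j n hj hn x => ?_⟩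
  change Y.d j i hj (i.negOnePow • Y.act i (-1) j _ x h) +
    n.negOnePow • Y.act n (-1) i _ (Y.d i n hn x) h = Y.act i 0 i _ x (l.f 0 (algElt k e))
  rw [map_zsmul_unit, Y.d_act i (-1) j n 0 i _ hn rfl hj x h, hh, smul_add, units_smul_smul_self,
    show n.negOnePow = -i.negOnePow by rw [← hn, Int.negOnePow_succ], Units.neg_smul]
  abel

end Corner


theorem ChainMap.isQuasiIso_of_section {V W : DGVect k} (φ : ChainMap V W) (σ : ChainMap W V)
    (h₁ : ∀ i x, φ.f i (σ.f i x) = x)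
    (h₂ : ∀ i x, V.IsCocycle i x → V.IsBoundary i (x - σ.f i (φ.f i x))) : φ.IsQuasiIso := by
  intro i
  constructor
  · rintro x hx ⟨j, hj, y, hy⟩
    obtain ⟨z, hz⟩ := (V.isBoundary_iff i j hj _).1 (h₂ i x hx)
    refine ⟨j, hj, z + σ.f j y, ?_⟩
    rw [map_add, hz, ← σ.comm, hy, sub_add_cancel]
  · intro y hy
    refine ⟨σ.f i y, ?_, i - 1, by omega, 0, ?_⟩
    · have hy : W.d i (i + 1) rfl y = 0 := hy
      change V.d i (i + 1) rfl (σ.f i y) = 0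
      rw [← σ.comm, hy, map_zero]
    · rw [h₁, sub_self, map_zero]

section UnitMaps

variable {Λ Γ : DGA k} (f : Λ ⟶ Γ) (X : DGMod Λ)

/-- The map `x ↦ x ⊗ 1`. -/
noncomputable def tensorOne : X ⟶ resObj f (tensorObj X (bimodOfHoms f (𝟙 Γ))) where
  f n := (tmul X (bimodOfHoms f (𝟙 Γ)) n 0 n (add_zero n)).flip Γ.one
  comm i j h x := by
    refine Eq.symm ((tensorD_tmul X (bimodOfHoms f (𝟙 Γ)) i 0 i j j 1 (add_zero i) h h rfl x
      Γ.one).trans ?_)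
    refine (congrArg (tmul X (bimodOfHoms f (𝟙 Γ)) j 0 j (add_zero j) (X.d i j h x) Γ.one + ·)
      ?_).trans (add_zero _)
    refine (congrArg (fun z => i.negOnePow • tmul X (bimodOfHoms f (𝟙 Γ)) i 1 j h x z)
      (Γ.d_one 1 rfl)).trans ?_
    exact (congrArg (i.negOnePow • ·) (map_zero _)).trans (smul_zero _)
  map_act i j l h x a := by
    refine (tmul_act X (bimodOfHoms f (𝟙 Γ)) i j 0 l j l h (add_zero j) (add_zero l) h x a
      Γ.one).trans ?_
    refine Eq.trans ?_ (tensorAct_tmul X (bimodOfHoms f (𝟙 Γ)) i 0 i j l j (add_zero i) h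
      (zero_add j) x Γ.one (f.f j a)).symm
    exact congrArg (tmul X (bimodOfHoms f (𝟙 Γ)) i j l h x)
      ((Γ.mul_one j (f.f j a)).trans (Γ.one_mul j (f.f j a)).symm)

theorem homX_one {n : ℤ} (g : HomX (bimodOfHoms (𝟙 Γ) f) X n) (i j : ℤ) (h : i + n = j)
    (h' : n + i = j) (a : Λ.X i) :
    g.app i j h (f.f i a) = X.act n i j h' (g.app 0 n (zero_add n) Γ.one) a := by
  refine Eq.trans ?_ (g.app_act 0 n i i j (zero_add n) (zero_add i) h' h Γ.one a)
  exact congrArg (g.app i j h) (Γ.one_mul i (f.f i a)).symm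

/-- The map `g ↦ g 1`. -/
def homOne : resObj f (homObj (bimodOfHoms (𝟙 Γ) f) X) ⟶ X where
  f n :=
    { toFun := fun g => HomX.app (N := bimodOfHoms (𝟙 Γ) f) (P := X) g 0 n (zero_add n) Γ.one
      map_add' := fun g g' => rfl
      map_smul' := fun r g => rfl }
  comm i j h g := by
    refine (homD_app (bimodOfHoms (𝟙 Γ) f) X i j h g 0 j 1 i (zero_add j) rfl (zero_add i)
      Γ.one).trans ?_
    refine (congrArg (X.d i j h (HomX.app g 0 i (zero_add i) Γ.one) - ·) ?_).trans (sub_zero _)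
    refine (congrArg (fun z => i.negOnePow • HomX.app (N := bimodOfHoms (𝟙 Γ) f) (P := X) g 1 j
      (by omega) z) (Γ.d_one 1 rfl)).trans ?_
    exact (congrArg (i.negOnePow • ·) (map_zero _)).trans (smul_zero _)
  map_act i j l h g a := by
    refine (homAct_app (bimodOfHoms (𝟙 Γ) f) X i j l h g (f.f j a) 0 l j (zero_add l) (add_zero j)
      Γ.one).trans ?_
    refine Eq.trans ?_ (homX_one f X g j l (by omega) h a)
    exact congrArg (HomX.app (N := bimodOfHoms (𝟙 Γ) f) (P := X) g j l (by omega))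
      (Γ.mul_one j (f.f j a))

end UnitMaps

/-! ### The triangles of the Drinfeld quotient -/

section Triangles

variable (k) {A : Type u} [Ring A] [Algebra k A] {e : A} (he : IsIdempotentElem e)

/-- The Drinfeld quotient as an `A`-`Drin`-bimodule. -/
noncomputable abbrev drinBimod : DGBimod (ofAlgebra k A) (drinDGA k he) :=
  bimodOfHoms (drinUnitHom k he) (𝟙 (drinDGA k he))

/-- The Drinfeld quotient as a `Drin`-`A`-bimodule. -/
noncomputable abbrev drinBimod' : DGBimod (drinDGA k he) (ofAlgebra k A) :=
  bimodOfHoms (𝟙 (drinDGA k he)) (drinUnitHom k he)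

theorem d_barIncl (i j : ℤ) (h : j + 1 = i) (i' : ℤ) (hi : i + 1 = i')
    (y : (barBimod k he).X i) : (drinDGA k he).d j i h (barIncl k he i j h y) +
      barIncl k he i' i hi ((barBimod k he).d i i' hi y) =
        (drinUnitHom k he).f i (barAug k he i y) := by
  refine Subtype.ext ?_
  change drinD k he y.1 + -(drinD k he y.1 - drinUnit k (drinAug k (drinD k he y.1))) =
    drinUnit k (drinAug k (drinD k he y.1))
  abel

theorem barProj_d (i j : ℤ) (h : j + 1 = i) (i' : ℤ) (hi : i + 1 = i')
    (w : (drinDGA k he).X j) : barProj k he i' i hi ((drinDGA k he).d j i h w) =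
      -(barBimod k he).d i i' hi (barProj k he i j h w) := by
  refine Subtype.ext ?_
  change drinProj k (drinD k he w.1) = - -drinProj k (drinD k he (drinProj k w.1))
  rw [drinD_proj, neg_neg]

theorem barIncl_proj (i j : ℤ) (h : j + 1 = i) (w : (drinDGA k he).X j) :
    (drinUnitHom k he).f j (drinAugMap k he j w) + barIncl k he i j h (barProj k he i j h w) = w :=
  Subtype.ext (add_sub_cancel (drinUnit k (drinAug k w.1)) w.1)

theorem barProj_incl (i j : ℤ) (h : j + 1 = i) (y : (barBimod k he).X i) :
    barProj k he i j h (barIncl k he i j h y) = y :=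
  Subtype.ext (drinProj_of_aug k y.2.2)

theorem barAug_proj (i j : ℤ) (h : j + 1 = i) (w : (drinDGA k he).X j) :
    barAug k he i (barProj k he i j h w) = drinAugMap k he i ((drinDGA k he).d j i h w) :=
  Subtype.ext (congrArg (drinAug k) (drinD_proj k he w.1))

theorem drinAugMap_incl (i j : ℤ) (h : j + 1 = i) (y : (barBimod k he).X i) :
    drinAugMap k he j (barIncl k he i j h y) = 0 :=
  Subtype.ext y.2.2

theorem drinAugMap_one : drinAugMap k he 0 (drinDGA k he).one = (ofAlgebra k A).one :=
  Subtype.ext (drinAug_unit k 1)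

theorem barProj_one : barProj k he 1 0 rfl (drinDGA k he).one = 0 :=
  Subtype.ext (drinProj_unit k 1)

theorem barIncl_lact (i j l : ℤ) (h : i + j = l) (j' l' : ℤ) (hj : j' + 1 = j) (hl : l' + 1 = l)
    (h' : i + j' = l') (a : (ofAlgebra k A).X i) (y : (barBimod k he).X j) :
    barIncl k he l l' hl ((barBimod k he).lact i j l h a y) =
      (drinBimod k he).lact i j' l' h' a (barIncl k he j j' hj y) :=
  Subtype.ext (drinMul_unit k he a.1 y.1).symm

theorem barIncl_act (i j l : ℤ) (h : i + j = l) (i' l' : ℤ) (hi : i' + 1 = i) (hl : l' + 1 = l)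
    (h' : i' + j = l') (y : (barBimod k he).X i) (a : (ofAlgebra k A).X j) :
    barIncl k he l l' hl ((barBimod k he).act i j l h y a) =
      (drinDGA k he).mul i' j l' h' (barIncl k he i i' hi y) ((drinUnitHom k he).f j a) := rfl

theorem barProj_lact (i j l : ℤ) (h : i + j = l) (j' l' : ℤ) (hj : j + 1 = j') (hl : l + 1 = l')
    (h' : i + j' = l') (a : (ofAlgebra k A).X i) (w : (drinDGA k he).X j) :
    barProj k he l' l hl ((drinDGA k he).mul i j l h ((drinUnitHom k he).f i a) w) =
      (barBimod k he).lact i j' l' h' a (barProj k he j' j hj w) :=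
  Subtype.ext ((congrArg (drinProj k) (drinMul_unit k he a.1 w.1)).trans (drinProj_L k a.1 w.1))

theorem barProj_act (i j l : ℤ) (h : i + j = l) (i' l' : ℤ) (hi : i + 1 = i') (hl : l + 1 = l')
    (h' : i' + j = l') (w : (drinDGA k he).X i) (a : (ofAlgebra k A).X j) :
    barProj k he l' l hl ((drinDGA k he).mul i j l h w ((drinUnitHom k he).f j a)) =
      (barBimod k he).act i' j l' h' (barProj k he i' i hi w) a :=
  Subtype.ext (drinProj_mul_unit k he a.1 w.1)

theorem drinAugMap_lact (i j l : ℤ) (h : i + j = l) (a : (ofAlgebra k A).X i)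
    (w : (drinDGA k he).X j) : drinAugMap k he l
      ((drinDGA k he).mul i j l h ((drinUnitHom k he).f i a) w) =
        (ofAlgebra k A).mul i j l h a (drinAugMap k he j w) :=
  Subtype.ext ((congrArg (drinAug k) (drinMul_unit k he a.1 w.1)).trans (drinAug_L k a.1 w.1))

theorem drinAugMap_act (i j l : ℤ) (h : i + j = l) (w : (drinDGA k he).X i)
    (a : (ofAlgebra k A).X j) : drinAugMap k he l
      ((drinDGA k he).mul i j l h w ((drinUnitHom k he).f j a)) =
        (ofAlgebra k A).mul i j l h (drinAugMap k he i w) a :=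
  Subtype.ext (drinAug_mul_unit k he a.1 w.1)

theorem barAug_lact (i j l : ℤ) (h : i + j = l) (a : (ofAlgebra k A).X i) (y : (barBimod k he).X j) :
    barAug k he l ((barBimod k he).lact i j l h a y) =
      (ofAlgebra k A).mul i j l h a (barAug k he j y) :=
  Subtype.ext ((congrArg (drinAug k) (drinD_L k he a.1 y.1)).trans (drinAug_L k a.1 _))

theorem barAug_act (i j l : ℤ) (h : i + j = l) (y : (barBimod k he).X i) (a : (ofAlgebra k A).X j) :
    barAug k he l ((barBimod k he).act i j l h y a) =
      (ofAlgebra k A).mul i j l h (barAug k he i y) a :=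
  Subtype.ext ((congrArg (drinAug k) (drinD_mul_unit k he a.1 y.1)).trans
    (drinAug_mul_unit k he a.1 _))

theorem barAug_d (i j : ℤ) (h : i + 1 = j) (y : (barBimod k he).X i) :
    barAug k he j ((barBimod k he).d i j h y) = 0 := by
  refine Subtype.ext ?_
  change drinAug k (drinD k he (-drinProj k (drinD k he y.1))) = 0
  rw [map_neg, drinD_proj, drinD_D, neg_zero, map_zero]

/-- The pairing `(x, y) ↦ x y` of `X` and the bar resolution. -/
noncomputable def barPairing (X : DGMod (ofAlgebra k A)) : Pairing X (barBimod k he) X where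
  φ i j n h := (X.act i j n h).compl₂ (barAug k he j)
  balanced i j l ij jl n h₁ h₂ h₃ h₄ x a y := by
    refine (X.act_act i j l ij jl n h₁ h₂ h₃ h₄ x a _).trans ?_
    exact congrArg (X.act i jl n h₄ x) (barAug_lact k he j l jl h₂ a y).symm
  comm i j n i' j' n' h hi hj hn x y := by
    refine (d_act_algebra' i j n i' n' h hi hn x _).trans ?_
    have h₀ : i.negOnePow • X.act i j' n' (by omega) x
        (barAug k he j' ((barBimod k he).d j j' hj y)) = 0 := by
      rw [barAug_d, map_zero, smul_zero]
    exact (add_zero _).symm.trans (congrArg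
      (X.act i' j n' (by omega) (X.d i i' hi x) (barAug k he j y) + ·) h₀.symm)
  map_act i j n l n' jl h hn hj x y c := by
    refine (congrArg (X.act i jl n' (by omega) x) (barAug_act k he j l jl hj y c)).trans ?_
    exact (X.act_act i j l n jl n' h hj hn (by omega) x _ c).symm

/-- The counit `X ⊗ bar ⟶ X`. -/
noncomputable def barCounit : tensorFunctor (barBimod k he) ⟶ 𝟭 (DGMod (ofAlgebra k A)) where
  app X := (barPairing k he X).lift
  naturality X X' φ := by
    apply tensorObj_hom_ext
    intro i j n h x y
    refine (congrArg ((barPairing k he X').lift.f n) (tensorMap_tmul _ φ i j n h x y)).trans ?_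
    refine ((barPairing k he X').lift_tmul i j n h _ y).trans ?_
    refine Eq.trans ?_ (congrArg (φ.f n) ((barPairing k he X).lift_tmul i j n h x y)).symm
    exact (φ.map_act i j n h x _).symm

/-- The unit `X ⟶ Hom(bar, X)`. -/
noncomputable def barUnit : 𝟭 (DGMod (ofAlgebra k A)) ⟶ homFunctor (barBimod k he) where
  app X := (barPairing k he X).curry
  naturality X X' φ := by
    ext n x
    apply HomX.ext
    intro i j h y
    exact (φ.map_act n i j (by omega) x _).symm

theorem tensorHomAdj_unit_comp_barCounit (X : DGMod (ofAlgebra k A)) :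
    (tensorHomAdj (barBimod k he)).unit.app X ≫
      (homFunctor (barBimod k he)).map ((barCounit k he).app X) = (barUnit k he).app X := by
  ext n x
  apply HomX.ext
  intro i j h y
  exact (barPairing k he X).lift_tmul n i j (by omega) x y

theorem barUnit_comp_tensorHomAdj_counit (X : DGMod (ofAlgebra k A)) :
    (tensorFunctor (barBimod k he)).map ((barUnit k he).app X) ≫
      (tensorHomAdj (barBimod k he)).counit.app X = (barCounit k he).app X := by
  apply tensorObj_hom_ext
  intro i j n h x y
  refine (congrArg ((evalPairing (barBimod k he) X).lift.f n)
    (tensorMap_tmul _ ((barUnit k he).app X) i j n h x y)).trans ?_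
  refine ((evalPairing (barBimod k he) X).lift_tmul i j n h _ y).trans ?_
  exact ((barPairing k he X).lift_tmul i j n h x y).symm

section TensorTriangle

variable (X : DGMod (ofAlgebra k A))

/-- The map `x ⊗ y ↦ (-1)^|x| x ⊗ y` of degree `-1`. -/
noncomputable def tensorBarIncl (n n' : ℤ) (hn : n' + 1 = n) :
    TensorX X (barBimod k he) n →ₗ[k] TensorX X (drinBimod k he) n' :=
  tensorLift (fun i j h => i.negOnePow • (tmul X (drinBimod k he) i (j - 1) n' (by omega)).compl₂
    (barIncl k he j (j - 1) (by omega))) (by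
    intro i j l ij jl h₁ h₂ h₃ h₄ x a y
    by_cases hj : j = 0
    · subst hj
      obtain rfl : i = ij := by omega
      obtain rfl : l = jl := by omega
      have key := tmul_act X (drinBimod k he) i 0 (l - 1) i (l - 1) n' h₁
        (by omega) (by omega) (by omega) x a (barIncl k he l (l - 1) (by omega) y)
      rw [← barIncl_lact k he 0 l l h₂ (l - 1) (l - 1) (by omega) (by omega) (by omega)] at key
      exact congrArg (i.negOnePow • ·) key
    · rw [ofAlgebra_eq_zero hj a]
      simp only [map_zero, LinearMap.zero_apply])

theorem tensorBarIncl_tmul (n n' : ℤ) (hn : n' + 1 = n) (i j j' : ℤ) (h : i + j = n)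
    (hj : j' + 1 = j) (x : X.X i) (y : (barBimod k he).X j) :
    tensorBarIncl k he X n n' hn (tmul X (barBimod k he) i j n h x y) =
      i.negOnePow • tmul X (drinBimod k he) i j' n' (by omega) x (barIncl k he j j' hj y) := by
  obtain rfl : j' = j - 1 := by omega
  exact tensorLift_tmul X (barBimod k he) _ _ i j h x y

theorem add_neg_cancel_middle {M : Type*} [AddCommGroup M] (a b c : M) :
    a + b + (-a + c) = b + c := by
  abel

theorem neg_add_cancel_middle {M : Type*} [AddCommGroup M] (a b c : M) :
    -a + (b + a + c) = b + c := by
  abel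

theorem d_tensorBarIncl (n n' n'' : ℤ) (hn : n' + 1 = n) (hn' : n + 1 = n'')
    (t : TensorX X (barBimod k he) n) :
    tensorD X (drinBimod k he) n' n hn (tensorBarIncl k he X n n' hn t) +
      tensorBarIncl k he X n'' n hn' (tensorD X (barBimod k he) n n'' hn' t) =
        tmul X (drinBimod k he) n 0 n (add_zero n) (((barPairing k he X).lift).f n t)
          (drinDGA k he).one := by
  refine LinearMap.congr_fun (f := tensorD X (drinBimod k he) n' n hn ∘ₗ tensorBarIncl k he X n n' hn +
    tensorBarIncl k he X n'' n hn' ∘ₗ tensorD X (barBimod k he) n n'' hn')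
    (g := (tmul X (drinBimod k he) n 0 n (add_zero n)).flip (drinDGA k he).one ∘ₗ
      ((barPairing k he X).lift).f n) (tensor_ext fun i j h x y => ?_) t
  have h₁ : tmul X (drinBimod k he) n 0 n (add_zero n) (X.act i j n h x (barAug k he j y))
      (drinDGA k he).one = tmul X (drinBimod k he) i j n h x
        ((drinUnitHom k he).f j (barAug k he j y)) := by
    refine (tmul_act X (drinBimod k he) i j 0 n j n h (add_zero j) (add_zero n) h x _ _).trans ?_
    exact congrArg (tmul X (drinBimod k he) i j n h x) ((drinDGA k he).mul_one j _)
  refine Eq.trans ?_ ((congrArg (fun z => tmul X (drinBimod k he) n 0 n (add_zero n) z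
    (drinDGA k he).one) ((barPairing k he X).lift_tmul i j n h x y)).trans h₁).symm
  change tensorD X (drinBimod k he) n' n hn
      (tensorBarIncl k he X n n' hn (tmul X (barBimod k he) i j n h x y)) +
    tensorBarIncl k he X n'' n hn' (tensorD X (barBimod k he) n n'' hn'
      (tmul X (barBimod k he) i j n h x y)) = _
  rw [tensorD_tmul X (barBimod k he) i j n n'' (i + 1) (j + 1) h hn' rfl rfl, map_add,
    map_zsmul_unit, tensorBarIncl_tmul k he X n n' hn i j (j - 1) h (by omega),
    tensorBarIncl_tmul k he X n'' n hn' (i + 1) j (j - 1) (by omega) (by omega),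
    tensorBarIncl_tmul k he X n'' n hn' i (j + 1) j (by omega) rfl, map_zsmul_unit,
    units_smul_smul_self, Int.negOnePow_succ, Units.neg_smul,
    tensorD_tmul X (drinBimod k he) i (j - 1) n' n (i + 1) j (by omega) hn rfl (by omega) x
      (barIncl k he j (j - 1) (by omega) y), smul_add, units_smul_smul_self]
  have h₂ : tmul X (drinBimod k he) i j n h x ((drinDGA k he).d (j - 1) j (by omega)
      (barIncl k he j (j - 1) (by omega) y)) + tmul X (drinBimod k he) i j n h x
        (barIncl k he (j + 1) j rfl ((barBimod k he).d j (j + 1) rfl y)) =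
      tmul X (drinBimod k he) i j n h x ((drinUnitHom k he).f j (barAug k he j y)) :=
    (map_add (tmul X (drinBimod k he) i j n h x) _ _).symm.trans
      (congrArg (tmul X (drinBimod k he) i j n h x) (d_barIncl k he j (j - 1) (by omega) (j + 1) rfl y))
  refine Eq.trans ?_ h₂
  exact add_neg_cancel_middle _ _ _

end TensorTriangle

end Triangles


section TensorTriangle

variable (k) {A : Type u} [Ring A] [Algebra k A] {e : A} (he : IsIdempotentElem e)
  (X : DGMod (ofAlgebra k A))

theorem tensorBarIncl_act (n n' l m m' : ℤ) (hn : n' + 1 = n) (hm : m' + 1 = m) (h : n + l = m)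
    (t : TensorX X (barBimod k he) n) (a : (ofAlgebra k A).X l) :
    tensorBarIncl k he X m m' hm (tensorAct X (barBimod k he) n l m h t a) =
      tensorAct X (drinBimod k he) n' l m' (by omega) (tensorBarIncl k he X n n' hn t)
        ((drinUnitHom k he).f l a) := by
  refine LinearMap.congr_fun (f := tensorBarIncl k he X m m' hm ∘ₗ
      (tensorAct X (barBimod k he) n l m h).flip a)
    (g := (tensorAct X (drinBimod k he) n' l m' (by omega)).flip ((drinUnitHom k he).f l a) ∘ₗ
      tensorBarIncl k he X n n' hn) (tensor_ext fun i j hij x y => ?_) t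
  change tensorBarIncl k he X m m' hm (tensorAct X (barBimod k he) n l m h
      (tmul X (barBimod k he) i j n hij x y) a) =
    tensorAct X (drinBimod k he) n' l m' (by omega) (tensorBarIncl k he X n n' hn
      (tmul X (barBimod k he) i j n hij x y)) ((drinUnitHom k he).f l a)
  rw [tensorAct_tmul X (barBimod k he) i j n l m (j + l) hij h rfl,
    tensorBarIncl_tmul k he X m m' hm i (j + l) (j - 1 + l) (by omega) (by omega),
    tensorBarIncl_tmul k he X n n' hn i j (j - 1) hij (by omega), map_zsmul_unit,
    LinearMap.smul_apply]
  refine Eq.trans ?_ (congrArg (i.negOnePow • ·) (tensorAct_tmul X (drinBimod k he) i (j - 1) n' l m'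
    (j - 1 + l) (by omega) (by omega) rfl x (barIncl k he j (j - 1) (by omega) y)
    ((drinUnitHom k he).f l a))).symm
  exact congrArg (fun z => i.negOnePow • tmul X (drinBimod k he) i (j - 1 + l) m' (by omega) x z)
    (barIncl_act k he j l (j + l) rfl (j - 1) (j - 1 + l) (by omega) (by omega) rfl y a)

/-- The map `x ↦ x ⊗ 1` in degree `n`. -/
noncomputable def tensorOneMap (n : ℤ) : X.X n →ₗ[k] TensorX X (drinBimod k he) n :=
  (tmul X (drinBimod k he) n 0 n (add_zero n)).flip (drinDGA k he).one

theorem tensorOneMap_d (i j : ℤ) (h : i + 1 = j) (x : X.X i) :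
    tensorOneMap k he X j (X.d i j h x) =
      tensorD X (drinBimod k he) i j h (tensorOneMap k he X i x) :=
  (tensorOne (drinUnitHom k he) X).comm i j h x

theorem tensorOneMap_act (i j l : ℤ) (h : i + j = l) (x : X.X i) (a : (ofAlgebra k A).X j) :
    tensorOneMap k he X l (X.act i j l h x a) =
      tensorAct X (drinBimod k he) i j l h (tensorOneMap k he X i x) ((drinUnitHom k he).f j a) :=
  (tensorOne (drinUnitHom k he) X).map_act i j l h x a

theorem tensorOneMap_barCounit (n n' n'' : ℤ) (hn : n' + 1 = n) (hn' : n + 1 = n'')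
    (t : TensorX X (barBimod k he) n) : tensorOneMap k he X n (((barPairing k he X).lift).f n t) =
    tensorD X (drinBimod k he) n' n hn (tensorBarIncl k he X n n' hn t) +
      tensorBarIncl k he X n'' n hn' (tensorD X (barBimod k he) n n'' hn' t) :=
  (d_tensorBarIncl k he X n n' n'' hn hn' t).symm

/-- The map `(t, x) ↦ t + x ⊗ 1` in degree `n`. -/
noncomputable def coneToTensorMap (n : ℤ) :
    TensorX X (barBimod k he) (n + 1) × X.X n →ₗ[k] TensorX X (drinBimod k he) n :=
  (tensorBarIncl k he X (n + 1) n rfl).coprod (tensorOneMap k he X n)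

theorem coneToTensorMap_comm (i : ℤ) (t : TensorX X (barBimod k he) (i + 1)) (x : X.X i) :
    coneToTensorMap k he X (i + 1) (-tensorD X (barBimod k he) (i + 1) (i + 1 + 1) rfl t,
        ((barPairing k he X).lift).f (i + 1) t + X.d i (i + 1) rfl x) =
      tensorD X (drinBimod k he) i (i + 1) rfl (coneToTensorMap k he X i (t, x)) := by
  simp only [coneToTensorMap, LinearMap.coprod_apply, map_neg, map_add]
  rw [tensorOneMap_barCounit k he X (i + 1) i (i + 1 + 1) rfl rfl, tensorOneMap_d]
  exact neg_add_cancel_middle _ _ _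

theorem coneToTensorMap_act (i j l : ℤ) (h : i + j = l) (t : TensorX X (barBimod k he) (i + 1))
    (x : X.X i) (a : (ofAlgebra k A).X j) :
    coneToTensorMap k he X l (tensorAct X (barBimod k he) (i + 1) j (l + 1) (by omega) t a,
        X.act i j l h x a) = tensorAct X (drinBimod k he) i j l h (coneToTensorMap k he X i (t, x))
          ((drinUnitHom k he).f j a) := by
  simp only [coneToTensorMap, LinearMap.coprod_apply, map_add, LinearMap.add_apply]
  rw [tensorBarIncl_act k he X (i + 1) i j (l + 1) l rfl rfl, tensorOneMap_act]

/-- The comparison of the cone of `X ⊗ bar ⟶ X` with `X ⊗ Drin`. -/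
noncomputable def coneToTensor : cone ((barCounit k he).app X) ⟶
    resObj (drinUnitHom k he) (tensorObj X (drinBimod k he)) where
  f n := coneToTensorMap k he X n
  comm i j h x := by
    subst h
    exact coneToTensorMap_comm k he X i x.1 x.2
  map_act i j l h x a := coneToTensorMap_act k he X i j l h x.1 x.2 a

theorem coneIn_comp_coneToTensor :
    coneIn ((barCounit k he).app X) ≫ coneToTensor k he X = tensorOne (drinUnitHom k he) X :=
  DGMod.hom_ext fun n x => LinearMap.congr_fun (LinearMap.coprod_inr
    (tensorBarIncl k he X (n + 1) n rfl) (tensorOneMap k he X n)) x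

/-- The map `x ⊗ w ↦ (-1)^|x| x ⊗ w'`, where `w'` is the reduced part of `w`. -/
noncomputable def tensorBarProj (n n' : ℤ) (hn : n' + 1 = n) :
    TensorX X (drinBimod k he) n' →ₗ[k] TensorX X (barBimod k he) n :=
  tensorLift (fun i j h => i.negOnePow • (tmul X (barBimod k he) i (j + 1) n (by omega)).compl₂
    (barProj k he (j + 1) j rfl)) (by
    intro i j l ij jl h₁ h₂ h₃ h₄ x a y
    by_cases hj : j = 0
    · subst hj
      obtain rfl : i = ij := by omega
      obtain rfl : l = jl := by omega
      have key := tmul_act X (barBimod k he) i 0 (l + 1) i (l + 1) n h₁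
        (by omega) (by omega) (by omega) x a (barProj k he (l + 1) l rfl y)
      exact congrArg (i.negOnePow • ·) (key.trans (congrArg _
        (barProj_lact k he 0 l l h₂ (l + 1) (l + 1) rfl rfl (by omega) a y).symm))
    · rw [ofAlgebra_eq_zero hj a]
      simp only [map_zero, LinearMap.zero_apply]
      exact LinearMap.map_zero₂ _ y)

theorem tensorBarProj_tmul (n n' : ℤ) (hn : n' + 1 = n) (i j j' : ℤ) (h : i + j' = n')
    (hj : j' + 1 = j) (x : X.X i) (y : (drinDGA k he).X j') :
    tensorBarProj k he X n n' hn (tmul X (drinBimod k he) i j' n' h x y) =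
      i.negOnePow • tmul X (barBimod k he) i j n (by omega) x (barProj k he j j' hj y) := by
  subst hj
  exact tensorLift_tmul X (drinBimod k he) _ _ i j' h x y

/-- The map `x ⊗ w ↦ x ε(w)`. -/
noncomputable def tensorAug (n : ℤ) : TensorX X (drinBimod k he) n →ₗ[k] X.X n :=
  tensorLift (fun i j h => (X.act i j n h).compl₂ (drinAugMap k he j)) (by
    intro i j l ij jl h₁ h₂ h₃ h₄ x a y
    refine (X.act_act i j l ij jl n h₁ h₂ h₃ h₄ x a _).trans ?_
    exact congrArg (X.act i jl n h₄ x) (drinAugMap_lact k he j l jl h₂ a y).symm)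

theorem tensorAug_tmul (i j n : ℤ) (h : i + j = n) (x : X.X i) (y : (drinDGA k he).X j) :
    tensorAug k he X n (tmul X (drinBimod k he) i j n h x y) =
      X.act i j n h x (drinAugMap k he j y) :=
  tensorLift_tmul X (drinBimod k he) _ _ i j h x y

theorem tensorBarProj_incl (n n' : ℤ) (hn : n' + 1 = n) (t : TensorX X (barBimod k he) n) :
    tensorBarProj k he X n n' hn (tensorBarIncl k he X n n' hn t) = t := by
  refine LinearMap.congr_fun (f := tensorBarProj k he X n n' hn ∘ₗ tensorBarIncl k he X n n' hn)
    (g := LinearMap.id) (tensor_ext fun i j h x y => ?_) t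
  change tensorBarProj k he X n n' hn (tensorBarIncl k he X n n' hn
    (tmul X (barBimod k he) i j n h x y)) = tmul X (barBimod k he) i j n h x y
  rw [tensorBarIncl_tmul k he X n n' hn i j (j - 1) h (by omega), map_zsmul_unit]
  refine (congrArg (i.negOnePow • ·) (tensorBarProj_tmul k he X n n' hn i j (j - 1) (by omega)
    (by omega) x (barIncl k he j (j - 1) (by omega) y))).trans ?_
  rw [units_smul_smul_self, barProj_incl]

theorem tensorAug_incl (n n' : ℤ) (hn : n' + 1 = n) (t : TensorX X (barBimod k he) n) :
    tensorAug k he X n' (tensorBarIncl k he X n n' hn t) = 0 := by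
  refine LinearMap.congr_fun (f := tensorAug k he X n' ∘ₗ tensorBarIncl k he X n n' hn)
    (g := 0) (tensor_ext fun i j h x y => ?_) t
  change tensorAug k he X n' (tensorBarIncl k he X n n' hn
    (tmul X (barBimod k he) i j n h x y)) = 0
  rw [tensorBarIncl_tmul k he X n n' hn i j (j - 1) h (by omega), map_zsmul_unit]
  refine (congrArg (i.negOnePow • ·) (tensorAug_tmul k he X i (j - 1) n' (by omega) x
    (barIncl k he j (j - 1) (by omega) y))).trans ?_
  rw [drinAugMap_incl, map_zero, smul_zero]

theorem tensorBarProj_one (n : ℤ) (x : X.X n) :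
    tensorBarProj k he X (n + 1) n rfl (tensorOneMap k he X n x) = 0 := by
  refine (tensorBarProj_tmul k he X (n + 1) n rfl n 1 0 (add_zero n) rfl x
    (drinDGA k he).one).trans ?_
  rw [barProj_one, map_zero, smul_zero]

theorem tensorAug_one (n : ℤ) (x : X.X n) :
    tensorAug k he X n (tensorOneMap k he X n x) = x := by
  refine (tensorAug_tmul k he X n 0 n (add_zero n) x (drinDGA k he).one).trans ?_
  rw [drinAugMap_one]
  exact X.act_one n x

theorem tensorBarIncl_proj (n : ℤ) (t : TensorX X (drinBimod k he) n) :
    tensorBarIncl k he X (n + 1) n rfl (tensorBarProj k he X (n + 1) n rfl t) +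
      tensorOneMap k he X n (tensorAug k he X n t) = t := by
  refine LinearMap.congr_fun (f := tensorBarIncl k he X (n + 1) n rfl ∘ₗ
      tensorBarProj k he X (n + 1) n rfl + tensorOneMap k he X n ∘ₗ tensorAug k he X n)
    (g := LinearMap.id) (tensor_ext fun i j h x w => ?_) t
  have h₁ : tensorOneMap k he X n (X.act i j n h x (drinAugMap k he j w)) =
      tmul X (drinBimod k he) i j n h x ((drinUnitHom k he).f j (drinAugMap k he j w)) :=
    (tmul_act X (drinBimod k he) i j 0 n j n h (add_zero j) (add_zero n) h x _ _).trans
      (congrArg (tmul X (drinBimod k he) i j n h x) ((drinDGA k he).mul_one j _))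
  have h₂ : tensorBarIncl k he X (n + 1) n rfl (tensorBarProj k he X (n + 1) n rfl
      (tmul X (drinBimod k he) i j n h x w)) = tmul X (drinBimod k he) i j n h x
        (barIncl k he (j + 1) j rfl (barProj k he (j + 1) j rfl w)) := by
    refine (congrArg (tensorBarIncl k he X (n + 1) n rfl)
      (tensorBarProj_tmul k he X (n + 1) n rfl i (j + 1) j h rfl x w)).trans ?_
    rw [map_zsmul_unit,
      tensorBarIncl_tmul k he X (n + 1) n rfl i (j + 1) j (by omega) rfl, units_smul_smul_self]
  refine (congrArg₂ (· + ·) h₂ ((congrArg (tensorOneMap k he X n)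
    (tensorAug_tmul k he X i j n h x w)).trans h₁)).trans ?_
  refine (map_add (tmul X (drinBimod k he) i j n h x) _ _).symm.trans ?_
  exact congrArg (tmul X (drinBimod k he) i j n h x)
    ((add_comm _ _).trans (barIncl_proj k he (j + 1) j rfl w))

theorem coneToTensorMap_bijective (n : ℤ) : Function.Bijective (coneToTensorMap k he X n) := by
  refine bijective_of_inverse (fun t => (tensorBarProj k he X (n + 1) n rfl t,
    tensorAug k he X n t)) ?_ (fun t => tensorBarIncl_proj k he X n t)
  rintro ⟨t, x⟩
  simp only [coneToTensorMap, LinearMap.coprod_apply, map_add, tensorBarProj_incl, tensorAug_incl,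
    tensorBarProj_one, tensorAug_one, add_zero, zero_add]

end TensorTriangle


theorem sub_smul_eq {M : Type*} [AddCommGroup M] (r : ℤˣ) (a b c : M) :
    a - r • b = a - -r • c - r • (c + b) := by
  rw [Units.neg_smul, smul_add]
  abel

section HomTriangle

variable (k) {A : Type u} [Ring A] [Algebra k A] {e : A} (he : IsIdempotentElem e)
  (X : DGMod (ofAlgebra k A))

/-- Precomposition with the inclusion of the bar resolution. -/
noncomputable def homBarIncl (n m : ℤ) (h : n + 1 = m) :
    HomX (drinBimod' k he) X m →ₗ[k] HomX (barBimod k he) X n where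
  toFun f := ⟨fun p => HomX.app (N := drinBimod' k he) f (p.1.1 - 1) p.1.2
      (by have := p.2; omega) ∘ₗ barIncl k he p.1.1 (p.1.1 - 1) (by omega), by
    intro i j l il jl h₁ h₂ h₃ x c
    refine Eq.trans ?_ (HomX.app_act (N := drinBimod' k he) (P := X) f (i - 1) j l (il - 1) jl
      (by omega) (by omega) h₃ (by omega) (barIncl k he i (i - 1) (by omega) x) c)
    exact congrArg (HomX.app (N := drinBimod' k he) (P := X) f (il - 1) jl (by omega))
      (barIncl_act k he i l il h₂ (i - 1) (il - 1) (by omega) (by omega) (by omega) x c)⟩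
  map_add' f g := rfl
  map_smul' r f := rfl

theorem homBarIncl_app (n m : ℤ) (h : n + 1 = m) (f : HomX (drinBimod' k he) X m) (i i' j : ℤ)
    (hj : i + n = j) (hi : i' + 1 = i) (y : (barBimod k he).X i) :
    (homBarIncl k he X n m h f).app i j hj y =
      HomX.app (N := drinBimod' k he) (P := X) f i' j (by omega) (barIncl k he i i' hi y) := by
  obtain rfl : i' = i - 1 := by omega
  rfl

/-- Precomposition with the projection to the bar resolution. -/
noncomputable def homBarProj (n m : ℤ) (h : n + 1 = m) :
    HomX (barBimod k he) X n →ₗ[k] HomX (drinBimod' k he) X m where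
  toFun g := ⟨fun p => g.app (p.1.1 + 1) p.1.2
      (by have := p.2; omega) ∘ₗ barProj k he (p.1.1 + 1) p.1.1 rfl, by
    intro i j l il jl h₁ h₂ h₃ x c
    refine Eq.trans ?_ (g.app_act (i + 1) j l (il + 1) jl (by omega) (by omega) h₃ (by omega)
      (barProj k he (i + 1) i rfl x) c)
    exact congrArg (g.app (il + 1) jl (by omega))
      (barProj_act k he i l il h₂ (i + 1) (il + 1) rfl rfl (by omega) x c)⟩
  map_add' f g := rfl
  map_smul' r f := rfl

theorem homBarProj_app (n m : ℤ) (h : n + 1 = m) (g : HomX (barBimod k he) X n) (i i' j : ℤ)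
    (hj : i + m = j) (hi : i + 1 = i') (w : (drinDGA k he).X i) :
    HomX.app (N := drinBimod' k he) (P := X) (homBarProj k he X n m h g) i j hj w =
      g.app i' j (by omega) (barProj k he i' i hi w) := by
  subst hi
  rfl

/-- The map `x ↦ (w ↦ x ε(w))`. -/
noncomputable def homAug (n : ℤ) : X.X n →ₗ[k] HomX (drinBimod' k he) X n where
  toFun x := ⟨fun p => X.act n p.1.1 p.1.2 (by have := p.2; omega) x ∘ₗ drinAugMap k he p.1.1, by
    intro i j l il jl h₁ h₂ h₃ w c
    refine Eq.trans ?_ (X.act_act n i l j il jl (by omega) h₂ h₃ (by omega) x _ c).symm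
    exact congrArg (X.act n il jl (by omega) x) (drinAugMap_act k he i l il h₂ w c)⟩
  map_add' x y := HomX.ext fun i j h w => LinearMap.map_add₂ (X.act n i j (by omega)) x y _
  map_smul' r x := HomX.ext fun i j h w => LinearMap.map_smul₂ (X.act n i j (by omega)) r x _

/-- Evaluation at `1`. -/
noncomputable def homOneMap (n : ℤ) : HomX (drinBimod' k he) X n →ₗ[k] X.X n :=
  (homOne (drinUnitHom k he) X).f n

/-- The map `x ↦ (y ↦ x y)` to the maps on the bar resolution. -/
noncomputable def homBarUnit (n : ℤ) : X.X n →ₗ[k] HomX (barBimod k he) X n :=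
  ((barUnit k he).app X).f n

theorem homBarUnit_d (i j : ℤ) (h : i + 1 = j) (x : X.X i) :
    homBarUnit k he X j (X.d i j h x) = homD (barBimod k he) X i j h (homBarUnit k he X i x) :=
  ((barUnit k he).app X).comm i j h x

theorem homBarUnit_act (i j l : ℤ) (h : i + j = l) (x : X.X i) (a : (ofAlgebra k A).X j) :
    homBarUnit k he X l (X.act i j l h x a) =
      homAct (barBimod k he) X i j l h (homBarUnit k he X i x) a :=
  ((barUnit k he).app X).map_act i j l h x a

theorem homD_homBarIncl (n m m' : ℤ) (h : n + 1 = m) (h' : m + 1 = m')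
    (f : HomX (drinBimod' k he) X m) : homD (barBimod k he) X n m h (homBarIncl k he X n m h f) =
      homBarIncl k he X m m' h' (homD (drinBimod' k he) X m m' h' f) -
        n.negOnePow • homBarUnit k he X m (homOneMap k he X m f) := by
  apply HomX.ext
  intro i j hj y
  have h₁ := homD_app (barBimod k he) X n m h (homBarIncl k he X n m h f) i j (i + 1) (i + n) hj rfl
    rfl y
  have h₂ := homD_app (drinBimod' k he) X m m' h' f (i - 1) j i (i + n) (by omega) (by omega) (by omega)
    (barIncl k he i (i - 1) (by omega) y)
  have h₃ : HomX.app (N := drinBimod' k he) (P := X) f i j hj ((drinDGA k he).d (i - 1) i (by omega)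
      (barIncl k he i (i - 1) (by omega) y)) + HomX.app (N := drinBimod' k he) (P := X) f i j hj
        (barIncl k he (i + 1) i rfl ((barBimod k he).d i (i + 1) rfl y)) =
      X.act m i j (by omega) (homOneMap k he X m f) (barAug k he i y) :=
    (map_add _ _ _).symm.trans ((congrArg (HomX.app (N := drinBimod' k he) (P := X) f i j hj)
      (d_barIncl k he i (i - 1) (by omega) (i + 1) rfl y)).trans
        (homX_one (drinUnitHom k he) X f i j hj (by omega) _))
  refine h₁.trans (Eq.trans ?_ (congrArg₂ (fun z w : X.X j => z - n.negOnePow • w) h₂ h₃.symm).symm)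
  rw [homBarIncl_app k he X n m h f i (i - 1) (i + n) rfl (by omega),
    homBarIncl_app k he X n m h f (i + 1) i j (by omega) rfl,
    show m.negOnePow = -n.negOnePow by rw [← h, Int.negOnePow_succ]]
  exact sub_smul_eq n.negOnePow _ _ _

theorem homBarIncl_act (n m l n' m' : ℤ) (h : n + 1 = m) (h' : n' + 1 = m') (hn : m + l = m')
    (f : HomX (drinBimod' k he) X m) (a : (ofAlgebra k A).X l) :
    homBarIncl k he X n' m' h' (homAct (drinBimod' k he) X m l m' hn f ((drinUnitHom k he).f l a)) =
      homAct (barBimod k he) X n l n' (by omega) (homBarIncl k he X n m h f) a := by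
  apply HomX.ext
  intro i j hj y
  have h₁ := barIncl_lact k he l i (l + i) rfl (i - 1) (l + (i - 1)) (by omega) (by omega) rfl a y
  refine Eq.trans ?_ (homAct_app (barBimod k he) X n l n' (by omega) (homBarIncl k he X n m h f) a i j
    (l + i) hj rfl y).symm
  refine Eq.trans ?_ (homBarIncl_app k he X n m h f (l + i) (l + (i - 1)) j (by omega) (by omega) _).symm
  refine (homBarIncl_app k he X n' m' h' _ i (i - 1) j hj (by omega) y).trans ?_
  refine (homAct_app (drinBimod' k he) X m l m' hn f ((drinUnitHom k he).f l a) (i - 1) j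
    (l + (i - 1)) (by omega) rfl _).trans ?_
  exact congrArg (HomX.app (N := drinBimod' k he) (P := X) f (l + (i - 1)) j (by omega)) h₁.symm

theorem homBarProj_d (n m m' : ℤ) (h : n + 1 = m) (h' : m + 1 = m') (g : HomX (barBimod k he) X n) :
    homD (drinBimod' k he) X m m' h' (homBarProj k he X n m h g) =
      homBarProj k he X m m' h' (homD (barBimod k he) X n m h g) := by
  apply HomX.ext
  intro i j hj w
  have h₁ := homD_app (barBimod k he) X n m h g (i + 1) j (i + 1 + 1) (i + m) (by omega) rfl (by omega)
    (barProj k he (i + 1) i rfl w)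
  refine (homD_app (drinBimod' k he) X m m' h' (homBarProj k he X n m h g) i j (i + 1) (i + m) hj
    rfl rfl w).trans (Eq.trans ?_ h₁.symm)
  refine congrArg (X.d (i + m) j (by omega) (g.app (i + 1) (i + m) (by omega)
    (barProj k he (i + 1) i rfl w)) - ·) ?_
  refine (congrArg (fun z => m.negOnePow • g.app (i + 1 + 1) j (by omega) z)
    (barProj_d k he (i + 1) i rfl (i + 1 + 1) rfl w)).trans ?_
  rw [map_neg, smul_neg, show m.negOnePow = -n.negOnePow by rw [← h, Int.negOnePow_succ],
    Units.neg_smul, neg_neg]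

theorem homOneMap_proj (n m : ℤ) (h : n + 1 = m) (g : HomX (barBimod k he) X n) :
    homOneMap k he X m (homBarProj k he X n m h g) = 0 :=
  (congrArg (g.app 1 m (by omega)) (barProj_one k he)).trans (map_zero _)

theorem homBarIncl_proj (n m : ℤ) (h : n + 1 = m) (g : HomX (barBimod k he) X n) :
    homBarIncl k he X n m h (homBarProj k he X n m h g) = g := by
  apply HomX.ext
  intro i j hj y
  refine (homBarIncl_app k he X n m h _ i (i - 1) j hj (by omega) y).trans ?_
  refine (homBarProj_app k he X n m h g (i - 1) i j (by omega) (by omega) _).trans ?_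
  rw [barProj_incl]

theorem homBarProj_incl (n m : ℤ) (h : n + 1 = m) (f : HomX (drinBimod' k he) X m) :
    homBarProj k he X n m h (homBarIncl k he X n m h f) = f - homAug k he X m (homOneMap k he X m f) := by
  apply HomX.ext
  intro i j hj w
  have h₁ : X.act m i j (by omega) (homOneMap k he X m f) (drinAugMap k he i w) +
      HomX.app (N := drinBimod' k he) (P := X) f i j hj
        (barIncl k he (i + 1) i rfl (barProj k he (i + 1) i rfl w)) =
      HomX.app (N := drinBimod' k he) (P := X) f i j hj w :=
    (congrArg (· + _) (homX_one (drinUnitHom k he) X f i j hj (by omega) _).symm).trans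
      ((map_add _ _ _).symm.trans (congrArg (HomX.app (N := drinBimod' k he) (P := X) f i j hj)
        (barIncl_proj k he (i + 1) i rfl w)))
  refine (homBarProj_app k he X n m h _ i (i + 1) j hj rfl w).trans ?_
  refine (homBarIncl_app k he X n m h f (i + 1) i j (by omega) rfl _).trans ?_
  exact eq_sub_of_add_eq' h₁

theorem homD_homAug (n m : ℤ) (h : n + 1 = m) (x : X.X n) :
    homD (drinBimod' k he) X n m h (homAug k he X n x) =
      homAug k he X m (X.d n m h x) - n.negOnePow • homBarProj k he X n m h (homBarUnit k he X n x) := by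
  apply HomX.ext
  intro i j hj w
  refine (homD_app (drinBimod' k he) X n m h (homAug k he X n x) i j (i + 1) (i + n) hj rfl
    rfl w).trans ?_
  refine congrArg₂ (fun y z : X.X j => y - n.negOnePow • z)
    (d_act_algebra' n i (i + n) m j (by omega) h (by omega) x (drinAugMap k he i w)) ?_
  exact congrArg (X.act n (i + 1) j (by omega) x) (barAug_proj k he (i + 1) i rfl w).symm

theorem homOneMap_aug (n : ℤ) (x : X.X n) : homOneMap k he X n (homAug k he X n x) = x :=
  (congrArg (X.act n 0 n (add_zero n) x) (drinAugMap_one k he)).trans (X.act_one n x)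

/-- The comparison of the cone of the evaluation `Hom(Drin, X) ⟶ X` with `Hom(bar, X)`. -/
noncomputable def coneToHomMap (n : ℤ) :
    HomX (drinBimod' k he) X (n + 1) × X.X n →ₗ[k] HomX (barBimod k he) X n :=
  ((n + 1).negOnePow • homBarIncl k he X n (n + 1) rfl).coprod (homBarUnit k he X n)

theorem coneToHomMap_comm (i : ℤ) (f : HomX (drinBimod' k he) X (i + 1)) (x : X.X i) :
    coneToHomMap k he X (i + 1) (-homD (drinBimod' k he) X (i + 1) (i + 1 + 1) rfl f,
        homOneMap k he X (i + 1) f + X.d i (i + 1) rfl x) =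
      homD (barBimod k he) X i (i + 1) rfl (coneToHomMap k he X i (f, x)) := by
  simp only [coneToHomMap, LinearMap.coprod_apply, map_neg, map_add, LinearMap.smul_apply,
    map_zsmul_unit]
  rw [homD_homBarIncl k he X i (i + 1) (i + 1 + 1) rfl rfl, homBarUnit_d, smul_sub, smul_smul,
    Int.negOnePow_succ (i + 1), Int.negOnePow_succ i, neg_neg, neg_mul, Int.units_mul_self]
  simp only [Units.neg_smul, one_smul, sub_neg_eq_add, add_assoc]

theorem coneToHomMap_act (i j l : ℤ) (h : i + j = l) (f : HomX (drinBimod' k he) X (i + 1))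
    (x : X.X i) (a : (ofAlgebra k A).X j) :
    coneToHomMap k he X l (homAct (drinBimod' k he) X (i + 1) j (l + 1) (by omega) f
        ((drinUnitHom k he).f j a), X.act i j l h x a) =
      homAct (barBimod k he) X i j l h (coneToHomMap k he X i (f, x)) a := by
  by_cases hj : j = 0
  · obtain rfl : i = l := by omega
    simp only [coneToHomMap, LinearMap.coprod_apply, map_add, LinearMap.add_apply,
      LinearMap.smul_apply, map_zsmul_unit]
    rw [homBarIncl_act k he X i (i + 1) j i (i + 1) rfl rfl, homBarUnit_act]
  · rw [ofAlgebra_eq_zero hj a]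
    simp only [map_zero]
    exact map_zero (coneToHomMap k he X l)

/-- The comparison of the cone of the evaluation `Hom(Drin, X) ⟶ X` with `Hom(bar, X)`. -/
noncomputable def coneToHom : cone (homOne (drinUnitHom k he) X) ⟶ homObj (barBimod k he) X where
  f n := coneToHomMap k he X n
  comm i j h x := by
    subst h
    exact coneToHomMap_comm k he X i x.1 x.2
  map_act i j l h x a := coneToHomMap_act k he X i j l h x.1 x.2 a

theorem coneIn_comp_coneToHom :
    coneIn (homOne (drinUnitHom k he) X) ≫ coneToHom k he X = (barUnit k he).app X :=
  DGMod.hom_ext fun n x => LinearMap.congr_fun (LinearMap.coprod_inr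
    ((n + 1).negOnePow • homBarIncl k he X n (n + 1) rfl) (homBarUnit k he X n)) x

theorem homD_smul_homBarProj (i : ℤ) (g : HomX (barBimod k he) X i) :
    (i + 1 + 1).negOnePow • homBarProj k he X (i + 1) (i + 1 + 1) rfl
        (homD (barBimod k he) X i (i + 1) rfl g) =
      -homD (drinBimod' k he) X (i + 1) (i + 1 + 1) rfl
        ((i + 1).negOnePow • homBarProj k he X i (i + 1) rfl g) := by
  rw [map_zsmul_unit, homBarProj_d, Int.negOnePow_succ (i + 1), Units.neg_smul]

theorem homOneMap_smul_proj (i : ℤ) (g : HomX (barBimod k he) X i) :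
    homOneMap k he X (i + 1) ((i + 1).negOnePow • homBarProj k he X i (i + 1) rfl g) +
      X.d i (i + 1) rfl 0 = 0 := by
  rw [map_zsmul_unit, homOneMap_proj, smul_zero, map_zero, add_zero]

/-- A section of `coneToHom`. -/
noncomputable def homToCone : ChainMap (homObj (barBimod k he) X).toDGVect
    (cone (homOne (drinUnitHom k he) X)).toDGVect where
  f n := (LinearMap.inl k (HomX (drinBimod' k he) X (n + 1)) (X.X n)) ∘ₗ
    ((n + 1).negOnePow • homBarProj k he X n (n + 1) rfl)
  comm i j h g := by
    subst h
    exact Prod.ext (homD_smul_homBarProj k he X i g) (homOneMap_smul_proj k he X i g).symm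

theorem coneToHomMap_proj (n : ℤ) (g : HomX (barBimod k he) X n) :
    coneToHomMap k he X n ((n + 1).negOnePow • homBarProj k he X n (n + 1) rfl g, 0) = g := by
  simp only [coneToHomMap, LinearMap.coprod_apply, map_zero, add_zero, LinearMap.smul_apply,
    map_zsmul_unit, homBarIncl_proj, units_smul_smul_self]

theorem homD_homAug_eq (m : ℤ) (f : HomX (drinBimod' k he) X (m + 1 + 1)) (x : X.X (m + 1))
    (hf : homOneMap k he X (m + 1 + 1) f + X.d (m + 1) (m + 1 + 1) rfl x = 0) :
    -homD (drinBimod' k he) X (m + 1) (m + 1 + 1) rfl (homAug k he X (m + 1) x) =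
      f - (m + 1 + 1).negOnePow • homBarProj k he X (m + 1) (m + 1 + 1) rfl
        (coneToHomMap k he X (m + 1) (f, x)) := by
  simp only [coneToHomMap, LinearMap.coprod_apply, LinearMap.smul_apply, map_add, map_zsmul_unit,
    homBarProj_incl, homD_homAug, smul_add, units_smul_smul_self]
  rw [eq_neg_of_add_eq_zero_left hf, map_neg, Int.negOnePow_succ (m + 1), Units.neg_smul]
  abel

theorem quasiIso_coneToHom : quasiIso _ (coneToHom k he X) := by
  refine ChainMap.isQuasiIso_of_section _ (homToCone k he X)
    (fun n g => coneToHomMap_proj k he X n g) ?_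
  rintro n ⟨f, x⟩ hc
  obtain ⟨m, rfl⟩ : ∃ m, n = m + 1 := ⟨n - 1, (sub_add_cancel n 1).symm⟩
  refine ⟨m, rfl, (homAug k he X (m + 1) x, (0 : X.X m)), ?_⟩
  refine Prod.ext (homD_homAug_eq k he X m f x (congrArg Prod.snd hc)) ?_
  refine (congrArg₂ (· + ·) (homOneMap_aug k he X (m + 1) x)
    (map_zero (X.d m (m + 1) rfl))).trans ?_
  exact (add_zero x).trans (sub_zero x).symm

end HomTriangle


section Exactness

variable (k) {A : Type u} [Ring A] [Algebra k A] {e : A} (he : IsIdempotentElem e)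

/-- The element of degree `-1` of the Drinfeld quotient. -/
noncomputable def drinElt : (drinDGA k he).X (-1) :=
  ⟨drinH k he 1 (drinUnit k 1), drinH_mem k he 1 (by norm_num) (drinUnit_mem k 1)⟩

theorem d_drinElt : (drinDGA k he).d (-1) 0 rfl (drinElt k he) =
    (drinUnitHom k he).f 0 (algElt k e) := by
  refine Subtype.ext ((drinD_H k he 1 (drinUnit k 1)).trans ?_)
  rw [drinD_unit, map_zero, sub_zero, one_mul, drinL_unit, mul_one]
  rfl

theorem quasiIso_of_acyclic {Λ : DGA k} {M N : DGMod Λ} (φ : M ⟶ N) (hM : M.Acyclic)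
    (hN : N.Acyclic) : quasiIso Λ φ := fun i =>
  ⟨fun x hx _ => hM i x hx, fun y hy => ⟨0, (DGVect.isCocycle_iff _ i (i + 1) rfl _).2 (map_zero _), by
    rw [map_zero, zero_sub]
    obtain ⟨j, h, z, rfl⟩ := hN i y hy
    exact ⟨j, h, -z, map_neg _ _⟩⟩⟩

theorem row_exact : Exact (homFunctor (rowBimod k he)) :=
  (homConeData _).exact fun _ hM => (cornerAcyclic_iff he).1 (CornerAcyclic.of_acyclic hM)

/-- A map of dg-`A`-modules is a corner equivalence if it becomes a quasi-isomorphism in the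
corner. -/
def CornerEquiv : MorphismProperty (DGMod (ofAlgebra k A)) :=
  (quasiIso (corner k e he)).inverseImage (homFunctor (rowBimod k he))

variable {k he}

theorem cornerEquiv_iff {M N : DGMod (ofAlgebra k A)} (φ : M ⟶ N) :
    CornerEquiv k he φ ↔ CornerAcyclic e (cone φ) :=
  ((homConeData (rowBimod k he)).acyclic_cone φ).symm.trans (cornerAcyclic_iff he).symm

theorem CornerAcyclic.of_quasiIso (he : IsIdempotentElem e) {M N : DGMod (ofAlgebra k A)} {φ : M ⟶ N}
    (hφ : quasiIso _ φ) (hN : CornerAcyclic e N) : CornerAcyclic e M :=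
  (cornerAcyclic_iff he).2 (((cornerAcyclic_iff he).1 hN).of_isQuasiIso' (row_exact k he φ hφ))

theorem CornerEquiv.tensor_bar {M N : DGMod (ofAlgebra k A)} {φ : M ⟶ N} (hφ : CornerEquiv k he φ) :
    quasiIso _ ((tensorFunctor (barBimod k he)).map φ) :=
  ((tensorConeData (barBimod k he)).acyclic_cone φ).1
    (acyclic_tensor_bar k he ((cornerEquiv_iff φ).1 hφ))

theorem CornerEquiv.hom_bar {M N : DGMod (ofAlgebra k A)} {φ : M ⟶ N} (hφ : CornerEquiv k he φ) :
    quasiIso _ ((homFunctor (barBimod k he)).map φ) :=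
  ((homConeData (barBimod k he)).acyclic_cone φ).1
    (acyclic_hom_bar k he ((cornerEquiv_iff φ).1 hφ))

variable (k he)

theorem tensor_bar_exact : Exact (tensorFunctor (barBimod k he)) :=
  fun _ _ φ hφ => CornerEquiv.tensor_bar (row_exact k he φ hφ)

theorem hom_bar_exact : Exact (homFunctor (barBimod k he)) :=
  fun _ _ φ hφ => CornerEquiv.hom_bar (row_exact k he φ hφ)

variable (X : DGMod (ofAlgebra k A))

theorem quasiIso_coneToTensor : quasiIso _ (coneToTensor k he X) :=
  ChainMap.isQuasiIso_of_bijective _ (coneToTensorMap_bijective k he X)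

theorem cornerEquiv_barCounit : CornerEquiv k he ((barCounit k he).app X) :=
  (cornerEquiv_iff _).2 (.of_quasiIso he (quasiIso_coneToTensor k he X)
    (cornerAcyclic_res k (drinUnitHom k he) (drinElt k he) (d_drinElt k he) _))

theorem cornerEquiv_barUnit : CornerEquiv k he ((barUnit k he).app X) := by
  let ev := homOne (drinUnitHom k he) X
  let c := homConeData (rowBimod k he)
  have h₁ : quasiIso _ ((homFunctor (rowBimod k he)).map (coneIn ev) ≫ (c.coneIso ev).hom) := by
    rw [c.coneIn_comp]
    exact quasiIso_coneIn _ ((cornerAcyclic_iff he).1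
      (cornerAcyclic_res k (drinUnitHom k he) (drinElt k he) (d_drinElt k he) _))
  have h₂ : quasiIso _ ((homFunctor (rowBimod k he)).map (coneIn ev)) :=
    (quasiIso _).of_postcomp _ _ (quasiIso_of_iso _) h₁
  have h₃ := (quasiIso _).comp_mem _ _ h₂ (row_exact k he _ (quasiIso_coneToHom k he X))
  rw [← Functor.map_comp, coneIn_comp_coneToHom] at h₃
  exact h₃

theorem drin_tensor_exact : Exact (tensorFunctor (drinBimod k he)) :=
  (tensorConeData _).exact fun M hM => ((quasiIso_iff_acyclic_cone _).1 (quasiIso_of_acyclic k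
    ((barCounit k he).app M) (acyclic_tensor_bar k he (CornerAcyclic.of_acyclic hM))
      hM)).of_isQuasiIso (quasiIso_coneToTensor k he M)

theorem drin_hom_exact : Exact (homFunctor (drinBimod' k he)) := by
  refine (homConeData _).exact fun M hM => ?_
  have h₁ : (homObj (barBimod k he) M).Acyclic :=
    acyclic_hom_bar k he (CornerAcyclic.of_acyclic hM)
  have h₂ : (cone (homOne (drinUnitHom k he) M)).Acyclic :=
    h₁.of_isQuasiIso' (quasiIso_coneToHom k he M)
  have h₃ : quasiIso _ (homOne (drinUnitHom k he) M) := (quasiIso_iff_acyclic_cone _).2 h₂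
  exact DGVect.Acyclic.of_isQuasiIso' (φ := (homOne (drinUnitHom k he) M).toChainMap) h₃ hM

theorem quasiIso_of_bijective {Λ : DGA k} {M N : DGMod Λ} (φ : M ⟶ N)
    (h : ∀ i, Function.Bijective (φ.f i)) : quasiIso Λ φ :=
  ChainMap.isQuasiIso_of_bijective _ h

theorem row_tensor_hom_exact : Exact (tensorFunctor (rowBimod k he) ⋙ homFunctor (rowBimod k he)) :=
  Exact.of_natTrans (tensorHomAdj (rowBimod k he)).unit
    (fun N => quasiIso_of_bijective k _ (cornerUnit_bijective k he N)) id_exact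

theorem col_tensor_exact : Exact (tensorFunctor (colBimod k he)) :=
  Exact.of_natTrans' (colRowIso k he).hom (fun _ => quasiIso_of_isIso _) (row_exact k he)

theorem col_hom_row_exact : Exact (homFunctor (colBimod k he) ⋙ homFunctor (rowBimod k he)) :=
  Exact.of_natTrans (Functor.whiskerLeft (homFunctor (colBimod k he)) (colRowIso k he).hom)
    (fun _ => quasiIso_of_isIso ((colRowIso k he).hom.app _))
    (Exact.of_natTrans' (tensorHomAdj (colBimod k he)).counit
      (fun N => quasiIso_of_bijective k _ (cornerCounit_bijective k he N)) id_exact)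

/-- The counit `Hom(eA, M) ⊗ eA ⟶ M` is a corner equivalence. -/
theorem cornerEquiv_row_counit : CornerEquiv k he ((tensorHomAdj (rowBimod k he)).counit.app X) := by
  have h := (tensorHomAdj (rowBimod k he)).right_triangle_components X
  refine (quasiIso _).of_precomp _ _
    (quasiIso_of_bijective k _ (cornerUnit_bijective k he ((homFunctor (rowBimod k he)).obj X)))
    (?_ : quasiIso _ ((tensorHomAdj (rowBimod k he)).unit.app _ ≫ _))
  rw [h]
  exact quasiIso_of_isIso _

/-- The map `M ⟶ Hom(Ae, Hom(eA, M))`. -/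
noncomputable def colUnit : 𝟭 (DGMod (ofAlgebra k A)) ⟶
    homFunctor (rowBimod k he) ⋙ homFunctor (colBimod k he) :=
  (tensorHomAdj (colBimod k he)).unit ≫
    Functor.whiskerRight (colRowIso k he).hom (homFunctor (colBimod k he))

theorem cornerEquiv_colUnit : CornerEquiv k he ((colUnit k he).app X) := by
  have h₁ : quasiIso _ ((homFunctor (rowBimod k he)).map
      ((tensorHomAdj (colBimod k he)).unit.app X)) := by
    have h := (tensorHomAdj (colBimod k he)).left_triangle_components X
    have h₂ : quasiIso _ ((tensorFunctor (colBimod k he)).map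
        ((tensorHomAdj (colBimod k he)).unit.app X)) := by
      refine (quasiIso _).of_postcomp _ _ (quasiIso_of_bijective k _ (cornerCounit_bijective k he
        ((tensorFunctor (colBimod k he)).obj X)))
        (?_ : quasiIso _ (_ ≫ (tensorHomAdj (colBimod k he)).counit.app _))
      rw [h]
      exact quasiIso_of_isIso _
    have h₃ := (colRowIso k he).hom.naturality ((tensorHomAdj (colBimod k he)).unit.app X)
    refine (quasiIso _).of_precomp _ _ (quasiIso_of_isIso ((colRowIso k he).hom.app X))
      (?_ : quasiIso _ ((colRowIso k he).hom.app X ≫ _))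
    refine h₃ ▸ (quasiIso _).comp_mem _ _ h₂ (quasiIso_of_isIso ((colRowIso k he).hom.app _))
  exact (quasiIso _).comp_mem _ _ h₁ (quasiIso_of_isIso ((homFunctor (rowBimod k he)).map
    ((homFunctor (colBimod k he)).map ((colRowIso k he).hom.app X))))

end Exactness


theorem exists_iso_of_eq_comp {C : Type*} [Category* C] {X Y Z : C} {f : X ⟶ Z} {p : X ⟶ Y}
    {q : Y ⟶ Z} (hp : IsIso p) (h : f = p ≫ q) : ∃ a : X ≅ Y, f = a.hom ≫ q := ⟨asIso p, h⟩

theorem exists_iso_of_eq_comp' {C : Type*} [Category* C] {X Y Z : C} {f : X ⟶ Z} {p : X ⟶ Y}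
    {q : Y ⟶ Z} (hq : IsIso q) (h : f = p ≫ q) : ∃ c : Y ≅ Z, f = p ≫ c.hom := ⟨asIso q, h⟩

section General

variable {Λ Γ : DGA k}

theorem Distinguished.exists_of_iso {X Y Z X' Z' : D Λ} {f : X ⟶ Y} {g : Y ⟶ Z}
    {h : Z ⟶ (shiftD Λ).obj X} (H : Distinguished f g h) (a : X' ≅ X) (c : Z ≅ Z')
    {f' : X' ⟶ Y} {g' : Y ⟶ Z'} (hf : f' = a.hom ≫ f) (hg : g' = g ≫ c.hom) :
    ∃ h', Distinguished f' g' h' := by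
  refine ⟨c.inv ≫ h ≫ (shiftD Λ).map a.inv, H.of_iso a (Iso.refl _) c.symm ?_ ?_ ?_⟩
  · simp [hf]
  · simp [hg]
  · simp [← Functor.map_comp]

theorem ofNatIsoRight_counit_app {C E : Type*} [Category* C] [Category* E] {F : C ⥤ E} {G H : E ⥤ C}
    (adj : F ⊣ G) (iso : G ≅ H) (X : E) : (adj.ofNatIsoRight iso).counit.app X =
      F.map (iso.inv.app X) ≫ adj.counit.app X := by
  simp

theorem ofNatIsoRight_unit_app {C E : Type*} [Category* C] [Category* E] {F : C ⥤ E} {G H : E ⥤ C}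
    (adj : F ⊣ G) (iso : G ≅ H) (X : C) : (adj.ofNatIsoRight iso).unit.app X =
      adj.unit.app X ≫ iso.hom.app (F.obj X) := by
  simp

theorem ofNatIsoLeft_unit_app {C E : Type*} [Category* C] [Category* E] {F F' : C ⥤ E} {G : E ⥤ C}
    (adj : F ⊣ G) (iso : F ≅ F') (X : C) : (adj.ofNatIsoLeft iso).unit.app X =
      adj.unit.app X ≫ G.map (iso.hom.app X) := by
  simp

theorem ofNatIsoLeft_counit_app {C E : Type*} [Category* C] [Category* E] {F F' : C ⥤ E} {G : E ⥤ C}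
    (adj : F ⊣ G) (iso : F ≅ F') (X : E) : (adj.ofNatIsoLeft iso).counit.app X =
      iso.inv.app (G.obj X) ≫ adj.counit.app X := by
  simp

theorem toD_map_comp_eq {X Y Y' Z : DGMod Λ} {f : X ⟶ Y} {g : Y ⟶ Z} {f' : X ⟶ Y'} {g' : Y' ⟶ Z}
    (h : f ≫ g = f' ≫ g') :
    (toD Λ).map f ≫ (toD Λ).map g = (toD Λ).map f' ≫ (toD Λ).map g' := by
  rw [← Functor.map_comp, h, Functor.map_comp]

theorem descAdj_ofNatIsoRight_counit {G : DGMod Λ ⥤ DGMod Γ} {F F' : DGMod Γ ⥤ DGMod Λ} (adj : G ⊣ F)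
    (hG : Exact G) (hF : Exact F) (hF' : Exact F') (τ : F' ⟶ F) (hτ : ∀ M, quasiIso Λ (τ.app M))
    (M : DGMod Γ) : ((descAdj adj hG hF).ofNatIsoRight (descMapIso hF' hF τ hτ).symm).counit.app
      ((toD Γ).obj M) = (toD Γ).map (G.map (τ.app M)) ≫ (toD Γ).map (adj.counit.app M) := by
  refine (ofNatIsoRight_counit_app _ _ _).trans (congrArg₂ (· ≫ ·) ?_ (descAdj_counit_app adj hG hF M))
  exact (congrArg (desc G hG).map (descMapIso_hom_app hF' hF τ hτ M)).trans (desc_map G hG _)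

theorem isIso_ofNatIsoRight_unit {G : DGMod Λ ⥤ DGMod Γ} {F : DGMod Γ ⥤ DGMod Λ} (adj : G ⊣ F)
    (hG : Exact G) (hF : Exact F) {F' : D Γ ⥤ D Λ} (i : desc F hF ≅ F')
    (h : ∀ M, quasiIso Λ (adj.unit.app M)) : IsIso ((descAdj adj hG hF).ofNatIsoRight i).unit := by
  refine @NatIso.isIso_of_isIso_app _ _ _ _ _ _ _ fun X => ?_
  obtain ⟨M, rfl⟩ := exists_toD_obj X
  rw [ofNatIsoRight_unit_app]
  have : IsIso ((descAdj adj hG hF).unit.app ((toD Λ).obj M)) :=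
    (descAdj_unit_app adj hG hF M).symm ▸ isIso_toD_map (h M)
  infer_instance

theorem descAdj_ofNatIsoLeft_unit {G G' : DGMod Λ ⥤ DGMod Γ} {F : DGMod Γ ⥤ DGMod Λ} (adj : G ⊣ F)
    (hG : Exact G) (hG' : Exact G') (hF : Exact F) (τ : G ⟶ G') (hτ : ∀ M, quasiIso Γ (τ.app M))
    (M : DGMod Λ) : ((descAdj adj hG hF).ofNatIsoLeft (descMapIso hG hG' τ hτ)).unit.app
      ((toD Λ).obj M) = (toD Λ).map (adj.unit.app M) ≫ (toD Λ).map (F.map (τ.app M)) := by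
  refine (ofNatIsoLeft_unit_app _ _ _).trans (congrArg₂ (· ≫ ·) (descAdj_unit_app adj hG hF M) ?_)
  exact (congrArg (desc F hF).map (descMapIso_hom_app hG hG' τ hτ M)).trans (desc_map F hF _)

theorem descAdj_ofNatIsoLeft_unit_eq {G G' : DGMod Λ ⥤ DGMod Γ} {F : DGMod Γ ⥤ DGMod Λ} (adj : G ⊣ F)
    (hG : Exact G) (hG' : Exact G') (hF : Exact F) (τ : G ⟶ G') (hτ : ∀ M, quasiIso Γ (τ.app M))
    (M : DGMod Λ) {N : DGMod Λ} {f : M ⟶ N} {g : N ⟶ F.obj (G'.obj M)}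
    (h : adj.unit.app M ≫ F.map (τ.app M) = f ≫ g) :
    ((descAdj adj hG hF).ofNatIsoLeft (descMapIso hG hG' τ hτ)).unit.app
      ((toD Λ).obj M) = (toD Λ).map f ≫ (toD Λ).map g :=
  (descAdj_ofNatIsoLeft_unit adj hG hG' hF τ hτ M).trans (toD_map_comp_eq h)

theorem exists_iso_unit_eq {G G' : DGMod Λ ⥤ DGMod Γ} {F : DGMod Γ ⥤ DGMod Λ}
    (adj : G ⊣ F) (hG : Exact G) (hG' : Exact G') (hF : Exact F) (τ : G ⟶ G')
    (hτ : ∀ M, quasiIso Γ (τ.app M)) (M : DGMod Λ) {N : DGMod Λ} {f : M ⟶ N}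
    {g : N ⟶ F.obj (G'.obj M)} (h : adj.unit.app M ≫ F.map (τ.app M) = f ≫ g)
    (hg : quasiIso Λ g) : ∃ c : (toD Λ).obj N ≅ (desc F hF).obj ((desc G' hG').obj ((toD Λ).obj M)),
      ((descAdj adj hG hF).ofNatIsoLeft (descMapIso hG hG' τ hτ)).unit.app ((toD Λ).obj M) =
        (toD Λ).map f ≫ c.hom :=
  exists_iso_of_eq_comp' (isIso_toD_map hg)
    (descAdj_ofNatIsoLeft_unit_eq adj hG hG' hF τ hτ M h)

theorem exists_iso_counit_eq {G : DGMod Λ ⥤ DGMod Γ} {F F' : DGMod Γ ⥤ DGMod Λ}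
    (adj : G ⊣ F) (hG : Exact G) (hF : Exact F) (hF' : Exact F') (τ : F' ⟶ F)
    (hτ : ∀ M, quasiIso Λ (τ.app M)) (M : DGMod Γ) {N : DGMod Γ} {f : N ⟶ M}
    {g : G.obj (F'.obj M) ⟶ N} (h : G.map (τ.app M) ≫ adj.counit.app M = g ≫ f)
    (hg : quasiIso Γ g) : ∃ a : (desc G hG).obj ((desc F' hF').obj ((toD Γ).obj M)) ≅ (toD Γ).obj N,
      ((descAdj adj hG hF).ofNatIsoRight (descMapIso hF' hF τ hτ).symm).counit.app ((toD Γ).obj M) =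
        a.hom ≫ (toD Γ).map f :=
  exists_iso_of_eq_comp (isIso_toD_map hg)
    ((descAdj_ofNatIsoRight_counit adj hG hF hF' τ hτ M).trans (toD_map_comp_eq h))

end General

section JFunctors

variable (k) {A : Type u} [Ring A] [Algebra k A] {e : A} (he : IsIdempotentElem e)

theorem row_bar_exact : Exact (tensorFunctor (rowBimod k he) ⋙ tensorFunctor (barBimod k he)) :=
  fun _ _ φ hφ => CornerEquiv.tensor_bar (row_tensor_hom_exact k he φ hφ)

theorem col_bar_exact : Exact (homFunctor (colBimod k he) ⋙ homFunctor (barBimod k he)) :=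
  fun _ _ φ hφ => CornerEquiv.hom_bar (col_hom_row_exact k he φ hφ)

/-- The functor `j^* = j^!`. -/
noncomputable def jPull : D (ofAlgebra k A) ⥤ D (corner k e he) :=
  desc (homFunctor (rowBimod k he)) (row_exact k he)

/-- The functor `j_!`. -/
noncomputable def jShriek : D (corner k e he) ⥤ D (ofAlgebra k A) :=
  desc _ (row_bar_exact k he)

/-- The functor `j_*`. -/
noncomputable def jPush : D (corner k e he) ⥤ D (ofAlgebra k A) :=
  desc _ (col_bar_exact k he)

/-- `j^!` in terms of the bar resolution. -/
noncomputable def jPullIsoHom : jPull k he ≅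
    desc _ ((hom_bar_exact k he).comp (row_exact k he)) :=
  descMapIso _ _ (Functor.whiskerRight (barUnit k he) (homFunctor (rowBimod k he)))
    (cornerEquiv_barUnit k he)

/-- The comparison of `- ⊗ bar ⊗ Ae` and `Hom(eA, -)`. -/
noncomputable def colBarMap : tensorFunctor (barBimod k he) ⋙ tensorFunctor (colBimod k he) ⟶
    homFunctor (rowBimod k he) :=
  Functor.whiskerRight (barCounit k he) (tensorFunctor (colBimod k he)) ≫ (colRowIso k he).hom

theorem quasiIso_colBarMap (M : DGMod (ofAlgebra k A)) : quasiIso _ ((colBarMap k he).app M) := by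
  have h : (colBarMap k he).app M = (colRowIso k he).hom.app _ ≫
      (homFunctor (rowBimod k he)).map ((barCounit k he).app M) :=
    (colRowIso k he).hom.naturality ((barCounit k he).app M)
  rw [h]
  exact (quasiIso _).comp_mem _ _ (quasiIso_of_isIso _) (cornerEquiv_barCounit k he M)

/-- `j^*` in terms of the bar resolution. -/
noncomputable def jPullIsoTensor : desc _ ((tensor_bar_exact k he).comp (col_tensor_exact k he)) ≅
    jPull k he :=
  descMapIso _ _ (colBarMap k he) (quasiIso_colBarMap k he)

/-- `j_! ⊣ j^!`. -/
noncomputable def jAdj : jShriek k he ⊣ jPull k he :=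
  (descAdj ((tensorHomAdj (rowBimod k he)).comp (tensorHomAdj (barBimod k he)))
    (row_bar_exact k he) ((hom_bar_exact k he).comp (row_exact k he))).ofNatIsoRight
      (jPullIsoHom k he).symm

/-- `j^* ⊣ j_*`. -/
noncomputable def jAdj' : jPull k he ⊣ jPush k he :=
  (descAdj ((tensorHomAdj (barBimod k he)).comp (tensorHomAdj (colBimod k he)))
    ((tensor_bar_exact k he).comp (col_tensor_exact k he)) (col_bar_exact k he)).ofNatIsoLeft
      (jPullIsoTensor k he)

variable (M : DGMod (ofAlgebra k A))

theorem row_bar_counit :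
    (tensorFunctor (barBimod k he)).map ((tensorFunctor (rowBimod k he)).map
        ((homFunctor (rowBimod k he)).map ((barUnit k he).app M))) ≫
      ((tensorHomAdj (rowBimod k he)).comp (tensorHomAdj (barBimod k he))).counit.app M =
    (tensorFunctor (barBimod k he)).map ((tensorHomAdj (rowBimod k he)).counit.app M) ≫
      (barCounit k he).app M := by
  have h₁ := (tensorHomAdj (rowBimod k he)).counit.naturality ((barUnit k he).app M)
  have h₂ := barUnit_comp_tensorHomAdj_counit k he M
  rw [Adjunction.comp_counit_app, ← h₂, ← Functor.map_comp_assoc, ← Functor.map_comp_assoc]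
  exact congrArg (fun z => (tensorFunctor (barBimod k he)).map z ≫
    (tensorHomAdj (barBimod k he)).counit.app M) h₁

theorem bar_col_unit :
    ((tensorHomAdj (barBimod k he)).comp (tensorHomAdj (colBimod k he))).unit.app M ≫
      (homFunctor (barBimod k he)).map ((homFunctor (colBimod k he)).map ((colBarMap k he).app M)) =
    (barUnit k he).app M ≫ (homFunctor (barBimod k he)).map ((colUnit k he).app M) := by
  have h₁ : (tensorHomAdj (colBimod k he)).unit.app _ ≫ (homFunctor (colBimod k he)).map
      ((tensorFunctor (colBimod k he)).map ((barCounit k he).app M)) =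
        (barCounit k he).app M ≫ (tensorHomAdj (colBimod k he)).unit.app M :=
    ((tensorHomAdj (colBimod k he)).unit.naturality ((barCounit k he).app M)).symm
  have h₂ : (tensorHomAdj (colBimod k he)).unit.app _ ≫ (homFunctor (colBimod k he)).map
      ((colBarMap k he).app M) = (barCounit k he).app M ≫ (colUnit k he).app M :=
    (congrArg (_ ≫ ·) ((homFunctor (colBimod k he)).map_comp _ _)).trans
      ((Category.assoc _ _ _).symm.trans ((congrArg (· ≫ (homFunctor (colBimod k he)).map
        ((colRowIso k he).hom.app M)) h₁).trans (Category.assoc _ _ _)))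
  rw [Adjunction.comp_unit_app, ← tensorHomAdj_unit_comp_barCounit, Category.assoc, Category.assoc,
    ← Functor.map_comp]
  exact congrArg (_ ≫ ·) ((congrArg _ h₂).trans ((homFunctor (barBimod k he)).map_comp _ _))

theorem jAdj_counit_factor :
    ∃ a : (jShriek k he).obj ((jPull k he).obj ((toD (ofAlgebra k A)).obj M)) ≅
      (toD (ofAlgebra k A)).obj ((tensorFunctor (barBimod k he)).obj M),
      (jAdj k he).counit.app ((toD (ofAlgebra k A)).obj M) =
        a.hom ≫ (toD (ofAlgebra k A)).map ((barCounit k he).app M) := by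
  exact exists_iso_counit_eq ((tensorHomAdj (rowBimod k he)).comp (tensorHomAdj (barBimod k he)))
    (row_bar_exact k he) ((hom_bar_exact k he).comp (row_exact k he)) (row_exact k he)
    (Functor.whiskerRight (barUnit k he) (homFunctor (rowBimod k he))) (cornerEquiv_barUnit k he) M
    (row_bar_counit k he M) (CornerEquiv.tensor_bar (cornerEquiv_row_counit k he M))

theorem jAdj'_unit_factor :
    ∃ c : (toD (ofAlgebra k A)).obj ((homFunctor (barBimod k he)).obj M) ≅
      (jPush k he).obj ((jPull k he).obj ((toD (ofAlgebra k A)).obj M)),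
      (jAdj' k he).unit.app ((toD (ofAlgebra k A)).obj M) =
        (toD (ofAlgebra k A)).map ((barUnit k he).app M) ≫ c.hom := by
  exact exists_iso_unit_eq ((tensorHomAdj (barBimod k he)).comp (tensorHomAdj (colBimod k he)))
    ((tensor_bar_exact k he).comp (col_tensor_exact k he)) (row_exact k he) (col_bar_exact k he)
    (colBarMap k he) (quasiIso_colBarMap k he) M (bar_col_unit k he M)
    (CornerEquiv.hom_bar (cornerEquiv_colUnit k he M))

theorem quasiIso_row_bar_unit (N : DGMod (corner k e he)) : quasiIso _
    (((tensorHomAdj (rowBimod k he)).comp (tensorHomAdj (barBimod k he))).unit.app N) := by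
  have h₁ : quasiIso _ ((homFunctor (rowBimod k he)).map
      ((tensorHomAdj (barBimod k he)).unit.app ((tensorFunctor (rowBimod k he)).obj N))) := by
    have h : quasiIso _ ((homFunctor (rowBimod k he)).map
        ((barUnit k he).app ((tensorFunctor (rowBimod k he)).obj N))) :=
      cornerEquiv_barUnit k he _
    rw [← tensorHomAdj_unit_comp_barCounit, Functor.map_comp] at h
    exact (quasiIso _).of_postcomp _ _ (row_exact k he _
      (CornerEquiv.hom_bar (cornerEquiv_barCounit k he _))) h
  rw [Adjunction.comp_unit_app]
  exact (quasiIso _).comp_mem _ _ (quasiIso_of_bijective k _ (cornerUnit_bijective k he N)) h₁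

/-- The unit of `j_! ⊣ j^!` is an isomorphism. -/
theorem isIso_jAdj_unit : IsIso (jAdj k he).unit :=
  isIso_ofNatIsoRight_unit ((tensorHomAdj (rowBimod k he)).comp (tensorHomAdj (barBimod k he)))
    (row_bar_exact k he) ((hom_bar_exact k he).comp (row_exact k he)) (jPullIsoHom k he).symm
      (quasiIso_row_bar_unit k he)

/-- `j_!` is fully faithful. -/
noncomputable def jShriekFullyFaithful : (jShriek k he).FullyFaithful :=
  have := isIso_jAdj_unit k he
  (jAdj k he).fullyFaithfulLOfIsIsoUnit

/-- `j_*` is fully faithful. -/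
noncomputable def jPushFullyFaithful : (jPush k he).FullyFaithful :=
  (Adjunction.Triple.mk (jAdj k he) (jAdj' k he)).fullyFaithfulEquiv (jShriekFullyFaithful k he)

theorem isTriangulated_jPull : IsTriangulated (jPull k he) :=
  (homConeData _).isTriangulated _

theorem isTriangulated_jShriek : IsTriangulated (jShriek k he) :=
  ((tensorConeData _).comp (tensorConeData _)).isTriangulated _

theorem isTriangulated_jPush : IsTriangulated (jPush k he) :=
  ((homConeData _).comp (homConeData _)).isTriangulated _

theorem isRightDerived_jPull : IsRightDerived (jPull k he) (homFunctor (rowBimod k he)) :=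
  isRightDerived_of_iso (descIso _ _)

theorem isLeftDerived_jPull : IsLeftDerived (jPull k he) (tensorFunctor (colBimod k he)) :=
  isLeftDerived_of_iso (descIso _ _ ≪≫ Functor.isoWhiskerRight (colRowIso k he).symm _)

theorem isLeftDerived_jShriek : IsLeftDerived (jShriek k he) (tensorFunctor (rowBimod k he)) :=
  isLeftDerived_of_adjunction (tensorHomAdj _) (jAdj k he) (descIso _ _)

theorem isRightDerived_jPush : IsRightDerived (jPush k he) (homFunctor (colBimod k he)) :=
  isRightDerived_of_adjunction (tensorHomAdj _) (jAdj' k he)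
    (descIso _ _ ≪≫ Functor.isoWhiskerRight (colRowIso k he).symm _)

end JFunctors


section ResAdj

variable {Λ Γ : DGA k} (f : Λ ⟶ Γ)

/-- Extension of scalars is left adjoint to restriction of scalars. -/
noncomputable def tensorResAdj : tensorFunctor (bimodOfHoms f (𝟙 Γ)) ⊣ res f :=
  (tensorHomAdj (bimodOfHoms f (𝟙 Γ))).ofNatIsoRight (resHomIso f).symm

theorem tensorResAdj_unit_app (M : DGMod Λ) : (tensorResAdj f).unit.app M = tensorOne f M := by
  refine (ofNatIsoRight_unit_app _ _ _).trans ((Iso.comp_inv_eq ((resHomIso f).app _)).2 ?_)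
  ext n x
  apply HomX.ext
  intro i j h y
  refine Eq.symm ((tensorAct_tmul M (bimodOfHoms f (𝟙 Γ)) n 0 n i j i (add_zero n) (by omega)
    (zero_add i) x Γ.one y).trans ?_)
  exact congrArg (tmul M (bimodOfHoms f (𝟙 Γ)) n i j (by omega) x) (Γ.one_mul i y)

/-- Coextension of scalars is right adjoint to restriction of scalars. -/
noncomputable def resHomAdj : res f ⊣ homFunctor (bimodOfHoms (𝟙 Γ) f) :=
  (tensorHomAdj (bimodOfHoms (𝟙 Γ) f)).ofNatIsoLeft (resTensorIso f)

theorem resHomAdj_counit_app (M : DGMod Λ) : (resHomAdj f).counit.app M = homOne f M := by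
  refine (ofNatIsoLeft_counit_app _ _ _).trans ((Iso.inv_comp_eq ((resTensorIso f).app _)).2 ?_)
  apply tensorObj_hom_ext
  intro i j n h g y
  refine ((evalPairing (bimodOfHoms (𝟙 Γ) f) M).lift_tmul i j n h g y).trans ?_
  refine Eq.trans ?_ (congrArg ((homOne f M).f n) ((resTensorPairing f
    (homObj (bimodOfHoms (𝟙 Γ) f) M)).lift_tmul i j n h g y)).symm
  refine Eq.trans ?_ (homAct_app (bimodOfHoms (𝟙 Γ) f) M i j n h g y 0 n j (zero_add n)
    (add_zero j) Γ.one).symm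
  exact congrArg (HomX.app (N := bimodOfHoms (𝟙 Γ) f) (P := M) g j n (by omega)) (Γ.mul_one j y).symm

theorem isIso_descAdj_counit {G : DGMod Λ ⥤ DGMod Γ} {F : DGMod Γ ⥤ DGMod Λ} (adj : G ⊣ F)
    (hG : Exact G) (hF : Exact F) (h : ∀ M, quasiIso Γ (adj.counit.app M)) :
    IsIso (descAdj adj hG hF).counit := by
  refine @NatIso.isIso_of_isIso_app _ _ _ _ _ _ _ fun X => ?_
  obtain ⟨M, rfl⟩ := exists_toD_obj X
  exact (descAdj_counit_app adj hG hF M).symm ▸ isIso_toD_map (h M)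

end ResAdj

section DrinRes

variable (k) {A : Type u} [Ring A] [Algebra k A] {e : A} (he : IsIdempotentElem e)

/-- The adjunction of extension and restriction of scalars along `A ⟶ Drin` on derived
categories. -/
noncomputable def drinAdj : desc _ (drin_tensor_exact k he) ⊣
    desc _ (res_exact (drinUnitHom k he)) :=
  descAdj (tensorResAdj (drinUnitHom k he)) (drin_tensor_exact k he) (res_exact _)

theorem quasiIso_tensorOne {X : DGMod (ofAlgebra k A)} (hX : CornerAcyclic e X) :
    quasiIso _ (tensorOne (drinUnitHom k he) X) := by
  rw [← coneIn_comp_coneToTensor]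
  exact (quasiIso _).comp_mem _ _ (quasiIso_coneIn _ (acyclic_tensor_bar k he hX))
    (quasiIso_coneToTensor k he X)

theorem quasiIso_drin_counit (Y : DGMod (drinDGA k he)) :
    quasiIso (drinDGA k he) ((tensorResAdj (drinUnitHom k he)).counit.app Y) := by
  have h₁ : quasiIso (ofAlgebra k A) ((tensorResAdj (drinUnitHom k he)).unit.app
      ((res (drinUnitHom k he)).obj Y) ≫
        (res (drinUnitHom k he)).map ((tensorResAdj (drinUnitHom k he)).counit.app Y)) := by
    rw [Adjunction.right_triangle_components]
    exact quasiIso_of_isIso _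
  have h₂ : quasiIso (ofAlgebra k A) ((tensorResAdj (drinUnitHom k he)).unit.app
      ((res (drinUnitHom k he)).obj Y)) := by
    rw [tensorResAdj_unit_app]
    exact quasiIso_tensorOne k he
      (cornerAcyclic_res k (drinUnitHom k he) (drinElt k he) (d_drinElt k he) Y)
  exact (quasiIso (ofAlgebra k A)).of_precomp _ _ h₂ h₁

/-- Restriction along `A ⟶ Drin` is fully faithful on derived categories. -/
noncomputable def drinResFullyFaithful :
    (desc _ (res_exact (drinUnitHom k he))).FullyFaithful :=
  have : IsIso (drinAdj k he).counit :=
    isIso_descAdj_counit (tensorResAdj (drinUnitHom k he)) (drin_tensor_exact k he)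
      (res_exact (drinUnitHom k he)) (quasiIso_drin_counit k he)
  (drinAdj k he).fullyFaithfulROfIsIsoCounit

end DrinRes


section DrinLift

variable {A : Type u} [Ring A] [Algebra k A] {e : A} (he : IsIdempotentElem e) {Γ : DGA k}
  (l : ofAlgebra k A ⟶ Γ) (h : Γ.X (-1))

/-- The operator `y ↦ l(a) y`. -/
def algMul (l : ofAlgebra k A ⟶ Γ) (j : ℤ) : A →ₗ[k] Γ.X j →ₗ[k] Γ.X j :=
  Γ.mul 0 j j (zero_add j) ∘ₗ l.f 0 ∘ₗ algElt k

theorem algMul_algMul (a b : A) (j : ℤ) (y : Γ.X j) :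
    algMul l j a (algMul l j b y) = algMul l j (a * b) y := by
  refine (Γ.mul_assoc 0 0 j 0 j j (zero_add 0) (zero_add j) (zero_add j) (zero_add j) _ _ y).symm.trans ?_
  exact congrArg (fun z => Γ.mul 0 j j (zero_add j) z y)
    (l.map_mul 0 0 0 (zero_add 0) (algElt k a) (algElt k b)).symm

theorem algMul_mul (a : A) (i j n : ℤ) (hn : i + j = n) (x : Γ.X i) (y : Γ.X j) :
    Γ.mul i j n hn (algMul l i a x) y = algMul l n a (Γ.mul i j n hn x y) :=
  Γ.mul_assoc 0 i j i n n (zero_add i) hn hn (zero_add n) _ x y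

theorem d_algMul (a : A) (i j : ℤ) (hj : i + 1 = j) (y : Γ.X i) :
    Γ.d i j hj (algMul l i a y) = algMul l j a (Γ.d i j hj y) := by
  refine (Γ.d_mul 0 i i 1 j j (zero_add i) rfl hj hj (l.f 0 (algElt k a)) y).trans ?_
  have h₀ : Γ.d 0 1 rfl (l.f 0 (algElt k a)) = 0 :=
    (l.comm 0 1 rfl (algElt k a)).symm.trans (map_zero _)
  rw [h₀, LinearMap.map_zero₂, zero_add, Int.negOnePow_zero, one_smul]
  rfl

/-- The components of the extension of `l` to the Drinfeld quotient. -/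
noncomputable def towerLift : ∀ (n : ℕ) (j : ℤ), (n : ℤ) + j = 0 → (tower k e n).X →ₗ[k] Γ.X j
  | 0, j, hj => l.f j ∘ₗ ({
      toFun := fun a => ⟨a, one_mul a, mul_one a, fun hj' => absurd (by simpa using hj) hj'⟩
      map_add' := fun _ _ => rfl
      map_smul' := fun _ _ => rfl } : A →ₗ[k] (ofAlgebra k A).X j)
  | n + 1, j, hj => tauLift k ((algMul l j).compl₂
      (Γ.mul (-1) (j + 1) j (by omega) h ∘ₗ towerLift n (j + 1) (by push_cast at hj; omega)))

/-- The extension of `l` to the Drinfeld quotient in degree `j`. -/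
noncomputable def drinLift (j : ℤ) : Drin k (e := e) →ₗ[k] Γ.X j :=
  DirectSum.toModule k ℕ _ fun n => if hj : (n : ℤ) + j = 0 then towerLift l h n j hj else 0

theorem drinLift_of_eq (n : ℕ) (j : ℤ) (hj : (n : ℤ) + j = 0) (x : (tower k e n).X) :
    drinLift l h j (drinOf k n x) = towerLift l h n j hj x :=
  (toModule_drinOf k _ n x).trans (by rw [dif_pos hj])

theorem drinLift_of_ne (n : ℕ) (j : ℤ) (hj : (n : ℤ) + j ≠ 0) (x : (tower k e n).X) :
    drinLift l h j (drinOf k n x) = 0 :=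
  (toModule_drinOf k _ n x).trans (by rw [dif_neg hj]; rfl)

theorem drinLift_eq_zero {i j : ℤ} (hij : i ≠ j) {x : Drin k (e := e)} (hx : x ∈ drinGr k e j) :
    drinLift l h i x = 0 :=
  drinGr_induction (P := fun x => drinLift l h i x = 0) (map_zero _)
    (fun n x hn => drinLift_of_ne l h n i (by omega) x) x hx

theorem drinLift_unit (a : A) : drinLift (e := e) l h 0 (drinUnit k a) = l.f 0 (algElt k a) :=
  drinLift_of_eq l h 0 0 rfl a

theorem drinLift_unit_of_ne (j : ℤ) (hj : j ≠ 0) (a : A) :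
    drinLift (e := e) l h j (drinUnit k a) = 0 :=
  drinLift_of_ne l h 0 j (by simpa using hj) a

theorem neg_one_add_add_one (n : ℤ) : -1 + (n + 1) = n := by omega

/-- The operator `y ↦ h y` of degree `-1`. -/
def eltMul (j : ℤ) : Γ.X (j + 1) →ₗ[k] Γ.X j := Γ.mul (-1) (j + 1) j (by omega) h

theorem drinLift_L (he : IsIdempotentElem e) (a : A) (j : ℤ) (x : Drin k (e := e)) :
    drinLift l h j (drinL k a x) = algMul l j a (drinLift l h j x) := by
  refine LinearMap.congr_fun (f := drinLift l h j ∘ₗ drinL k a) (g := algMul l j a ∘ₗ drinLift l h j)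
    (DirectSum.linearMap_ext _ fun n => LinearMap.ext fun y => ?_) x
  change drinLift l h j (drinL k a (drinOf k n y)) = algMul l j a (drinLift l h j (drinOf k n y))
  by_cases hj : (n : ℤ) + j = 0
  · cases n with
    | zero =>
      obtain rfl : j = 0 := by simpa using hj
      refine (congrArg (drinLift l h 0) (drinL_unit k a y)).trans ((drinLift_unit l h _).trans ?_)
      exact (l.map_mul 0 0 0 (zero_add 0) (algElt k a) (algElt k y)).trans
        (congrArg (algMul l 0 a) (drinLift_unit l h y).symm)
    | succ n =>
      refine LinearMap.congr_fun (f := drinLift l h j ∘ₗ drinL k a ∘ₗ drinOf k (n + 1))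
        (g := algMul l j a ∘ₗ drinLift l h j ∘ₗ drinOf k (n + 1)) (towerTau_ext he fun b z => ?_) y
      change drinLift l h j (drinL k a (drinOf k (n + 1) (towerTau k he n b z))) =
        algMul l j a (drinLift l h j (drinOf k (n + 1) (towerTau k he n b z)))
      rw [← drinH_of, drinL_H, drinH_of, drinH_of, drinLift_of_eq l h _ j hj,
        drinLift_of_eq l h _ j hj]
      refine (tauLift_tau k he _ (a * b) z).trans (Eq.trans ?_
        (congrArg (algMul l j a) (tauLift_tau k he _ b z)).symm)
      exact (congrArg (fun c => algMul l j c _) (mul_assoc a b e)).trans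
        (algMul_algMul l a (b * e) j _).symm
  · rw [drinL_of, drinLift_of_ne l h _ j hj, drinLift_of_ne l h _ j hj, map_zero]

variable {h} (he' : ∀ (j : ℤ) (y : Γ.X (j + 1)), algMul l j e (eltMul h j (algMul l (j + 1) e y)) =
  eltMul h j y)

theorem drinLift_H (he' : ∀ (j : ℤ) (y : Γ.X (j + 1)),
    algMul l j e (eltMul h j (algMul l (j + 1) e y)) = eltMul h j y)
    (a : A) (j : ℤ) (x : Drin k (e := e)) :
    drinLift l h j (drinH k he a x) = algMul l j a (eltMul h j (drinLift l h (j + 1) x)) := by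
  refine LinearMap.congr_fun (f := drinLift l h j ∘ₗ drinH k he a)
    (g := algMul l j a ∘ₗ eltMul h j ∘ₗ drinLift l h (j + 1))
    (DirectSum.linearMap_ext _ fun n => LinearMap.ext fun y => ?_) x
  change drinLift l h j (drinH k he a (drinOf k n y)) =
    algMul l j a (eltMul h j (drinLift l h (j + 1) (drinOf k n y)))
  rw [drinH_of]
  by_cases hj : ((n + 1 : ℕ) : ℤ) + j = 0
  · have hj' : (n : ℤ) + (j + 1) = 0 := by push_cast at hj; omega
    rw [drinLift_of_eq l h _ j hj]
    refine (tauLift_tau k he _ a y).trans ?_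
    change algMul l j (a * e) (eltMul h j (towerLift l h n (j + 1) _ (e • y))) = _
    rw [← drinLift_of_eq l h n (j + 1) hj', ← drinL_of, drinLift_L l h he, ← algMul_algMul, he']
  · rw [drinLift_of_ne l h _ j hj, drinLift_of_ne l h n (j + 1) (by push_cast at hj; omega), map_zero,
      map_zero]

theorem drinLift_mul (he' : ∀ (j : ℤ) (y : Γ.X (j + 1)),
    algMul l j e (eltMul h j (algMul l (j + 1) e y)) = eltMul h j y)
    (i j n : ℤ) (hn : i + j = n) (x : Drin k (e := e)) {y : Drin k (e := e)}
    (hy : y ∈ drinGr k e j) : drinLift l h n (drinMul k he x y) =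
      Γ.mul i j n hn (drinLift l h i x) (drinLift l h j y) := by
  let F : Drin k (e := e) →ₗ[k] (∀ i, Γ.X (i + j)) :=
    LinearMap.pi fun i => drinLift l h (i + j) ∘ₗ (drinMul k he).flip y
  let G : Drin k (e := e) →ₗ[k] (∀ i, Γ.X (i + j)) :=
    LinearMap.pi fun i => (Γ.mul i j (i + j) rfl).flip (drinLift l h j y) ∘ₗ drinLift l h i
  subst hn
  refine congrFun (LinearMap.congr_fun (f := F) (g := G) (drin_ext he (fun a => ?_)
    fun a x hx => ?_) x) i
  · funext i
    change drinLift l h (i + j) (drinMul k he (drinUnit k a) y) =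
      Γ.mul i j (i + j) rfl (drinLift l h i (drinUnit k a)) (drinLift l h j y)
    rw [drinMul_unit, drinLift_L l h he]
    by_cases hi : i = 0
    · subst hi
      rw [drinLift_unit]
      have key (m : ℤ) (hm : 0 + j = m) : algMul l m a (drinLift l h m y) =
          Γ.mul 0 j m hm (l.f 0 (algElt k a)) (drinLift l h j y) := by
        obtain rfl : j = m := by omega
        rfl
      exact key _ rfl
    · rw [drinLift_unit_of_ne l h i hi, drinLift_eq_zero l h (by omega) hy, map_zero,
        LinearMap.map_zero₂]
  · funext i
    have hx := congrFun hx (i + 1)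
    change drinLift l h (i + 1 + j) (drinMul k he x y) =
      Γ.mul (i + 1) j (i + 1 + j) rfl (drinLift l h (i + 1) x) (drinLift l h j y) at hx
    change drinLift l h (i + j) (drinMul k he (drinH k he a x) y) =
      Γ.mul i j (i + j) rfl (drinLift l h i (drinH k he a x)) (drinLift l h j y)
    rw [drinMul_H, drinLift_H he l he', drinLift_H he l he', algMul_mul]
    refine congrArg (algMul l (i + j) a) ?_
    have key (m : ℤ) (hm : i + 1 + j = m) (hm' : -1 + m = i + j) :
        Γ.mul (-1) m (i + j) hm' h (drinLift l h m (drinMul k he x y)) =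
          Γ.mul i j (i + j) rfl (eltMul h i (drinLift l h (i + 1) x)) (drinLift l h j y) := by
      subst hm
      rw [hx]
      exact (Γ.mul_assoc (-1) (i + 1) j i (i + 1 + j) (i + j) (by omega) rfl rfl hm' h _ _).symm
    exact key (i + j + 1) (add_right_comm i 1 j) (neg_one_add_add_one _)

theorem drinLift_d (he' : ∀ (j : ℤ) (y : Γ.X (j + 1)),
    algMul l j e (eltMul h j (algMul l (j + 1) e y)) = eltMul h j y)
    (hd : Γ.d (-1) 0 rfl h = l.f 0 (algElt k e)) (i j : ℤ) (hj : i + 1 = j)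
    (x : Drin k (e := e)) :
    drinLift l h j (drinD k he x) = Γ.d i j hj (drinLift l h i x) := by
  let F : Drin k (e := e) →ₗ[k] (∀ i, Γ.X (i + 1)) :=
    LinearMap.pi fun i => drinLift l h (i + 1) ∘ₗ drinD k he
  let G : Drin k (e := e) →ₗ[k] (∀ i, Γ.X (i + 1)) :=
    LinearMap.pi fun i => Γ.d i (i + 1) rfl ∘ₗ drinLift l h i
  subst hj
  refine congrFun (LinearMap.congr_fun (f := F) (g := G) (drin_ext he (fun a => ?_)
    fun a x hx => ?_) x) i
  · funext i
    change drinLift l h (i + 1) (drinD k he (drinUnit k a)) =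
      Γ.d i (i + 1) rfl (drinLift l h i (drinUnit k a))
    rw [drinD_unit, map_zero]
    by_cases hi : i = 0
    · subst hi
      rw [drinLift_unit]
      exact ((l.comm 0 (0 + 1) rfl (algElt k a)).symm.trans (map_zero _)).symm
    · rw [drinLift_unit_of_ne l h i hi, map_zero]
  · funext i
    have hx := congrFun hx (i + 1)
    change drinLift l h (i + 1 + 1) (drinD k he x) =
      Γ.d (i + 1) (i + 1 + 1) rfl (drinLift l h (i + 1) x) at hx
    change drinLift l h (i + 1) (drinD k he (drinH k he a x)) =
      Γ.d i (i + 1) rfl (drinLift l h i (drinH k he a x))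
    rw [drinD_H, map_sub, drinLift_L l h he, drinLift_H he l he', drinLift_H he l he', d_algMul, hx,
      ← algMul_algMul, ← map_sub]
    refine congrArg (algMul l (i + 1) a) ?_
    refine Eq.symm ((Γ.d_mul (-1) (i + 1) i 0 (i + 1 + 1) (i + 1) (by omega) rfl rfl rfl h _).trans ?_)
    rw [hd, Int.negOnePow_neg, Int.negOnePow_one, Units.neg_smul, one_smul, ← sub_eq_add_neg]
    rfl

/-- The dga map from the Drinfeld quotient given by an element of degree `-1` with boundary
`l(e)`. -/
noncomputable def drinLiftHom (hd : Γ.d (-1) 0 rfl h = l.f 0 (algElt k e)) : drinDGA k he ⟶ Γ where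
  f j := drinLift l h j ∘ₗ (drinGr k e j).subtype
  comm i j hj x := drinLift_d he l he' hd i j hj x.1
  map_one := (drinLift_unit l h 1).trans l.map_one
  map_mul i j n hn x y := drinLift_mul he l he' i j n hn x.1 y.2

theorem drinUnitHom_comp_lift (hd : Γ.d (-1) 0 rfl h = l.f 0 (algElt k e)) :
    drinUnitHom k he ≫ drinLiftHom he l he' hd = l := by
  refine DGA.Hom.ext (funext fun i => LinearMap.ext fun a => ?_)
  by_cases hi : i = 0
  · subst hi
    exact drinLift_unit l h a.1
  · rw [ofAlgebra_eq_zero hi a, map_zero, map_zero]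

end DrinLift


section Contractible

variable {A : Type u} [Ring A] [Algebra k A] {e : A}

theorem eq_of_isBoundary_ofAlgebra {i : ℤ} {x y : (ofAlgebra k A).X i}
    (h : (ofAlgebra k A).IsBoundary i (x - y)) : x = y := by
  obtain ⟨j, hj, z, hz⟩ := h
  exact sub_eq_zero.1 (hz.symm.trans rfl)

/-- If `l(1 - e)` is invertible in cohomology, then `l(e)` is the coboundary of an element of
`l(e) Γ l(e)`. -/
theorem exists_contraction_of_isInvertibleClass (he : IsIdempotentElem e) {Γ : DGA k}
    (l : ofAlgebra k A ⟶ Γ) (hs : Γ.IsInvertibleClass (l.f 0 (algElt k (1 - e)))) :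
    ∃ h : Γ.X (-1), (∀ (j : ℤ) (y : Γ.X (j + 1)),
      algMul l j e (eltMul h j (algMul l (j + 1) e y)) = eltMul h j y) ∧
      Γ.d (-1) 0 rfl h = l.f 0 (algElt k e) := by
  obtain ⟨w, -, hw, -⟩ := hs
  obtain ⟨y, hy⟩ := (Γ.isBoundary_iff 0 (-1) rfl _).1 hw
  have hde : Γ.d 0 1 rfl (l.f 0 (algElt k e)) = 0 :=
    (l.comm 0 1 rfl (algElt k e)).symm.trans (map_zero _)
  have hee : algMul l 0 e (l.f 0 (algElt k e)) = l.f 0 (algElt k e) := by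
    refine (l.map_mul 0 0 0 (zero_add 0) (algElt k e) (algElt k e)).symm.trans ?_
    exact congrArg (l.f 0) (Subtype.ext he)
  have hl1 : Γ.mul 0 0 0 (zero_add 0) Γ.one (l.f 0 (algElt k e)) = l.f 0 (algElt k e) :=
    Γ.one_mul 0 _
  refine ⟨-algMul l (-1) e (Γ.mul (-1) 0 (-1) rfl y (l.f 0 (algElt k e))), fun j x => ?_, ?_⟩
  · have h₁ : algMul l (-1) e (-algMul l (-1) e (Γ.mul (-1) 0 (-1) rfl y (l.f 0 (algElt k e)))) =
        -algMul l (-1) e (Γ.mul (-1) 0 (-1) rfl y (l.f 0 (algElt k e))) := by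
      rw [map_neg, algMul_algMul, he]
    have h₂ : Γ.mul (-1) 0 (-1) rfl (-algMul l (-1) e (Γ.mul (-1) 0 (-1) rfl y
        (l.f 0 (algElt k e)))) (l.f 0 (algElt k e)) =
        -algMul l (-1) e (Γ.mul (-1) 0 (-1) rfl y (l.f 0 (algElt k e))) := by
      rw [map_neg, LinearMap.neg_apply, algMul_mul]
      refine congrArg (fun z => -algMul l (-1) e z) ?_
      refine (Γ.mul_assoc (-1) 0 0 (-1) 0 (-1) rfl rfl rfl rfl y _ _).trans ?_
      exact congrArg (Γ.mul (-1) 0 (-1) rfl y) hee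
    generalize -algMul l (-1) e (Γ.mul (-1) 0 (-1) rfl y (l.f 0 (algElt k e))) = h at h₁ h₂
    have h₃ : eltMul h j (algMul l (j + 1) e x) = eltMul h j x := by
      refine (Γ.mul_assoc (-1) 0 (j + 1) (-1) (j + 1) j rfl (zero_add _) (by omega) (by omega) h
        (l.f 0 (algElt k e)) x).symm.trans ?_
      exact congrArg (fun z => Γ.mul (-1) (j + 1) j (by omega) z x) h₂
    rw [h₃]
    refine (algMul_mul l e (-1) (j + 1) j (by omega) h x).symm.trans ?_
    exact congrArg (fun z => Γ.mul (-1) (j + 1) j (by omega) z x) h₁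
  · rw [map_neg, d_algMul, Γ.d_mul (-1) 0 (-1) 0 1 0 rfl rfl rfl rfl, hy, hde, map_zero, smul_zero,
      add_zero, LinearMap.map_sub₂, hl1, map_sub, hee]
    have h₁ : algMul l 0 e (Γ.mul 0 0 0 (zero_add 0) (Γ.mul 0 0 0 (zero_add 0)
        (l.f 0 (algElt k (1 - e))) w) (l.f 0 (algElt k e))) = 0 := by
      refine (algMul_mul l e 0 0 0 (zero_add 0) _ _).symm.trans ?_
      have h₂ : algMul l 0 e (Γ.mul 0 0 0 (zero_add 0) (l.f 0 (algElt k (1 - e))) w) = 0 := by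
        refine (algMul_algMul l e (1 - e) 0 w).trans ?_
        rw [mul_sub, mul_one, he, sub_self, map_zero, LinearMap.zero_apply]
      rw [h₂, map_zero, LinearMap.zero_apply]
    refine (congrArg (fun z => -(z - _)) h₁).trans ?_
    rw [zero_sub, neg_neg]

theorem drin_isInvertibleClass (he : IsIdempotentElem e) :
    (drinDGA k he).IsInvertibleClass ((drinUnitHom k he).f 0 (algElt k (1 - e))) := by
  have h₁ : (drinDGA k he).IsBoundary 0
      ((drinUnitHom k he).f 0 (algElt k (1 - e)) - (drinDGA k he).one) := by
    refine ⟨-1, rfl, -drinElt k he, ?_⟩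
    rw [map_neg, d_drinElt, map_sub, map_sub]
    have h₂ : (drinUnitHom k he).f 0 (algElt k 1) = (drinDGA k he).one :=
      (drinUnitHom k he).map_one
    rw [h₂]
    abel
  refine ⟨(drinDGA k he).one, (drinDGA k he).d_one 1 rfl, ?_, ?_⟩
  · rwa [(drinDGA k he).mul_one]
  · rwa [(drinDGA k he).one_mul]

end Contractible

section UnderRegular

variable (Q : DGA k)

/-- A dga under `Q`, as a dg-module over `Q`. -/
def underRegular : Under Q ⥤ DGMod Q where
  obj Y := resObj Y.hom Y.right.regular
  map {X Y} φ :=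
    { f := φ.right.f
      comm := φ.right.comm
      map_act := fun i j l h x a => (φ.right.map_mul i j l h x _).trans
        (congrArg _ (congrArg (fun ψ : Q ⟶ Y.right => ψ.f j a) (Under.w φ))) }

theorem underRegular_inverts : (underQuasiIso Q).IsInvertedBy (underRegular Q ⋙ toD Q) :=
  fun _ _ _ h => Localization.inverts (toD Q) (quasiIso Q) _ h

/-- The functor induced by `underRegular` on homotopy categories. -/
noncomputable def underRegularD : (underQuasiIso Q).Localization ⥤ D Q :=
  Localization.Construction.lift _ (underRegular_inverts Q)

theorem underRegularD_map {X Y : Under Q} (φ : X ⟶ Y) :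
    (underRegularD Q).map ((underQuasiIso Q).Q.map φ) = (toD Q).map ((underRegular Q).map φ) :=
  lift_map _ _ φ

theorem regularMap_eq_comp_underRegular_map (X : Under Q) : regularMap X.hom =
    (regularMap (𝟙 Q) : Q.regular ⟶ (underRegular Q).obj (Under.mk (𝟙 Q))) ≫
      (underRegular Q).map (Under.mkIdInitial.to X) := by
  ext n x
  exact congrArg (fun ψ : Q ⟶ X.right => ψ.f n x)
    ((Under.w (Under.mkIdInitial.to X)).symm.trans (Category.id_comp _))

theorem underRegularD_map_unit {X : Under Q} (θ : (underQuasiIso Q).Q.obj X ⟶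
    (underQuasiIso Q).Q.obj X) :
    (toD Q).map (regularMap X.hom : Q.regular ⟶ (underRegular Q).obj X) ≫
      (underRegularD Q).map θ = (toD Q).map (regularMap X.hom) := by
  have h : (toD Q).map ((underRegular Q).map (Under.mkIdInitial.to X)) ≫ (underRegularD Q).map θ =
      (toD Q).map ((underRegular Q).map (Under.mkIdInitial.to X)) := by
    refine (congrArg (· ≫ (underRegularD Q).map θ) (underRegularD_map Q _)).symm.trans ?_
    refine ((underRegularD Q).map_comp _ _).symm.trans ?_
    exact (congrArg (underRegularD Q).map (exists_unique_hom_of_isInitial (underQuasiIso Q)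
      Under.mkIdInitial _ _ _)).trans (underRegularD_map Q _)
  have h' := ((toD Q).congr_map (regularMap_eq_comp_underRegular_map Q X)).trans
    ((toD Q).map_comp _ _)
  refine (congrArg (· ≫ (underRegularD Q).map θ) h').trans ((Category.assoc _ _ _).trans ?_)
  exact (congrArg (_ ≫ ·) h).trans h'.symm

end UnderRegular

theorem hom_ext_of_unit_comp {C E : Type*} [Category* C] [Category* E] {L : C ⥤ E} {R : E ⥤ C}
    (adj : L ⊣ R) {X : C} {Y Z : E} (i : L.obj X ⟶ Y) [IsIso i] {f g : Y ⟶ Z}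
    (h : (adj.unit.app X ≫ R.map i) ≫ R.map f = (adj.unit.app X ≫ R.map i) ≫ R.map g) : f = g := by
  rw [Category.assoc, Category.assoc, ← R.map_comp, ← R.map_comp] at h
  exact (cancel_epi i).1 ((adj.homEquiv X Z).injective
    ((adj.homEquiv_unit _ _ _).trans (h.trans (adj.homEquiv_unit _ _ _).symm)))

theorem endomorphism_eq_id {C E F : Type*} [Category* C] [Category* E] [Category* F] {L : C ⥤ E}
    {R : E ⥤ C} (adj : L ⊣ R) (hR : R.FullyFaithful) (G : C ⥤ F) (hG : G.FullyFaithful) {X : C}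
    {Y : E} (i : L.obj X ⟶ Y) [IsIso i] {W : F} (a : W ⟶ G.obj X) [IsIso a]
    (v : X ⟶ R.obj Y) (hv : v = adj.unit.app X ≫ R.map i)
    (θ : G.obj (R.obj Y) ⟶ G.obj (R.obj Y)) (h : (a ≫ G.map v) ≫ θ = a ≫ G.map v) : θ = 𝟙 _ := by
  obtain ⟨θ, rfl⟩ := hG.map_surjective θ
  obtain ⟨θ, rfl⟩ := hR.map_surjective θ
  rw [Category.assoc, ← G.map_comp] at h
  have h₂ : v ≫ R.map θ = v := hG.map_injective ((cancel_epi a).1 h)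
  subst hv
  have h₃ : θ = 𝟙 Y := hom_ext_of_unit_comp adj i (by rw [h₂, R.map_id, Category.comp_id])
  rw [h₃, R.map_id, G.map_id]

/-- Extension of scalars of the regular module. -/
noncomputable def regularTensorSelf {Λ Γ : DGA k} (f : Λ ⟶ Γ) :
    (tensorFunctor (bimodOfHoms f (𝟙 Γ))).obj Λ.regular ≅ Γ.regular :=
  regularTensorIso (bimodOfHoms f (𝟙 Γ))

theorem regularMap_eq {Λ Γ : DGA k} (f : Λ ⟶ Γ) : regularMap f =
    (tensorResAdj f).unit.app Λ.regular ≫ (res f).map (regularTensorSelf f).hom := by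
  refine Eq.trans ?_ (congrArg (· ≫ (res f).map (regularTensorSelf f).hom)
    (tensorResAdj_unit_app f Λ.regular)).symm
  ext n x
  refine Eq.symm (((regularPairing (bimodOfHoms f (𝟙 Γ))).lift_tmul n 0 n (add_zero n) x
    Γ.one).trans ?_)
  exact Γ.mul_one n _

theorem toD_map_unit_comp {Λ Γ : DGA k} {G : DGMod Λ ⥤ DGMod Γ} {F : DGMod Γ ⥤ DGMod Λ}
    (adj : G ⊣ F) (hG : Exact G) (hF : Exact F) {M : DGMod Λ} {N : DGMod Γ} (i : G.obj M ⟶ N) :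
    (toD Λ).map (adj.unit.app M) ≫ (toD Λ).map (F.map i) =
      (descAdj adj hG hF).unit.app ((toD Λ).obj M) ≫ (desc F hF).map ((toD Γ).map i) :=
  congrArg₂ (· ≫ ·) (descAdj_unit_app adj hG hF M).symm (desc_map F hF i).symm

theorem regular_endomorphism_eq_id {Q Λ Γ : DGA k} (q : Q ⟶ Λ) (hq : q.toChainMap.IsQuasiIso)
    (f : Λ ⟶ Γ) (hf : Exact (tensorFunctor (bimodOfHoms f (𝟙 Γ))))
    (hR : (desc (res f) (res_exact f)).FullyFaithful)
    (θ : (toD Q).obj ((res q).obj ((res f).obj Γ.regular)) ⟶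
      (toD Q).obj ((res q).obj ((res f).obj Γ.regular)))
    (h : (toD Q).map (regularMap q ≫ (res q).map (regularMap f)) ≫ θ =
      (toD Q).map (regularMap q ≫ (res q).map (regularMap f))) : θ = 𝟙 _ := by
  obtain ⟨i, hi, h₁⟩ : ∃ i : (desc _ hf).obj ((toD Λ).obj Λ.regular) ⟶ (toD Γ).obj Γ.regular,
      IsIso i ∧ (toD Λ).map (regularMap f) =
        (descAdj (tensorResAdj f) hf (res_exact f)).unit.app ((toD Λ).obj Λ.regular) ≫
          (desc (res f) (res_exact f)).map i := by
    refine ⟨(toD Γ).map (regularTensorSelf f).hom,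
      ((toD Γ).mapIso (regularTensorSelf f)).isIso_hom, ?_⟩
    rw [regularMap_eq, (toD Λ).map_comp]
    exact toD_map_unit_comp (tensorResAdj f) hf (res_exact f) _
  obtain ⟨a, ha, h₂⟩ : ∃ a : (toD Q).obj Q.regular ⟶
      (resEquiv q hq).functor.obj ((toD Λ).obj Λ.regular), IsIso a ∧
      (toD Q).map (regularMap q ≫ (res q).map (regularMap f)) =
        a ≫ (resEquiv q hq).functor.map ((toD Λ).map (regularMap f)) :=
    ⟨(toD Q).map (regularMap q), isIso_toD_map hq,
      ((toD Q).map_comp _ _).trans (congrArg _ (desc_map (res q) (res_exact q) _).symm)⟩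
  refine endomorphism_eq_id (descAdj (tensorResAdj f) hf (res_exact f)) hR
    (resEquiv q hq).functor (resEquiv q hq).fullyFaithfulFunctor i a _ h₁ θ ?_
  exact ((congrArg (· ≫ θ) h₂).symm.trans h).trans h₂

section Rigidity

variable {A : Type u} [Ring A] [Algebra k A] {e : A} (he : IsIdempotentElem e)

/-- The derived quotient is quasi-isomorphic to the Drinfeld quotient. -/
theorem IsDerivedQuotient.exists_quasiIso_drin {B : DGA k} {l : ofAlgebra k A ⟶ B}
    (hl : IsDerivedQuotient k e l) :
    ∃ g : drinDGA k he ⟶ B, g.toChainMap.IsQuasiIso ∧ drinUnitHom k he ≫ g = l := by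
  obtain ⟨Q, q, -, hq, hInv, hUniv⟩ := hl
  have hs : B.IsInvertibleClass (l.f 0 (algElt k (1 - e))) := by
    obtain ⟨z, hz, hz'⟩ := (hq 0).2 (algElt k (1 - e)) rfl
    have h := hInv z hz hz'
    have h' : q.f 0 z = algElt k (1 - e) := eq_of_isBoundary_ofAlgebra hz'
    exact h' ▸ h
  obtain ⟨h, he', hd⟩ := exists_contraction_of_isInvertibleClass he l hs
  refine ⟨drinLiftHom he l he' hd, ?_, drinUnitHom_comp_lift he l he' hd⟩
  have hg := drinUnitHom_comp_lift he l he' hd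
  generalize drinLiftHom he l he' hd = g at hg
  subst hg
  let UD : Under Q := Under.mk (q ≫ drinUnitHom k he)
  let UB : Under Q := Under.mk (q ≫ drinUnitHom k he ≫ g)
  let gU : UD ⟶ UB := Under.homMk g (Category.assoc _ _ _)
  have hD : Inverts q (algElt k (1 - e)) UD := by
    intro z hz hz'
    have h' : q.f 0 z = algElt k (1 - e) := eq_of_isBoundary_ofAlgebra hz'
    exact (congrArg (fun y => (drinDGA k he).IsInvertibleClass ((drinUnitHom k he).f 0 y)) h').mpr
      (drin_isInvertibleClass he)
  obtain ⟨⟨⟨r⟩, -⟩⟩ := hUniv UD hD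
  obtain ⟨⟨_, huniq⟩⟩ := hUniv UB hInv
  let W := underQuasiIso Q
  have h₁ : r ≫ W.Q.map gU = 𝟙 (W.Q.obj UB) := (huniq _).trans (huniq _).symm
  have h₂ : (underRegularD Q).map (W.Q.map gU ≫ r) = 𝟙 _ := by
    refine regular_endomorphism_eq_id q hq (drinUnitHom k he) (drin_tensor_exact k he)
      (drinResFullyFaithful k he) _ ?_
    exact underRegularD_map_unit Q (W.Q.map gU ≫ r)
  have h₃ : IsIso ((underRegularD Q).map (W.Q.map gU)) :=
    ⟨(underRegularD Q).map r, ((underRegularD Q).map_comp _ _).symm.trans h₂,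
      ((underRegularD Q).map_comp _ _).symm.trans
        ((congrArg _ h₁).trans ((underRegularD Q).map_id _))⟩
  have h₄ : IsIso ((toD Q).map ((underRegular Q).map gU)) :=
    (congrArg (fun φ => IsIso φ) (underRegularD_map Q gU)).mp h₃
  exact (quasiIso_iff_isIso_toD ((underRegular Q).map gU)).2 h₄

end Rigidity


section Triangles

variable {Λ Γ Ω : DGA k}

theorem exists_distinguished_unit {G : DGMod Λ ⥤ DGMod Γ} {F : DGMod Γ ⥤ DGMod Λ} (adj : G ⊣ F)
    (hG : Exact G) (hF : Exact F) (E : D Γ ≌ D Ω) {W M : DGMod Λ} {φ : W ⟶ M}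
    (t : cone φ ⟶ F.obj (G.obj M)) (ht : quasiIso Λ t) (hφ : coneIn φ ≫ t = adj.unit.app M)
    {X : D Λ} {f : X ⟶ (toD Λ).obj M} (a : X ≅ (toD Λ).obj W)
    (hf : f = a.hom ≫ (toD Λ).map φ) :
    ∃ h, Distinguished f (((descAdj adj hG hF).comp E.toAdjunction).unit.app ((toD Λ).obj M)) h := by
  have := isIso_toD_map ht
  refine (distinguished_cone φ).exists_of_iso a (asIso ((toD Λ).map t) ≪≫
    (desc F hF).mapIso (E.unitIso.app ((desc G hG).obj ((toD Λ).obj M)))) hf ?_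
  refine (Adjunction.comp_unit_app _ _ _).trans ?_
  refine (congrArg (· ≫ (desc F hF).map (E.unit.app ((desc G hG).obj ((toD Λ).obj M))))
    ((descAdj_unit_app adj hG hF M).trans (((toD Λ).congr_map hφ.symm).trans
      ((toD Λ).map_comp _ _)))).trans ?_
  exact Category.assoc _ _ _

theorem exists_distinguished_counit {G : DGMod Γ ⥤ DGMod Λ} {F : DGMod Λ ⥤ DGMod Γ} (adj : G ⊣ F)
    (hG : Exact G) (hF : Exact F) (E : D Ω ≌ D Γ) {M P : DGMod Λ}
    (t : cone (adj.counit.app M) ⟶ P) (ht : quasiIso Λ t) {Z : D Λ} {g : (toD Λ).obj M ⟶ Z}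
    (c : (toD Λ).obj P ≅ Z) (hg : g = (toD Λ).map (coneIn (adj.counit.app M) ≫ t) ≫ c.hom) :
    ∃ h, Distinguished ((E.toAdjunction.comp (descAdj adj hG hF)).counit.app ((toD Λ).obj M))
      g h := by
  have := isIso_toD_map ht
  refine (distinguished_cone (adj.counit.app M)).exists_of_iso
    ((desc G hG).mapIso (E.counitIso.app ((desc F hF).obj ((toD Λ).obj M))))
    (asIso ((toD Λ).map t) ≪≫ c) ?_ ?_
  · refine (Adjunction.comp_counit_app _ _ _).trans ?_
    exact congrArg ((desc G hG).map (E.counit.app ((desc F hF).obj ((toD Λ).obj M))) ≫ ·)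
      (descAdj_counit_app adj hG hF M)
  · rw [hg, Functor.map_comp, Category.assoc]
    rfl

end Triangles

section IFunctors

variable {Λ Γ Ω : DGA k} (f : Λ ⟶ Γ) (g : Γ ⟶ Ω)

/-- Restriction of scalars along a composition. -/
def resComp : res g ⋙ res f ≅ res (f ≫ g) := Iso.refl _

/-- Restriction of scalars along a composition, on derived categories. -/
noncomputable def descResComp : toD Ω ⋙ desc (res g) (res_exact g) ⋙ desc (res f) (res_exact f) ≅
    res (f ≫ g) ⋙ toD Λ :=
  Functor.isoWhiskerRight (descIso (res g) (res_exact g)) (desc (res f) (res_exact f)) ≪≫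
    Functor.isoWhiskerLeft (res g) (descIso (res f) (res_exact f)) ≪≫
    Functor.isoWhiskerRight (resComp f g) (toD Λ)

variable (hg : g.toChainMap.IsQuasiIso) (hT : Exact (tensorFunctor (bimodOfHoms f (𝟙 Γ))))
  (hH : Exact (homFunctor (bimodOfHoms (𝟙 Γ) f)))

/-- The functor `i^*`. -/
noncomputable def iPull : D Λ ⥤ D Ω := desc _ hT ⋙ (resEquiv g hg).inverse

/-- The functor `i_* = i_!`. -/
noncomputable def iPush : D Ω ⥤ D Λ := (resEquiv g hg).functor ⋙ desc _ (res_exact f)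

/-- The functor `i^!`. -/
noncomputable def iShriek : D Λ ⥤ D Ω := desc _ hH ⋙ (resEquiv g hg).inverse

/-- `i^* ⊣ i_*`. -/
noncomputable def iAdj : iPull f g hg hT ⊣ iPush f g hg :=
  (descAdj (tensorResAdj f) hT (res_exact f)).comp (resEquiv g hg).symm.toAdjunction

/-- `i_! ⊣ i^!`. -/
noncomputable def iAdj' : iPush f g hg ⊣ iShriek f g hg hH :=
  (resEquiv g hg).toAdjunction.comp (descAdj (resHomAdj f) (res_exact f) hH)

theorem isTriangulated_desc_res : IsTriangulated (desc (res f) (res_exact f)) :=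
  (resConeData f).isTriangulated _

theorem isTriangulated_iPull : IsTriangulated (iPull f g hg hT) :=
  ((tensorConeData _).isTriangulated hT).comp (isTriangulated_resEquiv_inverse g hg)

theorem isTriangulated_iPush : IsTriangulated (iPush f g hg) :=
  (isTriangulated_desc_res g).comp (isTriangulated_desc_res f)

theorem isTriangulated_iShriek : IsTriangulated (iShriek f g hg hH) :=
  ((homConeData _).isTriangulated hH).comp (isTriangulated_resEquiv_inverse g hg)

/-- `i_*` is induced by restriction of scalars. -/
noncomputable def iPushIso : toD Ω ⋙ iPush f g hg ≅ res (f ≫ g) ⋙ toD Λ := descResComp f g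

/-- `i_*` is induced by a Hom functor. -/
noncomputable def iPushIsoHom : toD Ω ⋙ iPush f g hg ≅
    homFunctor (bimodOfHoms (f ≫ g) (𝟙 Ω)) ⋙ toD Λ :=
  iPushIso f g hg ≪≫ Functor.isoWhiskerRight (resHomIso (f ≫ g)) (toD Λ)

/-- `i_!` is induced by a tensor functor. -/
noncomputable def iPushIsoTensor : toD Ω ⋙ iPush f g hg ≅
    tensorFunctor (bimodOfHoms (𝟙 Ω) (f ≫ g)) ⋙ toD Λ :=
  iPushIso f g hg ≪≫ Functor.isoWhiskerRight (resTensorIso (f ≫ g)).symm (toD Λ)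

theorem isLeftDerived_iPull :
    IsLeftDerived (iPull f g hg hT) (tensorFunctor (bimodOfHoms (f ≫ g) (𝟙 Ω))) :=
  isLeftDerived_of_adjunction (tensorHomAdj _) (iAdj f g hg hT) (iPushIsoHom f g hg)

theorem isRightDerived_iPush :
    IsRightDerived (iPush f g hg) (homFunctor (bimodOfHoms (f ≫ g) (𝟙 Ω))) :=
  isRightDerived_of_iso (iPushIsoHom f g hg)

theorem isLeftDerived_iPush :
    IsLeftDerived (iPush f g hg) (tensorFunctor (bimodOfHoms (𝟙 Ω) (f ≫ g))) :=
  isLeftDerived_of_iso (iPushIsoTensor f g hg)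

theorem isRightDerived_iShriek :
    IsRightDerived (iShriek f g hg hH) (homFunctor (bimodOfHoms (𝟙 Ω) (f ≫ g))) :=
  isRightDerived_of_adjunction (tensorHomAdj _) (iAdj' f g hg hH) (iPushIsoTensor f g hg)

end IFunctors

section Recollement

variable {A : Type u} [Ring A] [Algebra k A] {e : A} (he : IsIdempotentElem e)
  (M : DGMod (ofAlgebra k A))

variable {B : DGA k} (g : drinDGA k he ⟶ B) (hg : g.toChainMap.IsQuasiIso)

theorem exists_distinguished_i_j : ∃ h, Distinguished
    ((iAdj' (drinUnitHom k he) g hg (drin_hom_exact k he)).counit.app ((toD (ofAlgebra k A)).obj M))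
    ((jAdj' k he).unit.app ((toD (ofAlgebra k A)).obj M)) h := by
  obtain ⟨c, hc⟩ := jAdj'_unit_factor k he M
  have key : ∀ φ : (res (drinUnitHom k he)).obj
      ((homFunctor (bimodOfHoms (𝟙 (drinDGA k he)) (drinUnitHom k he))).obj M) ⟶ M,
      φ = homOne (drinUnitHom k he) M → ∃ t : cone φ ⟶ (homFunctor (barBimod k he)).obj M,
        quasiIso _ t ∧ coneIn φ ≫ t = (barUnit k he).app M := by
    rintro _ rfl
    exact ⟨coneToHom k he M, quasiIso_coneToHom k he M, coneIn_comp_coneToHom k he M⟩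
  obtain ⟨t, ht, ht'⟩ := key _ (resHomAdj_counit_app (drinUnitHom k he) M)
  rw [← ht'] at hc
  exact exists_distinguished_counit (resHomAdj (drinUnitHom k he)) (res_exact _)
    (drin_hom_exact k he) (resEquiv g hg) t ht c hc

theorem exists_distinguished_j_i : ∃ h, Distinguished
    ((jAdj k he).counit.app ((toD (ofAlgebra k A)).obj M))
    ((iAdj (drinUnitHom k he) g hg (drin_tensor_exact k he)).unit.app
      ((toD (ofAlgebra k A)).obj M)) h := by
  obtain ⟨a, ha⟩ := jAdj_counit_factor k he M
  exact exists_distinguished_unit (tensorResAdj (drinUnitHom k he)) (drin_tensor_exact k he)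
    (res_exact _) (resEquiv g hg).symm (coneToTensor k he M) (quasiIso_coneToTensor k he M)
    ((coneIn_comp_coneToTensor k he M).trans (tensorResAdj_unit_app _ M).symm) a ha

/-- `i_*` is fully faithful. -/
noncomputable def iPushFullyFaithful : (iPush (drinUnitHom k he) g hg).FullyFaithful :=
  (resEquiv g hg).fullyFaithfulFunctor.comp (drinResFullyFaithful k he)

theorem isZero_jPull_iPush (Y : D B) :
    Limits.IsZero ((jPull k he).obj ((iPush (drinUnitHom k he) g hg).obj Y)) := by
  obtain ⟨N, rfl⟩ := exists_toD_obj Y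
  exact isZero_toD_of_acyclic ((homFunctor (rowBimod k he)).obj
    (resObj (drinUnitHom k he) (resObj g N))) ((cornerAcyclic_iff he).1
      (cornerAcyclic_res k (drinUnitHom k he) (drinElt k he) (d_drinElt k he) (resObj g N)))

/-- The recollement defined by an idempotent. -/
noncomputable def recollement : Recollement
    (iPull (drinUnitHom k he) g hg (drin_tensor_exact k he)) (iPush (drinUnitHom k he) g hg)
    (iShriek (drinUnitHom k he) g hg (drin_hom_exact k he)) (jShriek k he) (jPull k he)
    (jPush k he) where
  iPull_triangulated := isTriangulated_iPull _ g hg _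
  iPush_triangulated := isTriangulated_iPush _ g hg
  iShriek_triangulated := isTriangulated_iShriek _ g hg _
  jShriek_triangulated := isTriangulated_jShriek k he
  jPull_triangulated := isTriangulated_jPull k he
  jPush_triangulated := isTriangulated_jPush k he
  iAdj := iAdj _ g hg _
  iAdj' := iAdj' _ g hg _
  jAdj := jAdj k he
  jAdj' := jAdj' k he
  iPush_full := (iPushFullyFaithful he g hg).full
  iPush_faithful := (iPushFullyFaithful he g hg).faithful
  jShriek_full := (jShriekFullyFaithful k he).full
  jShriek_faithful := (jShriekFullyFaithful k he).faithful
  jPush_full := (jPushFullyFaithful k he).full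
  jPush_faithful := (jPushFullyFaithful k he).faithful
  isZero := isZero_jPull_iPush he g hg
  triangle X := by
    obtain ⟨M, rfl⟩ := exists_toD_obj X
    exact exists_distinguished_i_j he M g hg
  triangle' X := by
    obtain ⟨M, rfl⟩ := exists_toD_obj X
    exact exists_distinguished_j_i he M g hg

end Recollement

end DG

theorem mainTheorem10 {k : Type u} [Field k] [IsAlgClosed k] [CharZero k]
    {A : Type u} [Ring A] [Algebra k A] (e : A) (he : IsIdempotentElem e)
    {B : DG.DGA k} (l : DG.ofAlgebra k A ⟶ B) (hl : DG.IsDerivedQuotient k e l) :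
    ∃ (iPull : DG.D (DG.ofAlgebra k A) ⥤ DG.D B)
      (iPush : DG.D B ⥤ DG.D (DG.ofAlgebra k A))
      (iShriek : DG.D (DG.ofAlgebra k A) ⥤ DG.D B)
      (jShriek : DG.D (DG.corner k e he) ⥤ DG.D (DG.ofAlgebra k A))
      (jPull : DG.D (DG.ofAlgebra k A) ⥤ DG.D (DG.corner k e he))
      (jPush : DG.D (DG.corner k e he) ⥤ DG.D (DG.ofAlgebra k A)),
      DG.IsLeftDerived iPull (DG.tensorFunctor (DG.bimodOfHoms l (𝟙 B))) ∧
      DG.IsRightDerived iPush (DG.homFunctor (DG.bimodOfHoms l (𝟙 B))) ∧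
      DG.IsLeftDerived iPush (DG.tensorFunctor (DG.bimodOfHoms (𝟙 B) l)) ∧
      DG.IsRightDerived iShriek (DG.homFunctor (DG.bimodOfHoms (𝟙 B) l)) ∧
      DG.IsLeftDerived jShriek
        (DG.tensorFunctor (DG.cornerBimod k e 1 he IsIdempotentElem.one)) ∧
      DG.IsRightDerived jPull
        (DG.homFunctor (DG.cornerBimod k e 1 he IsIdempotentElem.one)) ∧
      DG.IsLeftDerived jPull
        (DG.tensorFunctor (DG.cornerBimod k 1 e IsIdempotentElem.one he)) ∧
      DG.IsRightDerived jPush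
        (DG.homFunctor (DG.cornerBimod k 1 e IsIdempotentElem.one he)) ∧
      Nonempty (DG.Recollement iPull iPush iShriek jShriek jPull jPush) := by
  obtain ⟨g, hg, rfl⟩ := hl.exists_quasiIso_drin he
  exact ⟨_, _, _, _, _, _, DG.isLeftDerived_iPull _ g hg (DG.drin_tensor_exact k he),
    DG.isRightDerived_iPush _ g hg, DG.isLeftDerived_iPush _ g hg,
    DG.isRightDerived_iShriek _ g hg (DG.drin_hom_exact k he), DG.isLeftDerived_jShriek k he,
    DG.isRightDerived_jPull k he, DG.isLeftDerived_jPull k he, DG.isRightDerived_jPush k he,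
    ⟨DG.recollement he g hg⟩⟩
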